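/- **Setting.** Manifolds are smooth, finite-dimensional, Hausdorff and second countable. Let $(\mathcal E,\langle\cdot,\cdot\rangle,[\![\cdot,\cdot]\!],\pi)$ be an exact Courant algebroid over $M$, with $[\![e,e]\!]=\tfrac12\pi^*d\langle e,e\rangle$, where $\langle\pi^*\eta,v\rangle=\eta(\pi v)$. An isotropic splitting $\nabla:TM\to\mathcal E$ identifies $TM\oplus T^*M$ with $\mathcal E$ via $\nabla+\tfrac12\pi^*$; the pairing becomes $\langle X+\xi,Y+\eta\rangle=\tfrac12(\eta(X)+\xi(Y))$ and the bracket becomes $[X,Y]+\mathcal L_X\eta-i_Yd\xi+i_Yi_XH$. The closed 3-form $H$, that is $H(X,Y,Z)=2\langle[\![\nabla X,\nabla Y]\!],\nabla Z\rangle$, is the curvature of the splitting. A generalized metric $\mathcal G$ on $\mathcal E$ is an orthogonal self-adjoint bundle operator with $\langle\mathcal Ge,e\rangle>0$ for $e\ne0$; its metric splitting is the splitting with image $\mathcal G(T^*M)$, where $T^*M=\ker\pi$, and it induces on $M$ the metric $g(\pi u,\pi v)=\langle u,v\rangle$ for $u,v$ in the $+1$-eigenbundle $V_+$. Let $G$ be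 a connected Lie group with Lie algebra $\mathfrak g$ acting smoothly on $M$, with infinitesimal generators $X_\gamma$ (with the sign for which $\gamma\mapsto X_\gamma$ is a Lie algebra homomorphism), and let $\mathfrak a\to\mathfrak g$ be an exact Courant algebra with kernel $\mathfrak h$. Let $\Psi:\mathfrak a\to\Gamma(\mathcal E)$ be an extended action: a bracket-preserving linear map covering $\gamma\mapsto X_\gamma$, with $\Psi(\mathfrak h)\subset\Omega^1_{cl}(M)$, such that $\operatorname{ad}\circ\Psi$ integrates to an action of $G$ on $\mathcal E$ by Courant algebroid automorphisms covering the action on $M$. Put $K=\Psi(\mathfrak a)$ and $\Delta_b=\pi(K+K^\perp)$. Let $P\subset M$ be a $G$-stable leaf of $\Delta_b$ on which $G$ acts freely and properly, let $\iota:P\to M$ be the inclusion, and let $q:P\to M^{red}=P/G$ be the projection onto the quotient manifold. Assume that $K$ is isotropic over $P$. The reduced algebroid is $\mathcal E^{red}=(K^\perp/K)|_P/G$ over $M^{red}$, with the pairing and the anchor induced from $\mathcal E$. The bracket of two sections of $\mathcal E^{red}$ is represented by the bracket of arbitrary (local) extensions to $M$ of $G$-invariant lifts of them to $K^\perp|_P$.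 Assume that $G$ preserves $\mathcal G$. Then $\mathcal G^{red}$ denotes the operator induced by $\mathcal G$ via the isomorphism $K^\perp\cap\mathcal GK^\perp\cong K^\perp/K$. Let $H$ be the curvature of the metric splitting of $(\mathcal E,\mathcal G)$. In this splitting the action over $P$ is $\gamma\mapsto X_\gamma+\xi_\gamma$ with $\xi_\gamma\in\Omega^1(P)$, which defines $\xi\in\Omega^1(P;\mathfrak g^*)$. Put $$\tau_+=\{Y\in TP:\ g(Y,X_\gamma)=-\xi_\gamma(Y)\ \text{ for all }\gamma\in\mathfrak g\}.$$ **Proposition.** There is a unique principal connection $\theta_+\in\Omega^1(P;\mathfrak g)$ on $P\to M^{red}$ with horizontal distribution $\ker\theta_+=\tau_+$, and $(\mathcal E^{red},\mathcal G^{red})$ has a unique metric splitting. Let $F=d\theta_++\tfrac12[\theta_+,\theta_+]$ be the curvature of $\theta_+$. With respect to a basis $(\gamma_i)$ of $\mathfrak g$, write $\theta_+=\sum_i\theta_i\gamma_i$, $F=\sum_iF_i\gamma_i$, $\xi_i=\xi_{\gamma_i}$, $X_i=X_{\gamma_i}$, and let $$B=\sum_i\theta_i\wedge\xi_i+\tfrac12\sum_{i,j}\xi_j(X_i)\,\theta_i\wedge\theta_j\in\Omega^2(P),\qquad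 \langle F,\xi\rangle=\sum_iF_i\wedge\xi_i\in\Omega^3(P).$$ Then the curvature of the metric splitting of $\mathcal E^{red}$ is a uniquely determined 3-form $H^{red}\in\Omega^3(M^{red})$, and $$q^*H^{red}=\iota^*H+dB\quad\text{on }P,\qquad (q^*H^{red})|_{\tau_+}=(\iota^*H+\langle F,\xi\rangle)|_{\tau_+}.$$ -/

import Mathlib

open Bundle Set Filter VectorField
open scoped Manifold ContDiff Topology

noncomputable section

set_option linter.unusedSectionVars false

namespace CourantReduction

/-! ### Linear algebra of one fibre -/

section LinearAlgebra

variable {V T : Type*} [AddCommGroup V] [Module ℝ V] [AddCommGroup T] [Module ℝ T]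

/-- The space `K^⊥ / (K ∩ K^⊥)`; it is `K^⊥ / K` when `K` is isotropic. -/
abbrev RedSpace (b : LinearMap.BilinForm ℝ V) (K : Submodule ℝ V) : Type _ :=
  ↥(b.orthogonal K) ⧸ K.submoduleOf (b.orthogonal K)

/-- The class in `K^⊥ / (K ∩ K^⊥)` of an element of `K^⊥`. -/
def redClass (b : LinearMap.BilinForm ℝ V) (K : Submodule ℝ V) (v : V)
    (hv : v ∈ b.orthogonal K) : RedSpace b K :=
  Submodule.Quotient.mk ⟨v, hv⟩

/-- The pairing induced on `K^⊥ / (K ∩ K^⊥)` by a symmetric pairing. -/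
def redForm (b : LinearMap.BilinForm ℝ V) (hs : ∀ u v, b u v = b v u) (K : Submodule ℝ V) :
    LinearMap.BilinForm ℝ (RedSpace b K) :=
  Submodule.liftQ _
    { toFun := fun u => Submodule.liftQ (K.submoduleOf (b.orthogonal K))
        ((b (u : V)).comp (b.orthogonal K).subtype) (by
          intro v hv
          have h : b (v : V) (u : V) = 0 := u.2 v hv
          simpa [hs] using h)
      map_add' := by
        intro u v
        ext w
        simp
      map_smul' := by
        intro c u
        ext w
        simp }
    (by
      intro u hu
      rw [LinearMap.mem_ker]
      ext v
      have h : b (u : V) (v : V) = 0 := v.2 u hu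
      simpa using h)

/-- A generalized metric on one fibre: an orthogonal, self-adjoint operator `A` such that
`⟨A v, v⟩ > 0` for `v ≠ 0`. -/
structure IsGenMetric (b : LinearMap.BilinForm ℝ V) (A : V →ₗ[ℝ] V) : Prop where
  orthogonal : ∀ u v, b (A u) (A v) = b u v
  selfAdjoint : ∀ u v, b (A u) v = b u (A v)
  pos : ∀ v, v ≠ 0 → 0 < b (A v) v

theorem IsGenMetric.sq {b : LinearMap.BilinForm ℝ V} {A : V →ₗ[ℝ] V} (hA : IsGenMetric b A)
    (v : V) : A (A v) = v := by
  by_contra h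
  have h1 := hA.pos (A (A v) - v) (sub_ne_zero.2 h)
  rw [hA.selfAdjoint, map_sub, map_sub, LinearMap.sub_apply] at h1
  simp only [map_sub] at h1
  have e : ∀ w, b (A (A v)) w = b v (A (A w)) := fun w => by
    rw [hA.selfAdjoint, hA.selfAdjoint]
  have e2 : ∀ w, b (A (A v)) (A (A w)) = b v w := fun w => by
    rw [hA.orthogonal, hA.orthogonal]
  have e3 : b (A (A v)) (A v) = b v (A (A (A v))) := e _
  have e4 : b (A (A v)) (A (A (A v))) = b v (A v) := e2 _
  have e5 : b v (A (A (A v))) = b v (A v) := by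
    rw [← hA.selfAdjoint, hA.orthogonal]
  rw [e4, e3, e5] at h1
  linarith

/-- `K^A = K^⊥ ∩ A K^⊥`, the metric orthogonal complement of `K` in `K^⊥`. -/
def metricPerp (b : LinearMap.BilinForm ℝ V) (A : V →ₗ[ℝ] V) (K : Submodule ℝ V) :
    Submodule ℝ V :=
  b.orthogonal K ⊓ (b.orthogonal K).map A

theorem mem_metricPerp {b : LinearMap.BilinForm ℝ V} {A : V →ₗ[ℝ] V} (hA : IsGenMetric b A)
    {K : Submodule ℝ V} {v : V} :
    v ∈ metricPerp b A K ↔ v ∈ b.orthogonal K ∧ A v ∈ b.orthogonal K := by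
  constructor
  · rintro ⟨h1, w, hw, rfl⟩
    exact ⟨h1, by rw [hA.sq]; exact hw⟩
  · rintro ⟨h1, h2⟩
    exact ⟨h1, A v, h2, hA.sq v⟩

/-- The projection `K^A → K^⊥ / (K ∩ K^⊥)`. -/
def metricPerpProj (b : LinearMap.BilinForm ℝ V) (A : V →ₗ[ℝ] V) (K : Submodule ℝ V) :
    ↥(metricPerp b A K) →ₗ[ℝ] RedSpace b K :=
  (Submodule.mkQ _).comp (Submodule.inclusion inf_le_left)

theorem metricPerpProj_bijective [FiniteDimensional ℝ V] {b : LinearMap.BilinForm ℝ V}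
    {A : V →ₗ[ℝ] V} (hA : IsGenMetric b A) {K : Submodule ℝ V} (hK : K ≤ b.orthogonal K) :
    Function.Bijective (metricPerpProj b A K) := by
  constructor
  · rw [← LinearMap.ker_eq_bot, LinearMap.ker_eq_bot']
    rintro ⟨v, hv⟩ h
    have hvK : v ∈ K := by
      rw [metricPerpProj, LinearMap.comp_apply, Submodule.mkQ_apply,
        Submodule.Quotient.mk_eq_zero] at h
      exact h
    have h0 : b v (A v) = 0 := ((mem_metricPerp hA).1 hv).2 v hvK
    by_contra hne
    have hv0 : v ≠ 0 := fun h => hne (Subtype.ext h)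
    have := hA.pos v hv0
    rw [hA.selfAdjoint, h0] at this
    exact lt_irrefl _ this
  · intro x
    obtain ⟨⟨v, hv⟩, rfl⟩ := Submodule.mkQ_surjective _ x
    let c : ↥K →ₗ[ℝ] Module.Dual ℝ ↥K :=
      { toFun := fun k => (b.flip (A (k : V))).comp K.subtype
        map_add' := by
          intro k l
          ext w
          simp
        map_smul' := by
          intro r k
          ext w
          simp }
    have hc : Function.Injective c := by
      rw [← LinearMap.ker_eq_bot, LinearMap.ker_eq_bot']
      intro k hk
      by_contra hne
      have h1 := hA.pos (k : V) (fun h => hne (Subtype.ext h))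
      have h2 : b (k : V) (A (k : V)) = 0 := by simpa [c] using LinearMap.congr_fun hk k
      rw [hA.selfAdjoint, h2] at h1
      exact lt_irrefl _ h1
    have hcs : Function.Surjective c :=
      (LinearMap.injective_iff_surjective_of_finrank_eq_finrank
        (Subspace.dual_finrank_eq (K := ℝ) (V := ↥K)).symm).1 hc
    obtain ⟨k, hk⟩ := hcs ((b.flip (A v)).comp K.subtype)
    have hmem : v - k ∈ metricPerp b A K := by
      rw [mem_metricPerp hA]
      refine ⟨Submodule.sub_mem _ hv (hK k.2), fun u hu => ?_⟩
      have h1 : b u (A (k : V)) = b u (A v) := by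
        simpa [c] using LinearMap.congr_fun hk ⟨u, hu⟩
      change b u (A (v - k)) = 0
      rw [map_sub, map_sub, h1, sub_self]
    refine ⟨⟨v - k, hmem⟩, ?_⟩
    rw [metricPerpProj, LinearMap.comp_apply, ← sub_eq_zero, ← map_sub, Submodule.mkQ_apply,
      Submodule.Quotient.mk_eq_zero]
    change (v - k) - v ∈ K
    simp

/-- The reduced metric on `K^⊥ / K`: the operator `A` on `K^A`, transported along the isomorphism
`K^A ≅ K^⊥ / K`. -/
def redMetricOp [FiniteDimensional ℝ V] {b : LinearMap.BilinForm ℝ V} {A : V →ₗ[ℝ] V}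
    (hA : IsGenMetric b A) {K : Submodule ℝ V} (hK : K ≤ b.orthogonal K) :
    RedSpace b K →ₗ[ℝ] RedSpace b K :=
  let e := LinearEquiv.ofBijective (metricPerpProj b A K) (metricPerpProj_bijective hA hK)
  e.toLinearMap ∘ₗ
    A.restrict (p := metricPerp b A K) (q := metricPerp b A K) (fun v hv => by
      rw [mem_metricPerp hA] at hv ⊢
      exact ⟨hv.2, by rw [hA.sq]; exact hv.1⟩) ∘ₗ
    e.symm.toLinearMap

/-- `s` is the metric splitting of the sequence `0 → T^* → V → T → 0` with anchor `a` (in which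
`T^* = ker a`): it is a right inverse of `a` whose image is `A(T^*)`. -/
def IsMetricSplitting (a : V →ₗ[ℝ] T) (A : V →ₗ[ℝ] V) (s : T →ₗ[ℝ] V) : Prop :=
  (∀ X, a (s X) = X) ∧ LinearMap.range s = (LinearMap.ker a).map A

end LinearAlgebra

/-! ### Calculus on manifolds -/

section Calculus

variable {E : Type*} [NormedAddCommGroup E] [NormedSpace ℝ E]
  {M : Type*} [TopologicalSpace M] [ChartedSpace E M] [IsManifold 𝓘(ℝ, E) ∞ M]
  {E' : Type*} [NormedAddCommGroup E'] [NormedSpace ℝ E']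
  {M' : Type*} [TopologicalSpace M'] [ChartedSpace E' M'] [IsManifold 𝓘(ℝ, E') ∞ M']
  {W : Type*} [NormedAddCommGroup W] [NormedSpace ℝ W]

variable (E M) in
/-- Smooth vector fields on `M`. -/
abbrev VF : Type _ := Cₛ^∞⟮𝓘(ℝ, E); E, fun x : M => TangentSpace 𝓘(ℝ, E) x⟯

/-- The derivative of `f` at `x` in the direction `v`. -/
def dirDeriv (f : M → W) (x : M) (v : TangentSpace 𝓘(ℝ, E) x) : W :=
  mfderiv 𝓘(ℝ, E) 𝓘(ℝ, W) f x v

variable (E E') in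
/-- The differential of `f : M → M'` at `x`. -/
def tmap (f : M → M') (x : M) :
    TangentSpace 𝓘(ℝ, E) x →ₗ[ℝ] TangentSpace 𝓘(ℝ, E') (f x) :=
  (mfderiv 𝓘(ℝ, E) 𝓘(ℝ, E') f x).toLinearMap

variable (E M) in
/-- Smooth differential 3-forms on `M`. -/
structure ThreeForm where
  toFun : ∀ x : M, (TangentSpace 𝓘(ℝ, E) x) [⋀^Fin 3]→ₗ[ℝ] ℝ
  smooth : ∀ X Y Z : VF E M,
    ContMDiff 𝓘(ℝ, E) 𝓘(ℝ, ℝ) ∞ (fun x => toFun x ![X x, Y x, Z x])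

/-- The exterior derivative of a `W`-valued 1-form, evaluated on two vector fields:
`dθ(X, Y) = X θ(Y) - Y θ(X) - θ([X, Y])`. -/
def extDerivOne (θ : ∀ x : M, TangentSpace 𝓘(ℝ, E) x → W) (X Y : VF E M) (x : M) : W :=
  dirDeriv (fun y => θ y (Y y)) x (X x) - dirDeriv (fun y => θ y (X y)) x (Y x)
    - θ x (mlieBracket 𝓘(ℝ, E) X Y x)

/-- The exterior derivative of a 2-form, evaluated on three vector fields. -/
def extDerivTwo (B : ∀ x : M, TangentSpace 𝓘(ℝ, E) x → TangentSpace 𝓘(ℝ, E) x → ℝ)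
    (X Y Z : VF E M) (x : M) : ℝ :=
  dirDeriv (fun y => B y (Y y) (Z y)) x (X x)
    - dirDeriv (fun y => B y (X y) (Z y)) x (Y x)
    + dirDeriv (fun y => B y (X y) (Y y)) x (Z x)
    - B x (mlieBracket 𝓘(ℝ, E) X Y x) (Z x)
    + B x (mlieBracket 𝓘(ℝ, E) X Z x) (Y x)
    - B x (mlieBracket 𝓘(ℝ, E) Y Z x) (X x)

theorem tmap_injective_of_isImmersion {f : M → M'}
    (hf : Manifold.IsImmersion 𝓘(ℝ, E) 𝓘(ℝ, E') ∞ f) (x : M) :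
    Function.Injective (tmap E E' f x) := by
  have h := hf.isImmersionAt x
  set φ := h.domChart
  set ψ := h.codChart
  have hφx : x ∈ φ.source := h.mem_domChart_source
  have hψx : f x ∈ ψ.source := h.mem_codChart_source
  have hφ : MDifferentiableAt 𝓘(ℝ, E) 𝓘(ℝ, E) φ x :=
    ((contMDiffOn_of_mem_maximalAtlas h.domChart_mem_maximalAtlas).contMDiffAt
      (φ.open_source.mem_nhds hφx)).mdifferentiableAt (by simp)
  have hφs : MDifferentiableAt 𝓘(ℝ, E) 𝓘(ℝ, E) φ.symm (φ x) :=
    ((contMDiffOn_symm_of_mem_maximalAtlas h.domChart_mem_maximalAtlas).contMDiffAt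
      (φ.open_target.mem_nhds (φ.map_source hφx))).mdifferentiableAt (by simp)
  have hψ : MDifferentiableAt 𝓘(ℝ, E') 𝓘(ℝ, E') ψ (f x) :=
    ((contMDiffOn_of_mem_maximalAtlas h.codChart_mem_maximalAtlas).contMDiffAt
      (ψ.open_source.mem_nhds hψx)).mdifferentiableAt (by simp)
  have hfx : MDifferentiableAt 𝓘(ℝ, E) 𝓘(ℝ, E') f x :=
    h.contMDiffAt.mdifferentiableAt (by simp)
  let L : E' →L[ℝ] E := (ContinuousLinearMap.fst ℝ E h.complement).comp
    (h.equiv.symm : E' →L[ℝ] E × h.complement)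
  have hL : MDifferentiableAt 𝓘(ℝ, E') 𝓘(ℝ, E) L (ψ (f x)) := L.mdifferentiableAt
  have hval : ∀ y ∈ φ.source, L (ψ (f y)) = φ y := by
    intro y hy
    have hmem : φ y ∈ (h.domChart.extend 𝓘(ℝ, E)).target := by
      simpa [φ] using φ.map_source hy
    have h1 := h.writtenInCharts hmem
    have h2 : ψ (f y) = h.equiv (φ y, 0) := by
      simpa [φ, ψ, h.domChart.left_inv hy] using h1
    simp [h2, L]
  have heq : (φ.symm ∘ (L ∘ (ψ ∘ f))) =ᶠ[𝓝 x] id := by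
    filter_upwards [φ.open_source.mem_nhds hφx] with y hy
    simp [hval y hy, φ.left_inv hy]
  have hφs' : MDifferentiableAt 𝓘(ℝ, E) 𝓘(ℝ, E) φ.symm ((L ∘ (ψ ∘ f)) x) := by
    simpa [hval x hφx] using hφs
  have hcomp := hφs'.hasMFDerivAt.comp x (hL.hasMFDerivAt.comp x
    (hψ.hasMFDerivAt.comp x hfx.hasMFDerivAt))
  have hid := (hasMFDerivAt_id (I := 𝓘(ℝ, E)) x).congr_of_eventuallyEq heq
  have key := hasMFDerivAt_unique hcomp hid
  intro u v huv
  have huv' : mfderiv 𝓘(ℝ, E) 𝓘(ℝ, E') f x u = mfderiv 𝓘(ℝ, E) 𝓘(ℝ, E') f x v := huv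
  have hu := DFunLike.congr_fun key u
  have hv := DFunLike.congr_fun key v
  simp only [ContinuousLinearMap.comp_apply, huv'] at hu hv
  exact hu.symm.trans hv

end Calculus

/-! ### Courant algebroids, splittings, generalized metrics -/

section Algebroid

variable (E : Type*) [NormedAddCommGroup E] [NormedSpace ℝ E]
  {M : Type*} [TopologicalSpace M] [ChartedSpace E M] [IsManifold 𝓘(ℝ, E) ∞ M]
  (F : Type*) [NormedAddCommGroup F] [NormedSpace ℝ F]
  (𝓔 : M → Type*) [TopologicalSpace (TotalSpace F 𝓔)] [∀ x, AddCommGroup (𝓔 x)]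
  [∀ x, Module ℝ (𝓔 x)] [∀ x, TopologicalSpace (𝓔 x)] [FiberBundle F 𝓔] [VectorBundle ℝ F 𝓔]

/-- A Courant algebroid structure on the smooth vector bundle `𝓔 → M`. -/
structure CourantAlgebroid where
  pairing : ∀ x, LinearMap.BilinForm ℝ (𝓔 x)
  anchor : ∀ x, 𝓔 x →ₗ[ℝ] TangentSpace 𝓘(ℝ, E) x
  bracket : Cₛ^∞⟮𝓘(ℝ, E); F, 𝓔⟯ →ₗ[ℝ] Cₛ^∞⟮𝓘(ℝ, E); F, 𝓔⟯ →ₗ[ℝ] Cₛ^∞⟮𝓘(ℝ, E); F, 𝓔⟯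
  pairing_symm : ∀ x u v, pairing x u v = pairing x v u
  pairing_nondeg : ∀ x u, (∀ v, pairing x u v = 0) → u = 0
  pairing_smooth : ∀ e₁ e₂ : Cₛ^∞⟮𝓘(ℝ, E); F, 𝓔⟯,
    ContMDiff 𝓘(ℝ, E) 𝓘(ℝ, ℝ) ∞ (fun x => pairing x (e₁ x) (e₂ x))
  anchor_smooth : ∀ e : Cₛ^∞⟮𝓘(ℝ, E); F, 𝓔⟯,
    ContMDiff 𝓘(ℝ, E) (𝓘(ℝ, E).prod 𝓘(ℝ, E)) ∞
      (fun x => (⟨x, anchor x (e x)⟩ : TangentBundle 𝓘(ℝ, E) M))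
  jacobi : ∀ e₁ e₂ e₃, bracket e₁ (bracket e₂ e₃) =
    bracket (bracket e₁ e₂) e₃ + bracket e₂ (bracket e₁ e₃)
  anchor_bracket : ∀ e₁ e₂ x, anchor x (bracket e₁ e₂ x) =
    mlieBracket 𝓘(ℝ, E) (fun y => anchor y (e₁ y)) (fun y => anchor y (e₂ y)) x
  leibniz : ∀ (e₁ e₂ e₃ : Cₛ^∞⟮𝓘(ℝ, E); F, 𝓔⟯) (f : M → ℝ),
    ContMDiff 𝓘(ℝ, E) 𝓘(ℝ, ℝ) ∞ f → (∀ x, e₃ x = f x • e₂ x) →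
    ∀ x, bracket e₁ e₃ x =
      f x • bracket e₁ e₂ x + dirDeriv f x (anchor x (e₁ x)) • e₂ x
  invariant : ∀ e₁ e₂ e₃ x,
    dirDeriv (fun y => pairing y (e₂ y) (e₃ y)) x (anchor x (e₁ x)) =
      pairing x (bracket e₁ e₂ x) (e₃ x) + pairing x (e₂ x) (bracket e₁ e₃ x)
  /-- `⟦e, e⟧ = ½ π^* d⟨e, e⟩`, where `⟨π^* η, v⟩ = η(π v)`. -/
  bracket_self : ∀ e x (v : 𝓔 x), pairing x (bracket e e x) v =
    (1 / 2) * dirDeriv (fun y => pairing y (e y) (e y)) x (anchor x v)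

variable {E F 𝓔}

/-- Exactness of `0 → T^*M → 𝓔 → TM → 0`. The first map sends `η` to the `v` with
`⟨v, w⟩ = η(π w)` for all `w`; its injectivity amounts to the surjectivity of `π`. -/
structure CourantAlgebroid.IsExact (C : CourantAlgebroid E F 𝓔) : Prop where
  surjective : ∀ x, Function.Surjective (C.anchor x)
  ker_eq : ∀ x (v : 𝓔 x), C.anchor x v = 0 ↔
    ∃ η : Module.Dual ℝ (TangentSpace 𝓘(ℝ, E) x), ∀ w, C.pairing x v w = η (C.anchor x w)

/-- An isotropic splitting `∇ : TM → 𝓔`. -/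
structure IsotropicSplitting (C : CourantAlgebroid E F 𝓔) where
  toFun : ∀ x, TangentSpace 𝓘(ℝ, E) x →ₗ[ℝ] 𝓔 x
  smooth : ∀ X : VF E M, ContMDiff 𝓘(ℝ, E) (𝓘(ℝ, E).prod 𝓘(ℝ, F)) ∞
    (fun x => (⟨x, toFun x (X x)⟩ : TotalSpace F 𝓔))
  anchor_toFun : ∀ x X, C.anchor x (toFun x X) = X
  isotropic : ∀ x X Y, C.pairing x (toFun x X) (toFun x Y) = 0

/-- The section `∇ X` of `𝓔`. -/
def IsotropicSplitting.lift {C : CourantAlgebroid E F 𝓔} (s : IsotropicSplitting C)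
    (X : VF E M) : Cₛ^∞⟮𝓘(ℝ, E); F, 𝓔⟯ :=
  ⟨fun x => s.toFun x (X x), s.smooth X⟩

/-- `H` is the curvature 3-form of the splitting: transporting the bracket along
`∇ + ½ π^* : TM ⊕ T^*M ≅ 𝓔`, for which the pairing is `½ (η(X) + ξ(Y))`, gives the `H`-Courant
bracket. Since `⟨i_Y i_X H, Z⟩ = ½ H(X, Y, Z)`, this means
`H(X, Y, Z) = 2 ⟨⟦∇X, ∇Y⟧, ∇Z⟩`. -/
def IsotropicSplitting.IsCurvature {C : CourantAlgebroid E F 𝓔} (s : IsotropicSplitting C)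
    (H : ThreeForm E M) : Prop :=
  ∀ (X Y Z : VF E M) (x : M), H.toFun x ![X x, Y x, Z x] =
    2 * C.pairing x (C.bracket (s.lift X) (s.lift Y) x) (s.lift Z x)

/-- A generalized metric on `𝓔`. -/
structure GeneralizedMetric (C : CourantAlgebroid E F 𝓔) where
  op : ∀ x, 𝓔 x →ₗ[ℝ] 𝓔 x
  smooth : ∀ e : Cₛ^∞⟮𝓘(ℝ, E); F, 𝓔⟯, ContMDiff 𝓘(ℝ, E) (𝓘(ℝ, E).prod 𝓘(ℝ, F)) ∞
    (fun x => (⟨x, op x (e x)⟩ : TotalSpace F 𝓔))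
  isGenMetric : ∀ x, IsGenMetric (C.pairing x) (op x)

/-- The metric splitting `𝓖(T^*M) ⊕ T^*M`. -/
def IsotropicSplitting.IsMetric {C : CourantAlgebroid E F 𝓔} (s : IsotropicSplitting C)
    (𝓖 : GeneralizedMetric C) : Prop :=
  ∀ x, IsMetricSplitting (C.anchor x) (𝓖.op x) (s.toFun x)

/-- The metric `g` on `TM` induced by a generalized metric, `g(π u, π v) = ⟨u, v⟩` for `u, v` in
the `+1`-eigenbundle `V_+`, written in the metric splitting `s`: as `s` takes values in
`𝓖(T^*M)`, the element of `V_+` over `X` is `s X + 𝓖 (s X)`. -/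
def inducedMetric {C : CourantAlgebroid E F 𝓔} (𝓖 : GeneralizedMetric C)
    (s : IsotropicSplitting C) (x : M) (X Y : TangentSpace 𝓘(ℝ, E) x) : ℝ :=
  C.pairing x (s.toFun x X + 𝓖.op x (s.toFun x X)) (s.toFun x Y + 𝓖.op x (s.toFun x Y))

theorem finiteDimensional_fibre [FiniteDimensional ℝ F] (x : M) : FiniteDimensional ℝ (𝓔 x) :=
  LinearEquiv.finiteDimensional
    ((trivializationAt F 𝓔 x).continuousLinearEquivAt ℝ x
      (FiberBundle.mem_baseSet_trivializationAt' x)).symm.toLinearEquiv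

end Algebroid

/-! ### Lie group actions and extended actions -/

section Action

/-- An exact Courant algebra `𝔞` over the Lie algebra `𝔤`. -/
structure ExactCourantAlgebra (𝔤 𝔞 : Type*) [LieRing 𝔤] [LieAlgebra ℝ 𝔤] [AddCommGroup 𝔞]
    [Module ℝ 𝔞] where
  bracket : 𝔞 →ₗ[ℝ] 𝔞 →ₗ[ℝ] 𝔞
  proj : 𝔞 →ₗ[ℝ] 𝔤
  jacobi : ∀ a b c, bracket a (bracket b c) = bracket (bracket a b) c + bracket b (bracket a c)
  proj_bracket : ∀ a b, proj (bracket a b) = ⁅proj a, proj b⁆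
  surjective : Function.Surjective proj
  bracket_ker : ∀ a b, proj a = 0 → proj b = 0 → bracket a b = 0

/-- A linear right inverse `𝔤 → 𝔞` of the projection. -/
def ExactCourantAlgebra.splitting {𝔤 𝔞 : Type*} [LieRing 𝔤] [LieAlgebra ℝ 𝔤] [AddCommGroup 𝔞]
    [Module ℝ 𝔞] (A : ExactCourantAlgebra 𝔤 𝔞) : 𝔤 →ₗ[ℝ] 𝔞 :=
  Classical.choose (A.proj.exists_rightInverse_of_surjective
    (LinearMap.range_eq_top.2 A.surjective))

variable {EG : Type*} [NormedAddCommGroup EG] [NormedSpace ℝ EG] [FiniteDimensional ℝ EG]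
  {G : Type*} [TopologicalSpace G] [ChartedSpace EG G] [Group G] [LieGroup 𝓘(ℝ, EG) ∞ G]

instance lieGroup_minSmoothness : LieGroup 𝓘(ℝ, EG) (minSmoothness ℝ 3) G :=
  LieGroup.of_le (n := ∞) (by rw [minSmoothness_of_isRCLikeNormedField]; exact ENat.LEInfty.out)

instance finiteDimensional_groupLieAlgebra :
    FiniteDimensional ℝ (GroupLieAlgebra 𝓘(ℝ, EG) G) :=
  inferInstanceAs (FiniteDimensional ℝ EG)

variable {E : Type*} [NormedAddCommGroup E] [NormedSpace ℝ E]
  {M : Type*} [TopologicalSpace M] [ChartedSpace E M] [IsManifold 𝓘(ℝ, E) ∞ M]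
  [MulAction G M]
  {E' : Type*} [NormedAddCommGroup E'] [NormedSpace ℝ E']
  {M' : Type*} [TopologicalSpace M'] [ChartedSpace E' M'] [IsManifold 𝓘(ℝ, E') ∞ M']

/-- The infinitesimal generator `X_γ(x) = d/dt (exp(-tγ) • x)` at `t = 0`, that is, the
fundamental vector field of the right action `x · g = g⁻¹ • x`. With this sign `γ ↦ X_γ` is a
homomorphism of Lie algebras. -/
def infGen (γ : GroupLieAlgebra 𝓘(ℝ, EG) G) (x : M) : TangentSpace 𝓘(ℝ, E) x :=
  (mfderiv 𝓘(ℝ, EG) 𝓘(ℝ, E) (fun g : G => g⁻¹ • x) 1 : EG →L[ℝ] E) γ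

/-- The adjoint action of `G` on its Lie algebra. -/
def Ad (g : G) (γ : GroupLieAlgebra 𝓘(ℝ, EG) G) : GroupLieAlgebra 𝓘(ℝ, EG) G :=
  (mfderiv 𝓘(ℝ, EG) 𝓘(ℝ, EG) (fun h : G => g * h * g⁻¹) 1 : EG →L[ℝ] EG) γ

theorem mdifferentiableAt_inv_smul [ContMDiffSMul 𝓘(ℝ, EG) 𝓘(ℝ, E) ∞ G M] (x : M) :
    MDifferentiableAt 𝓘(ℝ, EG) 𝓘(ℝ, E) (fun g : G => g⁻¹ • x) 1 := by
  have h1 : ContMDiff (𝓘(ℝ, EG).prod 𝓘(ℝ, E)) 𝓘(ℝ, E) ∞ (fun z : G × M => z.1 • z.2) :=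
    contMDiff_smul
  have h2 : ContMDiff 𝓘(ℝ, EG) (𝓘(ℝ, EG).prod 𝓘(ℝ, E)) ∞ (fun g : G => (g⁻¹, x)) :=
    (contMDiff_inv 𝓘(ℝ, EG) ∞).prodMk contMDiff_const
  exact (h1.comp h2).mdifferentiableAt (by simp)

theorem mfderiv_comp_inv_smul [ContMDiffSMul 𝓘(ℝ, EG) 𝓘(ℝ, E) ∞ G M] {f : M → M'} {x : M}
    (hf : MDifferentiableAt 𝓘(ℝ, E) 𝓘(ℝ, E') f x) (γ : GroupLieAlgebra 𝓘(ℝ, EG) G) :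
    (mfderiv 𝓘(ℝ, EG) 𝓘(ℝ, E') (fun g : G => f (g⁻¹ • x)) 1 : EG →L[ℝ] E') γ =
      tmap E E' f x (infGen γ x) := by
  have hx : (1 : G)⁻¹ • x = x := by simp
  have hf' : MDifferentiableAt 𝓘(ℝ, E) 𝓘(ℝ, E') f ((1 : G)⁻¹ • x) := by rwa [hx]
  have h := mfderiv_comp (I' := 𝓘(ℝ, E)) (1 : G) hf'
    (mdifferentiableAt_inv_smul (EG := EG) (E := E) x)
  let D : M → (E →L[ℝ] E') := fun y => mfderiv 𝓘(ℝ, E) 𝓘(ℝ, E') f y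
  have hD : D ((1 : G)⁻¹ • x) = D x := by rw [hx]
  have h' := DFunLike.congr_fun h γ
  exact h'.trans (DFunLike.congr_fun hD (infGen γ x))

/-- Equivariant maps relate the infinitesimal generators. -/
theorem tmap_infGen [ContMDiffSMul 𝓘(ℝ, EG) 𝓘(ℝ, E) ∞ G M] [MulAction G M'] {f : M → M'} {x : M}
    (hf : MDifferentiableAt 𝓘(ℝ, E) 𝓘(ℝ, E') f x) (heq : ∀ (g : G) x, f (g • x) = g • f x)
    (γ : GroupLieAlgebra 𝓘(ℝ, EG) G) :
    tmap E E' f x (infGen γ x) = (infGen γ (f x) : TangentSpace 𝓘(ℝ, E') (f x)) := by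
  have h := mfderiv_comp_inv_smul hf γ
  have hfun : (fun g : G => f (g⁻¹ • x)) = fun g : G => g⁻¹ • f x := funext fun g => heq _ _
  rw [hfun] at h
  exact h.symm

/-- Invariant maps annihilate the infinitesimal generators. -/
theorem tmap_infGen_eq_zero [ContMDiffSMul 𝓘(ℝ, EG) 𝓘(ℝ, E) ∞ G M] {q : M → M'} {x : M}
    (hq : MDifferentiableAt 𝓘(ℝ, E) 𝓘(ℝ, E') q x) (heq : ∀ (g : G) x, q (g • x) = q x)
    (γ : GroupLieAlgebra 𝓘(ℝ, EG) G) :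
    tmap E E' q x (infGen γ x) = 0 := by
  have h := mfderiv_comp_inv_smul hq γ
  have hfun : (fun g : G => q (g⁻¹ • x)) = fun _ : G => q x := funext fun g => heq _ _
  rw [hfun, mfderiv_const] at h
  exact h.symm

end Action

section Extended

variable {EG : Type*} [NormedAddCommGroup EG] [NormedSpace ℝ EG] [FiniteDimensional ℝ EG]
  {G : Type*} [TopologicalSpace G] [ChartedSpace EG G] [Group G] [LieGroup 𝓘(ℝ, EG) ∞ G]
  {𝔞 : Type*} [AddCommGroup 𝔞] [Module ℝ 𝔞]
  {E : Type*} [NormedAddCommGroup E] [NormedSpace ℝ E]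
  {M : Type*} [TopologicalSpace M] [ChartedSpace E M] [IsManifold 𝓘(ℝ, E) ∞ M]
  [MulAction G M]
  {F : Type*} [NormedAddCommGroup F] [NormedSpace ℝ F]
  {𝓔 : M → Type*} [TopologicalSpace (TotalSpace F 𝓔)] [∀ x, AddCommGroup (𝓔 x)]
  [∀ x, Module ℝ (𝓔 x)] [∀ x, TopologicalSpace (𝓔 x)] [FiberBundle F 𝓔] [VectorBundle ℝ F 𝓔]

/-- An extended action: a morphism `Ψ` from an exact Courant algebra over the Lie algebra `𝔤` of
`G` to `Γ(𝓔)`, covering the infinitesimal action of `G` on `M`, mapping `𝔥 = ker(𝔞 → 𝔤)` to closed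
1-forms, and such that `ad ∘ Ψ` integrates to an action of `G` on `𝓔` by symmetries of the Courant
algebroid that covers the action on `M`. -/
structure ExtendedAction (C : CourantAlgebroid E F 𝓔)
    (A : ExactCourantAlgebra (GroupLieAlgebra 𝓘(ℝ, EG) G) 𝔞) where
  Ψ : 𝔞 →ₗ[ℝ] Cₛ^∞⟮𝓘(ℝ, E); F, 𝓔⟯
  map_bracket : ∀ a b, Ψ (A.bracket a b) = C.bracket (Ψ a) (Ψ b)
  anchor_map : ∀ a x, C.anchor x (Ψ a x) = infGen (A.proj a) x
  /-- For `l ∈ 𝔥`, `Ψ l = ½ π^* ω` where `ω(π v) = 2 ⟨Ψ l, v⟩`; the field says `½ dω = 0`,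
  evaluated on the vector fields `π e₁` and `π e₂`. -/
  closed : ∀ l, A.proj l = 0 → ∀ (e₁ e₂ : Cₛ^∞⟮𝓘(ℝ, E); F, 𝓔⟯) (x : M),
    dirDeriv (fun y => C.pairing y (Ψ l y) (e₂ y)) x (C.anchor x (e₁ x))
      - dirDeriv (fun y => C.pairing y (Ψ l y) (e₁ y)) x (C.anchor x (e₂ x))
      - C.pairing x (Ψ l x) (C.bracket e₁ e₂ x) = 0
  /-- The action of `g` on `𝓔`, mapping the fibre over `x` to the fibre over `g • x`. -/
  act : ∀ (g : G) (x : M), 𝓔 x ≃ₗ[ℝ] 𝓔 (g • x)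
  act_smooth : ContMDiff (𝓘(ℝ, EG).prod (𝓘(ℝ, E).prod 𝓘(ℝ, F))) (𝓘(ℝ, E).prod 𝓘(ℝ, F)) ∞
    (fun z : G × TotalSpace F 𝓔 =>
      (⟨z.1 • z.2.proj, act z.1 z.2.proj z.2.2⟩ : TotalSpace F 𝓔))
  act_one : ∀ x v, (⟨(1 : G) • x, act 1 x v⟩ : TotalSpace F 𝓔) = ⟨x, v⟩
  act_mul : ∀ g h x v, (⟨(g * h) • x, act (g * h) x v⟩ : TotalSpace F 𝓔) =
    ⟨g • h • x, act g (h • x) (act h x v)⟩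
  act_pairing : ∀ g x u v, C.pairing (g • x) (act g x u) (act g x v) = C.pairing x u v
  act_anchor : ∀ g x v, C.anchor (g • x) (act g x v) = tmap E E (fun y : M => g • y) x (C.anchor x v)
  act_bracket : ∀ g (e₁ e₂ e₁' e₂' : Cₛ^∞⟮𝓘(ℝ, E); F, 𝓔⟯),
    (∀ x, e₁' (g • x) = act g x (e₁ x)) → (∀ x, e₂' (g • x) = act g x (e₂ x)) →
    ∀ x, C.bracket e₁' e₂' (g • x) = act g x (C.bracket e₁ e₂ x)
  /-- The infinitesimal action is `ad ∘ Ψ`: for `a ∈ 𝔞` over `γ ∈ 𝔤`, the derivative at `t = 0` of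
  the pull-back of a section `e` by `exp(-tγ)` is `⟦Ψ a, e⟧`. -/
  infinitesimal : ∀ a (e : Cₛ^∞⟮𝓘(ℝ, E); F, 𝓔⟯) x (w : 𝓔 x),
    dirDeriv (fun g : G => C.pairing x ((act g⁻¹ x).symm (e (g⁻¹ • x))) w) 1 (A.proj a) =
      C.pairing x (C.bracket (Ψ a) e x) w

variable {C : CourantAlgebroid E F 𝓔} {A : ExactCourantAlgebra (GroupLieAlgebra 𝓘(ℝ, EG) G) 𝔞}

namespace ExtendedAction

/-- The extended action preserves the generalized metric. -/
def Preserves (Φ : ExtendedAction C A) (𝓖 : GeneralizedMetric C) : Prop :=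
  ∀ (g : G) (x : M) (v : 𝓔 x), 𝓖.op (g • x) (Φ.act g x v) = Φ.act g x (𝓖.op x v)

/-- The distribution `K = Ψ(𝔞)` in `𝓔`. -/
def K (Φ : ExtendedAction C A) (x : M) : Submodule ℝ (𝓔 x) :=
  LinearMap.range
    { toFun := fun a => Φ.Ψ a x
      map_add' := fun a b => by simp
      map_smul' := fun c a => by simp : 𝔞 →ₗ[ℝ] 𝓔 x }

/-- The distribution `K^⊥` in `𝓔`. -/
def Kperp (Φ : ExtendedAction C A) (x : M) : Submodule ℝ (𝓔 x) :=
  (C.pairing x).orthogonal (Φ.K x)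

/-- The distribution `Δ_b = π(K + K^⊥)` in `TM`. -/
def bigDistribution (Φ : ExtendedAction C A) (x : M) : Submodule ℝ (TangentSpace 𝓘(ℝ, E) x) :=
  (Φ.K x ⊔ Φ.Kperp x).map (C.anchor x)

end ExtendedAction

variable {EP : Type*} [NormedAddCommGroup EP] [NormedSpace ℝ EP]
  {P : Type*} [TopologicalSpace P] [ChartedSpace EP P] [IsManifold 𝓘(ℝ, EP) ∞ P]
  [MulAction G P]
  {ER : Type*} [NormedAddCommGroup ER] [NormedSpace ℝ ER]
  {R : Type*} [TopologicalSpace R] [ChartedSpace ER R] [IsManifold 𝓘(ℝ, ER) ∞ R]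

variable (EP) in
/-- `ι` exhibits `P` as a connected, injectively immersed integral manifold of `Δ_b` that is stable
under `G` and carries the induced action. (The leaves of `Δ_b` are the maximal ones; maximality is
not required.) -/
structure IsLeaf (Φ : ExtendedAction C A) (ι : P → M) : Prop where
  connected : ConnectedSpace P
  immersion : Manifold.IsImmersion 𝓘(ℝ, EP) 𝓘(ℝ, E) ∞ ι
  injective : Function.Injective ι
  equivariant : ∀ (g : G) p, ι (g • p) = g • ι p
  tangent : ∀ p, LinearMap.range (tmap EP E ι p) = Φ.bigDistribution (ι p)

variable (G EP ER) in
/-- `q : P → R` exhibits the manifold `R` as the quotient manifold `P / G`. -/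
structure IsOrbitProjection (q : P → R) : Prop where
  submersion : Manifold.IsSubmersion 𝓘(ℝ, EP) 𝓘(ℝ, ER) ∞ q
  surjective : Function.Surjective q
  fibres : ∀ p p', q p = q p' ↔ ∃ g : G, g • p = p'

/-- `K` is isotropic over `P`. -/
def IsotropicOver (Φ : ExtendedAction C A) (ι : P → M) : Prop :=
  ∀ p, Φ.K (ι p) ≤ Φ.Kperp (ι p)

/-! ### The reduced algebroid

The fibre of `𝓔^red = (K^⊥ / K)|_P / G` over `q p` is identified with `K^⊥ / K` at `ι p`, and
sections of `𝓔^red` over `P / G` with `G`-invariant sections of `(K^⊥ / K)|_P`. -/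

/-- The fibre `K^⊥ / (K ∩ K^⊥)`. -/
abbrev RedFibre (Φ : ExtendedAction C A) (x : M) : Type _ := RedSpace (C.pairing x) (Φ.K x)

/-- The pairing of `𝓔^red`. -/
def redPairing (Φ : ExtendedAction C A) (x : M) : LinearMap.BilinForm ℝ (RedFibre Φ x) :=
  redForm (C.pairing x) (C.pairing_symm x) (Φ.K x)

/-- The anchor of `𝓔^red`: the class of `v ∈ K^⊥` at `ι p` is sent to `dq(Y)`, where `Y ∈ T_p P` is
the vector with `dι(Y) = π v`. -/
def redAnchor [ContMDiffSMul 𝓘(ℝ, EG) 𝓘(ℝ, EP) ∞ G P] {Φ : ExtendedAction C A} {ι : P → M}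
    (hι : IsLeaf EP Φ ι) {q : P → R} (hq : IsOrbitProjection G EP ER q) (p : P) :
    RedFibre Φ (ι p) →ₗ[ℝ] TangentSpace 𝓘(ℝ, ER) (q p) :=
  Submodule.liftQ _
    (tmap EP ER q p ∘ₗ (tmap EP E ι p).leftInverse ∘ₗ C.anchor (ι p) ∘ₗ
      ((C.pairing (ι p)).orthogonal (Φ.K (ι p))).subtype)
    (by
      rintro ⟨v, hv⟩ ⟨a, rfl⟩
      have h1 : C.anchor (ι p) (Φ.Ψ a (ι p)) = tmap EP E ι p (infGen (A.proj a) p) := by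
        rw [Φ.anchor_map, tmap_infGen (hι.immersion.contMDiff.mdifferentiableAt (by simp))
          hι.equivariant]
      rw [LinearMap.mem_ker]
      change tmap EP ER q p ((tmap EP E ι p).leftInverse (C.anchor (ι p) (Φ.Ψ a (ι p)))) = 0
      rw [h1, LinearMap.leftInverse_apply_of_inj
        (LinearMap.ker_eq_bot.2 (tmap_injective_of_isImmersion hι.immersion p))]
      exact tmap_infGen_eq_zero (hq.submersion.contMDiff.mdifferentiableAt (by simp))
        (fun g x => ((hq.fibres x (g • x)).2 ⟨g, rfl⟩).symm) _)

/-- The generalized metric `𝓖^red` of `𝓔^red`. -/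
def redMetric [FiniteDimensional ℝ F] (𝓖 : GeneralizedMetric C) {Φ : ExtendedAction C A}
    {ι : P → M} (hK : IsotropicOver Φ ι) (p : P) :
    RedFibre Φ (ι p) →ₗ[ℝ] RedFibre Φ (ι p) :=
  haveI := finiteDimensional_fibre (F := F) (𝓔 := 𝓔) (ι p)
  redMetricOp (𝓖.isGenMetric (ι p)) (hK p)

/-- The identification of the fibres over two equal points. -/
def fibreCast {x y : M} (h : x = y) : 𝓔 x ≃ₗ[ℝ] 𝓔 y := h ▸ LinearEquiv.refl ℝ (𝓔 x)

/-- The action of `g` on `𝓔|_P`. -/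
def leafAct {Φ : ExtendedAction C A} {ι : P → M} (hι : IsLeaf EP Φ ι) (g : G) (p : P) :
    𝓔 (ι p) ≃ₗ[ℝ] 𝓔 (ι (g • p)) :=
  (Φ.act g (ι p)).trans (fibreCast (hι.equivariant g p).symm)

/-- `k` is a smooth `G`-invariant section of `K^⊥|_P` that represents the section `s`. -/
structure IsInvariantLift {Φ : ExtendedAction C A} {ι : P → M} (hι : IsLeaf EP Φ ι)
    (s : ∀ p, RedFibre Φ (ι p)) (k : ∀ p, 𝓔 (ι p)) : Prop where
  smooth : ContMDiff 𝓘(ℝ, EP) (𝓘(ℝ, E).prod 𝓘(ℝ, F)) ∞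
    (fun p => (⟨ι p, k p⟩ : TotalSpace F 𝓔))
  invariant : ∀ (g : G) p, k (g • p) = leafAct hι g p (k p)
  represents : ∀ p, ∃ h, redClass (C.pairing (ι p)) (Φ.K (ι p)) (k p) h = s p

/-- `s` is a smooth section of `𝓔^red`. -/
def IsRedSection {Φ : ExtendedAction C A} {ι : P → M} (hι : IsLeaf EP Φ ι)
    (s : ∀ p, RedFibre Φ (ι p)) : Prop :=
  ∃ k, IsInvariantLift hι s k

/-- `e` is a section of `𝓔` that, near `p`, extends a `G`-invariant lift of the section `s` of
`𝓔^red`. -/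
def IsExtensionAt {Φ : ExtendedAction C A} {ι : P → M} (hι : IsLeaf EP Φ ι)
    (s : ∀ p, RedFibre Φ (ι p)) (p : P) (e : Cₛ^∞⟮𝓘(ℝ, E); F, 𝓔⟯) : Prop :=
  ∃ k, IsInvariantLift hι s k ∧ ∀ᶠ p' in 𝓝 p, e (ι p') = k p'

/-- `s₃` is the bracket of the sections `s₁` and `s₂` of `𝓔^red`: at every point, extensions of
invariant lifts of `s₁` and `s₂` exist, and for every choice of them their bracket lies in `K^⊥`
and represents `s₃`. -/
def IsRedBracket {Φ : ExtendedAction C A} {ι : P → M} (hι : IsLeaf EP Φ ι)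
    (s₁ s₂ s₃ : ∀ p, RedFibre Φ (ι p)) : Prop :=
  ∀ p, (∃ e₁, IsExtensionAt hι s₁ p e₁) ∧ (∃ e₂, IsExtensionAt hι s₂ p e₂) ∧
    ∀ e₁ e₂, IsExtensionAt hι s₁ p e₁ → IsExtensionAt hι s₂ p e₂ →
      ∃ h, redClass (C.pairing (ι p)) (Φ.K (ι p)) (C.bracket e₁ e₂ (ι p)) h = s₃ p

/-- The section `∇X` of `𝓔^red`, for a splitting `t` of `𝓔^red` and a vector field `X` on `P / G`. -/
def redLift {Φ : ExtendedAction C A} {ι : P → M} {q : P → R}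
    (t : ∀ p, TangentSpace 𝓘(ℝ, ER) (q p) →ₗ[ℝ] RedFibre Φ (ι p)) (X : VF ER R) (p : P) :
    RedFibre Φ (ι p) :=
  t p (X (q p))

/-- `t` is the metric splitting of `(𝓔^red, 𝓖^red)`. -/
structure IsRedMetricSplitting [FiniteDimensional ℝ F] [ContMDiffSMul 𝓘(ℝ, EG) 𝓘(ℝ, EP) ∞ G P]
    (𝓖 : GeneralizedMetric C) {Φ : ExtendedAction C A} {ι : P → M} (hι : IsLeaf EP Φ ι)
    (hK : IsotropicOver Φ ι) {q : P → R} (hq : IsOrbitProjection G EP ER q)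
    (t : ∀ p, TangentSpace 𝓘(ℝ, ER) (q p) →ₗ[ℝ] RedFibre Φ (ι p)) : Prop where
  isMetricSplitting : ∀ p, IsMetricSplitting (redAnchor hι hq p) (redMetric 𝓖 hK p) (t p)
  smooth : ∀ X : VF ER R, IsRedSection hι (redLift t X)

/-- `H` is the curvature of the splitting `t` of `𝓔^red`, normalized as for `𝓔`. -/
def IsRedCurvature {Φ : ExtendedAction C A} {ι : P → M} (hι : IsLeaf EP Φ ι) {q : P → R}
    (t : ∀ p, TangentSpace 𝓘(ℝ, ER) (q p) →ₗ[ℝ] RedFibre Φ (ι p)) (H : ThreeForm ER R) : Prop :=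
  ∀ X Y Z : VF ER R, ∃ s, IsRedBracket hι (redLift t X) (redLift t Y) s ∧
    ∀ p, H.toFun (q p) ![X (q p), Y (q p), Z (q p)] =
      2 * redPairing Φ (ι p) (s p) (redLift t Z p)

/-! ### The distribution `τ_+`, connections and the 2-form `B` -/

/-- The 1-form `ξ_γ` on `P`: in the splitting `s`, over `P` the action is `γ ↦ X_γ + ξ_γ`. If
`a ∈ 𝔞` lies over `γ`, then `Ψ a = s X_γ + ½ π^* ξ_γ`, so `ξ_γ(Y) = 2 ⟨Ψ a, s Y⟩`; over an
isotropic leaf the choice of `a` does not matter. -/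
def xi (Φ : ExtendedAction C A) (s : IsotropicSplitting C) (ι : P → M) (p : P)
    (γ : GroupLieAlgebra 𝓘(ℝ, EG) G) (Y : TangentSpace 𝓘(ℝ, EP) p) : ℝ :=
  2 * C.pairing (ι p) (Φ.Ψ (A.splitting γ) (ι p)) (s.toFun (ι p) (tmap EP E ι p Y))

/-- The distribution `τ_+ = {Y ∈ TP : g(Y, X_γ) = - ξ_γ(Y) for all γ ∈ 𝔤}` on `P`, for the metric
splitting `s`, in which the 2-form part of the generalized metric vanishes. -/
def tauPlus (𝓖 : GeneralizedMetric C) (Φ : ExtendedAction C A) (s : IsotropicSplitting C)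
    (ι : P → M) (p : P) : Set (TangentSpace 𝓘(ℝ, EP) p) :=
  {Y | ∀ γ : GroupLieAlgebra 𝓘(ℝ, EG) G,
    inducedMetric 𝓖 s (ι p) (tmap EP E ι p Y) (tmap EP E ι p (infGen γ p)) = - xi Φ s ι p γ Y}

variable (EG G EP P) in
/-- A principal connection on `P`, as a `𝔤`-valued 1-form. -/
structure PrincipalConnection where
  toFun : ∀ p : P, TangentSpace 𝓘(ℝ, EP) p →ₗ[ℝ] GroupLieAlgebra 𝓘(ℝ, EG) G
  smooth : ∀ Y : VF EP P, ContMDiff (M' := EG) 𝓘(ℝ, EP) 𝓘(ℝ, EG) ∞ (fun p => toFun p (Y p))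
  vertical : ∀ p γ, toFun p (infGen γ p) = γ
  equivariant : ∀ (g : G) p Y,
    toFun (g • p) (tmap EP EP (fun p' : P => g • p') p Y) = Ad g (toFun p Y)

/-- The curvature `F = dθ + ½ [θ, θ]`, evaluated on two vector fields. -/
def PrincipalConnection.curvature (θ : PrincipalConnection EG G EP P) (Y Z : VF EP P) (p : P) :
    GroupLieAlgebra 𝓘(ℝ, EG) G :=
  let dθ : GroupLieAlgebra 𝓘(ℝ, EG) G := extDerivOne (W := EG) (fun p' => θ.toFun p') Y Z p
  dθ + ⁅θ.toFun p (Y p), θ.toFun p (Z p)⁆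

/-- The 2-form `B = ∑ θ_i ∧ ξ_i + ½ ∑ ξ_j(X_i) θ_i ∧ θ_j`. -/
def straightening (Φ : ExtendedAction C A) (s : IsotropicSplitting C) (ι : P → M)
    (θ : PrincipalConnection EG G EP P) (p : P) (Y Z : TangentSpace 𝓘(ℝ, EP) p) : ℝ :=
  let b := Module.finBasis ℝ (GroupLieAlgebra 𝓘(ℝ, EG) G)
  let θc := fun i (Y : TangentSpace 𝓘(ℝ, EP) p) => b.repr (θ.toFun p Y) i
  ∑ i, (θc i Y * xi Φ s ι p (b i) Z - θc i Z * xi Φ s ι p (b i) Y)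
    + (1 / 2) * ∑ i, ∑ j, xi (EP := EP) Φ s ι p (b j) (infGen (b i) p) * (θc i Y * θc j Z - θc i Z * θc j Y)

/-- The 3-form `⟨F, ξ⟩ = ∑ F_i ∧ ξ_i`, where `F` is the curvature of `θ`, evaluated on three vector
fields. -/
def curvaturePairing (Φ : ExtendedAction C A) (s : IsotropicSplitting C) (ι : P → M)
    (θ : PrincipalConnection EG G EP P) (Y₁ Y₂ Y₃ : VF EP P) (p : P) : ℝ :=
  xi Φ s ι p (θ.curvature Y₁ Y₂ p) (Y₃ p) + xi Φ s ι p (θ.curvature Y₂ Y₃ p) (Y₁ p)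
    + xi Φ s ι p (θ.curvature Y₃ Y₁ p) (Y₂ p)

end Extended

end CourantReduction

end

open CourantReduction

/-! Over `P` write elements of the algebroid in the metric splitting as `Y + η`. The element of the
eigenbundle `V_ε` (`ε = ±1`) over `Y` is `Y + ε g(Y, ·)` (`eigenLift`), and it lies in `K^⊥` exactly
when `g(Y, X_γ) + ε ξ_γ(Y) = 0` for all `γ` (`eigenLift_mem_Kperp_iff_connPairing`). Isotropy of `K`
makes `ξ_γ(X_γ')` antisymmetric, so restricting this condition to vertical `Y` gives a nondegenerate
form on the Lie algebra. Hence each sign defines a complement `τ_±` of the vertical directions. It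
is the kernel of a principal connection because `ξ` is equivariant (`xiForm_smul`); that is proved
infinitesimally from `ad ∘ Ψ` and then integrated over the connected group.

The reduced metric splitting sends `X` to the class of the mean of the two eigenlifts of the `τ_+`-
and `τ_-`-horizontal lifts of `X` (`splittingRep`, `isMetricSplitting_redSplitting`). This rests on
the fact that `ker dq` consists of infinitesimal generators (`exists_infGen_eq_of_tmap_eq_zero`),
which is where freeness and properness of the action enter.

Let `D` be the preimage in `K^⊥` of the image of this splitting, so `D` is spanned by the
representatives and `K` (`splittingSpan`). It is isotropic. In the metric splitting its elements
over `Y ∈ TP` have the form `Y + i_Y B`, with `B` built from `θ_+`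
(`two_mul_pairing_splittingSpan`): contraction of `B` with `X_γ` is `ξ_γ`, which settles vertical
test vectors, and on test vectors in `τ_+` the defining equation of `τ_+` turns `g` into `ξ`.

On sections of `D` the expression `⟨⟦e₁, e₂⟧, e₃⟩` along the leaf is alternating, tensorial and
insensitive to `K` (`SplittingNear.congr_mod`). So the reduced curvature at `dq Y₁, dq Y₂, dq Y₃`
can be computed from any sections of `D` over the `Y_i`, invariant or not. For `Y_i + i_{Y_i} B` the
bracket gives `H + dB` (`two_mul_pairing_bracket_eq`, `curvatureAt_tmap`). At a point where the
`Y_i` are horizontal, all terms of `dB` are differentiated or bracketed values of `θ_+` paired with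
`ξ`, and they assemble to `⟨F, ξ⟩` (`extDerivTwo_straightening`).

What remains is to see that the reduced bracket is well defined and that the curvature descends to a
smooth form on the quotient. The bracket is well defined because `⟦Ψ a, e⟧` vanishes along the leaf
for invariant `e` (`bracket_Ψ_eq_zero`, `bracket_sub_bracket_mem_K`). The curvature descends because
the group preserves the bracket and the splitting (`curvatureAt_smul_point`). -/

noncomputable section

set_option linter.unusedSectionVars false

namespace CourantReduction

/-! ### Lie brackets of vector fields and directional derivatives. -/

section Calculus

variable {E : Type*} [NormedAddCommGroup E] [NormedSpace ℝ E] [FiniteDimensional ℝ E]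
  {M : Type*} [TopologicalSpace M] [ChartedSpace E M] [IsManifold 𝓘(ℝ, E) ∞ M]
  {E' : Type*} [NormedAddCommGroup E'] [NormedSpace ℝ E'] [FiniteDimensional ℝ E']
  {M' : Type*} [TopologicalSpace M'] [ChartedSpace E' M'] [IsManifold 𝓘(ℝ, E') ∞ M']
  {W : Type*} [NormedAddCommGroup W] [NormedSpace ℝ W]

theorem two_le_infty : (2 : WithTop ℕ∞) ≤ ∞ := ENat.LEInfty.out

theorem one_le_infty : (1 : WithTop ℕ∞) ≤ ∞ := ENat.LEInfty.out

theorem tmap_comp {E'' : Type*} [NormedAddCommGroup E''] [NormedSpace ℝ E'']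
    {M'' : Type*} [TopologicalSpace M''] [ChartedSpace E'' M''] [IsManifold 𝓘(ℝ, E'') ∞ M'']
    {g : M' → M''} {f : M → M'} {x : M} (hg : MDifferentiableAt 𝓘(ℝ, E') 𝓘(ℝ, E'') g (f x))
    (hf : MDifferentiableAt 𝓘(ℝ, E) 𝓘(ℝ, E') f x) (v : TangentSpace 𝓘(ℝ, E) x) :
    tmap E E'' (fun y => g (f y)) x v = tmap E' E'' g (f x) (tmap E E' f x v) :=
  DFunLike.congr_fun (mfderiv_comp x hg hf) v

theorem dirDeriv_comp {g : M' → W} {f : M → M'} {x : M}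
    (hg : MDifferentiableAt 𝓘(ℝ, E') 𝓘(ℝ, W) g (f x))
    (hf : MDifferentiableAt 𝓘(ℝ, E) 𝓘(ℝ, E') f x) (v : TangentSpace 𝓘(ℝ, E) x) :
    dirDeriv (fun y => g (f y)) x v = dirDeriv g (f x) (tmap E E' f x v) :=
  DFunLike.congr_fun (mfderiv_comp x hg hf) v

theorem tmap_congr {f f' : M → M'} {x : M} (h : f =ᶠ[𝓝 x] f') (v : TangentSpace 𝓘(ℝ, E) x) :
    (tmap E E' f x v : E') = tmap E E' f' x v :=
  DFunLike.congr_fun h.mfderiv_eq v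

theorem dirDeriv_congr {f f' : M → W} {x : M} (h : f =ᶠ[𝓝 x] f') (v : TangentSpace 𝓘(ℝ, E) x) :
    dirDeriv f x v = dirDeriv f' x v :=
  DFunLike.congr_fun h.mfderiv_eq v

/-- On a vector space, the Lie bracket is the commutator of the directional derivatives. -/
theorem fderiv_lieBracket {f : E → W} {X Y : E → E} {x : E} (hf : ContDiffAt ℝ 2 f x)
    (hX : DifferentiableAt ℝ X x) (hY : DifferentiableAt ℝ Y x) :
    fderiv ℝ f x (lieBracket ℝ X Y x) =
      fderiv ℝ (fun y => fderiv ℝ f y (Y y)) x (X x)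
        - fderiv ℝ (fun y => fderiv ℝ f y (X y)) x (Y x) := by
  have hd : DifferentiableAt ℝ (fderiv ℝ f) x :=
    (hf.fderiv_right (m := 1) (by norm_num)).differentiableAt (by norm_num)
  have hs : IsSymmSndFDerivAt ℝ f x := hf.isSymmSndFDerivAt (by simp)
  rw [fderiv_clm_apply hd hY, fderiv_clm_apply hd hX]
  simp only [lieBracket_eq, map_sub, add_apply,
    ContinuousLinearMap.comp_apply, ContinuousLinearMap.flip_apply]
  rw [hs (X x) (Y x)]
  abel

theorem eventually_contMDiffAt_extChartAt_symm (x : M) :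
    ∀ᶠ z in 𝓝 (extChartAt 𝓘(ℝ, E) x x),
      ContMDiffAt 𝓘(ℝ, E) 𝓘(ℝ, E) ∞ (extChartAt 𝓘(ℝ, E) x).symm z := by
  filter_upwards [(isOpen_extChartAt_target x).mem_nhds (mem_extChartAt_target x)] with z hz
  exact (contMDiffOn_extChartAt_symm x).contMDiffAt ((isOpen_extChartAt_target x).mem_nhds hz)

theorem isInvertible_mfderiv_extChartAt_symm {x : M} {z : E}
    (hz : z ∈ (extChartAt 𝓘(ℝ, E) x).target) :
    (mfderiv 𝓘(ℝ, E) 𝓘(ℝ, E) (extChartAt 𝓘(ℝ, E) x).symm z).IsInvertible := by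
  have h := isInvertible_mfderivWithin_extChartAt_symm (I := 𝓘(ℝ, E)) (x := x) hz
  simpa using h

/-- In the inverse chart both claims concern `f ∘ c` and the pulled-back fields on a vector space,
where the symmetry of the second derivative applies. They are proved together because they share
this translation. -/
theorem mdifferentiableAt_dirDeriv_and_dirDeriv_mlieBracket {f : M → W} {X Y : ∀ x : M, TangentSpace 𝓘(ℝ, E) x} {x : M}
    (hf : ∀ᶠ y in 𝓝 x, ContMDiffAt 𝓘(ℝ, E) 𝓘(ℝ, W) ∞ f y)
    (hX : MDifferentiableAt 𝓘(ℝ, E) (𝓘(ℝ, E).prod 𝓘(ℝ, E))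
      (fun y => (⟨y, X y⟩ : TangentBundle 𝓘(ℝ, E) M)) x)
    (hY : MDifferentiableAt 𝓘(ℝ, E) (𝓘(ℝ, E).prod 𝓘(ℝ, E))
      (fun y => (⟨y, Y y⟩ : TangentBundle 𝓘(ℝ, E) M)) x) :
    MDifferentiableAt 𝓘(ℝ, E) 𝓘(ℝ, W) (fun y => dirDeriv f y (X y)) x ∧
    dirDeriv f x (mlieBracket 𝓘(ℝ, E) X Y x) =
      dirDeriv (fun y => dirDeriv f y (Y y)) x (X x)
        - dirDeriv (fun y => dirDeriv f y (X y)) x (Y x) := by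
  let c : E → M := (extChartAt 𝓘(ℝ, E) x).symm
  let x' : E := extChartAt 𝓘(ℝ, E) x x
  have hcx : c x' = x := extChartAt_to_inv x
  have hcev := eventually_contMDiffAt_extChartAt_symm (E := E) x
  have hcs : ContMDiffAt 𝓘(ℝ, E) 𝓘(ℝ, E) ∞ c x' := hcev.self_of_nhds
  have hinv : ∀ᶠ z in 𝓝 x', (mfderiv 𝓘(ℝ, E) 𝓘(ℝ, E) c z).IsInvertible := by
    filter_upwards [(isOpen_extChartAt_target x).mem_nhds (mem_extChartAt_target x)] with z hz
    exact isInvertible_mfderiv_extChartAt_symm hz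
  -- Differentiating `f ∘ c` along the pull-back of `Z` is differentiating `f` along `Z`;
  -- invertibility of `dc` is what makes the pull-back field meaningful.
  have key : ∀ (Z : ∀ x : M, TangentSpace 𝓘(ℝ, E) x), ∀ᶠ z in 𝓝 x',
      fderiv ℝ (f ∘ c) z (mpullback 𝓘(ℝ, E) 𝓘(ℝ, E) c Z z) = dirDeriv f (c z) (Z (c z)) := by
    intro Z
    have hcont : Tendsto c (𝓝 x') (𝓝 x) := by
      have := hcs.continuousAt; rwa [ContinuousAt, hcx] at this
    filter_upwards [hinv, hcev, hcont.eventually hf] with z hz hz' hfz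
    have h1 := dirDeriv_comp (hfz.mdifferentiableAt (by simp)) (hz'.mdifferentiableAt (by simp))
      (mpullback 𝓘(ℝ, E) 𝓘(ℝ, E) c Z z)
    rw [dirDeriv, mfderiv_eq_fderiv] at h1
    refine h1.trans ?_
    exact congrArg (dirDeriv f (c z)) (hz.self_apply_inverse _)
  have hdiff : ∀ (Z : ∀ x : M, TangentSpace 𝓘(ℝ, E) x), MDifferentiableAt 𝓘(ℝ, E)
      (𝓘(ℝ, E).prod 𝓘(ℝ, E)) (fun y => (⟨y, Z y⟩ : TangentBundle 𝓘(ℝ, E) M)) x →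
      DifferentiableAt ℝ (fun z => (mpullback 𝓘(ℝ, E) 𝓘(ℝ, E) c Z z : E)) x' := by
    intro Z hZ
    rw [← hcx] at hZ
    exact ((contMDiff_snd_tangentBundle_modelSpace E 𝓘(ℝ, E)).contMDiffAt.mdifferentiableAt
      one_ne_zero |>.comp x' (MDifferentiableAt.mpullback_vectorField hZ hcs hinv.self_of_nhds
        two_le_infty)).differentiableAt
  have hfc : ContDiffAt ℝ 2 (f ∘ c) x' := by
    have h1 : ContMDiffAt 𝓘(ℝ, E) 𝓘(ℝ, W) ∞ f (c x') := by rw [hcx]; exact hf.self_of_nhds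
    exact ((h1.comp x' hcs).contDiffAt).of_le two_le_infty
  have hF : ∀ (Z : ∀ x : M, TangentSpace 𝓘(ℝ, E) x), MDifferentiableAt 𝓘(ℝ, E)
      (𝓘(ℝ, E).prod 𝓘(ℝ, E)) (fun y => (⟨y, Z y⟩ : TangentBundle 𝓘(ℝ, E) M)) x →
      MDifferentiableAt 𝓘(ℝ, E) 𝓘(ℝ, W) (fun y => dirDeriv f y (Z y)) x := by
    intro Z hZ
    have h1 : DifferentiableAt ℝ
        (fun z => fderiv ℝ (f ∘ c) z (mpullback 𝓘(ℝ, E) 𝓘(ℝ, E) c Z z)) x' :=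
      ((hfc.fderiv_right (m := 1) (by norm_num)).differentiableAt (by norm_num)).clm_apply
        (hdiff Z hZ)
    have h2 := h1.mdifferentiableAt.comp x
      ((contMDiffAt_extChartAt (I := 𝓘(ℝ, E)) (n := ∞) (x := x)).mdifferentiableAt (by simp))
    refine h2.congr_of_eventuallyEq ?_
    filter_upwards [(continuousAt_extChartAt (I := 𝓘(ℝ, E)) x).eventually (key Z),
      extChartAt_source_mem_nhds (I := 𝓘(ℝ, E)) x] with y hy hy'
    -- The vector `Z y'` lives in a type that depends on `y'`, so the equality of base points is
    -- eliminated by substitution and not by rewriting.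
    have h3 : ∀ y', y' = y → dirDeriv f y' (Z y') = dirDeriv f y (Z y) := by rintro _ rfl; rfl
    exact (hy.trans (h3 _ ((extChartAt 𝓘(ℝ, E) x).left_inv hy'))).symm
  have key2 : ∀ (Z Z' : ∀ x : M, TangentSpace 𝓘(ℝ, E) x), MDifferentiableAt 𝓘(ℝ, E)
      (𝓘(ℝ, E).prod 𝓘(ℝ, E)) (fun y => (⟨y, Z y⟩ : TangentBundle 𝓘(ℝ, E) M)) x →
      fderiv ℝ (fun z => fderiv ℝ (f ∘ c) z (mpullback 𝓘(ℝ, E) 𝓘(ℝ, E) c Z z)) x'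
        (mpullback 𝓘(ℝ, E) 𝓘(ℝ, E) c Z' x') = dirDeriv (fun y => dirDeriv f y (Z y)) x (Z' x) := by
    intro Z Z' hZ
    have h3 : MDifferentiableAt 𝓘(ℝ, E) 𝓘(ℝ, W) (fun y => dirDeriv f y (Z y)) (c x') := by
      rw [hcx]; exact hF Z hZ
    have h4 : ∀ y, y = x → dirDeriv (fun y => dirDeriv f y (Z y)) y (Z' y) =
        dirDeriv (fun y => dirDeriv f y (Z y)) x (Z' x) := by
      rintro _ rfl; rfl
    have h5 := dirDeriv_comp h3 (hcs.mdifferentiableAt (by simp))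
      (mpullback 𝓘(ℝ, E) 𝓘(ℝ, E) c Z' x')
    rw [dirDeriv, mfderiv_eq_fderiv] at h5
    have h6 : fderiv ℝ (fun z => fderiv ℝ (f ∘ c) z (mpullback 𝓘(ℝ, E) 𝓘(ℝ, E) c Z z)) x' =
        fderiv ℝ (fun z => dirDeriv f (c z) (Z (c z))) x' := Filter.EventuallyEq.fderiv_eq (key Z)
    refine (DFunLike.congr_fun h6 _).trans (h5.trans ?_)
    refine Eq.trans ?_ (h4 _ hcx)
    exact congrArg (dirDeriv _ (c x')) (hinv.self_of_nhds.self_apply_inverse _)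
  refine ⟨hF X hX, ?_⟩
  have h5 := fderiv_lieBracket hfc (hdiff X hX) (hdiff Y hY)
  rw [key2 Y X hY, key2 X Y hX] at h5
  rw [← h5]
  have : IsManifold 𝓘(ℝ, E) (minSmoothness ℝ 2) M := IsManifold.of_le (n := ∞) (by
    rw [minSmoothness_of_isRCLikeNormedField]; exact two_le_infty)
  have h6 := mpullback_mlieBracket (I := 𝓘(ℝ, E)) (I' := 𝓘(ℝ, E)) (f := c) (x₀ := x') (V := X)
    (W := Y) (n := ∞) (by rw [hcx]; exact hX) (by rw [hcx]; exact hY) hcs (by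
      rw [minSmoothness_of_isRCLikeNormedField]; exact two_le_infty)
  rw [← mlieBracketWithin_univ, ← mlieBracketWithin_univ, mlieBracketWithin_eq_lieBracketWithin,
    mlieBracketWithin_univ] at h6
  replace h6 := h6.trans (congrFun (lieBracketWithin_univ (𝕜 := ℝ) (E := E)) x')
  have h7 : ∀ y, y = x → dirDeriv f y (mlieBracket 𝓘(ℝ, E) X Y y) =
      dirDeriv f x (mlieBracket 𝓘(ℝ, E) X Y x) := by rintro _ rfl; rfl
  rw [← h7 _ hcx, ← (key _).self_of_nhds]
  exact congrArg _ h6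

theorem mdifferentiableAt_dirDeriv {f : M → W} {X : ∀ x : M, TangentSpace 𝓘(ℝ, E) x} {x : M}
    (hf : ∀ᶠ y in 𝓝 x, ContMDiffAt 𝓘(ℝ, E) 𝓘(ℝ, W) ∞ f y)
    (hX : MDifferentiableAt 𝓘(ℝ, E) (𝓘(ℝ, E).prod 𝓘(ℝ, E))
      (fun y => (⟨y, X y⟩ : TangentBundle 𝓘(ℝ, E) M)) x) :
    MDifferentiableAt 𝓘(ℝ, E) 𝓘(ℝ, W) (fun y => dirDeriv f y (X y)) x :=
  (mdifferentiableAt_dirDeriv_and_dirDeriv_mlieBracket hf hX hX).1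

/-- The Lie bracket is the commutator of the directional derivatives. -/
theorem dirDeriv_mlieBracket {f : M → W} {X Y : ∀ x : M, TangentSpace 𝓘(ℝ, E) x} {x : M}
    (hf : ∀ᶠ y in 𝓝 x, ContMDiffAt 𝓘(ℝ, E) 𝓘(ℝ, W) ∞ f y)
    (hX : MDifferentiableAt 𝓘(ℝ, E) (𝓘(ℝ, E).prod 𝓘(ℝ, E))
      (fun y => (⟨y, X y⟩ : TangentBundle 𝓘(ℝ, E) M)) x)
    (hY : MDifferentiableAt 𝓘(ℝ, E) (𝓘(ℝ, E).prod 𝓘(ℝ, E))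
      (fun y => (⟨y, Y y⟩ : TangentBundle 𝓘(ℝ, E) M)) x) :
    dirDeriv f x (mlieBracket 𝓘(ℝ, E) X Y x) =
      dirDeriv (fun y => dirDeriv f y (Y y)) x (X x)
        - dirDeriv (fun y => dirDeriv f y (X y)) x (Y x) :=
  (mdifferentiableAt_dirDeriv_and_dirDeriv_mlieBracket hf hX hY).2

/-- The Lie brackets of related vector fields are related. -/
theorem tmap_mlieBracket_of_related {f : M → M'} {X Y : ∀ x : M, TangentSpace 𝓘(ℝ, E) x}
    {X' Y' : ∀ x : M', TangentSpace 𝓘(ℝ, E') x} {x : M}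
    (hf : ∀ᶠ y in 𝓝 x, ContMDiffAt 𝓘(ℝ, E) 𝓘(ℝ, E') ∞ f y)
    (hX : MDifferentiableAt 𝓘(ℝ, E) (𝓘(ℝ, E).prod 𝓘(ℝ, E))
      (fun y => (⟨y, X y⟩ : TangentBundle 𝓘(ℝ, E) M)) x)
    (hY : MDifferentiableAt 𝓘(ℝ, E) (𝓘(ℝ, E).prod 𝓘(ℝ, E))
      (fun y => (⟨y, Y y⟩ : TangentBundle 𝓘(ℝ, E) M)) x)
    (hX' : MDifferentiableAt 𝓘(ℝ, E') (𝓘(ℝ, E').prod 𝓘(ℝ, E'))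
      (fun y => (⟨y, X' y⟩ : TangentBundle 𝓘(ℝ, E') M')) (f x))
    (hY' : MDifferentiableAt 𝓘(ℝ, E') (𝓘(ℝ, E').prod 𝓘(ℝ, E'))
      (fun y => (⟨y, Y' y⟩ : TangentBundle 𝓘(ℝ, E') M')) (f x))
    (hXX' : ∀ᶠ y in 𝓝 x, tmap E E' f y (X y) = X' (f y))
    (hYY' : ∀ᶠ y in 𝓝 x, tmap E E' f y (Y y) = Y' (f y)) :
    tmap E E' f x (mlieBracket 𝓘(ℝ, E) X Y x) = mlieBracket 𝓘(ℝ, E') X' Y' (f x) := by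
  -- A tangent vector at `f x` is determined by its action on the chart `ψ`, whose differential is
  -- injective. On `ψ` both brackets are commutators of derivations, and relatedness identifies
  -- those.
  let ψ : M' → E' := extChartAt 𝓘(ℝ, E') (f x)
  have hψ : ∀ᶠ y in 𝓝 (f x), ContMDiffAt 𝓘(ℝ, E') 𝓘(ℝ, E') ∞ ψ y := by
    filter_upwards [chart_source_mem_nhds E' (f x)] with y hy
    exact contMDiffAt_extChartAt' hy
  have hfx := hf.self_of_nhds
  have hfd := hfx.mdifferentiableAt (by simp)
  have hψf : ∀ᶠ y in 𝓝 x, ContMDiffAt 𝓘(ℝ, E) 𝓘(ℝ, E') ∞ (fun y => ψ (f y)) y := by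
    filter_upwards [hf, hfx.continuousAt.eventually hψ] with y hy hy'
    exact hy'.comp y hy
  have hdir : ∀ {Z : ∀ x : M, TangentSpace 𝓘(ℝ, E) x} {Z' : ∀ x : M', TangentSpace 𝓘(ℝ, E') x},
      (∀ᶠ y in 𝓝 x, tmap E E' f y (Z y) = Z' (f y)) →
      (fun y => dirDeriv (fun y => ψ (f y)) y (Z y)) =ᶠ[𝓝 x]
        (fun y => dirDeriv ψ (f y) (Z' (f y))) := by
    intro Z Z' h
    filter_upwards [h, hf, hfx.continuousAt.eventually hψ] with y hy hfy hψy
    rw [dirDeriv_comp (hψy.mdifferentiableAt (by simp)) (hfy.mdifferentiableAt (by simp)), hy]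
  have h1 := dirDeriv_mlieBracket hψf hX hY
  have h2 := dirDeriv_mlieBracket hψ hX' hY'
  rw [dirDeriv_comp (hψ.self_of_nhds.mdifferentiableAt (by simp)) hfd,
    dirDeriv_congr (hdir hXX'), dirDeriv_congr (hdir hYY'),
    dirDeriv_comp (g := fun y => dirDeriv ψ y (Y' y)) (mdifferentiableAt_dirDeriv hψ hY') hfd,
    dirDeriv_comp (g := fun y => dirDeriv ψ y (X' y)) (mdifferentiableAt_dirDeriv hψ hX') hfd,
    hXX'.self_of_nhds, hYY'.self_of_nhds, ← h2] at h1
  exact (isInvertible_mfderiv_extChartAt (I := 𝓘(ℝ, E')) (mem_extChartAt_source (f x))).injective h1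
end Calculus

/-! ### Local left inverses of immersions and local sections of submersions. -/

section LocalInverses

variable {E : Type*} [NormedAddCommGroup E] [NormedSpace ℝ E]
  {M : Type*} [TopologicalSpace M] [ChartedSpace E M] [IsManifold 𝓘(ℝ, E) ∞ M]
  {E' : Type*} [NormedAddCommGroup E'] [NormedSpace ℝ E']
  {M' : Type*} [TopologicalSpace M'] [ChartedSpace E' M'] [IsManifold 𝓘(ℝ, E') ∞ M']

/-- An immersion has smooth local left inverses. -/
theorem exists_leftInverse_of_isImmersion {f : M → M'}
    (hf : Manifold.IsImmersion 𝓘(ℝ, E) 𝓘(ℝ, E') ∞ f) (x : M) :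
    ∃ ρ : M' → M, (∀ᶠ y in 𝓝 (f x), ContMDiffAt 𝓘(ℝ, E') 𝓘(ℝ, E) ∞ ρ y) ∧
      ∀ᶠ y in 𝓝 x, ρ (f y) = y := by
  have h := hf.isImmersionAt x
  let φ := h.domChart
  let ψ := h.codChart
  have hφx : x ∈ φ.source := h.mem_domChart_source
  have hψx : f x ∈ ψ.source := h.mem_codChart_source
  -- In the charts of the immersion `f` is `y ↦ (y, 0)`, so the projection `L` to the first factor
  -- undoes it.
  let L : E' →L[ℝ] E := (ContinuousLinearMap.fst ℝ E h.complement).comp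
    (h.equiv.symm : E' →L[ℝ] E × h.complement)
  have hval : ∀ y ∈ φ.source, L (ψ (f y)) = φ y := by
    intro y hy
    have hmem : φ y ∈ (h.domChart.extend 𝓘(ℝ, E)).target := by
      simpa [φ] using φ.map_source hy
    have h1 := h.writtenInCharts hmem
    have h2 : ψ (f y) = h.equiv (φ y, 0) := by
      simpa [φ, ψ, h.domChart.left_inv hy] using h1
    simp [h2, L]
  refine ⟨fun z => φ.symm (L (ψ z)), ?_, ?_⟩
  · have hcont : ContinuousAt (fun z => L (ψ z)) (f x) :=
      L.continuous.continuousAt.comp (ψ.continuousAt hψx)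
    have h1 : ∀ᶠ z in 𝓝 (f x), L (ψ z) ∈ φ.target := by
      apply hcont.eventually
      simp only [hval x hφx]
      exact φ.open_target.mem_nhds (φ.map_source hφx)
    filter_upwards [h1, ψ.open_source.mem_nhds hψx] with z hz hz'
    have hψz := (contMDiffOn_of_mem_maximalAtlas h.codChart_mem_maximalAtlas).contMDiffAt
      (ψ.open_source.mem_nhds hz')
    have hφz := (contMDiffOn_symm_of_mem_maximalAtlas h.domChart_mem_maximalAtlas).contMDiffAt
      (φ.open_target.mem_nhds hz)
    exact hφz.comp z (L.contMDiff.contMDiffAt.comp z hψz)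
  · filter_upwards [φ.open_source.mem_nhds hφx] with y hy
    simp only [hval y hy]
    exact φ.left_inv hy

/-- A submersion has smooth local sections through every point. -/
theorem exists_rightInverse_of_isSubmersion {f : M → M'}
    (hf : Manifold.IsSubmersion 𝓘(ℝ, E) 𝓘(ℝ, E') ∞ f) (x : M) :
    ∃ σ : M' → M, (∀ᶠ y in 𝓝 (f x), ContMDiffAt 𝓘(ℝ, E') 𝓘(ℝ, E) ∞ σ y) ∧ σ (f x) = x ∧
      ∀ᶠ y in 𝓝 (f x), f (σ y) = y := by
  have h := hf.isSubmersionAt x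
  let φ := h.domChart
  let ψ := h.codChart
  have hφx : x ∈ φ.source := h.mem_domChart_source
  have hψx : f x ∈ ψ.source := h.mem_codChart_source
  have hval : ∀ z ∈ φ.target, ψ (f (φ.symm z)) = (h.equiv z).1 := by
    intro z hz
    have hmem : z ∈ (h.domChart.extend 𝓘(ℝ, E)).target := by simpa [φ] using hz
    simpa [φ, ψ] using h.writtenInCharts hmem
  -- Freezing the complementary coordinate at its value at `x` makes the section pass through `x`.
  let c : h.complement := (h.equiv (φ x)).2
  let j : E' → E := fun u => h.equiv.symm (u, c)
  have hj : ContMDiff 𝓘(ℝ, E') 𝓘(ℝ, E) ∞ j :=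
    (h.equiv.symm.contDiff.comp (contDiff_id.prodMk contDiff_const)).contMDiff
  have hjx : j (ψ (f x)) = φ x := by
    have := hval (φ x) (φ.map_source hφx)
    rw [φ.left_inv hφx] at this
    simp only [j, c, this, Prod.mk.eta, ContinuousLinearEquiv.symm_apply_apply]
  have h1 : ∀ᶠ z in 𝓝 (f x), j (ψ z) ∈ φ.target := by
    have hcont : ContinuousAt (fun z => j (ψ z)) (f x) :=
      hj.continuous.continuousAt.comp (ψ.continuousAt hψx)
    apply hcont.eventually
    simp only [hjx]
    exact φ.open_target.mem_nhds (φ.map_source hφx)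
  refine ⟨fun z => φ.symm (j (ψ z)), ?_, ?_, ?_⟩
  · filter_upwards [h1, ψ.open_source.mem_nhds hψx] with z hz hz'
    have hψz := (contMDiffOn_of_mem_maximalAtlas h.codChart_mem_maximalAtlas).contMDiffAt
      (ψ.open_source.mem_nhds hz')
    have hφz := (contMDiffOn_symm_of_mem_maximalAtlas h.domChart_mem_maximalAtlas).contMDiffAt
      (φ.open_target.mem_nhds hz)
    exact hφz.comp z (hj.contMDiffAt.comp z hψz)
  · simp only [hjx]
    exact φ.left_inv hφx
  · filter_upwards [h1, ψ.open_source.mem_nhds hψx] with z hz hz'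
    apply ψ.injOn (h.source_subset_preimage_source (φ.map_target hz)) hz'
    rw [hval _ hz]
    simp [j]

/-- Differentiate `f ∘ σ = id` for a local section `σ` through `x`. -/
theorem tmap_surjective_of_isSubmersion {f : M → M'}
    (hf : Manifold.IsSubmersion 𝓘(ℝ, E) 𝓘(ℝ, E') ∞ f) (x : M) :
    Function.Surjective (tmap E E' f x) := by
  obtain ⟨σ, hσ, hσx, hfσ⟩ := exists_rightInverse_of_isSubmersion hf x
  intro v
  have h1 : MDifferentiableAt 𝓘(ℝ, E) 𝓘(ℝ, E') f (σ (f x)) :=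
    hf.contMDiff.mdifferentiableAt (by simp)
  have h2 : MDifferentiableAt 𝓘(ℝ, E') 𝓘(ℝ, E) σ (f x) :=
    hσ.self_of_nhds.mdifferentiableAt (by simp)
  have h3 : ((mfderiv 𝓘(ℝ, E) 𝓘(ℝ, E') f (σ (f x)) : E →L[ℝ] E'))
      (mfderiv 𝓘(ℝ, E') 𝓘(ℝ, E) σ (f x) v) = v := by
    have h4 := (h1.hasMFDerivAt.comp (f x) h2.hasMFDerivAt)
    have h5 := (hasMFDerivAt_id (I := 𝓘(ℝ, E')) (f x)).congr_of_eventuallyEq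
      (f₁ := f ∘ σ) hfσ
    exact DFunLike.congr_fun (hasMFDerivAt_unique h4 h5) v
  have h6 : ∀ y, y = x → ((mfderiv 𝓘(ℝ, E) 𝓘(ℝ, E') f y : E →L[ℝ] E')) =
      (mfderiv 𝓘(ℝ, E) 𝓘(ℝ, E') f x : E →L[ℝ] E') := by rintro _ rfl; rfl
  rw [h6 _ hσx] at h3
  exact ⟨_, h3⟩

/-- A function on the target of a surjective submersion is smooth if its pull-back is. -/
theorem contMDiff_of_comp_isSubmersion {W : Type*} [NormedAddCommGroup W] [NormedSpace ℝ W]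
    {f : M → M'} (hf : Manifold.IsSubmersion 𝓘(ℝ, E) 𝓘(ℝ, E') ∞ f)
    (hs : Function.Surjective f) {u : M' → W}
    (hu : ContMDiff 𝓘(ℝ, E) 𝓘(ℝ, W) ∞ (fun x => u (f x))) : ContMDiff 𝓘(ℝ, E') 𝓘(ℝ, W) ∞ u := by
  intro y
  obtain ⟨x, rfl⟩ := hs y
  obtain ⟨σ, hσ, -, hfσ⟩ := exists_rightInverse_of_isSubmersion hf x
  refine ((hu (σ (f x))).comp (f x) hσ.self_of_nhds).congr_of_eventuallyEq ?_
  filter_upwards [hfσ] with z hz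
  simp [hz]

end LocalInverses

/-! ### Extending local sections, and sections along an immersion, to global sections. -/

section Extension

variable {E : Type*} [NormedAddCommGroup E] [NormedSpace ℝ E] [FiniteDimensional ℝ E]
  {M : Type*} [TopologicalSpace M] [ChartedSpace E M] [IsManifold 𝓘(ℝ, E) ∞ M] [T2Space M]
  {F : Type*} [NormedAddCommGroup F] [NormedSpace ℝ F]
  {V : M → Type*} [TopologicalSpace (TotalSpace F V)] [∀ x, AddCommGroup (V x)]
  [∀ x, Module ℝ (V x)] [∀ x, TopologicalSpace (V x)] [FiberBundle F V] [VectorBundle ℝ F V]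
  [ContMDiffVectorBundle ∞ F V 𝓘(ℝ, E)]
  {EP : Type*} [NormedAddCommGroup EP] [NormedSpace ℝ EP]
  {P : Type*} [TopologicalSpace P] [ChartedSpace EP P] [IsManifold 𝓘(ℝ, EP) ∞ P]

/-- A section that is smooth near a point agrees near that point with a global smooth section. -/
theorem exists_section_eventuallyEq {σ : ∀ x, V x} {x : M}
    (hσ : ∀ᶠ y in 𝓝 x, ContMDiffAt 𝓘(ℝ, E) (𝓘(ℝ, E).prod 𝓘(ℝ, F)) ∞
      (fun y => (⟨y, σ y⟩ : TotalSpace F V)) y) :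
    ∃ e : Cₛ^∞⟮𝓘(ℝ, E); F, V⟯, ∀ᶠ y in 𝓝 x, e y = σ y := by
  obtain ⟨u, hu, huo, hxu⟩ := eventually_nhds_iff.1 hσ
  obtain ⟨b, -, hb⟩ := (SmoothBumpFunction.nhds_basis_tsupport (I := 𝓘(ℝ, E)) x).mem_iff.1
    (huo.mem_nhds hxu)
  have hs : ContMDiffOn 𝓘(ℝ, E) (𝓘(ℝ, E).prod 𝓘(ℝ, F)) ∞
      (fun y => (⟨y, σ y⟩ : TotalSpace F V)) u := fun y hy => (hu y hy).contMDiffWithinAt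
  refine ⟨⟨_, ContMDiffOn.smul_section_of_tsupport (b.contMDiff.contMDiffOn) huo hb hs⟩, ?_⟩
  filter_upwards [b.eventuallyEq_one] with y hy
  change b y • σ y = σ y
  rw [hy]
  simp

/-- Every vector is the value of a global smooth section. -/
theorem exists_section_eq {x : M} (v : V x) : ∃ e : Cₛ^∞⟮𝓘(ℝ, E); F, V⟯, e x = v := by
  have h : ∀ᶠ y in 𝓝 x, ContMDiffAt 𝓘(ℝ, E) (𝓘(ℝ, E).prod 𝓘(ℝ, F)) ∞
      (fun y => (⟨y, FiberBundle.extend F v y⟩ : TotalSpace F V)) y := by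
    let t := trivializationAt F V x
    filter_upwards [t.open_baseSet.mem_nhds (FiberBundle.mem_baseSet_trivializationAt' x)] with y hy
    rw [t.contMDiffAt_section_iff hy]
    refine (contMDiffAt_const (c := (t ⟨x, v⟩).2)).congr_of_eventuallyEq ?_
    filter_upwards [t.open_baseSet.mem_nhds hy] with z hz
    exact (congrArg Prod.snd (t.apply_mk_symm hz _) :)
  obtain ⟨e, he⟩ := exists_section_eventuallyEq h
  exact ⟨e, by rw [he.self_of_nhds, FiberBundle.extend_apply_self]⟩

/-- A smooth section along an immersion extends locally to a global smooth section. -/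
theorem exists_section_extending {ι : P → M}
    (hι : Manifold.IsImmersion 𝓘(ℝ, EP) 𝓘(ℝ, E) ∞ ι) {p : P} {k : ∀ p, V (ι p)}
    (hk : ∀ᶠ p' in 𝓝 p, ContMDiffAt 𝓘(ℝ, EP) (𝓘(ℝ, E).prod 𝓘(ℝ, F)) ∞
      (fun p => (⟨ι p, k p⟩ : TotalSpace F V)) p') :
    ∃ e : Cₛ^∞⟮𝓘(ℝ, E); F, V⟯, ∀ᶠ p' in 𝓝 p, e (ι p') = k p' := by
  obtain ⟨ρ, hρ, hρι⟩ := exists_leftInverse_of_isImmersion hι p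
  let t := trivializationAt F V (ι p)
  have hbase : ∀ᶠ y in 𝓝 (ι p), y ∈ t.baseSet :=
    t.open_baseSet.mem_nhds (FiberBundle.mem_baseSet_trivializationAt' (ι p))
  have hιc : ContinuousAt ι p := hι.contMDiff.continuous.continuousAt
  have hρp : ρ (ι p) = p := hρι.self_of_nhds
  have hρc : Tendsto ρ (𝓝 (ι p)) (𝓝 p) := by
    have := hρ.self_of_nhds.continuousAt
    rwa [ContinuousAt, hρp] at this
  -- The vector `k (ρ y)` lies over `ι (ρ y)` and not over `y`. Its fibre coordinate in the
  -- trivialization is therefore transplanted to the fibre over `y`; the two points agree on the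
  -- image of `ι` near `p`.
  have hsm : ∀ᶠ y in 𝓝 (ι p), ContMDiffAt 𝓘(ℝ, E) (𝓘(ℝ, E).prod 𝓘(ℝ, F)) ∞
      (fun y => (⟨y, t.symm y (t ⟨ι (ρ y), k (ρ y)⟩).2⟩ : TotalSpace F V)) y := by
    filter_upwards [hbase, hρ, hρc.eventually hk, hρc.eventually (hιc.eventually hbase)]
      with y hy hρy hky hby
    rw [t.contMDiffAt_section_iff hy]
    have h1 := (((t.contMDiffAt_iff (f := fun p => (⟨ι p, k p⟩ : TotalSpace F V))
      (t.mem_source.2 hby)).1 hky).2).comp y hρy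
    refine h1.congr_of_eventuallyEq ?_
    filter_upwards [t.open_baseSet.mem_nhds hy] with z hz
    exact (congrArg Prod.snd (t.apply_mk_symm hz _) :)
  obtain ⟨e, he⟩ := exists_section_eventuallyEq hsm
  refine ⟨e, ?_⟩
  filter_upwards [hιc.eventually he, hρι, hιc.eventually hbase] with p' h1 h2 h3
  rw [h1, h2]
  exact t.symm_apply_apply_mk h3 _

/-- A smooth function on the source of an immersion extends locally to a global smooth function. -/
theorem exists_function_extending {W : Type*} [NormedAddCommGroup W] [NormedSpace ℝ W] {ι : P → M}
    (hι : Manifold.IsImmersion 𝓘(ℝ, EP) 𝓘(ℝ, E) ∞ ι) {p : P} {f : P → W}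
    (hf : ∀ᶠ p' in 𝓝 p, ContMDiffAt 𝓘(ℝ, EP) 𝓘(ℝ, W) ∞ f p') :
    ∃ f' : M → W, ContMDiff 𝓘(ℝ, E) 𝓘(ℝ, W) ∞ f' ∧ ∀ᶠ p' in 𝓝 p, f' (ι p') = f p' := by
  have hk : ∀ᶠ p' in 𝓝 p, ContMDiffAt 𝓘(ℝ, EP) (𝓘(ℝ, E).prod 𝓘(ℝ, W)) ∞
      (fun p => (⟨ι p, f p⟩ : TotalSpace W (Bundle.Trivial M W))) p' := by
    filter_upwards [hf] with p' hp'
    rw [contMDiffAt_totalSpace]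
    exact ⟨hι.contMDiff.contMDiffAt, hp'⟩
  obtain ⟨e, he⟩ := exists_section_extending hι hk
  refine ⟨fun x => e x, fun x => ?_, he⟩
  exact (contMDiffAt_section x).1 (e.contMDiff x)

end Extension

/-! ### Maps with vanishing derivative. -/

section ZeroDerivative

variable {E : Type*} [NormedAddCommGroup E] [NormedSpace ℝ E] [FiniteDimensional ℝ E]
  {M : Type*} [TopologicalSpace M] [ChartedSpace E M] [IsManifold 𝓘(ℝ, E) ∞ M]
  {E' : Type*} [NormedAddCommGroup E'] [NormedSpace ℝ E']
  {M' : Type*} [TopologicalSpace M'] [ChartedSpace E' M'] [IsManifold 𝓘(ℝ, E') ∞ M']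

/-- On a small ball the map stays in one chart of the target, and there the mean value inequality on
a convex set applies. -/
theorem eventually_eq_of_hasMFDerivAt_zero {u : E → M'} {x : E}
    (h : ∀ᶠ y in 𝓝 x, HasMFDerivAt 𝓘(ℝ, E) 𝓘(ℝ, E') u y 0) : ∀ᶠ y in 𝓝 x, u y = u x := by
  have hc : ContinuousAt u x := h.self_of_nhds.1
  let ψ : M' → E' := extChartAt 𝓘(ℝ, E') (u x)
  have hs : ∀ᶠ y in 𝓝 x, u y ∈ (chartAt E' (u x)).source :=
    hc.eventually (chart_source_mem_nhds E' (u x))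
  have hd : ∀ᶠ y in 𝓝 x, HasFDerivAt (fun y => ψ (u y)) (0 : E →L[ℝ] E') y := by
    filter_upwards [h, hs] with y hy hsy
    have h1 : MDifferentiableAt 𝓘(ℝ, E') 𝓘(ℝ, E') ψ (u y) :=
      (contMDiffAt_extChartAt' (n := ∞) hsy).mdifferentiableAt (by simp)
    have h2 := (h1.hasMFDerivAt.comp y hy).hasFDerivAt
    have h3 : (mfderiv 𝓘(ℝ, E') 𝓘(ℝ, E') ψ (u y) : E' →L[ℝ] E').comp (0 : E →L[ℝ] E') = 0 :=
      ContinuousLinearMap.comp_zero _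
    exact h3 ▸ h2
  obtain ⟨r, hr, hball⟩ := Metric.eventually_nhds_iff_ball.1 (hd.and hs)
  filter_upwards [Metric.ball_mem_nhds x hr] with y hy
  have hconst : ψ (u y) = ψ (u x) := by
    refine (convex_ball x r).is_const_of_fderivWithin_eq_zero (𝕜 := ℝ)
      (f := fun y => ψ (u y)) (fun z hz => ((hball z hz).1.differentiableAt.differentiableWithinAt))
      (fun z hz => ?_) hy (Metric.mem_ball_self hr)
    exact (hball z hz).1.hasFDerivWithinAt.fderivWithin (Metric.isOpen_ball.uniqueDiffWithinAt hz)
  exact (extChartAt 𝓘(ℝ, E') (u x)).injOn (by simpa using (hball y hy).2)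
    (by simp) hconst

/-- The map is locally constant, as one sees in charts, and the source is connected. -/
theorem eq_of_mfderiv_eq_zero [PreconnectedSpace M] {f : M → M'}
    (hf : MDifferentiable 𝓘(ℝ, E) 𝓘(ℝ, E') f) (h : ∀ x v, tmap E E' f x v = 0)
    (x y : M) : f x = f y := by
  refine IsLocallyConstant.apply_eq_of_preconnectedSpace
    ((IsLocallyConstant.iff_eventually_eq f).2 fun x => ?_) x y
  let c : E → M := (extChartAt 𝓘(ℝ, E) x).symm
  let x' : E := extChartAt 𝓘(ℝ, E) x x
  have hcx : c x' = x := extChartAt_to_inv x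
  have h1 : ∀ᶠ z in 𝓝 x', HasMFDerivAt 𝓘(ℝ, E) 𝓘(ℝ, E') (f ∘ c) z 0 := by
    filter_upwards [eventually_contMDiffAt_extChartAt_symm (E := E) x] with z hz
    have h2 := (hf (c z)).hasMFDerivAt.comp z ((hz.mdifferentiableAt (by simp)).hasMFDerivAt)
    have h3 : (mfderiv 𝓘(ℝ, E) 𝓘(ℝ, E') f (c z) : E →L[ℝ] E') = 0 :=
      ContinuousLinearMap.ext fun v => h (c z) v
    have h4 : ((mfderiv 𝓘(ℝ, E) 𝓘(ℝ, E') f (c z) : E →L[ℝ] E').comp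
      (mfderiv 𝓘(ℝ, E) 𝓘(ℝ, E) c z : E →L[ℝ] E)) = 0 := by
      rw [h3]; exact ContinuousLinearMap.zero_comp _
    exact h4 ▸ h2
  have h2 := eventually_eq_of_hasMFDerivAt_zero h1
  filter_upwards [(continuousAt_extChartAt (I := 𝓘(ℝ, E)) x).eventually h2,
    extChartAt_source_mem_nhds (I := 𝓘(ℝ, E)) x] with y hy hy'
  have h3 : c (extChartAt 𝓘(ℝ, E) x y) = y := (extChartAt 𝓘(ℝ, E) x).left_inv hy'
  simpa only [Function.comp_apply, h3, hcx] using hy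

end ZeroDerivative

/-! ### Smooth families of linear maps and of linear equations. -/

section LinearFamilies

variable {E : Type*} [NormedAddCommGroup E] [NormedSpace ℝ E] [FiniteDimensional ℝ E]
  {M : Type*} [TopologicalSpace M] [ChartedSpace E M] [IsManifold 𝓘(ℝ, E) ∞ M]
  {E₁ : Type*} [NormedAddCommGroup E₁] [NormedSpace ℝ E₁] [FiniteDimensional ℝ E₁]
  {W : Type*} [NormedAddCommGroup W] [NormedSpace ℝ W]

/-- In finite dimension an operator is the sum over a basis of rank-one operators built from its
values on that basis. -/
theorem contMDiffAt_of_clm_apply {L : M → E₁ →L[ℝ] W} {x : M}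
    (h : ∀ v, ContMDiffAt 𝓘(ℝ, E) 𝓘(ℝ, W) ∞ (fun y => L y v) x) :
    ContMDiffAt 𝓘(ℝ, E) 𝓘(ℝ, E₁ →L[ℝ] W) ∞ L x := by
  let b := Module.finBasis ℝ E₁
  have hL : L = fun y => ∑ i, ContinuousLinearMap.smulRightL ℝ E₁ W
      (LinearMap.toContinuousLinearMap (b.coord i)) (L y (b i)) := by
    ext y v
    conv_lhs => rw [← b.sum_repr v, map_sum]
    simp [ContinuousLinearMap.smulRightL]
  rw [hL]
  refine ContMDiffAt.sum fun i _ => ?_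
  exact (ContinuousLinearMap.contMDiff _).contMDiffAt.comp x (h (b i))

/-- Solutions of smooth invertible linear equations are smooth. -/
theorem contMDiffAt_of_clm_apply_eq {L : M → E₁ →L[ℝ] W} {x : M} {w : M → W} {v : M → E₁}
    (hL : ContMDiffAt 𝓘(ℝ, E) 𝓘(ℝ, E₁ →L[ℝ] W) ∞ L x) (hbij : Function.Bijective (L x))
    (hw : ContMDiffAt 𝓘(ℝ, E) 𝓘(ℝ, W) ∞ w x) (hv : ∀ᶠ y in 𝓝 x, L y (v y) = w y) :
    ContMDiffAt 𝓘(ℝ, E) 𝓘(ℝ, E₁) ∞ v x := by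
  have : CompleteSpace E₁ := FiniteDimensional.complete ℝ E₁
  have : FiniteDimensional ℝ W :=
    LinearEquiv.finiteDimensional (LinearEquiv.ofBijective (L x).toLinearMap hbij)
  let e : E₁ ≃L[ℝ] W := (LinearEquiv.ofBijective (L x).toLinearMap hbij).toContinuousLinearEquiv
  have he : (e : E₁ →L[ℝ] W) = L x := by ext v; rfl
  have hinv : ContMDiffAt 𝓘(ℝ, E) 𝓘(ℝ, W →L[ℝ] E₁) ∞
      (fun y => ContinuousLinearMap.inverse (L y)) x := by
    have h1 : ContDiffAt ℝ ∞ (ContinuousLinearMap.inverse : (E₁ →L[ℝ] W) → (W →L[ℝ] E₁)) (L x) :=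
      he ▸ contDiffAt_map_inverse e
    exact h1.contMDiffAt.comp x hL
  refine (hinv.clm_apply hw).congr_of_eventuallyEq ?_
  -- `ContinuousLinearMap.inverse` takes the value zero at non-invertible operators. It recovers `v
  -- y` only where `L y` is invertible, which is an open condition.
  have hn : ∀ᶠ y in 𝓝 x, L y ∈ range ((↑) : (E₁ ≃L[ℝ] W) → E₁ →L[ℝ] W) := by
    apply hL.continuousAt.eventually
    rw [← he]
    exact ContinuousLinearEquiv.nhds e
  filter_upwards [hv, hn] with y hy hy'
  obtain ⟨e', he'⟩ := hy'
  rw [← hy, ← he', ContinuousLinearMap.inverse_equiv]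
  simp

variable [T2Space M]
  {V : M → Type*} [TopologicalSpace (TotalSpace E₁ V)] [∀ x, AddCommGroup (V x)]
  [∀ x, Module ℝ (V x)] [∀ x, TopologicalSpace (V x)] [FiberBundle E₁ V] [VectorBundle ℝ E₁ V]
  [ContMDiffVectorBundle ∞ E₁ V 𝓘(ℝ, E)]

/-- A section of a vector bundle is smooth if its image under a smooth family of isomorphisms to a
fixed vector space is. -/
theorem contMDiffAt_section_of_bijective {A : ∀ x, V x →ₗ[ℝ] W} {σ : ∀ x, V x} {x : M}
    (hA : ∀ e : Cₛ^∞⟮𝓘(ℝ, E); E₁, V⟯, ContMDiffAt 𝓘(ℝ, E) 𝓘(ℝ, W) ∞ (fun y => A y (e y)) x)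
    (hbij : Function.Bijective (A x))
    (hσ : ContMDiffAt 𝓘(ℝ, E) 𝓘(ℝ, W) ∞ (fun y => A y (σ y)) x) :
    ContMDiffAt 𝓘(ℝ, E) (𝓘(ℝ, E).prod 𝓘(ℝ, E₁)) ∞ (fun y => (⟨y, σ y⟩ : TotalSpace E₁ V)) x := by
  let t := trivializationAt E₁ V x
  have hx : x ∈ t.baseSet := FiberBundle.mem_baseSet_trivializationAt' x
  rw [contMDiffAt_section]
  let L : M → E₁ →L[ℝ] W := fun y =>
    LinearMap.toContinuousLinearMap ((A y).comp (t.symmL ℝ y).toLinearMap)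
  have hLa : ∀ y ∈ t.baseSet, ∀ v, L y v = A y (t.symm y v) := fun y hy v =>
    congrArg (A y) (t.symmL_apply (R := ℝ) hy v)
  have hL : ContMDiffAt 𝓘(ℝ, E) 𝓘(ℝ, E₁ →L[ℝ] W) ∞ L x := by
    refine contMDiffAt_of_clm_apply fun v => ?_
    have h : ∀ᶠ y in 𝓝 x, ContMDiffAt 𝓘(ℝ, E) (𝓘(ℝ, E).prod 𝓘(ℝ, E₁)) ∞
        (fun y => (⟨y, t.symm y v⟩ : TotalSpace E₁ V)) y := by
      filter_upwards [t.open_baseSet.mem_nhds hx] with y hy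
      rw [t.contMDiffAt_section_iff hy]
      refine (contMDiffAt_const (c := v)).congr_of_eventuallyEq ?_
      filter_upwards [t.open_baseSet.mem_nhds hy] with z hz
      exact (congrArg Prod.snd (t.apply_mk_symm hz _) :)
    obtain ⟨e, he⟩ := exists_section_eventuallyEq h
    refine (hA e).congr_of_eventuallyEq ?_
    filter_upwards [he, t.open_baseSet.mem_nhds hx] with y hy hy'
    rw [hLa y hy', hy]
  refine contMDiffAt_of_clm_apply_eq hL ?_ hσ ?_
  · refine hbij.comp ⟨fun v w h => ?_, fun w => ⟨t.continuousLinearMapAt ℝ x w, ?_⟩⟩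
    · rw [← t.continuousLinearMapAt_symmL (R := ℝ) hx v,
        ← t.continuousLinearMapAt_symmL (R := ℝ) hx w]
      exact congrArg _ h
    · exact t.symmL_continuousLinearMapAt hx w
  · filter_upwards [t.open_baseSet.mem_nhds hx] with y hy
    rw [hLa y hy]
    exact congrArg _ (t.symm_apply_apply_mk hy _)

end LinearFamilies

/-! ### Orbit maps and infinitesimal generators. -/

section Orbits

/-- A chain rule with the intermediate point as a separate variable. It serves compositions whose
intermediate point is equal to the given one only propositionally, such as `1⁻¹ = 1`, with all
vectors read in the model space. -/
theorem mfderiv_comp_apply_eq {E : Type*} [NormedAddCommGroup E] [NormedSpace ℝ E]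
    {M : Type*} [TopologicalSpace M] [ChartedSpace E M]
    {E' : Type*} [NormedAddCommGroup E'] [NormedSpace ℝ E']
    {M' : Type*} [TopologicalSpace M'] [ChartedSpace E' M']
    {E'' : Type*} [NormedAddCommGroup E''] [NormedSpace ℝ E'']
    {M'' : Type*} [TopologicalSpace M''] [ChartedSpace E'' M'']
    {g : M' → M''} {f : M → M'} {x : M} {y : M'} (hxy : f x = y)
    (hg : MDifferentiableAt 𝓘(ℝ, E') 𝓘(ℝ, E'') g y)
    (hf : MDifferentiableAt 𝓘(ℝ, E) 𝓘(ℝ, E') f x) (v : E) :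
    (mfderiv 𝓘(ℝ, E) 𝓘(ℝ, E'') (fun z => g (f z)) x : E →L[ℝ] E'') v =
      (mfderiv 𝓘(ℝ, E') 𝓘(ℝ, E'') g y : E' →L[ℝ] E'')
        ((mfderiv 𝓘(ℝ, E) 𝓘(ℝ, E') f x : E →L[ℝ] E') v) := by
  subst hxy
  exact DFunLike.congr_fun (mfderiv_comp x hg hf) v

variable {EG : Type*} [NormedAddCommGroup EG] [NormedSpace ℝ EG] [FiniteDimensional ℝ EG]
  {G : Type*} [TopologicalSpace G] [ChartedSpace EG G] [Group G] [LieGroup 𝓘(ℝ, EG) ∞ G]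
  {E : Type*} [NormedAddCommGroup E] [NormedSpace ℝ E]
  {M : Type*} [TopologicalSpace M] [ChartedSpace E M] [IsManifold 𝓘(ℝ, E) ∞ M]
  [MulAction G M] [ContMDiffSMul 𝓘(ℝ, EG) 𝓘(ℝ, E) ∞ G M]

/-- Differentiate `g * g⁻¹ = 1` at the identity by the product rule. -/
theorem mfderiv_inv_one (γ : EG) :
    (mfderiv 𝓘(ℝ, EG) 𝓘(ℝ, EG) (fun g : G => g⁻¹) 1 : EG →L[ℝ] EG) γ = -γ := by
  have hmul : ContMDiff (𝓘(ℝ, EG).prod 𝓘(ℝ, EG)) 𝓘(ℝ, EG) ∞ (fun z : G × G => z.1 * z.2) :=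
    contMDiff_mul 𝓘(ℝ, EG) ∞
  have hi : MDifferentiableAt 𝓘(ℝ, EG) 𝓘(ℝ, EG) (fun g : G => g⁻¹) 1 :=
    (contMDiff_inv 𝓘(ℝ, EG) ∞).mdifferentiableAt (by simp)
  have hm : MDifferentiableAt (𝓘(ℝ, EG).prod 𝓘(ℝ, EG)) 𝓘(ℝ, EG) (fun z : G × G => z.1 * z.2)
    ((1 : G), (1 : G)⁻¹) := hmul.mdifferentiableAt (by simp)
  have h1 := hm.hasMFDerivAt.comp (1 : G)
    ((hasMFDerivAt_id (I := 𝓘(ℝ, EG)) (1 : G)).prodMk hi.hasMFDerivAt)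
  have h2 : HasMFDerivAt 𝓘(ℝ, EG) 𝓘(ℝ, EG)
      ((fun z : G × G => z.1 * z.2) ∘ fun g : G => (id g, g⁻¹)) 1
      (0 : EG →L[ℝ] EG) := by
    have h3 : ((fun z : G × G => z.1 * z.2) ∘ fun g : G => (id g, g⁻¹)) = fun _ => 1 := by
      funext g; simp
    have h4 := (hasMFDerivAt_const (I := 𝓘(ℝ, EG)) (I' := 𝓘(ℝ, EG)) (1 : G) (1 : G))
    rw [h3]
    exact h4
  have h5 := DFunLike.congr_fun (hasMFDerivAt_unique h1 h2) γ
  let δ : EG := (mfderiv 𝓘(ℝ, EG) 𝓘(ℝ, EG) (fun g : G => g⁻¹) 1 : EG →L[ℝ] EG) γ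
  have h6 := mfderiv_prod_eq_add_apply (E := EG) (E' := EG) hm (v := ((γ, δ) : EG × EG))
  have h7 : (fun z : G => z * (1 : G)⁻¹) = id := by funext z; simp
  have h8 : (fun z : G => (1 : G) * z) = id := by funext z; simp
  have h9 : (mfderiv 𝓘(ℝ, EG) 𝓘(ℝ, EG) (fun z : G => z * (1 : G)⁻¹) 1 : EG →L[ℝ] EG) γ = γ := by
    rw [h7]; exact DFunLike.congr_fun (mfderiv_id (I := 𝓘(ℝ, EG)) (x := (1 : G))) γ
  have h10 : ∀ (x : G) (w : EG),
      (mfderiv 𝓘(ℝ, EG) 𝓘(ℝ, EG) (fun z : G => (1 : G) * z) x : EG →L[ℝ] EG) w = w := by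
    intro x w
    rw [h8]; exact DFunLike.congr_fun (mfderiv_id (I := 𝓘(ℝ, EG)) (x := x)) w
  have h11 : γ + δ = 0 := by
    have h12 := h6.symm.trans h5
    have h13 := congrArg₂ (fun a b : EG => a + b) h9
      (h10 ((1 : G)⁻¹) ((mfderiv 𝓘(ℝ, EG) 𝓘(ℝ, EG) (fun g : G => g⁻¹) 1 : EG →L[ℝ] EG) γ))
    exact h13.symm.trans h12
  exact eq_neg_of_add_eq_zero_right h11

theorem mdifferentiableAt_smul_left (x : M) (g : G) :
    MDifferentiableAt 𝓘(ℝ, EG) 𝓘(ℝ, E) (fun g : G => g • x) g := by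
  have h1 : ContMDiff (𝓘(ℝ, EG).prod 𝓘(ℝ, E)) 𝓘(ℝ, E) ∞ (fun z : G × M => z.1 • z.2) :=
    contMDiff_smul
  have h2 : ContMDiff 𝓘(ℝ, EG) (𝓘(ℝ, EG).prod 𝓘(ℝ, E)) ∞ (fun g : G => (g, x)) :=
    contMDiff_id.prodMk contMDiff_const
  exact (h1.comp h2).mdifferentiableAt (by simp)

theorem contMDiff_smul_right (EG : Type*) [NormedAddCommGroup EG] [NormedSpace ℝ EG]
    {G : Type*} [TopologicalSpace G] [ChartedSpace EG G] [Group G]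
    {E : Type*} [NormedAddCommGroup E] [NormedSpace ℝ E]
    {M : Type*} [TopologicalSpace M] [ChartedSpace E M] [MulAction G M]
    [ContMDiffSMul 𝓘(ℝ, EG) 𝓘(ℝ, E) ∞ G M] (g : G) : ContMDiff 𝓘(ℝ, E) 𝓘(ℝ, E) ∞ (fun x : M => g • x) :=
  ContMDiffSMul.contMDiff_const_smul (I := 𝓘(ℝ, EG)) g

theorem mdifferentiableAt_smul_right (EG : Type*) [NormedAddCommGroup EG] [NormedSpace ℝ EG]
    {G : Type*} [TopologicalSpace G] [ChartedSpace EG G] [Group G]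
    {E : Type*} [NormedAddCommGroup E] [NormedSpace ℝ E]
    {M : Type*} [TopologicalSpace M] [ChartedSpace E M] [MulAction G M]
    [ContMDiffSMul 𝓘(ℝ, EG) 𝓘(ℝ, E) ∞ G M] (g : G) (x : M) :
    MDifferentiableAt 𝓘(ℝ, E) 𝓘(ℝ, E) (fun x : M => g • x) x :=
  (contMDiff_smul_right EG g).mdifferentiableAt (by simp)

theorem mdifferentiableAt_conj (g h : G) :
    MDifferentiableAt 𝓘(ℝ, EG) 𝓘(ℝ, EG) (fun h : G => g * h * g⁻¹) h := by
  have := topologicalGroup_of_lieGroup 𝓘(ℝ, EG) ∞ (G := G)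
  have h1 : ContMDiff 𝓘(ℝ, EG) 𝓘(ℝ, EG) ∞ (fun h : G => g * h * g⁻¹) :=
    (contMDiff_const.mul contMDiff_id).mul contMDiff_const
  exact h1.mdifferentiableAt (by simp)

variable (EG G E) in
/-- The infinitesimal generators at `x`, as a linear map. -/
def infGenMap (x : M) : GroupLieAlgebra 𝓘(ℝ, EG) G →ₗ[ℝ] TangentSpace 𝓘(ℝ, E) x :=
  (mfderiv 𝓘(ℝ, EG) 𝓘(ℝ, E) (fun g : G => g⁻¹ • x) 1 : EG →L[ℝ] E).toLinearMap

theorem infGenMap_apply (x : M) (γ : GroupLieAlgebra 𝓘(ℝ, EG) G) :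
    infGenMap EG G E x γ = infGen γ x := rfl

/-- Differentiate `(g * h * g⁻¹)⁻¹ • g • x = g • h⁻¹ • x` in `h` at the identity. -/
theorem tmap_smul_infGen (g : G) (x : M) (γ : GroupLieAlgebra 𝓘(ℝ, EG) G) :
    tmap E E (fun y : M => g • y) x (infGen γ x) = infGen (Ad g γ) (g • x) := by
  have h1 := mfderiv_comp_inv_smul (mdifferentiableAt_smul_right EG (E := E) g x) γ
  have h2 := mfderiv_comp_apply_eq (x := (1 : G)) (y := (1 : G)) (f := fun h : G => g * h * g⁻¹)
    (g := fun h : G => h⁻¹ • g • x) (by simp)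
    (mdifferentiableAt_inv_smul (EG := EG) (E := E) (g • x)) (mdifferentiableAt_conj g 1) γ
  have h3 : (fun h : G => (g * h * g⁻¹)⁻¹ • g • x) = fun h : G => g • h⁻¹ • x := by
    funext h
    simp [mul_smul]
  rw [h3] at h2
  exact h1.symm.trans h2

theorem mfderiv_smul_left_one (x : M) (γ : GroupLieAlgebra 𝓘(ℝ, EG) G) :
    (mfderiv 𝓘(ℝ, EG) 𝓘(ℝ, E) (fun g : G => g • x) 1 : EG →L[ℝ] E) γ =
      -(infGen γ x : TangentSpace 𝓘(ℝ, E) x) := by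
  have h := mfderiv_comp_apply_eq (x := (1 : G)) (y := (1 : G)) (f := fun h : G => h⁻¹)
    (g := fun h : G => h⁻¹ • x) (by simp)
    (mdifferentiableAt_inv_smul (EG := EG) (E := E) x)
    ((contMDiff_inv 𝓘(ℝ, EG) ∞).mdifferentiableAt (by simp)) γ
  have h1 : (fun h : G => h⁻¹⁻¹ • x) = fun h => h • x := by simp
  rw [h1] at h
  exact h.trans ((congrArg _ (mfderiv_inv_one (EG := EG) (G := G) γ)).trans
    (map_neg (mfderiv 𝓘(ℝ, EG) 𝓘(ℝ, E) (fun g : G => g⁻¹ • x) 1 : EG →L[ℝ] E) γ))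

/-- A free action is infinitesimally free. -/
theorem infGen_eq_zero [IsCancelSMul G M] {x : M} {γ : GroupLieAlgebra 𝓘(ℝ, EG) G}
    (h : (infGen γ x : TangentSpace 𝓘(ℝ, E) x) = 0) : γ = 0 := by
  have hN : (mfderiv 𝓘(ℝ, EG) 𝓘(ℝ, E) (fun g : G => g • x) 1 : EG →L[ℝ] E) γ = 0 := by
    rw [mfderiv_smul_left_one, h]; exact neg_zero
  have : CompleteSpace EG := FiniteDimensional.complete ℝ EG
  have : IsManifold 𝓘(ℝ, EG) 1 G := IsManifold.of_le (n := ∞) one_le_infty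
  have : IsTopologicalGroup G := topologicalGroup_of_lieGroup 𝓘(ℝ, EG) ∞
  -- The curve `c` integrates the left-invariant field of `γ`. The orbit curve `c t • x` will have
  -- zero velocity, hence be constant near `0`. Freeness then makes `c` constant, so its initial
  -- velocity `γ` vanishes.
  obtain ⟨c, hc0, hc⟩ := exists_isMIntegralCurveAt_of_contMDiffAt_boundaryless (I := 𝓘(ℝ, EG))
    (v := fun g : G => mulInvariantVectorField γ g) (t₀ := 0) (x₀ := (1 : G))
    (((contMDiff_mulInvariantVectorField γ).of_le (by
      rw [minSmoothness_of_isRCLikeNormedField]; norm_num)).contMDiffAt)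
  -- The orbit map intertwines left multiplication by `g` with the action of `g`, so its
  -- differential kills the whole left-invariant field once it kills `γ` at the identity.
  have hzero : ∀ g : G, (mfderiv 𝓘(ℝ, EG) 𝓘(ℝ, E) (fun g : G => g • x) g : EG →L[ℝ] E)
      (mulInvariantVectorField γ g) = 0 := by
    intro g
    have h1 := mfderiv_comp_apply_eq (x := (1 : G)) (y := g) (f := fun h : G => g * h)
      (g := fun h : G => h • x) (by simp) (mdifferentiableAt_smul_left (EG := EG) (E := E) x g)
      ((contMDiff_mul_left (I := 𝓘(ℝ, EG)) (n := ∞)).mdifferentiableAt (by simp)) γ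
    have h2 := mfderiv_comp_apply_eq (x := (1 : G)) (y := x) (f := fun h : G => h • x)
      (g := fun y : M => g • y) (by simp) (mdifferentiableAt_smul_right EG (E := E) g x)
      (mdifferentiableAt_smul_left (EG := EG) (E := E) x (1 : G)) γ
    have h3 : (fun h : G => (g * h) • x) = fun h => g • h • x := by simp only [mul_smul]
    rw [h3] at h1
    refine h1.symm.trans (h2.trans ?_)
    exact (congrArg _ hN).trans (map_zero (mfderiv 𝓘(ℝ, E) 𝓘(ℝ, E) (fun y : M => g • y) x :
      E →L[ℝ] E))
  have hconst : ∀ᶠ t in 𝓝 (0 : ℝ), c t • x = c 0 • x := by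
    refine eventually_eq_of_hasMFDerivAt_zero (E := ℝ) (E' := E) (u := fun t => c t • x) ?_
    filter_upwards [hc] with t ht
    have h3 := (mdifferentiableAt_smul_left (EG := EG) (E := E) x (c t)).hasMFDerivAt.comp t ht
    have h4 : (mfderiv 𝓘(ℝ, EG) 𝓘(ℝ, E) (fun g : G => g • x) (c t) : EG →L[ℝ] E).comp
        ((1 : ℝ →L[ℝ] ℝ).smulRight (mulInvariantVectorField γ (c t) : EG)) = 0 := by
      ext
      simpa using hzero (c t)
    exact h4 ▸ h3
  have hc1 : c =ᶠ[𝓝 0] fun _ => 1 := by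
    filter_upwards [hconst] with t ht
    rw [hc0] at ht
    exact IsCancelSMul.right_cancel _ _ _ ht
  have h5 := hc.self_of_nhds
  have h6 : HasMFDerivAt 𝓘(ℝ, ℝ) 𝓘(ℝ, EG) c 0 (0 : ℝ →L[ℝ] EG) :=
    (hasMFDerivAt_const (I := 𝓘(ℝ, ℝ)) (I' := 𝓘(ℝ, EG)) (1 : G) (0 : ℝ)).congr_of_eventuallyEq hc1
  have h7 := DFunLike.congr_fun (hasMFDerivAt_unique h5 h6) (1 : ℝ)
  have h8 : ∀ g : G, g = 1 → (mulInvariantVectorField γ g : EG) = γ := by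
    rintro _ rfl
    have : (fun h : G => (1 : G) * h) = id := by funext z; simp
    rw [mulInvariantVectorField, this]
    exact DFunLike.congr_fun (mfderiv_id (I := 𝓘(ℝ, EG)) (x := (1 : G))) γ
  rw [← h8 _ hc0]
  have h9 : (1 : ℝ) • (mulInvariantVectorField γ (c 0) : EG) = 0 := h7
  rwa [one_smul] at h9

end Orbits

/-! ### The kernel of the differential of the orbit projection. -/

section Quotient

variable {EG : Type*} [NormedAddCommGroup EG] [NormedSpace ℝ EG] [FiniteDimensional ℝ EG]
  {G : Type*} [TopologicalSpace G] [ChartedSpace EG G] [Group G] [LieGroup 𝓘(ℝ, EG) ∞ G]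
  {EP : Type*} [NormedAddCommGroup EP] [NormedSpace ℝ EP] [FiniteDimensional ℝ EP]
  {P : Type*} [TopologicalSpace P] [ChartedSpace EP P] [IsManifold 𝓘(ℝ, EP) ∞ P]
  [MulAction G P] [ContMDiffSMul 𝓘(ℝ, EG) 𝓘(ℝ, EP) ∞ G P]
  {ER : Type*} [NormedAddCommGroup ER] [NormedSpace ℝ ER] [FiniteDimensional ℝ ER]
  {R : Type*} [TopologicalSpace R] [ChartedSpace ER R] [IsManifold 𝓘(ℝ, ER) ∞ R]

/-- For a free proper action, group elements that move a point little are close to the identity. -/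
theorem tendsto_one_of_tendsto_smul [IsCancelSMul G P] [ProperSMul G P] {α : Type*} {l : Filter α}
    {g : α → G} {p : P} (h : Tendsto (fun a => g a • p) l (𝓝 p)) : Tendsto g l (𝓝 1) := by
  have hinj : Function.Injective (fun gx : G × P => (gx.1 • gx.2, gx.2)) := by
    rintro ⟨g, x⟩ ⟨g', x'⟩ hgx
    obtain ⟨h1, h2⟩ := Prod.mk.inj hgx
    change x = x' at h2
    subst h2
    exact Prod.ext (IsCancelSMul.right_cancel _ _ _ h1) rfl
  -- For a free proper action `(g, x) ↦ (g • x, x)` is a closed embedding, so convergence of the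
  -- images to `(p, p)`, the image of `(1, p)`, lifts to the source.
  have hemb := (Topology.IsClosedEmbedding.of_continuous_injective_isClosedMap
    (ProperSMul.isProperMap_smul_pair (G := G) (X := P)).continuous hinj
    (ProperSMul.isProperMap_smul_pair (G := G) (X := P)).isClosedMap)
  have h1 : Tendsto (fun a => (g a, p)) l (𝓝 ((1 : G), p)) := by
    rw [hemb.isInducing.tendsto_nhds_iff]
    have : Tendsto (fun a => (g a • p, p)) l (𝓝 (p, p)) := h.prodMk_nhds tendsto_const_nhds
    simpa [Function.comp_def] using this
  exact (continuous_fst.tendsto ((1 : G), p)).comp h1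

/-- Composing with a linear left inverse of the derivative gives a map with derivative the identity,
to which the inverse function theorem applies. -/
theorem eventually_leftInverse_of_hasStrictFDerivAt {E W : Type*} [NormedAddCommGroup E]
    [NormedSpace ℝ E] [FiniteDimensional ℝ E] [NormedAddCommGroup W] [NormedSpace ℝ W]
    [FiniteDimensional ℝ W] {f : E → W} {f' : E →L[ℝ] W} {a : E} (hf : HasStrictFDerivAt f f' a)
    (hinj : Function.Injective f') : ∃ u : W → E, ∀ᶠ x in 𝓝 a, u (f x) = x := by
  have : CompleteSpace E := FiniteDimensional.complete ℝ E
  obtain ⟨L, hL⟩ := LinearMap.exists_leftInverse_of_injective f'.toLinearMap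
    (LinearMap.ker_eq_bot.2 hinj)
  let L' : W →L[ℝ] E := LinearMap.toContinuousLinearMap L
  have h1 : HasStrictFDerivAt (fun x => L' (f x))
      ((ContinuousLinearEquiv.refl ℝ E : E ≃L[ℝ] E) : E →L[ℝ] E) a := by
    have h2 := L'.hasStrictFDerivAt.comp a hf
    have h3 : L'.comp f' = ((ContinuousLinearEquiv.refl ℝ E : E ≃L[ℝ] E) : E →L[ℝ] E) := by
      ext v; exact LinearMap.congr_fun hL v
    exact h3 ▸ h2
  exact ⟨fun w => h1.localInverse _ _ _ (L' w), h1.eventually_left_inverse⟩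

/-- The vertical vectors of an orbit projection are the infinitesimal generators. -/
theorem exists_infGen_eq_of_tmap_eq_zero [IsCancelSMul G P] [ProperSMul G P] {q : P → R}
    (hq : IsOrbitProjection G EP ER q) {p : P} {Y : TangentSpace 𝓘(ℝ, EP) p}
    (hY : tmap EP ER q p Y = 0) : ∃ γ : GroupLieAlgebra 𝓘(ℝ, EG) G, infGen γ p = Y := by
  have h := hq.submersion.isSubmersionAt p
  let φ := h.domChart
  let ψ := h.codChart
  have hφp : p ∈ φ.source := h.mem_domChart_source
  have hψp : q p ∈ ψ.source := h.mem_codChart_source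
  have hval : ∀ z ∈ φ.target, ψ (q (φ.symm z)) = (h.equiv z).1 := by
    intro z hz
    have hmem : z ∈ (h.domChart.extend 𝓘(ℝ, EP)).target := by simpa [φ] using hz
    simpa [φ, ψ] using h.writtenInCharts hmem
  have : FiniteDimensional ℝ h.complement :=
    Module.Finite.of_surjective ((LinearMap.snd ℝ ER h.complement).comp
      h.equiv.toLinearEquiv.toLinearMap)
      (Prod.snd_surjective.comp h.equiv.surjective)
  -- In the normal form of the submersion `κ` is a coordinate along the fibres of `q`. The claim
  -- becomes that the orbit map, read in `κ`, has surjective differential.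
  let κ : P → h.complement := fun p' => (h.equiv (φ p')).2
  have hφs : ContMDiffAt 𝓘(ℝ, EP) 𝓘(ℝ, EP) ∞ φ p :=
    (contMDiffOn_of_mem_maximalAtlas h.domChart_mem_maximalAtlas).contMDiffAt
      (φ.open_source.mem_nhds hφp)
  have hψs : ContMDiffAt 𝓘(ℝ, ER) 𝓘(ℝ, ER) ∞ ψ (q p) :=
    (contMDiffOn_of_mem_maximalAtlas h.codChart_mem_maximalAtlas).contMDiffAt
      (ψ.open_source.mem_nhds hψp)
  have hφss : ContMDiffAt 𝓘(ℝ, EP) 𝓘(ℝ, EP) ∞ φ.symm (φ p) :=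
    (contMDiffOn_symm_of_mem_maximalAtlas h.domChart_mem_maximalAtlas).contMDiffAt
      (φ.open_target.mem_nhds (φ.map_source hφp))
  let e₂ : EP →L[ℝ] h.complement := (ContinuousLinearMap.snd ℝ ER h.complement).comp
    (h.equiv : EP →L[ℝ] ER × h.complement)
  have hκ : ContMDiffAt 𝓘(ℝ, EP) 𝓘(ℝ, h.complement) ∞ κ p :=
    (e₂.contMDiff.contMDiffAt (x := φ p)).comp p hφs
  have hqs : MDifferentiableAt 𝓘(ℝ, EP) 𝓘(ℝ, ER) q p :=
    hq.submersion.contMDiff.mdifferentiableAt (by simp)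
  -- a vector killed by `dq` and `dκ` vanishes
  have hjoint : ∀ w : EP, (mfderiv 𝓘(ℝ, EP) 𝓘(ℝ, ER) q p : EP →L[ℝ] ER) w = 0 →
      (mfderiv 𝓘(ℝ, EP) 𝓘(ℝ, h.complement) κ p : EP →L[ℝ] h.complement) w = 0 → w = 0 := by
    intro w hw1 hw2
    let e₁ : EP →L[ℝ] ER := (ContinuousLinearMap.fst ℝ ER h.complement).comp
      (h.equiv : EP →L[ℝ] ER × h.complement)
    let w' : EP := (mfderiv 𝓘(ℝ, EP) 𝓘(ℝ, EP) φ p : EP →L[ℝ] EP) w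
    have hd2 : e₂ w' = 0 := by
      have := mfderiv_comp_apply_eq (f := φ) (g := e₂) (x := p) rfl
        (e₂.contMDiff.mdifferentiableAt (n := ∞) (by simp)) (hφs.mdifferentiableAt (by simp)) w
      have h2 := this.symm.trans hw2
      rwa [mfderiv_eq_fderiv, ContinuousLinearMap.fderiv] at h2
    have hd1 : e₁ w' = 0 := by
      have h3 := mfderiv_comp_apply_eq (f := φ) (g := e₁) (x := p) rfl
        (e₁.contMDiff.mdifferentiableAt (n := ∞) (by simp)) (hφs.mdifferentiableAt (by simp)) w
      have h4 := mfderiv_comp_apply_eq (f := q) (g := ψ) (x := p) rfl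
        (hψs.mdifferentiableAt (by simp)) hqs w
      have h5 : (fun z => e₁ (φ z)) =ᶠ[𝓝 p] fun z => ψ (q z) := by
        filter_upwards [φ.open_source.mem_nhds hφp] with z hz
        have := hval (φ z) (φ.map_source hz)
        rw [φ.left_inv hz] at this
        exact this.symm
      have h6 := DFunLike.congr_fun (h5.mfderiv_eq (I := 𝓘(ℝ, EP)) (I' := 𝓘(ℝ, ER))) w
      have h7 : (mfderiv 𝓘(ℝ, EP) 𝓘(ℝ, ER) e₁ (φ p) : EP →L[ℝ] ER) w' = 0 := by
        refine (h3.symm.trans h6).trans (h4.trans ?_)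
        exact (congrArg _ hw1).trans (map_zero (mfderiv 𝓘(ℝ, ER) 𝓘(ℝ, ER) ψ (q p) : ER →L[ℝ] ER))
      rwa [mfderiv_eq_fderiv, ContinuousLinearMap.fderiv] at h7
    have hw' : w' = 0 := by
      apply h.equiv.injective
      rw [map_zero]
      exact Prod.ext hd1 hd2
    have h8 := mfderiv_comp_apply_eq (f := φ) (g := φ.symm) (x := p) rfl
        (hφss.mdifferentiableAt (by simp)) (hφs.mdifferentiableAt (by simp)) w
    have h9 : (fun z => φ.symm (φ z)) =ᶠ[𝓝 p] id := by
      filter_upwards [φ.open_source.mem_nhds hφp] with z hz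
      exact φ.left_inv hz
    have h10 : (mfderiv 𝓘(ℝ, EP) 𝓘(ℝ, EP) (fun z => φ.symm (φ z)) p : EP →L[ℝ] EP) w = w :=
      (DFunLike.congr_fun (h9.mfderiv_eq (I := 𝓘(ℝ, EP)) (I' := 𝓘(ℝ, EP))) w).trans
        (DFunLike.congr_fun (mfderiv_id (I := 𝓘(ℝ, EP)) (x := p)) w)
    rw [← h10, h8]
    exact (congrArg _ hw').trans (map_zero (mfderiv 𝓘(ℝ, EP) 𝓘(ℝ, EP) φ.symm (φ p) : EP →L[ℝ] EP))
  have hvert : ∀ γ : GroupLieAlgebra 𝓘(ℝ, EG) G,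
      (mfderiv 𝓘(ℝ, EP) 𝓘(ℝ, ER) q p : EP →L[ℝ] ER) (infGen γ p) = 0 := fun γ =>
    tmap_infGen_eq_zero hqs (fun g x => ((hq.fibres x (g • x)).2 ⟨g, rfl⟩).symm) γ
  -- the orbit map in charts
  let c : EG → G := (extChartAt 𝓘(ℝ, EG) (1 : G)).symm
  let z₀ : EG := extChartAt 𝓘(ℝ, EG) (1 : G) 1
  have hcz : c z₀ = 1 := extChartAt_to_inv (1 : G)
  have hcs : ContMDiffAt 𝓘(ℝ, EG) 𝓘(ℝ, EG) ∞ c z₀ :=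
    (eventually_contMDiffAt_extChartAt_symm (E := EG) (1 : G)).self_of_nhds
  let o : EG → P := fun z => c z • p
  have hoz : o z₀ = p := by simp [o, hcz]
  have hos : ContMDiffAt 𝓘(ℝ, EG) 𝓘(ℝ, EP) ∞ o z₀ := hcs.smul contMDiffAt_const
  have hκo : ContDiffAt ℝ ∞ (fun z => κ (o z)) z₀ := by
    have : ContMDiffAt 𝓘(ℝ, EP) 𝓘(ℝ, h.complement) ∞ κ (o z₀) := by rw [hoz]; exact hκ
    exact (this.comp z₀ hos).contDiffAt
  let A : EG →L[ℝ] h.complement := fderiv ℝ (fun z => κ (o z)) z₀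
  have hA : ∀ v : EG, ∃ γ : GroupLieAlgebra 𝓘(ℝ, EG) G, (γ = 0 → v = 0) ∧
      A v = (mfderiv 𝓘(ℝ, EP) 𝓘(ℝ, h.complement) κ p : EP →L[ℝ] h.complement) (infGen γ p) := by
    intro v
    let γ : GroupLieAlgebra 𝓘(ℝ, EG) G :=
      ((mfderiv 𝓘(ℝ, EG) 𝓘(ℝ, EG) c z₀ : EG →L[ℝ] EG) v : EG)
    refine ⟨-γ, fun hγ => ?_, ?_⟩
    · have h1 := isInvertible_mfderiv_extChartAt_symm (E := EG) (mem_extChartAt_target (1 : G))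
      apply h1.injective
      exact (neg_eq_zero.1 hγ : γ = 0).trans
        (map_zero (mfderiv 𝓘(ℝ, EG) 𝓘(ℝ, EG) c z₀ : EG →L[ℝ] EG)).symm
    · have h1 := mfderiv_comp_apply_eq (f := o) (g := κ) (x := z₀) hoz
        (hκ.mdifferentiableAt (by simp)) (hos.mdifferentiableAt (by simp)) v
      have h2 := mfderiv_comp_apply_eq (f := c) (g := fun g : G => g • p) (x := z₀) hcz
        (mdifferentiableAt_smul_left (EG := EG) (E := EP) p (1 : G))
        (hcs.mdifferentiableAt (by simp)) v
      rw [mfderiv_eq_fderiv] at h1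
      refine h1.trans (congrArg _ (h2.trans ?_))
      exact (mfderiv_smul_left_one p γ).trans (map_neg (infGenMap EG G EP p) γ).symm
  -- Generators are killed by `dq`, so one that is also killed by `dκ` is zero, and a free action is
  -- infinitesimally free.
  have hAinj : Function.Injective A := by
    rw [injective_iff_map_eq_zero]
    intro v hv
    obtain ⟨γ, hγ, hγA⟩ := hA v
    exact hγ (infGen_eq_zero (hjoint _ (hvert γ) (hγA ▸ hv)))
  -- No dimension count for the fibre is at hand. If `w` were not in the range of `A`, then `Θ (z,
  -- r) = κ (c z • p) - r • w` would be an immersion at `(z₀, 0)`, hence injective near it. But the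
  -- fibre is a single orbit, so its point with coordinate `κ p + r • w` is `g r • p` for some `g
  -- r`, and there `Θ` takes the value `κ p` for every small `r`.
  have hAsurj : Function.Surjective A := by
    intro w
    by_contra hw
    have hw : ∀ v, A v ≠ w := fun v hv => hw ⟨v, hv⟩
    let Θ : EG × ℝ → h.complement := fun z => κ (o z.1) - z.2 • w
    have hΘ : HasStrictFDerivAt Θ (A.comp (ContinuousLinearMap.fst ℝ EG ℝ)
        - (ContinuousLinearMap.snd ℝ EG ℝ).smulRight w) (z₀, 0) := by
      have h1 : HasStrictFDerivAt (fun z => κ (o z)) A ((z₀, (0 : ℝ)) : EG × ℝ).1 :=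
        hκo.hasStrictFDerivAt (by simp)
      exact (h1.comp (z₀, (0 : ℝ)) hasStrictFDerivAt_fst).sub
        (((ContinuousLinearMap.snd ℝ EG ℝ).smulRight w).hasStrictFDerivAt)
    have hinj : Function.Injective (A.comp (ContinuousLinearMap.fst ℝ EG ℝ)
        - (ContinuousLinearMap.snd ℝ EG ℝ).smulRight w) := by
      rw [injective_iff_map_eq_zero]
      rintro ⟨v, r⟩ hvr
      have h2 : A v - r • w = 0 := by simpa using hvr
      by_cases hr : r = 0
      · subst hr
        rw [zero_smul, sub_zero] at h2
        rw [hAinj (h2.trans (map_zero A).symm)]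
        rfl
      · exfalso
        apply hw (r⁻¹ • v)
        rw [map_smul, sub_eq_zero.1 h2, smul_smul, inv_mul_cancel₀ hr, one_smul]
    obtain ⟨u, hu⟩ := eventually_leftInverse_of_hasStrictFDerivAt hΘ hinj
    -- points of the fibre of `q` near `p`
    let j : ℝ → EP := fun r => h.equiv.symm (ψ (q p), κ p + r • w)
    have hj : Continuous j := h.equiv.symm.continuous.comp (by fun_prop)
    have hψq : ψ (q p) = (h.equiv (φ p)).1 := by
      have := hval (φ p) (φ.map_source hφp)
      rwa [φ.left_inv hφp] at this
    have hj0 : j 0 = φ p := by simp [j, hψq, κ]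
    have hjt : ∀ᶠ r in 𝓝 (0 : ℝ), j r ∈ φ.target := by
      apply hj.continuousAt.eventually
      rw [hj0]
      exact φ.open_target.mem_nhds (φ.map_source hφp)
    have hjq : ∀ r, j r ∈ φ.target → ∃ g : G, g • p = φ.symm (j r) := by
      intro r hr
      refine (hq.fibres _ _).1 ?_
      apply ψ.injOn hψp (h.source_subset_preimage_source (φ.map_target hr))
      rw [hval _ hr]
      simp [j]
    choose! g hg using hjq
    have hgt : Tendsto (fun r => g r • p) (𝓝 0) (𝓝 p) := by
      have h3 : Tendsto (fun r => φ.symm (j r)) (𝓝 0) (𝓝 p) := by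
        have h4 : ContinuousAt φ.symm (j 0) := by
          rw [hj0]; exact φ.symm.continuousAt (φ.map_source hφp)
        have h5 := h4.comp (f := j) hj.continuousAt
        rw [ContinuousAt] at h5
        simpa [Function.comp_def, hj0, φ.left_inv hφp] using h5
      refine h3.congr' ?_
      filter_upwards [hjt] with r hr
      exact (hg r hr).symm
    -- Properness is used here: the elements `g r` were chosen arbitrarily, and they have to enter
    -- the neighbourhood on which `Θ` is injective.
    have hg1 := tendsto_one_of_tendsto_smul hgt
    have hz : Tendsto (fun r => extChartAt 𝓘(ℝ, EG) (1 : G) (g r)) (𝓝 0) (𝓝 z₀) :=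
      (continuousAt_extChartAt (I := 𝓘(ℝ, EG)) (1 : G)).tendsto.comp hg1
    have hzr : Tendsto (fun r => (extChartAt 𝓘(ℝ, EG) (1 : G) (g r), r)) (𝓝 0) (𝓝 (z₀, 0)) :=
      hz.prodMk_nhds tendsto_id
    have hfin : ∀ᶠ r in 𝓝 (0 : ℝ), r = 0 := by
      filter_upwards [hzr.eventually hu, hjt,
        hg1.eventually (extChartAt_source_mem_nhds (I := 𝓘(ℝ, EG)) (1 : G))] with r h1 h2 h3
      have h4 : c (extChartAt 𝓘(ℝ, EG) (1 : G) (g r)) = g r :=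
        (extChartAt 𝓘(ℝ, EG) (1 : G)).left_inv h3
      have h5 : Θ (extChartAt 𝓘(ℝ, EG) (1 : G) (g r), r) = Θ (z₀, 0) := by
        simp only [Θ, o, h4, hcz, hg r h2, one_smul, zero_smul, sub_zero]
        simp [κ, φ.right_inv h2, j]
      rw [h5, hu.self_of_nhds] at h1
      exact (Prod.mk.inj h1).2.symm
    obtain ⟨ε, hε, hball⟩ := Metric.eventually_nhds_iff.1 hfin
    have := hball (y := ε / 2) (by simp [abs_of_pos hε, hε])
    linarith
  obtain ⟨v, hv⟩ := hAsurj ((mfderiv 𝓘(ℝ, EP) 𝓘(ℝ, h.complement) κ p : EP →L[ℝ] h.complement) Y)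
  obtain ⟨γ, -, hγ⟩ := hA v
  refine ⟨γ, ?_⟩
  have h1 := hjoint ((infGen γ p : EP) - (Y : EP))
    ((map_sub (mfderiv 𝓘(ℝ, EP) 𝓘(ℝ, ER) q p : EP →L[ℝ] ER) _ _).trans ?_)
    ((map_sub (mfderiv 𝓘(ℝ, EP) 𝓘(ℝ, h.complement) κ p : EP →L[ℝ] h.complement) _ _).trans ?_)
  · exact sub_eq_zero.1 h1
  · rw [hvert γ]
    exact sub_eq_zero.2 hY.symm
  · exact sub_eq_zero.2 (hγ.symm.trans hv)

end Quotient

/-! ### Linear algebra of an exact Courant algebroid and its metric splitting. -/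

section Fibres

variable {EG : Type*} [NormedAddCommGroup EG] [NormedSpace ℝ EG] [FiniteDimensional ℝ EG]
  {G : Type*} [TopologicalSpace G] [ChartedSpace EG G] [Group G] [LieGroup 𝓘(ℝ, EG) ∞ G]
  {𝔞 : Type*} [AddCommGroup 𝔞] [Module ℝ 𝔞]
  {E : Type*} [NormedAddCommGroup E] [NormedSpace ℝ E] [FiniteDimensional ℝ E]
  {M : Type*} [TopologicalSpace M] [ChartedSpace E M] [IsManifold 𝓘(ℝ, E) ∞ M] [T2Space M]
  [MulAction G M] [ContMDiffSMul 𝓘(ℝ, EG) 𝓘(ℝ, E) ∞ G M]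
  {F : Type*} [NormedAddCommGroup F] [NormedSpace ℝ F] [FiniteDimensional ℝ F]
  {𝓔 : M → Type*} [TopologicalSpace (TotalSpace F 𝓔)] [∀ x, AddCommGroup (𝓔 x)]
  [∀ x, Module ℝ (𝓔 x)] [∀ x, TopologicalSpace (𝓔 x)] [FiberBundle F 𝓔] [VectorBundle ℝ F 𝓔]
  [ContMDiffVectorBundle ∞ F 𝓔 𝓘(ℝ, E)]
  {C : CourantAlgebroid E F 𝓔} {A : ExactCourantAlgebra (GroupLieAlgebra 𝓘(ℝ, EG) G) 𝔞}
  {EP : Type*} [NormedAddCommGroup EP] [NormedSpace ℝ EP] [FiniteDimensional ℝ EP]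
  {P : Type*} [TopologicalSpace P] [ChartedSpace EP P] [IsManifold 𝓘(ℝ, EP) ∞ P] [T2Space P]
  [MulAction G P] [ContMDiffSMul 𝓘(ℝ, EG) 𝓘(ℝ, EP) ∞ G P]

theorem ExactCourantAlgebra.proj_splitting (γ : GroupLieAlgebra 𝓘(ℝ, EG) G) :
    A.proj (A.splitting γ) = γ :=
  LinearMap.congr_fun (Classical.choose_spec (A.proj.exists_rightInverse_of_surjective
    (LinearMap.range_eq_top.2 A.surjective))) γ

/-- By exactness an element of the kernel of the anchor is a covector, and its pairing sees only the
anchor of the other argument. -/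
theorem pairing_congr_anchor (hC : C.IsExact) {x : M} {u v w : 𝓔 x} (hu : C.anchor x u = 0)
    (h : C.anchor x v = C.anchor x w) : C.pairing x u v = C.pairing x u w := by
  obtain ⟨η, hη⟩ := (hC.ker_eq x u).1 hu
  rw [hη, hη, h]

theorem pairing_eq_zero_of_anchor (hC : C.IsExact) {x : M} {u v : 𝓔 x} (hu : C.anchor x u = 0)
    (hv : C.anchor x v = 0) : C.pairing x u v = 0 := by
  rw [pairing_congr_anchor hC hu (w := 0) (by rw [hv, map_zero]), map_zero]

/-- The elements `u - s (π u)` and `v - s (π v)` lie in `T^*M`, which is isotropic, and so is the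
image of `s`. -/
theorem pairing_eq_add (hC : C.IsExact) (s : IsotropicSplitting C) {x : M} (u v : 𝓔 x) :
    C.pairing x u v = C.pairing x u (s.toFun x (C.anchor x v))
      + C.pairing x (s.toFun x (C.anchor x u)) v := by
  have h1 : C.anchor x (u - s.toFun x (C.anchor x u)) = 0 := by
    rw [map_sub, s.anchor_toFun, sub_self]
  have h2 : C.anchor x (v - s.toFun x (C.anchor x v)) = 0 := by
    rw [map_sub, s.anchor_toFun, sub_self]
  have h3 := pairing_eq_zero_of_anchor hC h1 h2
  simp only [map_sub, LinearMap.sub_apply, s.isotropic] at h3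
  linarith

/-- Every covector comes from an element of the kernel of the anchor. -/
theorem exists_pairing_eq (hC : C.IsExact) {x : M}
    (η : Module.Dual ℝ (TangentSpace 𝓘(ℝ, E) x)) :
    ∃ w : 𝓔 x, C.anchor x w = 0 ∧ ∀ v, C.pairing x v w = η (C.anchor x v) := by
  have := finiteDimensional_fibre (F := F) (𝓔 := 𝓔) x
  have hinj : Function.Injective (C.pairing x) := by
    rw [injective_iff_map_eq_zero]
    intro u hu
    exact C.pairing_nondeg x u fun v => by rw [hu]; rfl
  have hsurj : Function.Surjective (C.pairing x) :=
    (LinearMap.injective_iff_surjective_of_finrank_eq_finrank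
      (Subspace.dual_finrank_eq (K := ℝ) (V := 𝓔 x)).symm).1 hinj
  obtain ⟨w, hw⟩ := hsurj (η.comp (C.anchor x))
  have hw' : ∀ v, C.pairing x w v = η (C.anchor x v) := fun v => LinearMap.congr_fun hw v
  exact ⟨w, (hC.ker_eq x w).2 ⟨η, hw'⟩, fun v => by rw [C.pairing_symm, hw']⟩

/-! #### The metric splitting -/

/-- The metric splitting takes values in `𝓖(T^*M)` and `𝓖² = 1`. -/
theorem anchor_op_splitting {𝓖 : GeneralizedMetric C} {s : IsotropicSplitting C}
    (hs : s.IsMetric 𝓖) {x : M} (X : TangentSpace 𝓘(ℝ, E) x) :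
    C.anchor x (𝓖.op x (s.toFun x X)) = 0 := by
  have h : s.toFun x X ∈ (LinearMap.ker (C.anchor x)).map (𝓖.op x) := by
    rw [← (hs x).2]; exact LinearMap.mem_range_self _ X
  obtain ⟨z, hz, hzX⟩ := h
  rw [← hzX, (𝓖.isGenMetric x).sq]
  exact hz

/-- Of the four terms, those with no `𝓖` or with two vanish by isotropy and orthogonality. The two
mixed ones agree by self-adjointness. -/
theorem inducedMetric_eq {𝓖 : GeneralizedMetric C} {s : IsotropicSplitting C}
    {x : M} (X Y : TangentSpace 𝓘(ℝ, E) x) :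
    inducedMetric 𝓖 s x X Y = 2 * C.pairing x (𝓖.op x (s.toFun x X)) (s.toFun x Y) := by
  have h1 := (𝓖.isGenMetric x).orthogonal (s.toFun x X) (s.toFun x Y)
  have h2 := (𝓖.isGenMetric x).selfAdjoint (s.toFun x X) (s.toFun x Y)
  rw [s.isotropic] at h1
  simp only [inducedMetric, map_add, LinearMap.add_apply, s.isotropic, h1, ← h2]
  ring

theorem inducedMetric_symm {𝓖 : GeneralizedMetric C} {s : IsotropicSplitting C}
    {x : M} (X Y : TangentSpace 𝓘(ℝ, E) x) :
    inducedMetric 𝓖 s x X Y = inducedMetric 𝓖 s x Y X :=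
  C.pairing_symm x _ _

theorem inducedMetric_pos {𝓖 : GeneralizedMetric C} {s : IsotropicSplitting C}
    {x : M} {X : TangentSpace 𝓘(ℝ, E) x} (hX : X ≠ 0) : 0 < inducedMetric 𝓖 s x X X := by
  rw [inducedMetric_eq]
  have h := (𝓖.isGenMetric x).pos (s.toFun x X) (fun h => hX (by
    rw [← s.anchor_toFun x X, h, map_zero]))
  linarith

/-- The metric as a bilinear map. -/
def inducedMetricForm (𝓖 : GeneralizedMetric C) (s : IsotropicSplitting C) (x : M) :
    LinearMap.BilinForm ℝ (TangentSpace 𝓘(ℝ, E) x) :=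
  (2 : ℝ) • (C.pairing x).compl₁₂ ((𝓖.op x).comp (s.toFun x)) (s.toFun x)

theorem inducedMetricForm_apply {𝓖 : GeneralizedMetric C} {s : IsotropicSplitting C}
    {x : M} (X Y : TangentSpace 𝓘(ℝ, E) x) :
    inducedMetricForm 𝓖 s x X Y = inducedMetric 𝓖 s x X Y := by
  rw [inducedMetric_eq]; rfl

/-- The element `s X + ε 𝓖 (s X)` over `X`; for `ε = ±1` it lies in the `ε`-eigenbundle. -/
def eigenLift (𝓖 : GeneralizedMetric C) (s : IsotropicSplitting C) (ε : ℝ) (x : M) :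
    TangentSpace 𝓘(ℝ, E) x →ₗ[ℝ] 𝓔 x :=
  s.toFun x + ε • (𝓖.op x).comp (s.toFun x)

theorem eigenLift_apply (𝓖 : GeneralizedMetric C) (s : IsotropicSplitting C) (ε : ℝ) (x : M)
    (X : TangentSpace 𝓘(ℝ, E) x) :
    eigenLift 𝓖 s ε x X = s.toFun x X + ε • 𝓖.op x (s.toFun x X) := rfl

theorem anchor_eigenLift {𝓖 : GeneralizedMetric C} {s : IsotropicSplitting C}
    (hs : s.IsMetric 𝓖) (ε : ℝ) {x : M} (X : TangentSpace 𝓘(ℝ, E) x) :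
    C.anchor x (eigenLift 𝓖 s ε x X) = X := by
  rw [eigenLift_apply, map_add, map_smul, anchor_op_splitting hs, smul_zero, add_zero,
    s.anchor_toFun]

theorem op_eigenLift {𝓖 : GeneralizedMetric C} {s : IsotropicSplitting C} {ε : ℝ}
    (hε : ε * ε = 1) {x : M} (X : TangentSpace 𝓘(ℝ, E) x) :
    𝓖.op x (eigenLift 𝓖 s ε x X) = ε • eigenLift 𝓖 s ε x X := by
  rw [eigenLift_apply, map_add, map_smul, (𝓖.isGenMetric x).sq, smul_add, smul_smul, hε, one_smul,
    add_comm]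

/-- In `TM ⊕ T^*M` the eigenlift is `X + ε g(X, ·)`, and twice the pairing with `s Y` reads off the
covector part at `Y`. -/
theorem two_mul_pairing_eigenLift_splitting {𝓖 : GeneralizedMetric C} {s : IsotropicSplitting C}
    (ε : ℝ) {x : M} (X Y : TangentSpace 𝓘(ℝ, E) x) :
    2 * C.pairing x (eigenLift 𝓖 s ε x X) (s.toFun x Y) = ε * inducedMetric 𝓖 s x X Y := by
  rw [eigenLift_apply, inducedMetric_eq, map_add, map_smul, LinearMap.add_apply, s.isotropic,
    LinearMap.smul_apply, smul_eq_mul]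
  ring

/-- An element of the `ε`-eigenspace is the eigenlift of its anchor. -/
theorem eq_eigenLift_of_op_eq (hC : C.IsExact) {𝓖 : GeneralizedMetric C} {s : IsotropicSplitting C}
    (hs : s.IsMetric 𝓖) {ε : ℝ} (hε : ε * ε = 1) {x : M} {v : 𝓔 x} (hv : 𝓖.op x v = ε • v) :
    v = eigenLift 𝓖 s ε x (C.anchor x v) := by
  rw [← sub_eq_zero]
  set u := v - eigenLift 𝓖 s ε x (C.anchor x v) with hu
  by_contra hne
  -- The difference is both an eigenvector and a covector. Covectors are isotropic while the pairing
  -- is definite on an eigenspace, so it vanishes.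
  have h1 : 𝓖.op x u = ε • u := by
    rw [hu, map_sub, hv, op_eigenLift hε, smul_sub]
  have h2 : C.anchor x u = 0 := by
    rw [hu, map_sub, anchor_eigenLift hs, sub_self]
  have h3 := (𝓖.isGenMetric x).pos u hne
  rw [h1, map_smul, LinearMap.smul_apply, pairing_eq_zero_of_anchor hC h2 h2, smul_zero] at h3
  exact lt_irrefl _ h3

end Fibres

/-! ### `K`, `K^⊥` and the form `ξ` over the leaf. -/

section Leaf

variable {EG : Type*} [NormedAddCommGroup EG] [NormedSpace ℝ EG] [FiniteDimensional ℝ EG]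
  {G : Type*} [TopologicalSpace G] [ChartedSpace EG G] [Group G] [LieGroup 𝓘(ℝ, EG) ∞ G]
  {𝔞 : Type*} [AddCommGroup 𝔞] [Module ℝ 𝔞]
  {E : Type*} [NormedAddCommGroup E] [NormedSpace ℝ E] [FiniteDimensional ℝ E]
  {M : Type*} [TopologicalSpace M] [ChartedSpace E M] [IsManifold 𝓘(ℝ, E) ∞ M] [T2Space M]
  [MulAction G M] [ContMDiffSMul 𝓘(ℝ, EG) 𝓘(ℝ, E) ∞ G M]
  {F : Type*} [NormedAddCommGroup F] [NormedSpace ℝ F] [FiniteDimensional ℝ F]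
  {𝓔 : M → Type*} [TopologicalSpace (TotalSpace F 𝓔)] [∀ x, AddCommGroup (𝓔 x)]
  [∀ x, Module ℝ (𝓔 x)] [∀ x, TopologicalSpace (𝓔 x)] [FiberBundle F 𝓔] [VectorBundle ℝ F 𝓔]
  [ContMDiffVectorBundle ∞ F 𝓔 𝓘(ℝ, E)]
  {C : CourantAlgebroid E F 𝓔} {A : ExactCourantAlgebra (GroupLieAlgebra 𝓘(ℝ, EG) G) 𝔞}
  {EP : Type*} [NormedAddCommGroup EP] [NormedSpace ℝ EP] [FiniteDimensional ℝ EP]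
  {P : Type*} [TopologicalSpace P] [ChartedSpace EP P] [IsManifold 𝓘(ℝ, EP) ∞ P] [T2Space P]
  [MulAction G P] [ContMDiffSMul 𝓘(ℝ, EG) 𝓘(ℝ, EP) ∞ G P]
  {Φ : ExtendedAction C A} {𝓖 : GeneralizedMetric C} {s : IsotropicSplitting C} {ι : P → M}

theorem mem_Kperp {x : M} {v : 𝓔 x} : v ∈ Φ.Kperp x ↔ ∀ a, C.pairing x (Φ.Ψ a x) v = 0 := by
  constructor
  · intro h a
    exact h _ ⟨a, rfl⟩
  · rintro h _ ⟨a, rfl⟩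
    exact h a

theorem Ψ_mem_K (a : 𝔞) (x : M) : Φ.Ψ a x ∈ Φ.K x := ⟨a, rfl⟩

/-- Isotropy gives `K ⊆ K^⊥`, so `Δ_b` is `π(K^⊥)`. -/
theorem exists_mem_Kperp_anchor_eq (hι : IsLeaf EP Φ ι) (hK : IsotropicOver Φ ι) {p : P}
    (Y : TangentSpace 𝓘(ℝ, EP) p) :
    ∃ v ∈ Φ.Kperp (ι p), C.anchor (ι p) v = tmap EP E ι p Y := by
  have h : tmap EP E ι p Y ∈ Φ.bigDistribution (ι p) := by
    rw [← hι.tangent]; exact LinearMap.mem_range_self _ Y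
  obtain ⟨v, hv, hvY⟩ := h
  rw [sup_eq_right.2 (hK p)] at hv
  exact ⟨v, hv, hvY⟩

theorem exists_tmap_eq_anchor (hι : IsLeaf EP Φ ι) {p : P} {v : 𝓔 (ι p)}
    (hv : v ∈ Φ.Kperp (ι p)) : ∃ Y, tmap EP E ι p Y = C.anchor (ι p) v := by
  have h : C.anchor (ι p) v ∈ Φ.bigDistribution (ι p) :=
    ⟨v, Submodule.mem_sup_right hv, rfl⟩
  rw [← hι.tangent] at h
  exact h

theorem IsLeaf.mdifferentiableAt (hι : IsLeaf EP Φ ι) (p : P) :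
    MDifferentiableAt 𝓘(ℝ, EP) 𝓘(ℝ, E) ι p :=
  hι.immersion.contMDiff.mdifferentiableAt (by simp)

theorem IsLeaf.tmap_injective (hι : IsLeaf EP Φ ι) (p : P) :
    Function.Injective (tmap EP E ι p) :=
  tmap_injective_of_isImmersion hι.immersion p

theorem IsLeaf.tmap_infGen (hι : IsLeaf EP Φ ι) (γ : GroupLieAlgebra 𝓘(ℝ, EG) G) (p : P) :
    tmap EP E ι p (infGen γ p) = (infGen γ (ι p) : TangentSpace 𝓘(ℝ, E) (ι p)) :=
  CourantReduction.tmap_infGen (hι.mdifferentiableAt p) hι.equivariant γ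

theorem anchor_Ψ_leaf (hι : IsLeaf EP Φ ι) (a : 𝔞) (p : P) :
    C.anchor (ι p) (Φ.Ψ a (ι p)) = tmap EP E ι p (infGen (A.proj a) p) := by
  rw [Φ.anchor_map, hι.tmap_infGen]

/-- For `l ∈ 𝔥` the element `Ψ l` is a covector over the leaf. Each tangent vector of the leaf is
the anchor of an element of `K^⊥`, so this covector annihilates `TP`. This makes `ξ` independent of
the lift from `𝔤` to `𝔞`. -/
theorem pairing_Ψ_eq_zero_of_proj (hC : C.IsExact) (hι : IsLeaf EP Φ ι) (hK : IsotropicOver Φ ι)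
    {l : 𝔞} (hl : A.proj l = 0) {p : P} {v : 𝓔 (ι p)} {Y : TangentSpace 𝓘(ℝ, EP) p}
    (hv : C.anchor (ι p) v = tmap EP E ι p Y) : C.pairing (ι p) (Φ.Ψ l (ι p)) v = 0 := by
  obtain ⟨w, hw, hwY⟩ := exists_mem_Kperp_anchor_eq hι hK Y
  have h0 : C.anchor (ι p) (Φ.Ψ l (ι p)) = 0 := by
    rw [anchor_Ψ_leaf hι, hl, ← infGenMap_apply, map_zero, map_zero]
  rw [pairing_congr_anchor hC h0 (hv.trans hwY.symm)]
  exact mem_Kperp.1 hw l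

/-- Over the leaf, the pairing with `Ψ a` depends on the image of `a` in the Lie algebra only. -/
theorem pairing_Ψ_congr (hC : C.IsExact) (hι : IsLeaf EP Φ ι) (hK : IsotropicOver Φ ι)
    {a b : 𝔞} (hab : A.proj a = A.proj b) {p : P} {v : 𝓔 (ι p)} {Y : TangentSpace 𝓘(ℝ, EP) p}
    (hv : C.anchor (ι p) v = tmap EP E ι p Y) :
    C.pairing (ι p) (Φ.Ψ a (ι p)) v = C.pairing (ι p) (Φ.Ψ b (ι p)) v := by
  have h := pairing_Ψ_eq_zero_of_proj hC hι hK (l := a - b) (by rw [map_sub, hab, sub_self]) hv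
  rw [map_sub, ContMDiffSection.coe_sub, Pi.sub_apply, map_sub, LinearMap.sub_apply] at h
  linarith

theorem two_mul_pairing_Ψ_splitting (hC : C.IsExact) (hι : IsLeaf EP Φ ι) (hK : IsotropicOver Φ ι)
    (a : 𝔞) {p : P} (W : TangentSpace 𝓘(ℝ, EP) p) :
    2 * C.pairing (ι p) (Φ.Ψ a (ι p)) (s.toFun (ι p) (tmap EP E ι p W))
      = xi Φ s ι p (A.proj a) W := by
  rw [xi, pairing_Ψ_congr hC hι hK (ExactCourantAlgebra.proj_splitting (A.proj a)).symm
    (s.anchor_toFun _ _)]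

variable (Φ s ι) in
/-- The 1-form `ξ_γ`, as a bilinear map. -/
def xiForm (p : P) :
    GroupLieAlgebra 𝓘(ℝ, EG) G →ₗ[ℝ] TangentSpace 𝓘(ℝ, EP) p →ₗ[ℝ] ℝ :=
  LinearMap.mk₂ ℝ (fun γ Y => xi Φ s ι p γ Y)
    (fun γ γ' Y => by simp [xi, mul_add]) (fun c γ Y => by simp [xi, mul_left_comm])
    (fun γ Y Y' => by simp [xi, mul_add]) (fun c γ Y => by simp [xi, mul_left_comm])

theorem xiForm_apply (p : P) (γ : GroupLieAlgebra 𝓘(ℝ, EG) G) (Y : TangentSpace 𝓘(ℝ, EP) p) :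
    xiForm Φ s ι p γ Y = xi Φ s ι p γ Y := rfl

/-- If `v` lies over `Y`, then `2⟨Ψ a, v⟩ = ξ_a(Y) + 2⟨v, s X_a⟩`. -/
theorem two_mul_pairing_Ψ (hC : C.IsExact) (hι : IsLeaf EP Φ ι) (hK : IsotropicOver Φ ι)
    (s : IsotropicSplitting C)
    (a : 𝔞) {p : P} {v : 𝓔 (ι p)} {Y : TangentSpace 𝓘(ℝ, EP) p}
    (hv : C.anchor (ι p) v = tmap EP E ι p Y) :
    2 * C.pairing (ι p) (Φ.Ψ a (ι p)) v = xiForm Φ s ι p (A.proj a) Y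
      + 2 * C.pairing (ι p) v (s.toFun (ι p) (tmap EP E ι p (infGen (A.proj a) p))) := by
  rw [pairing_eq_add hC s, hv, anchor_Ψ_leaf hι, mul_add, two_mul_pairing_Ψ_splitting hC hι hK,
    xiForm_apply, C.pairing_symm (ι p) v]

/-- This is the isotropy of `K`: the pairing of `X_γ + ξ_γ` with `X_γ' + ξ_γ'` is half of `ξ_γ(X_γ')
+ ξ_γ'(X_γ)`. -/
theorem xiForm_infGen (hC : C.IsExact) (hι : IsLeaf EP Φ ι) (hK : IsotropicOver Φ ι) (p : P)
    (γ γ' : GroupLieAlgebra 𝓘(ℝ, EG) G) :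
    xiForm (EP := EP) Φ s ι p γ (infGen γ' p) = -xiForm (EP := EP) Φ s ι p γ' (infGen γ p) := by
  have h := two_mul_pairing_Ψ hC hι hK s (A.splitting γ)
    (anchor_Ψ_leaf hι (A.splitting γ') p)
  rw [mem_Kperp.1 (hK p (Ψ_mem_K _ _)), two_mul_pairing_Ψ_splitting hC hι hK,
    ExactCourantAlgebra.proj_splitting, ExactCourantAlgebra.proj_splitting] at h
  rw [xiForm_apply] at h ⊢
  rw [xiForm_apply]
  linarith

theorem mem_Kperp_iff (hC : C.IsExact) (hι : IsLeaf EP Φ ι) (hK : IsotropicOver Φ ι)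
    (s : IsotropicSplitting C) {p : P} {v : 𝓔 (ι p)} {Y : TangentSpace 𝓘(ℝ, EP) p}
    (hv : C.anchor (ι p) v = tmap EP E ι p Y) :
    v ∈ Φ.Kperp (ι p) ↔ ∀ γ : GroupLieAlgebra 𝓘(ℝ, EG) G,
      2 * C.pairing (ι p) v (s.toFun (ι p) (tmap EP E ι p (infGen γ p)))
        + xiForm Φ s ι p γ Y = 0 := by
  rw [mem_Kperp]
  constructor
  · intro h γ
    have h1 := two_mul_pairing_Ψ hC hι hK s (A.splitting γ) hv
    rw [h, ExactCourantAlgebra.proj_splitting] at h1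
    linarith
  · intro h a
    have h1 := two_mul_pairing_Ψ hC hι hK s a hv
    have h2 := h (A.proj a)
    linarith

/-- The source of the connections: for `ε = 1` the condition is the one defining `τ_+`, and for `ε =
-1` it is the same with the sign of `ξ` reversed. -/
theorem eigenLift_mem_Kperp_iff (hC : C.IsExact) (hι : IsLeaf EP Φ ι) (hK : IsotropicOver Φ ι)
    (hs : s.IsMetric 𝓖) (ε : ℝ) {p : P} (Y : TangentSpace 𝓘(ℝ, EP) p) :
    eigenLift 𝓖 s ε (ι p) (tmap EP E ι p Y) ∈ Φ.Kperp (ι p) ↔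
      ∀ γ : GroupLieAlgebra 𝓘(ℝ, EG) G,
        ε * inducedMetric 𝓖 s (ι p) (tmap EP E ι p Y) (tmap EP E ι p (infGen γ p))
          + xiForm Φ s ι p γ Y = 0 := by
  rw [mem_Kperp_iff hC hι hK s (anchor_eigenLift hs ε _)]
  simp only [two_mul_pairing_eigenLift_splitting]

/-! #### The group action -/

theorem fibreCast_pairing {x y : M} (h : x = y) (u v : 𝓔 x) :
    C.pairing y (fibreCast h u) (fibreCast h v) = C.pairing x u v := by
  subst h; rfl

theorem fibreCast_op {x y : M} (h : x = y) (v : 𝓔 x) :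
    𝓖.op y (fibreCast h v) = fibreCast h (𝓖.op x v) := by
  subst h; rfl

theorem fibreCast_splitting {x y : M} (h : x = y) (X : E) :
    fibreCast h (s.toFun x X) = s.toFun y (X : TangentSpace 𝓘(ℝ, E) y) := by
  subst h; rfl

theorem mk_fibreCast {x y : M} (h : x = y) (v : 𝓔 x) :
    (⟨y, fibreCast h v⟩ : TotalSpace F 𝓔) = ⟨x, v⟩ := by
  subst h; rfl

/-- The action commutes with `𝓖` and covers the action on `TM`, so it preserves `T^*M` and
`𝓖(T^*M)`, the image of the metric splitting. -/
theorem act_splitting (hΦ : Φ.Preserves 𝓖) (hs : s.IsMetric 𝓖) (g : G) (x : M)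
    (X : TangentSpace 𝓘(ℝ, E) x) :
    Φ.act g x (s.toFun x X) = s.toFun (g • x) (tmap E E (fun y : M => g • y) x X) := by
  have h1 : C.anchor (g • x) (𝓖.op (g • x) (Φ.act g x (s.toFun x X))) = 0 := by
    rw [hΦ, Φ.act_anchor, anchor_op_splitting hs, map_zero]
  have h2 : Φ.act g x (s.toFun x X) ∈ LinearMap.range (s.toFun (g • x)) := by
    rw [(hs (g • x)).2]
    exact ⟨_, h1, (𝓖.isGenMetric _).sq _⟩
  obtain ⟨X', hX'⟩ := h2
  have h3 := congrArg (C.anchor (g • x)) hX'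
  rw [s.anchor_toFun, Φ.act_anchor, s.anchor_toFun] at h3
  rw [← hX', h3]

theorem tmap_leaf_smul (hι : IsLeaf EP Φ ι) (g : G) (p : P) (Y : TangentSpace 𝓘(ℝ, EP) p) :
    (tmap EP E ι (g • p) (tmap EP EP (fun y : P => g • y) p Y) : E) =
      tmap E E (fun y : M => g • y) (ι p) (tmap EP E ι p Y) := by
  have h1 := tmap_comp (g := ι) (f := fun y : P => g • y) (hι.mdifferentiableAt (g • p))
    (mdifferentiableAt_smul_right EG g p) Y
  have h2 := tmap_comp (g := fun y : M => g • y) (f := ι)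
    (mdifferentiableAt_smul_right EG g (ι p)) (hι.mdifferentiableAt p) Y
  have h3 : (fun y : P => ι (g • y)) = fun y => g • ι y := funext fun y => hι.equivariant g y
  have h4 : (tmap EP E (fun y : P => ι (g • y)) p Y : E) = tmap EP E (fun y : P => g • ι y) p Y :=
    tmap_congr (EventuallyEq.of_eq h3) Y
  exact h1.symm.trans (h4.trans h2)

theorem pairing_leafAct (hι : IsLeaf EP Φ ι) (g : G) (p : P) (u v : 𝓔 (ι p)) :
    C.pairing (ι (g • p)) (leafAct hι g p u) (leafAct hι g p v) = C.pairing (ι p) u v :=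
  (fibreCast_pairing _ _ _).trans (Φ.act_pairing g (ι p) u v)

theorem op_leafAct (hΦ : Φ.Preserves 𝓖) (hι : IsLeaf EP Φ ι) (g : G) (p : P) (v : 𝓔 (ι p)) :
    𝓖.op (ι (g • p)) (leafAct hι g p v) = leafAct hι g p (𝓖.op (ι p) v) :=
  (fibreCast_op _ _).trans (congrArg _ (hΦ g (ι p) v))

theorem leafAct_splitting (hΦ : Φ.Preserves 𝓖) (hs : s.IsMetric 𝓖)
    (hι : IsLeaf EP Φ ι) (g : G) (p : P) (Y : TangentSpace 𝓘(ℝ, EP) p) :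
    leafAct hι g p (s.toFun (ι p) (tmap EP E ι p Y)) =
      s.toFun (ι (g • p)) (tmap EP E ι (g • p) (tmap EP EP (fun y : P => g • y) p Y)) := by
  have h1 : leafAct hι g p (s.toFun (ι p) (tmap EP E ι p Y)) =
      fibreCast (hι.equivariant g p).symm (s.toFun (g • ι p)
        (tmap E E (fun y : M => g • y) (ι p) (tmap EP E ι p Y))) :=
    congrArg _ (act_splitting hΦ hs g (ι p) _)
  have h2 := fibreCast_splitting (s := s) (hι.equivariant g p).symm
    (tmap E E (fun y : M => g • y) (ι p) (tmap EP E ι p Y))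
  exact h1.trans (h2.trans (congrArg (s.toFun (ι (g • p))) (tmap_leaf_smul hι g p Y).symm))

theorem leafAct_eigenLift (hΦ : Φ.Preserves 𝓖) (hs : s.IsMetric 𝓖)
    (hι : IsLeaf EP Φ ι) (ε : ℝ) (g : G) (p : P) (Y : TangentSpace 𝓘(ℝ, EP) p) :
    leafAct hι g p (eigenLift 𝓖 s ε (ι p) (tmap EP E ι p Y)) =
      eigenLift 𝓖 s ε (ι (g • p))
        (tmap EP E ι (g • p) (tmap EP EP (fun y : P => g • y) p Y)) := by
  rw [eigenLift_apply, map_add, map_smul, ← op_leafAct hΦ, leafAct_splitting hΦ hs,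
    eigenLift_apply]

theorem inducedMetric_leaf_smul (hΦ : Φ.Preserves 𝓖) (hs : s.IsMetric 𝓖)
    (hι : IsLeaf EP Φ ι) (g : G) (p : P) (Y Z : TangentSpace 𝓘(ℝ, EP) p) :
    inducedMetric 𝓖 s (ι (g • p))
        (tmap EP E ι (g • p) (tmap EP EP (fun y : P => g • y) p Y))
        (tmap EP E ι (g • p) (tmap EP EP (fun y : P => g • y) p Z)) =
      inducedMetric 𝓖 s (ι p) (tmap EP E ι p Y) (tmap EP E ι p Z) := by
  rw [inducedMetric_eq, inducedMetric_eq, ← leafAct_splitting hΦ hs hι,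
    ← leafAct_splitting hΦ hs hι, op_leafAct hΦ, pairing_leafAct]

end Leaf

/-! ### Rules for directional derivatives. -/

section Rules

variable {E : Type*} [NormedAddCommGroup E] [NormedSpace ℝ E]
  {M : Type*} [TopologicalSpace M] [ChartedSpace E M] [IsManifold 𝓘(ℝ, E) ∞ M]
  {W : Type*} [NormedAddCommGroup W] [NormedSpace ℝ W] {x : M}

theorem dirDeriv_add {f g : M → W} (hf : MDifferentiableAt 𝓘(ℝ, E) 𝓘(ℝ, W) f x)
    (hg : MDifferentiableAt 𝓘(ℝ, E) 𝓘(ℝ, W) g x) (v : TangentSpace 𝓘(ℝ, E) x) :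
    dirDeriv (fun y => f y + g y) x v = dirDeriv f x v + dirDeriv g x v :=
  DFunLike.congr_fun (hf.hasMFDerivAt.add hg.hasMFDerivAt).mfderiv v

theorem dirDeriv_sub {f g : M → W} (hf : MDifferentiableAt 𝓘(ℝ, E) 𝓘(ℝ, W) f x)
    (hg : MDifferentiableAt 𝓘(ℝ, E) 𝓘(ℝ, W) g x) (v : TangentSpace 𝓘(ℝ, E) x) :
    dirDeriv (fun y => f y - g y) x v = dirDeriv f x v - dirDeriv g x v :=
  DFunLike.congr_fun (hf.hasMFDerivAt.sub hg.hasMFDerivAt).mfderiv v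

theorem dirDeriv_mul {f g : M → ℝ} (hf : MDifferentiableAt 𝓘(ℝ, E) 𝓘(ℝ, ℝ) f x)
    (hg : MDifferentiableAt 𝓘(ℝ, E) 𝓘(ℝ, ℝ) g x) (v : TangentSpace 𝓘(ℝ, E) x) :
    dirDeriv (fun y => f y * g y) x v = f x * dirDeriv g x v + g x * dirDeriv f x v :=
  DFunLike.congr_fun (hf.hasMFDerivAt.mul hg.hasMFDerivAt).mfderiv v

theorem dirDeriv_const_mul {f : M → ℝ} (hf : MDifferentiableAt 𝓘(ℝ, E) 𝓘(ℝ, ℝ) f x) (c : ℝ)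
    (v : TangentSpace 𝓘(ℝ, E) x) :
    dirDeriv (fun y => c * f y) x v = c * dirDeriv f x v :=
  DFunLike.congr_fun (hf.hasMFDerivAt.const_smul c).mfderiv v

theorem dirDeriv_const (c : W) (v : TangentSpace 𝓘(ℝ, E) x) :
    dirDeriv (fun _ : M => c) x v = 0 :=
  DFunLike.congr_fun (hasMFDerivAt_const (I := 𝓘(ℝ, E)) (I' := 𝓘(ℝ, W)) c x).mfderiv v

theorem dirDeriv_clm {W' : Type*} [NormedAddCommGroup W'] [NormedSpace ℝ W'] (L : W →L[ℝ] W')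
    {f : M → W} (hf : MDifferentiableAt 𝓘(ℝ, E) 𝓘(ℝ, W) f x) (v : TangentSpace 𝓘(ℝ, E) x) :
    dirDeriv (fun y => L (f y)) x v = L (dirDeriv f x v) :=
  DFunLike.congr_fun (L.hasMFDerivAt.comp x hf.hasMFDerivAt).mfderiv v

theorem mdifferentiableAt_sum {κ : Type} (t : Finset κ) {f : κ → M → W}
    (hf : ∀ i ∈ t, MDifferentiableAt 𝓘(ℝ, E) 𝓘(ℝ, W) (f i) x) :
    MDifferentiableAt 𝓘(ℝ, E) 𝓘(ℝ, W) (fun y => ∑ i ∈ t, f i y) x := by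
  have h := MDifferentiableAt.sum hf
  have h1 : (∑ i ∈ t, f i) = fun y => ∑ i ∈ t, f i y := by ext y; simp
  rwa [h1] at h

theorem dirDeriv_sum {κ : Type} (t : Finset κ) {f : κ → M → W}
    (hf : ∀ i ∈ t, MDifferentiableAt 𝓘(ℝ, E) 𝓘(ℝ, W) (f i) x) (v : TangentSpace 𝓘(ℝ, E) x) :
    dirDeriv (fun y => ∑ i ∈ t, f i y) x v = ∑ i ∈ t, dirDeriv (f i) x v := by
  classical
  induction t using Finset.induction_on with
  | empty => simpa using dirDeriv_const (0 : W) v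
  | insert a t ha ih =>
    simp only [Finset.sum_insert ha]
    rw [← ih fun i hi => hf i (Finset.mem_insert_of_mem hi)]
    exact dirDeriv_add (hf a (Finset.mem_insert_self a t))
      (mdifferentiableAt_sum t fun i hi => hf i (Finset.mem_insert_of_mem hi)) v

end Rules

/-! ### Local frames for sections along a map. -/

section Frames

variable {E : Type*} [NormedAddCommGroup E] [NormedSpace ℝ E] [FiniteDimensional ℝ E]
  {M : Type*} [TopologicalSpace M] [ChartedSpace E M] [IsManifold 𝓘(ℝ, E) ∞ M] [T2Space M]
  {F : Type*} [NormedAddCommGroup F] [NormedSpace ℝ F] [FiniteDimensional ℝ F]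
  {V : M → Type*} [TopologicalSpace (TotalSpace F V)] [∀ x, AddCommGroup (V x)]
  [∀ x, Module ℝ (V x)] [∀ x, TopologicalSpace (V x)] [FiberBundle F V] [VectorBundle ℝ F V]
  [ContMDiffVectorBundle ∞ F V 𝓘(ℝ, E)]
  {EN : Type*} [NormedAddCommGroup EN] [NormedSpace ℝ EN]
  {N : Type*} [TopologicalSpace N] [ChartedSpace EN N] [IsManifold 𝓘(ℝ, EN) ∞ N]

/-- A section along a map is locally a combination of global sections. -/
theorem exists_eq_sum_smul_sections {h : N → M} {k : ∀ n, V (h n)} {n₀ : N}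
    (hk : ∀ᶠ n in 𝓝 n₀, ContMDiffAt 𝓘(ℝ, EN) (𝓘(ℝ, E).prod 𝓘(ℝ, F)) ∞
      (fun n => (⟨h n, k n⟩ : TotalSpace F V)) n) :
    ∃ (e : Fin (Module.finrank ℝ F) → Cₛ^∞⟮𝓘(ℝ, E); F, V⟯)
      (c : Fin (Module.finrank ℝ F) → N → ℝ),
      (∀ i, ∀ᶠ n in 𝓝 n₀, ContMDiffAt 𝓘(ℝ, EN) 𝓘(ℝ, ℝ) ∞ (c i) n) ∧
      ∀ᶠ n in 𝓝 n₀, k n = ∑ i, c i n • e i (h n) := by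
  let t := trivializationAt F V (h n₀)
  have hx : h n₀ ∈ t.baseSet := FiberBundle.mem_baseSet_trivializationAt' (h n₀)
  let b := Module.finBasis ℝ F
  have he : ∀ i, ∃ e : Cₛ^∞⟮𝓘(ℝ, E); F, V⟯, ∀ᶠ y in 𝓝 (h n₀), e y = t.symm y (b i) := by
    intro i
    apply exists_section_eventuallyEq
    filter_upwards [t.open_baseSet.mem_nhds hx] with y hy
    rw [t.contMDiffAt_section_iff hy]
    refine (contMDiffAt_const (c := b i)).congr_of_eventuallyEq ?_
    filter_upwards [t.open_baseSet.mem_nhds hy] with z hz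
    exact (congrArg Prod.snd (t.apply_mk_symm hz _) :)
  choose e he using he
  have hhc : ContinuousAt h n₀ :=
    ((contMDiffAt_totalSpace.1 hk.self_of_nhds).1.continuousAt :)
  have hbase : ∀ᶠ n in 𝓝 n₀, h n ∈ t.baseSet := hhc.eventually (t.open_baseSet.mem_nhds hx)
  refine ⟨e, fun i n => LinearMap.toContinuousLinearMap (b.coord i) (t ⟨h n, k n⟩).2,
    fun i => ?_, ?_⟩
  · filter_upwards [hk, hbase] with n hn hb
    have h1 := ((t.contMDiffAt_iff (f := fun n => (⟨h n, k n⟩ : TotalSpace F V))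
      (t.mem_source.2 hb)).1 hn).2
    exact (ContinuousLinearMap.contMDiff _).contMDiffAt.comp n h1
  · filter_upwards [hbase, eventually_all.2 fun i => hhc.eventually (he i)] with n hb hn
    simp only [hn, LinearMap.coe_toContinuousLinearMap', Module.Basis.coord_apply]
    have h2 : ∀ v, t.symm (h n) v = t.symmL ℝ (h n) v := fun v =>
      (t.symmL_apply (R := ℝ) hb v).symm
    simp only [h2, ← map_smul, ← map_sum, b.sum_repr]
    rw [← h2]
    exact (t.symm_apply_apply_mk hb _).symm

end Frames

/-! ### Smoothness of pairings along a map. -/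

section Coefficients

variable {EG : Type*} [NormedAddCommGroup EG] [NormedSpace ℝ EG] [FiniteDimensional ℝ EG]
  {G : Type*} [TopologicalSpace G] [ChartedSpace EG G] [Group G] [LieGroup 𝓘(ℝ, EG) ∞ G]
  {𝔞 : Type*} [AddCommGroup 𝔞] [Module ℝ 𝔞]
  {E : Type*} [NormedAddCommGroup E] [NormedSpace ℝ E] [FiniteDimensional ℝ E]
  {M : Type*} [TopologicalSpace M] [ChartedSpace E M] [IsManifold 𝓘(ℝ, E) ∞ M] [T2Space M]
  [MulAction G M] [ContMDiffSMul 𝓘(ℝ, EG) 𝓘(ℝ, E) ∞ G M]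
  {F : Type*} [NormedAddCommGroup F] [NormedSpace ℝ F] [FiniteDimensional ℝ F]
  {𝓔 : M → Type*} [TopologicalSpace (TotalSpace F 𝓔)] [∀ x, AddCommGroup (𝓔 x)]
  [∀ x, Module ℝ (𝓔 x)] [∀ x, TopologicalSpace (𝓔 x)] [FiberBundle F 𝓔] [VectorBundle ℝ F 𝓔]
  [ContMDiffVectorBundle ∞ F 𝓔 𝓘(ℝ, E)]
  {C : CourantAlgebroid E F 𝓔} {A : ExactCourantAlgebra (GroupLieAlgebra 𝓘(ℝ, EG) G) 𝔞}
  {EP : Type*} [NormedAddCommGroup EP] [NormedSpace ℝ EP] [FiniteDimensional ℝ EP]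
  {P : Type*} [TopologicalSpace P] [ChartedSpace EP P] [IsManifold 𝓘(ℝ, EP) ∞ P] [T2Space P]
  [MulAction G P] [ContMDiffSMul 𝓘(ℝ, EG) 𝓘(ℝ, EP) ∞ G P]
  {EN : Type*} [NormedAddCommGroup EN] [NormedSpace ℝ EN]
  {N : Type*} [TopologicalSpace N] [ChartedSpace EN N] [IsManifold 𝓘(ℝ, EN) ∞ N]

/-- The pairing of two smooth sections along a map is smooth. -/
theorem eventually_contMDiffAt_pairing (C : CourantAlgebroid E F 𝓔) {h : N → M}
    {k l : ∀ n, 𝓔 (h n)} {n₀ : N}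
    (hk : ∀ᶠ n in 𝓝 n₀, ContMDiffAt 𝓘(ℝ, EN) (𝓘(ℝ, E).prod 𝓘(ℝ, F)) ∞
      (fun n => (⟨h n, k n⟩ : TotalSpace F 𝓔)) n)
    (hl : ∀ᶠ n in 𝓝 n₀, ContMDiffAt 𝓘(ℝ, EN) (𝓘(ℝ, E).prod 𝓘(ℝ, F)) ∞
      (fun n => (⟨h n, l n⟩ : TotalSpace F 𝓔)) n) :
    ∀ᶠ n in 𝓝 n₀, ContMDiffAt 𝓘(ℝ, EN) 𝓘(ℝ, ℝ) ∞ (fun n => C.pairing (h n) (k n) (l n)) n := by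
  obtain ⟨e, c, hc, hke⟩ := exists_eq_sum_smul_sections hk
  obtain ⟨e', c', hc', hle⟩ := exists_eq_sum_smul_sections hl
  filter_upwards [eventually_all.2 hc, eventually_all.2 hc', eventually_eventually_nhds.2 hke,
    eventually_eventually_nhds.2 hle, hk] with n hc hc' hke hle hk
  have hh : ContMDiffAt 𝓘(ℝ, EN) 𝓘(ℝ, E) ∞ h n := (contMDiffAt_totalSpace.1 hk).1
  have h1 : ContMDiffAt 𝓘(ℝ, EN) 𝓘(ℝ, ℝ) ∞ (fun n => ∑ i, ∑ j, c i n * (c' j n *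
      C.pairing (h n) (e i (h n)) (e' j (h n)))) n := by
    refine ContMDiffAt.sum fun i _ => ContMDiffAt.sum fun j _ => ?_
    exact (hc i).mul ((hc' j).mul (ContMDiffAt.comp n ((C.pairing_smooth _ _).contMDiffAt) hh))
  refine h1.congr_of_eventuallyEq ?_
  filter_upwards [hke, hle] with m hm hm'
  simp only [hm, hm', map_sum, map_smul, LinearMap.sum_apply, LinearMap.smul_apply, smul_eq_mul,
    Finset.mul_sum]
  rw [Finset.sum_comm]
  refine Finset.sum_congr rfl fun i _ => Finset.sum_congr rfl fun j _ => by ring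

end Coefficients

/-! ### The adjoint action and functoriality of the differentials of the action. -/

section Adjoint

variable {EG : Type*} [NormedAddCommGroup EG] [NormedSpace ℝ EG] [FiniteDimensional ℝ EG]
  {G : Type*} [TopologicalSpace G] [ChartedSpace EG G] [Group G] [LieGroup 𝓘(ℝ, EG) ∞ G]
  {E : Type*} [NormedAddCommGroup E] [NormedSpace ℝ E] [FiniteDimensional ℝ E]
  {M : Type*} [TopologicalSpace M] [ChartedSpace E M] [IsManifold 𝓘(ℝ, E) ∞ M]
  [MulAction G M] [ContMDiffSMul 𝓘(ℝ, EG) 𝓘(ℝ, E) ∞ G M]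

theorem Ad_one (γ : GroupLieAlgebra 𝓘(ℝ, EG) G) : Ad 1 γ = γ := by
  have h : (fun h : G => (1 : G) * h * (1 : G)⁻¹) = id := by funext h; simp
  rw [Ad, h]
  exact DFunLike.congr_fun (mfderiv_id (I := 𝓘(ℝ, EG)) (x := (1 : G))) γ

theorem Ad_mul (g h : G) (γ : GroupLieAlgebra 𝓘(ℝ, EG) G) : Ad (g * h) γ = Ad g (Ad h γ) := by
  have h1 := mfderiv_comp_apply_eq (E := EG) (E' := EG) (E'' := EG) (x := (1 : G)) (y := (1 : G))
    (f := fun k : G => h * k * h⁻¹)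
    (g := fun k : G => g * k * g⁻¹) (by simp) (mdifferentiableAt_conj g 1)
    (mdifferentiableAt_conj h 1) γ
  have h2 : (fun k : G => g * (h * k * h⁻¹) * g⁻¹) = fun k : G => g * h * k * (g * h)⁻¹ := by
    funext k; simp [mul_assoc]
  rw [h2] at h1
  exact h1

theorem Ad_inv_Ad (g : G) (γ : GroupLieAlgebra 𝓘(ℝ, EG) G) : Ad g⁻¹ (Ad g γ) = γ := by
  rw [← Ad_mul, inv_mul_cancel, Ad_one]

theorem Ad_Ad_inv (g : G) (γ : GroupLieAlgebra 𝓘(ℝ, EG) G) : Ad g (Ad g⁻¹ γ) = γ := by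
  rw [← Ad_mul, mul_inv_cancel, Ad_one]

theorem tmap_smul_mul (EG : Type*) [NormedAddCommGroup EG] [NormedSpace ℝ EG]
    {G : Type*} [TopologicalSpace G] [ChartedSpace EG G] [Group G]
    {E : Type*} [NormedAddCommGroup E] [NormedSpace ℝ E] [FiniteDimensional ℝ E]
    {M : Type*} [TopologicalSpace M] [ChartedSpace E M] [IsManifold 𝓘(ℝ, E) ∞ M] [MulAction G M]
    [ContMDiffSMul 𝓘(ℝ, EG) 𝓘(ℝ, E) ∞ G M] (g h : G) (x : M) (v : TangentSpace 𝓘(ℝ, E) x) :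
    (tmap E E (fun y : M => (g * h) • y) x v : E) =
      tmap E E (fun y : M => g • y) (h • x) (tmap E E (fun y : M => h • y) x v) := by
  have h1 := tmap_comp (g := fun y : M => g • y) (f := fun y : M => h • y)
    (mdifferentiableAt_smul_right EG g (h • x)) (mdifferentiableAt_smul_right EG h x) v
  have h2 : (fun y : M => (g * h) • y) = fun y => g • h • y := funext fun y => mul_smul g h y
  exact (tmap_congr (EventuallyEq.of_eq h2) v).trans h1

theorem tmap_smul_one (EG : Type*) [NormedAddCommGroup EG] [NormedSpace ℝ EG]
    {G : Type*} [TopologicalSpace G] [ChartedSpace EG G] [Group G]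
    {E : Type*} [NormedAddCommGroup E] [NormedSpace ℝ E] [FiniteDimensional ℝ E]
    {M : Type*} [TopologicalSpace M] [ChartedSpace E M] [IsManifold 𝓘(ℝ, E) ∞ M] [MulAction G M]
    [ContMDiffSMul 𝓘(ℝ, EG) 𝓘(ℝ, E) ∞ G M] (x : M) (v : TangentSpace 𝓘(ℝ, E) x) :
    (tmap E E (fun y : M => (1 : G) • y) x v : E) = v := by
  have h2 : (fun y : M => (1 : G) • y) = id := funext fun y => one_smul G y
  exact (tmap_congr (EventuallyEq.of_eq h2) v).trans
    (DFunLike.congr_fun (mfderiv_id (I := 𝓘(ℝ, E)) (x := x)) v)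

theorem tmap_smul_injective (EG : Type*) [NormedAddCommGroup EG] [NormedSpace ℝ EG]
    {G : Type*} [TopologicalSpace G] [ChartedSpace EG G] [Group G]
    {E : Type*} [NormedAddCommGroup E] [NormedSpace ℝ E] [FiniteDimensional ℝ E]
    {M : Type*} [TopologicalSpace M] [ChartedSpace E M] [IsManifold 𝓘(ℝ, E) ∞ M] [MulAction G M]
    [ContMDiffSMul 𝓘(ℝ, EG) 𝓘(ℝ, E) ∞ G M] (g : G) (x : M) :
    Function.Injective (tmap E E (fun y : M => g • y) x) := by
  have h : ∀ v : TangentSpace 𝓘(ℝ, E) x, (tmap E E (fun y : M => g⁻¹ • y) (g • x)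
      (tmap E E (fun y : M => g • y) x v) : E) = v := by
    intro v
    have h1 : (fun y : M => (g⁻¹ * g) • y) = fun y => (1 : G) • y := by
      rw [inv_mul_cancel]
    exact (tmap_smul_mul EG g⁻¹ g x v).symm.trans
      ((tmap_congr (EventuallyEq.of_eq h1) v).trans (tmap_smul_one EG x v))
  intro v w hvw
  have h2 : (tmap E E (fun y : M => g⁻¹ • y) (g • x) (tmap E E (fun y : M => g • y) x v) : E) =
      tmap E E (fun y : M => g⁻¹ • y) (g • x) (tmap E E (fun y : M => g • y) x w) :=
    congrArg _ hvw
  exact (h v).symm.trans (h2.trans (h w))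

end Adjoint

/-! ### Equivariance of `ξ`. -/

section Equivariance

variable {EG : Type*} [NormedAddCommGroup EG] [NormedSpace ℝ EG] [FiniteDimensional ℝ EG]
  {G : Type*} [TopologicalSpace G] [ChartedSpace EG G] [Group G] [LieGroup 𝓘(ℝ, EG) ∞ G]
  {𝔞 : Type*} [AddCommGroup 𝔞] [Module ℝ 𝔞]
  {E : Type*} [NormedAddCommGroup E] [NormedSpace ℝ E] [FiniteDimensional ℝ E]
  {M : Type*} [TopologicalSpace M] [ChartedSpace E M] [IsManifold 𝓘(ℝ, E) ∞ M] [T2Space M]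
  [MulAction G M] [ContMDiffSMul 𝓘(ℝ, EG) 𝓘(ℝ, E) ∞ G M]
  {F : Type*} [NormedAddCommGroup F] [NormedSpace ℝ F] [FiniteDimensional ℝ F]
  {𝓔 : M → Type*} [TopologicalSpace (TotalSpace F 𝓔)] [∀ x, AddCommGroup (𝓔 x)]
  [∀ x, Module ℝ (𝓔 x)] [∀ x, TopologicalSpace (𝓔 x)] [FiberBundle F 𝓔] [VectorBundle ℝ F 𝓔]
  [ContMDiffVectorBundle ∞ F 𝓔 𝓘(ℝ, E)]
  {C : CourantAlgebroid E F 𝓔} {A : ExactCourantAlgebra (GroupLieAlgebra 𝓘(ℝ, EG) G) 𝔞}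
  {EP : Type*} [NormedAddCommGroup EP] [NormedSpace ℝ EP] [FiniteDimensional ℝ EP]
  {P : Type*} [TopologicalSpace P] [ChartedSpace EP P] [IsManifold 𝓘(ℝ, EP) ∞ P] [T2Space P]
  [MulAction G P] [ContMDiffSMul 𝓘(ℝ, EG) 𝓘(ℝ, EP) ∞ G P]
  {Φ : ExtendedAction C A} {𝓖 : GeneralizedMetric C} {s : IsotropicSplitting C} {ι : P → M}

theorem contMDiff_act_inv (Φ : ExtendedAction C A) (x : M) (w : 𝓔 x) :
    ContMDiff 𝓘(ℝ, EG) (𝓘(ℝ, E).prod 𝓘(ℝ, F)) ∞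
      (fun g : G => (⟨g⁻¹ • x, Φ.act g⁻¹ x w⟩ : TotalSpace F 𝓔)) := by
  have h : ContMDiff 𝓘(ℝ, EG) (𝓘(ℝ, EG).prod (𝓘(ℝ, E).prod 𝓘(ℝ, F))) ∞
      (fun g : G => (g⁻¹, (⟨x, w⟩ : TotalSpace F 𝓔))) :=
    (contMDiff_inv 𝓘(ℝ, EG) ∞).prodMk contMDiff_const
  exact Φ.act_smooth.comp h

theorem pairing_act_symm (Φ : ExtendedAction C A) (g : G) (x : M) (u : 𝓔 (g • x)) (w : 𝓔 x) :
    C.pairing x ((Φ.act g x).symm u) w = C.pairing (g • x) u (Φ.act g x w) := by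
  rw [← Φ.act_pairing g x, LinearEquiv.apply_symm_apply]

theorem mdifferentiable_pairing_act (Φ : ExtendedAction C A) (e : Cₛ^∞⟮𝓘(ℝ, E); F, 𝓔⟯) (x : M)
    (w : 𝓔 x) :
    MDifferentiable 𝓘(ℝ, EG) 𝓘(ℝ, ℝ)
      (fun g : G => C.pairing x ((Φ.act g⁻¹ x).symm (e (g⁻¹ • x))) w) := by
  intro g
  simp only [pairing_act_symm]
  have h1 : ContMDiff 𝓘(ℝ, EG) 𝓘(ℝ, E) ∞ (fun g : G => g⁻¹ • x) := fun g =>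
    ((contMDiffAt_totalSpace.1 (contMDiff_act_inv Φ x w g)).1 :)
  have h := eventually_contMDiffAt_pairing (n₀ := g) C (h := fun g : G => g⁻¹ • x)
    (k := fun g => e (g⁻¹ • x)) (l := fun g => Φ.act g⁻¹ x w)
    (Eventually.of_forall fun g => (e.contMDiff.comp h1).contMDiffAt)
    (Eventually.of_forall fun g => (contMDiff_act_inv Φ x w).contMDiffAt)
  exact h.self_of_nhds.mdifferentiableAt (by simp)

/-- Apply the differential of `g⁻¹` to both sides: it conjugates generators by `Ad g⁻¹`, which
cancels `Ad g`. -/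
theorem anchor_act_symm_Ψ (Φ : ExtendedAction C A) (a : 𝔞) (g : G) (x : M) :
    C.anchor x ((Φ.act g⁻¹ x).symm (Φ.Ψ a (g⁻¹ • x))) = infGen (Ad g (A.proj a)) x := by
  apply tmap_smul_injective EG g⁻¹ x
  rw [← Φ.act_anchor, LinearEquiv.apply_symm_apply, Φ.anchor_map, tmap_smul_infGen, Ad_inv_Ad]

/-- The derivative of the adjoint action is the bracket. -/
theorem mdifferentiableAt_Ad_and_dirDeriv (hC : C.IsExact) (Φ : ExtendedAction C A) {x : M}
    (hx : Function.Injective (infGenMap EG G E x)) (γ δ : GroupLieAlgebra 𝓘(ℝ, EG) G) :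
    MDifferentiableAt (M' := EG) 𝓘(ℝ, EG) 𝓘(ℝ, EG) (fun g : G => Ad g γ) 1 ∧
      dirDeriv (W := EG) (fun g : G => Ad g γ) 1 δ = (⁅δ, γ⁆ : GroupLieAlgebra 𝓘(ℝ, EG) G) := by
  obtain ⟨L, hL⟩ := (infGenMap EG G E x).exists_leftInverse_of_injective (LinearMap.ker_eq_bot.2 hx)
  have key : ∀ ℓ : Module.Dual ℝ (GroupLieAlgebra 𝓘(ℝ, EG) G),
      MDifferentiableAt 𝓘(ℝ, EG) 𝓘(ℝ, ℝ) (fun g : G => ℓ (Ad g γ)) 1 ∧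
      dirDeriv (fun g : G => ℓ (Ad g γ)) 1 δ = ℓ ⁅δ, γ⁆ := by
    intro ℓ
    -- Pairing with this covector `w` computes `ℓ ∘ L ∘ π`. Hence `ℓ (Ad g γ)` is exactly the
    -- function whose derivative `infinitesimal` gives. The derivative of `Ad` is thus read off from
    -- the extended action at a point where generators are independent.
    obtain ⟨w, -, hw⟩ := exists_pairing_eq hC (ℓ.comp L)
    have hℓ : ∀ γ', (ℓ.comp L) (infGen γ' x) = ℓ γ' := fun γ' => by
      rw [LinearMap.comp_apply, ← infGenMap_apply, ← LinearMap.comp_apply L, hL]; rfl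
    have hfun : (fun g : G => ℓ (Ad g γ)) =
        fun g : G => C.pairing x ((Φ.act g⁻¹ x).symm (Φ.Ψ (A.splitting γ) (g⁻¹ • x))) w := by
      funext g
      rw [hw, anchor_act_symm_Ψ, ExactCourantAlgebra.proj_splitting, hℓ]
    rw [hfun]
    refine ⟨mdifferentiable_pairing_act Φ _ x w 1, ?_⟩
    have h1 := Φ.infinitesimal (A.splitting δ) (Φ.Ψ (A.splitting γ)) x w
    rw [ExactCourantAlgebra.proj_splitting] at h1
    rw [h1, ← Φ.map_bracket, hw, Φ.anchor_map, hℓ, A.proj_bracket,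
      ExactCourantAlgebra.proj_splitting, ExactCourantAlgebra.proj_splitting]
  let b : Module.Basis _ ℝ EG := Module.finBasis ℝ EG
  have hsum : (fun g : G => (Ad g γ : EG)) = fun g => ∑ i, b.coord i (Ad g γ) • b i := by
    funext g; exact (b.sum_repr _).symm
  have hd : ∀ i, MDifferentiableAt 𝓘(ℝ, EG) 𝓘(ℝ, EG)
      (fun g : G => b.coord i (Ad g γ) • b i) 1 := fun i =>
    ((ContinuousLinearMap.toSpanSingleton ℝ (b i)).mdifferentiableAt).comp (1 : G)
      (key (b.coord i)).1
  constructor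
  · refine MDifferentiableAt.congr_of_eventuallyEq ?_ (EventuallyEq.of_eq hsum)
    exact mdifferentiableAt_sum _ fun i _ => hd i
  · have h1 := dirDeriv_congr (E := EG) (W := EG) (x := (1 : G)) (EventuallyEq.of_eq hsum) δ
    refine h1.trans ((dirDeriv_sum _ (fun i _ => hd i) δ).trans ?_)
    have h2 : ∀ i, dirDeriv (fun g : G => b.coord i (Ad g γ) • b i) 1 δ =
        b.coord i (⁅δ, γ⁆ : GroupLieAlgebra 𝓘(ℝ, EG) G) • b i := fun i =>
      (dirDeriv_clm (ContinuousLinearMap.toSpanSingleton ℝ (b i)) (key (b.coord i)).1 δ).trans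
        (congrArg (fun r : ℝ => r • b i) (key (b.coord i)).2)
    rw [Finset.sum_congr rfl fun i _ => h2 i]
    exact b.sum_repr _

theorem infGenMap_leaf_injective [IsCancelSMul G P] (hι : IsLeaf EP Φ ι) (p : P) :
    Function.Injective (infGenMap EG G E (ι p)) := by
  rw [injective_iff_map_eq_zero]
  intro γ hγ
  rw [infGenMap_apply, ← hι.tmap_infGen] at hγ
  exact infGen_eq_zero ((hι.tmap_injective p) (hγ.trans (map_zero _).symm))

theorem xiForm_congr {p p' : P} (h : p = p') (γ : GroupLieAlgebra 𝓘(ℝ, EG) G) (Y : EP) :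
    xiForm (EP := EP) Φ s ι p γ (Y : TangentSpace 𝓘(ℝ, EP) p) =
      xiForm (EP := EP) Φ s ι p' γ (Y : TangentSpace 𝓘(ℝ, EP) p') := by
  subst h; rfl

theorem fibreCast_pairing_section {x y : M} (h : x = y) (e : Cₛ^∞⟮𝓘(ℝ, E); F, 𝓔⟯) (v : 𝓔 x) :
    C.pairing y (e y) (fibreCast h v) = C.pairing x (e x) v := by
  subst h; rfl

theorem xiForm_smul_eq (hΦ : Φ.Preserves 𝓖) (hs : s.IsMetric 𝓖) (hι : IsLeaf EP Φ ι)
    (g : G) (p : P) (γ : GroupLieAlgebra 𝓘(ℝ, EG) G) (Y : TangentSpace 𝓘(ℝ, EP) p) :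
    xiForm Φ s ι (g • p) γ (tmap EP EP (fun y : P => g • y) p Y) =
      2 * C.pairing (ι p) ((Φ.act g (ι p)).symm (Φ.Ψ (A.splitting γ) (g • ι p)))
        (s.toFun (ι p) (tmap EP E ι p Y)) := by
  rw [xiForm_apply, xi, ← leafAct_splitting hΦ hs hι, pairing_act_symm]
  exact congrArg (2 * ·) (fibreCast_pairing_section (hι.equivariant g p).symm _ _)

/-- Expand `Ad g⁻¹ γ` in a basis. Differentiating the coefficients contributes `-ξ` of `⁅δ, γ⁆`.
Differentiating the pulled-back sections `Ψ (b i)` contributes `+ξ` of the same bracket, by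
`infinitesimal` and `map_bracket`. Over an isotropic leaf `ξ` sees only the image in `𝔤`, so the two
cancel. -/
theorem xiForm_inv_smul_derivative [IsCancelSMul G P] (hC : C.IsExact) (hΦ : Φ.Preserves 𝓖)
    (hs : s.IsMetric 𝓖) (hι : IsLeaf EP Φ ι) (hK : IsotropicOver Φ ι) (p : P)
    (γ δ : GroupLieAlgebra 𝓘(ℝ, EG) G) (Y : TangentSpace 𝓘(ℝ, EP) p) :
    MDifferentiableAt 𝓘(ℝ, EG) 𝓘(ℝ, ℝ) (fun g : G => xiForm Φ s ι (g⁻¹ • p) (Ad g⁻¹ γ)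
      (tmap EP EP (fun y : P => g⁻¹ • y) p Y)) 1 ∧
    dirDeriv (fun g : G => xiForm Φ s ι (g⁻¹ • p) (Ad g⁻¹ γ)
      (tmap EP EP (fun y : P => g⁻¹ • y) p Y)) 1 δ = 0 := by
  let b : Module.Basis _ ℝ (GroupLieAlgebra 𝓘(ℝ, EG) G) := Module.finBasis ℝ _
  let w := s.toFun (ι p) (tmap EP E ι p Y)
  have hwY : C.anchor (ι p) w = tmap EP E ι p Y := s.anchor_toFun _ _
  let φ : Fin _ → G → ℝ := fun i g =>
    C.pairing (ι p) ((Φ.act g⁻¹ (ι p)).symm (Φ.Ψ (A.splitting (b i)) (g⁻¹ • ι p))) w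
  let bc : ∀ i, EG →L[ℝ] ℝ := fun i =>
    LinearMap.toContinuousLinearMap (𝕜 := ℝ) (E := EG) (F' := ℝ) (b.coord i)
  let c : Fin _ → G → ℝ := fun i g => b.coord i (Ad g⁻¹ γ)
  have hfun : (fun g : G => xiForm Φ s ι (g⁻¹ • p) (Ad g⁻¹ γ)
      (tmap EP EP (fun y : P => g⁻¹ • y) p Y)) = fun g => ∑ i, c i g * (2 * φ i g) := by
    funext g
    conv_lhs => rw [← b.sum_repr (Ad g⁻¹ γ), map_sum, LinearMap.sum_apply]
    refine Finset.sum_congr rfl fun i _ => ?_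
    rw [map_smul, LinearMap.smul_apply, xiForm_smul_eq hΦ hs hι]
    rfl
  have hinv : MDifferentiableAt 𝓘(ℝ, EG) 𝓘(ℝ, EG) (fun g : G => g⁻¹) 1 :=
    (contMDiff_inv 𝓘(ℝ, EG) ∞).mdifferentiableAt (by simp)
  have hAd := fun δ => mdifferentiableAt_Ad_and_dirDeriv hC Φ (infGenMap_leaf_injective hι p) γ δ
  have hc0 : ∀ i, MDifferentiableAt 𝓘(ℝ, EG) 𝓘(ℝ, ℝ) (fun g : G => b.coord i (Ad g γ)) 1 :=
    fun i => ((bc i).mdifferentiableAt).comp (1 : G) (hAd δ).1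
  have hc : ∀ i, MDifferentiableAt 𝓘(ℝ, EG) 𝓘(ℝ, ℝ) (c i) 1 := by
    intro i
    have h := hc0 i
    rw [← inv_one] at h
    exact h.comp (1 : G) hinv
  have hφ : ∀ i, MDifferentiableAt 𝓘(ℝ, EG) 𝓘(ℝ, ℝ) (φ i) 1 := fun i =>
    mdifferentiable_pairing_act Φ _ _ _ 1
  have hφ2 : ∀ i, MDifferentiableAt 𝓘(ℝ, EG) 𝓘(ℝ, ℝ) (fun g => 2 * φ i g) 1 := fun i =>
    (hφ i).const_smul (2 : ℝ)
  have hcd : ∀ i, dirDeriv (c i) 1 δ = -b.coord i ⁅δ, γ⁆ := by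
    intro i
    have h1 := mfderiv_comp_apply_eq (E := EG) (E' := EG) (E'' := ℝ) (x := (1 : G)) (y := (1 : G))
      (f := fun g : G => g⁻¹)
      (g := fun g : G => b.coord i (Ad g γ)) (by simp) (hc0 i) hinv δ
    -- The minus sign in `hcd` comes from differentiating the inversion inside `Ad g⁻¹`.
    refine h1.trans ((congrArg _ (mfderiv_inv_one (EG := EG) (G := G) δ)).trans ?_)
    have h2 : (mfderiv 𝓘(ℝ, EG) 𝓘(ℝ, ℝ) (fun g : G => b.coord i (Ad g γ)) 1 : EG →L[ℝ] ℝ) δ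
        = b.coord i ⁅δ, γ⁆ :=
      (dirDeriv_clm (bc i) (hAd δ).1 δ).trans
        (congrArg (b.coord i) (hAd δ).2)
    exact (map_neg _ _).trans (congrArg Neg.neg h2)
  have hφd : ∀ i, 2 * dirDeriv (φ i) 1 δ = xiForm Φ s ι p ⁅δ, b i⁆ Y := by
    intro i
    have h1 := Φ.infinitesimal (A.splitting δ) (Φ.Ψ (A.splitting (b i))) (ι p) w
    rw [ExactCourantAlgebra.proj_splitting] at h1
    have h2 : dirDeriv (φ i) 1 δ = _ := h1
    rw [h2, ← Φ.map_bracket, two_mul_pairing_Ψ_splitting hC hι hK, A.proj_bracket,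
      ExactCourantAlgebra.proj_splitting, ExactCourantAlgebra.proj_splitting, xiForm_apply]
  have hm : ∀ i, MDifferentiableAt 𝓘(ℝ, EG) 𝓘(ℝ, ℝ) (fun g => c i g * (2 * φ i g)) 1 :=
    fun i => (hc i).mul (hφ2 i)
  rw [hfun]
  refine ⟨mdifferentiableAt_sum _ fun i _ => hm i, ?_⟩
  rw [dirDeriv_sum _ fun i _ => hm i]
  have hc1 : ∀ i, c i 1 = b.coord i γ := fun i => by
    change b.coord i (Ad (1 : G)⁻¹ γ) = _
    rw [inv_one, Ad_one]
  have hφ1 : ∀ i, 2 * φ i 1 = xiForm Φ s ι p (b i) Y := by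
    intro i
    have h1 := xiForm_smul_eq hΦ hs hι (1 : G)⁻¹ p (b i) Y
    refine h1.symm.trans ?_
    have h2 : (fun y : P => (1 : G)⁻¹ • y) = fun y => (1 : G) • y := by rw [inv_one]
    have h3 : (tmap EP EP (fun y : P => (1 : G)⁻¹ • y) p Y : EP) = Y :=
      (tmap_congr (EventuallyEq.of_eq h2) Y).trans (tmap_smul_one EG p Y)
    refine (xiForm_congr (EP := EP) (by rw [inv_one, one_smul]) (b i)
      (tmap EP EP (fun y : P => (1 : G)⁻¹ • y) p Y)).trans ?_
    exact congrArg _ h3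
  calc ∑ i, dirDeriv (fun g => c i g * (2 * φ i g)) 1 δ
      = ∑ i, (b.coord i γ • xiForm Φ s ι p ⁅δ, b i⁆ Y
          - b.coord i ⁅δ, γ⁆ • xiForm Φ s ι p (b i) Y) := by
        refine Finset.sum_congr rfl fun i _ => ?_
        rw [dirDeriv_mul (hc i) (hφ2 i), dirDeriv_const_mul (hφ i), hcd, hc1, hφ1, hφd,
          smul_eq_mul, smul_eq_mul]
        ring
    _ = xiForm Φ s ι p ⁅δ, ∑ i, b.coord i γ • b i⁆ Y
          - xiForm Φ s ι p (∑ i, b.coord i ⁅δ, γ⁆ • b i) Y := by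
        rw [Finset.sum_sub_distrib, lie_sum]
        simp only [lie_smul, map_sum, map_smul, LinearMap.sum_apply, LinearMap.smul_apply]
    _ = 0 := by
        have h := b.sum_repr
        simp only [Module.Basis.coord_apply, h, sub_self]

/-- The form `ξ` is equivariant. -/
theorem xiForm_smul [ConnectedSpace G] [IsCancelSMul G P] (hC : C.IsExact) (hΦ : Φ.Preserves 𝓖)
    (hs : s.IsMetric 𝓖) (hι : IsLeaf EP Φ ι) (hK : IsotropicOver Φ ι) (g : G) (p : P)
    (γ : GroupLieAlgebra 𝓘(ℝ, EG) G) (Y : TangentSpace 𝓘(ℝ, EP) p) :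
    xiForm Φ s ι (g • p) (Ad g γ) (tmap EP EP (fun y : P => g • y) p Y) = xiForm Φ s ι p γ Y := by
  let f : ∀ (p : P) (_ : GroupLieAlgebra 𝓘(ℝ, EG) G) (_ : TangentSpace 𝓘(ℝ, EP) p), G → ℝ :=
    fun p γ Y g => xiForm Φ s ι (g⁻¹ • p) (Ad g⁻¹ γ) (tmap EP EP (fun y : P => g⁻¹ • y) p Y)
  have hd := fun p γ Y δ => xiForm_inv_smul_derivative hC hΦ hs hι hK p γ δ Y
  -- This cocycle identity moves the derivative at `h` to the derivative at the identity for the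
  -- translated data. Vanishing there for all data gives vanishing everywhere, and connectedness of
  -- `G` gives constancy.
  have htr : ∀ h g : G, f p γ Y g =
      f (h⁻¹ • p) (Ad h⁻¹ γ) (tmap EP EP (fun y : P => h⁻¹ • y) p Y) (h⁻¹ * g) := by
    intro h g
    have e : g⁻¹ = (h⁻¹ * g)⁻¹ * h⁻¹ := by simp
    have e1 : g⁻¹ • p = (h⁻¹ * g)⁻¹ • h⁻¹ • p := by rw [← mul_smul, ← e]
    have e2 : Ad g⁻¹ γ = Ad (h⁻¹ * g)⁻¹ (Ad h⁻¹ γ) := by rw [← Ad_mul, ← e]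
    have e3 : (tmap EP EP (fun y : P => g⁻¹ • y) p Y : EP) =
        tmap EP EP (fun y : P => (h⁻¹ * g)⁻¹ • y) (h⁻¹ • p)
          (tmap EP EP (fun y : P => h⁻¹ • y) p Y) := by
      have e4 : (fun y : P => g⁻¹ • y) = fun y => ((h⁻¹ * g)⁻¹ * h⁻¹) • y := by rw [← e]
      exact (tmap_congr (EventuallyEq.of_eq e4) Y).trans (tmap_smul_mul EG _ _ p Y)
    change xiForm Φ s ι (g⁻¹ • p) (Ad g⁻¹ γ) _ = _
    rw [e2]
    exact (xiForm_congr e1 _ _).trans (congrArg _ e3)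
  have hmul : ∀ h : G, MDifferentiableAt 𝓘(ℝ, EG) 𝓘(ℝ, EG) (fun g : G => h⁻¹ * g) h := fun h =>
    (contMDiff_mul_left (I := 𝓘(ℝ, EG)) (n := ∞) (a := h⁻¹)).mdifferentiableAt (by simp)
  have hf : MDifferentiable 𝓘(ℝ, EG) 𝓘(ℝ, ℝ) (f p γ Y) := by
    intro h
    rw [funext (htr h)]
    have h1 := (hd (h⁻¹ • p) (Ad h⁻¹ γ) (tmap EP EP (fun y : P => h⁻¹ • y) p Y) 0).1
    rw [← inv_mul_cancel h] at h1
    exact h1.comp h (hmul h)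
  have hz : ∀ h v, tmap EG ℝ (f p γ Y) h v = 0 := by
    intro h v
    have h1 := mfderiv_comp_apply_eq (E := EG) (x := h) (y := (1 : G)) (f := fun g : G => h⁻¹ * g)
      (g := f (h⁻¹ • p) (Ad h⁻¹ γ) (tmap EP EP (fun y : P => h⁻¹ • y) p Y)) (by simp)
      (hd _ _ _ 0).1 (hmul h) v
    have h2 : (tmap EG ℝ (f p γ Y) h v : ℝ) = tmap EG ℝ (fun g => f (h⁻¹ • p) (Ad h⁻¹ γ)
        (tmap EP EP (fun y : P => h⁻¹ • y) p Y) (h⁻¹ * g)) h v :=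
      tmap_congr (EventuallyEq.of_eq (funext (htr h))) v
    exact h2.trans (h1.trans (hd _ _ _ _).2)
  have h1 := eq_of_mfderiv_eq_zero hf hz g⁻¹ 1
  have e1 : ∀ g' : G, f p γ Y g'⁻¹ =
      xiForm Φ s ι (g' • p) (Ad g' γ) (tmap EP EP (fun y : P => g' • y) p Y) := by
    intro g'
    change xiForm Φ s ι (g'⁻¹⁻¹ • p) (Ad g'⁻¹⁻¹ γ) (tmap EP EP (fun y : P => g'⁻¹⁻¹ • y) p Y) = _
    rw [inv_inv]
  rw [← e1, h1, ← inv_one, e1, Ad_one]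
  exact (xiForm_congr (one_smul G p) γ _).trans (congrArg _ (tmap_smul_one EG p Y))

end Equivariance

/-! ### The principal connections `θ_ε` defined by the metric and `ξ`. -/

section Extension

variable {EG : Type*} [NormedAddCommGroup EG] [NormedSpace ℝ EG] [FiniteDimensional ℝ EG]
  {G : Type*} [TopologicalSpace G] [ChartedSpace EG G] [Group G] [LieGroup 𝓘(ℝ, EG) ∞ G]
  {𝔞 : Type*} [AddCommGroup 𝔞] [Module ℝ 𝔞]
  {E : Type*} [NormedAddCommGroup E] [NormedSpace ℝ E] [FiniteDimensional ℝ E]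
  {M : Type*} [TopologicalSpace M] [ChartedSpace E M] [IsManifold 𝓘(ℝ, E) ∞ M] [T2Space M]
  [MulAction G M] [ContMDiffSMul 𝓘(ℝ, EG) 𝓘(ℝ, E) ∞ G M]
  {F : Type*} [NormedAddCommGroup F] [NormedSpace ℝ F] [FiniteDimensional ℝ F]
  {𝓔 : M → Type*} [TopologicalSpace (TotalSpace F 𝓔)] [∀ x, AddCommGroup (𝓔 x)]
  [∀ x, Module ℝ (𝓔 x)] [∀ x, TopologicalSpace (𝓔 x)] [FiberBundle F 𝓔] [VectorBundle ℝ F 𝓔]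
  [ContMDiffVectorBundle ∞ F 𝓔 𝓘(ℝ, E)]
  {C : CourantAlgebroid E F 𝓔} {A : ExactCourantAlgebra (GroupLieAlgebra 𝓘(ℝ, EG) G) 𝔞}
  {EP : Type*} [NormedAddCommGroup EP] [NormedSpace ℝ EP] [FiniteDimensional ℝ EP]
  {P : Type*} [TopologicalSpace P] [ChartedSpace EP P] [IsManifold 𝓘(ℝ, EP) ∞ P] [T2Space P]
  [MulAction G P] [ContMDiffSMul 𝓘(ℝ, EG) 𝓘(ℝ, EP) ∞ G P]
  {𝓖 : GeneralizedMetric C} {Φ : ExtendedAction C A} {s : IsotropicSplitting C} {ι : P → M}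

/-- The image under the anchor of a section of the algebroid. -/
def anchorVF (C : CourantAlgebroid E F 𝓔) (e : Cₛ^∞⟮𝓘(ℝ, E); F, 𝓔⟯) : VF E M :=
  ⟨fun x => C.anchor x (e x), C.anchor_smooth e⟩

theorem anchorVF_apply (e : Cₛ^∞⟮𝓘(ℝ, E); F, 𝓔⟯) (x : M) :
    anchorVF C e x = C.anchor x (e x) := rfl

/-- The image of a section under the generalized metric. -/
def opSection (𝓖 : GeneralizedMetric C) (e : Cₛ^∞⟮𝓘(ℝ, E); F, 𝓔⟯) : Cₛ^∞⟮𝓘(ℝ, E); F, 𝓔⟯ :=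
  ⟨fun x => 𝓖.op x (e x), 𝓖.smooth e⟩

theorem lift_apply (X : VF E M) (x : M) : s.lift X x = s.toFun x (X x) := rfl

variable (E ι) in
/-- Near `p`, the field `Y` of tangent vectors of `P` is the restriction of a smooth vector field
on `M`. -/
def ExtendsNear (Y : ∀ p : P, TangentSpace 𝓘(ℝ, EP) p) (p : P) : Prop :=
  ∃ Y' : VF E M, ∀ᶠ p' in 𝓝 p, Y' (ι p') = tmap EP E ι p' (Y p')

theorem contMDiff_tmap_section {ER : Type*} [NormedAddCommGroup ER] [NormedSpace ℝ ER]
    {R : Type*} [TopologicalSpace R] [ChartedSpace ER R] [IsManifold 𝓘(ℝ, ER) ∞ R]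
    {q : P → R} (hq : ContMDiff 𝓘(ℝ, EP) 𝓘(ℝ, ER) ∞ q) (Y : VF EP P) :
    ContMDiff 𝓘(ℝ, EP) (𝓘(ℝ, ER).prod 𝓘(ℝ, ER)) ∞
      (fun p => (⟨q p, tmap EP ER q p (Y p)⟩ : TangentBundle 𝓘(ℝ, ER) R)) :=
  ContMDiff.comp (g := tangentMap 𝓘(ℝ, EP) 𝓘(ℝ, ER) q)
    (hq.contMDiff_tangentMap (m := ∞) (by simp)) Y.contMDiff

theorem extendsNear_VF (hι : IsLeaf EP Φ ι) (Y : VF EP P) (p : P) :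
    ExtendsNear E ι (fun p => Y p) p :=
  exists_section_extending (V := fun x : M => TangentSpace 𝓘(ℝ, E) x) hι.immersion
    (k := fun p => tmap EP E ι p (Y p)) (Eventually.of_forall fun _ =>
      (contMDiff_tmap_section hι.immersion.contMDiff Y).contMDiffAt)

theorem extendsNear_infGen (hι : IsLeaf EP Φ ι) (γ : GroupLieAlgebra 𝓘(ℝ, EG) G) (p : P) :
    ExtendsNear E ι (fun p => (infGen γ p : TangentSpace 𝓘(ℝ, EP) p)) p := by
  refine ⟨anchorVF C (Φ.Ψ (A.splitting γ)), Eventually.of_forall fun p' => ?_⟩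
  rw [anchorVF_apply, anchor_Ψ_leaf hι, ExactCourantAlgebra.proj_splitting]

theorem IsLeaf.contMDiffAt_comp (hι : IsLeaf EP Φ ι) {f : M → ℝ}
    (hf : ContMDiff 𝓘(ℝ, E) 𝓘(ℝ, ℝ) ∞ f) (p : P) :
    ContMDiffAt 𝓘(ℝ, EP) 𝓘(ℝ, ℝ) ∞ (fun p => f (ι p)) p :=
  (hf.comp hι.immersion.contMDiff).contMDiffAt

theorem contMDiffAt_xiForm (hι : IsLeaf EP Φ ι) (γ : GroupLieAlgebra 𝓘(ℝ, EG) G)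
    {Y : ∀ p : P, TangentSpace 𝓘(ℝ, EP) p} {p : P} (hY : ExtendsNear E ι Y p) :
    ContMDiffAt 𝓘(ℝ, EP) 𝓘(ℝ, ℝ) ∞ (fun p => xiForm Φ s ι p γ (Y p)) p := by
  obtain ⟨Y', hY'⟩ := hY
  have h1 := hι.contMDiffAt_comp
    (C.pairing_smooth (Φ.Ψ (A.splitting γ)) (s.lift Y')) p
  refine (contMDiffAt_const (c := (2 : ℝ)) |>.mul h1).congr_of_eventuallyEq ?_
  filter_upwards [hY'] with p' hp'
  change _ = 2 * C.pairing (ι p') _ (s.toFun (ι p') (Y' (ι p')))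
  rw [hp']; rfl

theorem contMDiffAt_inducedMetric (hι : IsLeaf EP Φ ι)
    {Y Z : ∀ p : P, TangentSpace 𝓘(ℝ, EP) p} {p : P} (hY : ExtendsNear E ι Y p)
    (hZ : ExtendsNear E ι Z p) :
    ContMDiffAt 𝓘(ℝ, EP) 𝓘(ℝ, ℝ) ∞ (fun p => inducedMetric 𝓖 s (ι p) (tmap EP E ι p (Y p))
      (tmap EP E ι p (Z p))) p := by
  obtain ⟨Y', hY'⟩ := hY
  obtain ⟨Z', hZ'⟩ := hZ
  have h1 := hι.contMDiffAt_comp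
    (C.pairing_smooth (opSection 𝓖 (s.lift Y')) (s.lift Z')) p
  refine (contMDiffAt_const (c := (2 : ℝ)) |>.mul h1).congr_of_eventuallyEq ?_
  filter_upwards [hY', hZ'] with p' hp' hp
  change _ = 2 * C.pairing (ι p') (𝓖.op (ι p') (s.toFun (ι p') (Y' (ι p'))))
    (s.toFun (ι p') (Z' (ι p')))
  rw [hp', hp, inducedMetric_eq]

/-! #### The connections of the metric splitting -/

variable (𝓖 Φ s ι) in
/-- The pairing `(Y, γ) ↦ g(Y, X_γ) + ε ξ_γ(Y)`. -/
def connPairing (ε : ℝ) (p : P) :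
    TangentSpace 𝓘(ℝ, EP) p →ₗ[ℝ] Module.Dual ℝ (GroupLieAlgebra 𝓘(ℝ, EG) G) :=
  (inducedMetricForm 𝓖 s (ι p)).compl₁₂ (tmap EP E ι p)
    ((tmap EP E ι p).comp (infGenMap EG G EP p)) + ε • (xiForm Φ s ι p).flip

theorem connPairing_apply (ε : ℝ) (p : P) (Y : TangentSpace 𝓘(ℝ, EP) p)
    (γ : GroupLieAlgebra 𝓘(ℝ, EG) G) :
    connPairing 𝓖 Φ s ι ε p Y γ =
      inducedMetric 𝓖 s (ι p) (tmap EP E ι p Y) (tmap EP E ι p (infGen γ p))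
        + ε * xiForm Φ s ι p γ Y := by
  rw [← inducedMetricForm_apply]; rfl

/-- On the diagonal the antisymmetric term `ξ_γ(X_γ)` drops out and `g(X_γ, X_γ) > 0` is left for `γ
≠ 0`, as the action is infinitesimally free. Hence the kernel of the pairing is a complement of the
vertical directions, for every `ε`. -/
theorem connPairing_bijective [IsCancelSMul G P] (hC : C.IsExact) (hι : IsLeaf EP Φ ι)
    (hK : IsotropicOver Φ ι) (ε : ℝ) (p : P) :
    Function.Bijective ((connPairing 𝓖 Φ s ι ε p).comp (infGenMap EG G EP p)) := by
  have hinj : Function.Injective ((connPairing 𝓖 Φ s ι ε p).comp (infGenMap EG G EP p)) := by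
    rw [injective_iff_map_eq_zero]
    intro γ hγ
    have h1 : connPairing (EP := EP) 𝓖 Φ s ι ε p (infGen γ p) γ = 0 := LinearMap.congr_fun hγ γ
    have h2 := xiForm_infGen (s := s) hC hι hK p γ γ
    have h3 : xiForm (EP := EP) Φ s ι p γ (infGen γ p) = 0 := by linarith
    rw [connPairing_apply, h3, mul_zero, add_zero] at h1
    by_contra hne
    have h4 : tmap EP E ι p (infGen γ p) ≠ 0 := fun h0 =>
      hne (infGen_eq_zero ((hι.tmap_injective p) (h0.trans (map_zero _).symm)))
    exact (inducedMetric_pos (𝓖 := 𝓖) (s := s) h4).ne' h1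
  exact ⟨hinj, (LinearMap.injective_iff_surjective_of_finrank_eq_finrank
    (Subspace.dual_finrank_eq (K := ℝ) (V := GroupLieAlgebra 𝓘(ℝ, EG) G)).symm).1 hinj⟩

variable (𝓖 s) in
/-- The form whose kernel at `p` consists of the `Y` with `g(Y, X_γ) = -ε ξ_γ(Y)` for all `γ`. -/
def connForm [IsCancelSMul G P] (hC : C.IsExact) (hι : IsLeaf EP Φ ι)
    (hK : IsotropicOver Φ ι) (ε : ℝ) (p : P) :
    TangentSpace 𝓘(ℝ, EP) p →ₗ[ℝ] GroupLieAlgebra 𝓘(ℝ, EG) G :=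
  (LinearEquiv.ofBijective _ (connPairing_bijective (𝓖 := 𝓖) (s := s) hC hι hK ε p)).symm.toLinearMap
    ∘ₗ connPairing 𝓖 Φ s ι ε p

theorem connPairing_infGen_connForm [IsCancelSMul G P] (hC : C.IsExact) (hι : IsLeaf EP Φ ι)
    (hK : IsotropicOver Φ ι) (ε : ℝ) (p : P) (Y : TangentSpace 𝓘(ℝ, EP) p) :
    connPairing (EP := EP) 𝓖 Φ s ι ε p (infGen (connForm 𝓖 s hC hι hK ε p Y) p) =
      connPairing 𝓖 Φ s ι ε p Y :=
  LinearEquiv.apply_symm_apply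
    (LinearEquiv.ofBijective _ (connPairing_bijective (𝓖 := 𝓖) (s := s) hC hι hK ε p)) _

theorem connForm_eq [IsCancelSMul G P] (hC : C.IsExact) (hι : IsLeaf EP Φ ι)
    (hK : IsotropicOver Φ ι) {ε : ℝ} {p : P} {Y : TangentSpace 𝓘(ℝ, EP) p}
    {γ : GroupLieAlgebra 𝓘(ℝ, EG) G}
    (h : connPairing (EP := EP) 𝓖 Φ s ι ε p (infGen γ p) = connPairing 𝓖 Φ s ι ε p Y) :
    connForm 𝓖 s hC hι hK ε p Y = γ :=
  (connPairing_bijective (𝓖 := 𝓖) (s := s) hC hι hK ε p).1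
    ((connPairing_infGen_connForm hC hι hK ε p Y).trans h.symm)

theorem connForm_eq_zero_iff [IsCancelSMul G P] (hC : C.IsExact) (hι : IsLeaf EP Φ ι)
    (hK : IsotropicOver Φ ι) {ε : ℝ} {p : P} {Y : TangentSpace 𝓘(ℝ, EP) p} :
    connForm 𝓖 s hC hι hK ε p Y = 0 ↔ connPairing 𝓖 Φ s ι ε p Y = 0 := by
  constructor
  · intro h
    have h1 := connPairing_infGen_connForm (𝓖 := 𝓖) (s := s) hC hι hK ε p Y
    rw [h, ← infGenMap_apply, map_zero, map_zero] at h1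
    exact h1.symm
  · intro h
    apply connForm_eq
    rw [h, ← infGenMap_apply, map_zero, map_zero]

theorem contMDiffAt_connPairing (hι : IsLeaf EP Φ ι) (ε : ℝ) (γ : GroupLieAlgebra 𝓘(ℝ, EG) G)
    {Y : ∀ p : P, TangentSpace 𝓘(ℝ, EP) p} {p : P} (hY : ExtendsNear E ι Y p) :
    ContMDiffAt 𝓘(ℝ, EP) 𝓘(ℝ, ℝ) ∞ (fun p => connPairing 𝓖 Φ s ι ε p (Y p) γ) p := by
  simp only [connPairing_apply]
  exact (contMDiffAt_inducedMetric hι hY (extendsNear_infGen hι γ p)).add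
    (contMDiffAt_const.mul (contMDiffAt_xiForm hι γ hY))

/-- The form solves a linear equation with smooth coefficients that is invertible at every point. -/
theorem contMDiffAt_connForm [IsCancelSMul G P] (hC : C.IsExact) (hι : IsLeaf EP Φ ι)
    (hK : IsotropicOver Φ ι) (ε : ℝ)
    {Y : ∀ p : P, TangentSpace 𝓘(ℝ, EP) p} {p : P} (hY : ExtendsNear E ι Y p) :
    ContMDiffAt (M' := EG) 𝓘(ℝ, EP) 𝓘(ℝ, EG) ∞
      (fun p => connForm 𝓖 s hC hι hK ε p (Y p)) p := by
  let b : Module.Basis _ ℝ (GroupLieAlgebra 𝓘(ℝ, EG) G) := Module.finBasis ℝ _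
  -- Coordinates on the dual make the target a normed space, as the lemma on smooth linear equations
  -- requires.
  let ev : Module.Dual ℝ (GroupLieAlgebra 𝓘(ℝ, EG) G) ≃ₗ[ℝ] (Fin _ → ℝ) := b.dualBasis.equivFun
  have hev : ∀ η i, ev η i = η (b i) := fun η i => by
    simp [ev, Module.Basis.dualBasis_equivFun]
  let L : P → EG →L[ℝ] (Fin _ → ℝ) := fun p => LinearMap.toContinuousLinearMap (𝕜 := ℝ) (E := EG)
    (ev.toLinearMap ∘ₗ (connPairing 𝓖 Φ s ι ε p).comp (infGenMap EG G EP p))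
  refine contMDiffAt_of_clm_apply_eq (L := L)
    (w := fun p => ev (connPairing 𝓖 Φ s ι ε p (Y p))) ?_ ?_ ?_ (Eventually.of_forall fun p' => ?_)
  · refine contMDiffAt_of_clm_apply fun γ => contMDiffAt_pi_space.2 fun i => ?_
    have h := contMDiffAt_connPairing (𝓖 := 𝓖) (s := s) hι ε (b i) (extendsNear_infGen hι γ p)
    refine h.congr_of_eventuallyEq (Eventually.of_forall fun p' => ?_)
    exact hev _ i
  · exact ev.bijective.comp (connPairing_bijective hC hι hK ε p)
  · refine contMDiffAt_pi_space.2 fun i => ?_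
    simp only [hev]
    exact contMDiffAt_connPairing hι ε (b i) hY
  · exact congrArg ev (connPairing_infGen_connForm hC hι hK ε p' (Y p'))

theorem connPairing_smul [ConnectedSpace G] [IsCancelSMul G P] (hC : C.IsExact)
    (hΦ : Φ.Preserves 𝓖) (hs : s.IsMetric 𝓖) (hι : IsLeaf EP Φ ι) (hK : IsotropicOver Φ ι)
    (ε : ℝ) (g : G) (p : P) (Y : TangentSpace 𝓘(ℝ, EP) p) (γ : GroupLieAlgebra 𝓘(ℝ, EG) G) :
    connPairing 𝓖 Φ s ι ε (g • p) (tmap EP EP (fun y : P => g • y) p Y) (Ad g γ) =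
      connPairing 𝓖 Φ s ι ε p Y γ := by
  rw [connPairing_apply, connPairing_apply, xiForm_smul hC hΦ hs hι hK, ← tmap_smul_infGen,
    inducedMetric_leaf_smul hΦ hs hι]

theorem connForm_smul [ConnectedSpace G] [IsCancelSMul G P] (hC : C.IsExact)
    (hΦ : Φ.Preserves 𝓖) (hs : s.IsMetric 𝓖) (hι : IsLeaf EP Φ ι) (hK : IsotropicOver Φ ι)
    (ε : ℝ) (g : G) (p : P) (Y : TangentSpace 𝓘(ℝ, EP) p) :
    connForm 𝓖 s hC hι hK ε (g • p) (tmap EP EP (fun y : P => g • y) p Y) =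
      Ad g (connForm 𝓖 s hC hι hK ε p Y) := by
  apply connForm_eq
  ext γ
  -- Writing the test element as `Ad g` of something brings both sides into the range of the
  -- equivariance of the pairing.
  rw [← Ad_Ad_inv g γ, ← tmap_smul_infGen, connPairing_smul hC hΦ hs hι hK,
    connPairing_smul hC hΦ hs hι hK, connPairing_infGen_connForm]

variable (s) in
/-- The principal connection with horizontal distribution `{Y : g(Y, X_γ) = -ε ξ_γ(Y)}`. -/
def metricConnection [ConnectedSpace G] [IsCancelSMul G P] (hC : C.IsExact)
    (hΦ : Φ.Preserves 𝓖) (hs : s.IsMetric 𝓖) (hι : IsLeaf EP Φ ι) (hK : IsotropicOver Φ ι)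
    (ε : ℝ) : PrincipalConnection EG G EP P where
  toFun := connForm 𝓖 s hC hι hK ε
  smooth Y p := contMDiffAt_connForm hC hι hK ε (extendsNear_VF hι Y p)
  vertical _ _ := connForm_eq hC hι hK rfl
  equivariant := connForm_smul hC hΦ hs hι hK ε

theorem mem_tauPlus_iff {p : P} {Y : TangentSpace 𝓘(ℝ, EP) p} :
    Y ∈ tauPlus 𝓖 Φ s ι p ↔ connPairing 𝓖 Φ s ι 1 p Y = 0 := by
  constructor
  · intro h
    ext γ
    rw [connPairing_apply, h γ, xiForm_apply, one_mul, neg_add_cancel]; rfl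
  · intro h γ
    have h1 := LinearMap.congr_fun h γ
    rw [connPairing_apply, xiForm_apply, one_mul] at h1
    exact eq_neg_of_add_eq_zero_left h1

/-- Subtracting from `Y` its vertical part with respect to `θ'` gives an element of the common
kernel. Applying `θ` to it gives `θ Y = θ' Y`. -/
theorem PrincipalConnection.ext_ker {θ θ' : PrincipalConnection EG G EP P}
    (h : ∀ p, {Y | θ.toFun p Y = 0} = {Y | θ'.toFun p Y = 0}) : θ = θ' := by
  have h1 : θ.toFun = θ'.toFun := by
    funext p
    ext Y
    have h2 : Y - infGen (θ'.toFun p Y) p ∈ {Y | θ'.toFun p Y = 0} := by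
      rw [mem_ofPred_eq, map_sub, θ'.vertical, sub_self]
    rw [← h p, mem_ofPred_eq, map_sub, θ.vertical, sub_eq_zero] at h2
    exact h2
  cases θ; cases θ'
  congr

/-- There is a unique principal connection with horizontal distribution `τ_+`. -/
theorem existsUnique_connection [ConnectedSpace G] [IsCancelSMul G P] (hC : C.IsExact)
    (hΦ : Φ.Preserves 𝓖) (hs : s.IsMetric 𝓖) (hι : IsLeaf EP Φ ι) (hK : IsotropicOver Φ ι) :
    ∃! θ : PrincipalConnection EG G EP P,
      ∀ p, {Y | θ.toFun p Y = 0} = tauPlus 𝓖 Φ s ι p := by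
  refine ⟨metricConnection s hC hΦ hs hι hK 1, fun p => ?_, fun θ hθ => ?_⟩
  · ext Y
    rw [mem_tauPlus_iff]
    exact connForm_eq_zero_iff hC hι hK
  · apply PrincipalConnection.ext_ker
    intro p
    rw [hθ p]
    ext Y
    rw [mem_tauPlus_iff]
    exact (connForm_eq_zero_iff hC hι hK).symm

end Extension

/-! ### The reduced metric on representatives. -/

section ReducedLinearAlgebra

variable {V T : Type*} [AddCommGroup V] [Module ℝ V] [AddCommGroup T] [Module ℝ T]

theorem redClass_eq_iff {b : LinearMap.BilinForm ℝ V} {K : Submodule ℝ V} {u v : V}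
    (hu : u ∈ b.orthogonal K) (hv : v ∈ b.orthogonal K) :
    redClass b K u hu = redClass b K v hv ↔ u - v ∈ K :=
  Submodule.Quotient.eq _

/-- Such a `v` lies in `K^⊥ ∩ A K^⊥`, so it is the representative through which the reduced operator
is defined. -/
theorem redMetricOp_redClass [FiniteDimensional ℝ V] {b : LinearMap.BilinForm ℝ V} {A : V →ₗ[ℝ] V}
    (hA : IsGenMetric b A) {K : Submodule ℝ V} (hK : K ≤ b.orthogonal K) {v : V}
    (hv : v ∈ b.orthogonal K) (hAv : A v ∈ b.orthogonal K) :
    redMetricOp hA hK (redClass b K v hv) = redClass b K (A v) hAv := by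
  let e := LinearEquiv.ofBijective (metricPerpProj b A K) (metricPerpProj_bijective hA hK)
  have hv' : v ∈ metricPerp b A K := (mem_metricPerp hA).2 ⟨hv, hAv⟩
  have h1 : e.symm (redClass b K v hv) = ⟨v, hv'⟩ := by
    rw [LinearEquiv.symm_apply_eq]; rfl
  have hm : ∀ w ∈ metricPerp b A K, A w ∈ metricPerp b A K := fun w hw => by
    rw [mem_metricPerp hA] at hw ⊢
    exact ⟨hw.2, by rw [hA.sq]; exact hw.1⟩
  change e (A.restrict hm (e.symm (redClass b K v hv))) = _
  rw [h1]
  rfl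

theorem exists_redClass_eq [FiniteDimensional ℝ V] {b : LinearMap.BilinForm ℝ V} {A : V →ₗ[ℝ] V}
    (hA : IsGenMetric b A) {K : Submodule ℝ V} (hK : K ≤ b.orthogonal K) (z : RedSpace b K) :
    ∃ (v : V) (hv : v ∈ b.orthogonal K) (_ : A v ∈ b.orthogonal K), redClass b K v hv = z := by
  obtain ⟨⟨v, hv⟩, hz⟩ := (metricPerpProj_bijective hA hK).2 z
  exact ⟨v, ((mem_metricPerp hA).1 hv).1, ((mem_metricPerp hA).1 hv).2, hz⟩

theorem redMetricOp_redMetricOp [FiniteDimensional ℝ V] {b : LinearMap.BilinForm ℝ V}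
    {A : V →ₗ[ℝ] V} (hA : IsGenMetric b A) {K : Submodule ℝ V} (hK : K ≤ b.orthogonal K)
    (z : RedSpace b K) : redMetricOp hA hK (redMetricOp hA hK z) = z := by
  obtain ⟨v, hv, hAv, rfl⟩ := exists_redClass_eq hA hK z
  have hAAv : A (A v) ∈ b.orthogonal K := by rw [hA.sq]; exact hv
  rw [redMetricOp_redClass hA hK hv hAv, redMetricOp_redClass hA hK hAv hAAv]
  congr 1
  exact hA.sq v

/-- A right inverse of the anchor is determined by its image. -/
theorem IsMetricSplitting.unique {a : V →ₗ[ℝ] T} {A : V →ₗ[ℝ] V} {s s' : T →ₗ[ℝ] V}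
    (h : IsMetricSplitting a A s) (h' : IsMetricSplitting a A s') : s = s' := by
  ext X
  have h1 : s X ∈ LinearMap.range s' := by
    rw [h'.2, ← h.2]; exact LinearMap.mem_range_self _ X
  obtain ⟨X', hX'⟩ := h1
  have h2 := congrArg a hX'
  rw [h.1, h'.1] at h2
  rw [← hX', h2]

end ReducedLinearAlgebra

/-! ### Horizontal lifts from the orbit space. -/

section HorizontalLift

variable {EG : Type*} [NormedAddCommGroup EG] [NormedSpace ℝ EG] [FiniteDimensional ℝ EG]
  {G : Type*} [TopologicalSpace G] [ChartedSpace EG G] [Group G] [LieGroup 𝓘(ℝ, EG) ∞ G]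
  {EP : Type*} [NormedAddCommGroup EP] [NormedSpace ℝ EP] [FiniteDimensional ℝ EP]
  {P : Type*} [TopologicalSpace P] [ChartedSpace EP P] [IsManifold 𝓘(ℝ, EP) ∞ P] [T2Space P]
  [MulAction G P] [ContMDiffSMul 𝓘(ℝ, EG) 𝓘(ℝ, EP) ∞ G P] [IsCancelSMul G P] [ProperSMul G P]
  {ER : Type*} [NormedAddCommGroup ER] [NormedSpace ℝ ER] [FiniteDimensional ℝ ER]
  {R : Type*} [TopologicalSpace R] [ChartedSpace ER R] [IsManifold 𝓘(ℝ, ER) ∞ R]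
  {q : P → R}

theorem tmap_orbit_infGen (hq : IsOrbitProjection G EP ER q)
    (γ : GroupLieAlgebra 𝓘(ℝ, EG) G) (p : P) : tmap EP ER q p (infGen γ p) = 0 :=
  tmap_infGen_eq_zero (hq.submersion.contMDiff.mdifferentiableAt (by simp))
    (fun g x => ((hq.fibres x (g • x)).2 ⟨g, rfl⟩).symm) γ

theorem tmap_orbit_smul (hq : IsOrbitProjection G EP ER q) (EG : Type*) [NormedAddCommGroup EG]
    [NormedSpace ℝ EG] [ChartedSpace EG G] [ContMDiffSMul 𝓘(ℝ, EG) 𝓘(ℝ, EP) ∞ G P] (g : G) (p : P)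
    (Y : TangentSpace 𝓘(ℝ, EP) p) :
    (tmap EP ER q (g • p) (tmap EP EP (fun y : P => g • y) p Y) : ER) = tmap EP ER q p Y := by
  have h1 := tmap_comp (g := q) (f := fun y : P => g • y)
    (hq.submersion.contMDiff.mdifferentiableAt (by simp))
    (mdifferentiableAt_smul_right EG g p) Y
  have h2 : (fun y : P => q (g • y)) = q :=
    funext fun y => ((hq.fibres y (g • y)).2 ⟨g, rfl⟩).symm
  exact h1.symm.trans (tmap_congr (EventuallyEq.of_eq h2) Y)

/-- The kernel of `dq` consists of generators, on which the connection is injective. For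
surjectivity, a lift of `X` is corrected by a generator. -/
theorem prod_tmap_connection_bijective (hq : IsOrbitProjection G EP ER q)
    (θ : PrincipalConnection EG G EP P) (p : P) :
    Function.Bijective ((tmap EP ER q p).prod (θ.toFun p)) := by
  constructor
  · rw [injective_iff_map_eq_zero]
    intro Y hY
    have h1 : tmap EP ER q p Y = 0 := congrArg Prod.fst hY
    have h2 : θ.toFun p Y = 0 := congrArg Prod.snd hY
    obtain ⟨γ, rfl⟩ := exists_infGen_eq_of_tmap_eq_zero (EG := EG) hq h1
    rw [θ.vertical] at h2
    rw [h2, ← infGenMap_apply, map_zero]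
  · rintro ⟨X, γ⟩
    obtain ⟨Y, rfl⟩ := tmap_surjective_of_isSubmersion hq.submersion p X
    refine ⟨Y + infGen (γ - θ.toFun p Y) p, Prod.ext ?_ ?_⟩
    · change tmap EP ER q p (Y + infGen (γ - θ.toFun p Y) p) = _
      rw [map_add, tmap_orbit_infGen hq, add_zero]
    · change θ.toFun p (Y + infGen (γ - θ.toFun p Y) p) = _
      rw [map_add, θ.vertical, add_sub_cancel]

/-- The horizontal lift of tangent vectors of the orbit space. -/
def hlift (hq : IsOrbitProjection G EP ER q) (θ : PrincipalConnection EG G EP P) (p : P) :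
    TangentSpace 𝓘(ℝ, ER) (q p) →ₗ[ℝ] TangentSpace 𝓘(ℝ, EP) p :=
  (LinearEquiv.ofBijective _ (prod_tmap_connection_bijective hq θ p)).symm.toLinearMap ∘ₗ
    LinearMap.inl ℝ _ _

theorem prod_hlift (hq : IsOrbitProjection G EP ER q) (θ : PrincipalConnection EG G EP P) (p : P)
    (X : TangentSpace 𝓘(ℝ, ER) (q p)) :
    (tmap EP ER q p).prod (θ.toFun p) (hlift hq θ p X) = (X, 0) :=
  LinearEquiv.apply_symm_apply
    (LinearEquiv.ofBijective _ (prod_tmap_connection_bijective hq θ p)) _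

theorem tmap_hlift (hq : IsOrbitProjection G EP ER q) (θ : PrincipalConnection EG G EP P) (p : P)
    (X : TangentSpace 𝓘(ℝ, ER) (q p)) : tmap EP ER q p (hlift hq θ p X) = X :=
  congrArg Prod.fst (prod_hlift hq θ p X)

theorem connection_hlift (hq : IsOrbitProjection G EP ER q) (θ : PrincipalConnection EG G EP P)
    (p : P) (X : TangentSpace 𝓘(ℝ, ER) (q p)) : θ.toFun p (hlift hq θ p X) = 0 :=
  congrArg Prod.snd (prod_hlift hq θ p X)

theorem hlift_eq (hq : IsOrbitProjection G EP ER q) (θ : PrincipalConnection EG G EP P) {p : P}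
    {X : TangentSpace 𝓘(ℝ, ER) (q p)} {Y : TangentSpace 𝓘(ℝ, EP) p}
    (hX : tmap EP ER q p Y = X) (hθ : θ.toFun p Y = 0) : hlift hq θ p X = Y :=
  (prod_tmap_connection_bijective hq θ p).1 ((prod_hlift hq θ p X).trans (Prod.ext hX.symm hθ.symm))

theorem Ad_zero (g : G) : Ad g (0 : GroupLieAlgebra 𝓘(ℝ, EG) G) = 0 :=
  map_zero (mfderiv 𝓘(ℝ, EG) 𝓘(ℝ, EG) (fun h : G => g * h * g⁻¹) 1 : EG →L[ℝ] EG)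

theorem tmap_smul_hlift (hq : IsOrbitProjection G EP ER q) (θ : PrincipalConnection EG G EP P)
    (X : VF ER R) (g : G) (p : P) :
    tmap EP EP (fun y : P => g • y) p (hlift hq θ p (X (q p))) =
      hlift hq θ (g • p) (X (q (g • p))) := by
  refine (hlift_eq hq θ ?_ ?_).symm
  · have h1 := tmap_orbit_smul hq EG g p (hlift hq θ p (X (q p)))
    have h2 : q (g • p) = q p := ((hq.fibres p (g • p)).2 ⟨g, rfl⟩).symm
    have h3 : (X (q (g • p)) : ER) = X (q p) := congrArg (fun r => (X r : ER)) h2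
    exact h1.trans ((tmap_hlift hq θ p _).trans h3.symm)
  · rw [θ.equivariant, connection_hlift, Ad_zero]

theorem contMDiff_hlift (hq : IsOrbitProjection G EP ER q) (θ : PrincipalConnection EG G EP P)
    (X : VF ER R) :
    ContMDiff 𝓘(ℝ, EP) (𝓘(ℝ, EP).prod 𝓘(ℝ, EP)) ∞
      (fun p => (⟨p, hlift hq θ p (X (q p))⟩ : TangentBundle 𝓘(ℝ, EP) P)) := by
  intro p
  let t := trivializationAt ER (fun r : R => TangentSpace 𝓘(ℝ, ER) r) (q p)
  have hqp : q p ∈ t.baseSet := FiberBundle.mem_baseSet_trivializationAt' (q p)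
  have hqc : ContinuousAt q p := hq.submersion.contMDiff.continuous.continuousAt
  have hbase : ∀ᶠ p' in 𝓝 p, q p' ∈ t.baseSet := hqc.eventually (t.open_baseSet.mem_nhds hqp)
  -- A trivialization of the tangent bundle of the orbit space turns `(dq, θ)` into a smooth family
  -- of isomorphisms onto a fixed space. The horizontal lift solves a linear equation for it with
  -- smooth right-hand side.
  let A : ∀ p' : P, TangentSpace 𝓘(ℝ, EP) p' →ₗ[ℝ] ER × EG := fun p' =>
    ((t.continuousLinearMapAt ℝ (q p')).toLinearMap.comp (tmap EP ER q p')).prod (θ.toFun p')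
  have hA : ∀ {p'} (_ : q p' ∈ t.baseSet) (Y : TangentSpace 𝓘(ℝ, EP) p'),
      A p' Y = ((t ⟨q p', tmap EP ER q p' Y⟩).2, θ.toFun p' Y) := by
    intro p' h Y
    exact Prod.ext (t.continuousLinearMapAt_apply_of_mem (R := ℝ) h _) rfl
  have hsm : ∀ {Z : ∀ p' : P, TangentSpace 𝓘(ℝ, ER) (q p')}
      (_ : ContMDiffAt 𝓘(ℝ, EP) (𝓘(ℝ, ER).prod 𝓘(ℝ, ER)) ∞
        (fun p' => (⟨q p', Z p'⟩ : TangentBundle 𝓘(ℝ, ER) R)) p),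
      ContMDiffAt 𝓘(ℝ, EP) 𝓘(ℝ, ER) ∞ (fun p' => (t ⟨q p', Z p'⟩).2) p := fun hZ =>
    ((t.contMDiffAt_iff (t.mem_source.2 hqp)).1 hZ).2
  refine contMDiffAt_section_of_bijective (V := fun p : P => TangentSpace 𝓘(ℝ, EP) p)
    (A := A) (fun Y => ?_) ?_ ?_
  · refine ContMDiffAt.congr_of_eventuallyEq (f := fun p' =>
      (((t ⟨q p', tmap EP ER q p' (Y p')⟩).2, θ.toFun p' (Y p')) : ER × EG)) ?_ ?_
    · exact (hsm (contMDiff_tmap_section hq.submersion.contMDiff Y).contMDiffAt).prodMk_space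
        (θ.smooth Y).contMDiffAt
    · filter_upwards [hbase] with p' hp'
      exact hA hp' _
  · have h1 := prod_tmap_connection_bijective hq θ p
    have h2 : Function.Bijective (t.continuousLinearMapAt ℝ (q p)) :=
      Function.bijective_iff_has_inverse.2 ⟨t.symmL ℝ (q p),
        fun v => t.symmL_continuousLinearMapAt hqp v,
        fun v => t.continuousLinearMapAt_symmL hqp v⟩
    exact (Function.Bijective.prodMap h2 Function.bijective_id).comp h1
  · refine ContMDiffAt.congr_of_eventuallyEq (f := fun p' =>
      (((t ⟨q p', X (q p')⟩).2, 0) : ER × EG)) ?_ ?_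
    · exact (hsm ((X.contMDiff.comp hq.submersion.contMDiff).contMDiffAt)).prodMk_space
        contMDiffAt_const
    · filter_upwards [hbase] with p' hp'
      rw [hA hp', tmap_hlift, connection_hlift]
      rfl

/-- The horizontal lift of a vector field. -/
def hliftVF (hq : IsOrbitProjection G EP ER q) (θ : PrincipalConnection EG G EP P)
    (X : VF ER R) : VF EP P :=
  ⟨fun p => hlift hq θ p (X (q p)), contMDiff_hlift hq θ X⟩

end HorizontalLift

section Reduction

variable {EG : Type*} [NormedAddCommGroup EG] [NormedSpace ℝ EG] [FiniteDimensional ℝ EG]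
  {G : Type*} [TopologicalSpace G] [ChartedSpace EG G] [Group G] [LieGroup 𝓘(ℝ, EG) ∞ G]
  {𝔞 : Type*} [AddCommGroup 𝔞] [Module ℝ 𝔞]
  {E : Type*} [NormedAddCommGroup E] [NormedSpace ℝ E] [FiniteDimensional ℝ E]
  {M : Type*} [TopologicalSpace M] [ChartedSpace E M] [IsManifold 𝓘(ℝ, E) ∞ M] [T2Space M]
  [MulAction G M] [ContMDiffSMul 𝓘(ℝ, EG) 𝓘(ℝ, E) ∞ G M]
  {F : Type*} [NormedAddCommGroup F] [NormedSpace ℝ F] [FiniteDimensional ℝ F]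
  {𝓔 : M → Type*} [TopologicalSpace (TotalSpace F 𝓔)] [∀ x, AddCommGroup (𝓔 x)]
  [∀ x, Module ℝ (𝓔 x)] [∀ x, TopologicalSpace (𝓔 x)] [FiberBundle F 𝓔] [VectorBundle ℝ F 𝓔]
  [ContMDiffVectorBundle ∞ F 𝓔 𝓘(ℝ, E)]
  {C : CourantAlgebroid E F 𝓔} {A : ExactCourantAlgebra (GroupLieAlgebra 𝓘(ℝ, EG) G) 𝔞}
  {EP : Type*} [NormedAddCommGroup EP] [NormedSpace ℝ EP] [FiniteDimensional ℝ EP]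
  {P : Type*} [TopologicalSpace P] [ChartedSpace EP P] [IsManifold 𝓘(ℝ, EP) ∞ P] [T2Space P]
  [MulAction G P] [ContMDiffSMul 𝓘(ℝ, EG) 𝓘(ℝ, EP) ∞ G P]
  {𝓖 : GeneralizedMetric C} {Φ : ExtendedAction C A} {s : IsotropicSplitting C} {ι : P → M}

/-! ### Existence and uniqueness of the reduced metric splitting. -/

section MetricSplitting

variable {ER : Type*} [NormedAddCommGroup ER] [NormedSpace ℝ ER] [FiniteDimensional ℝ ER]
  {R : Type*} [TopologicalSpace R] [ChartedSpace ER R] [IsManifold 𝓘(ℝ, ER) ∞ R] [T2Space R]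
  {q : P → R}

theorem redAnchor_redClass (hι : IsLeaf EP Φ ι) (hq : IsOrbitProjection G EP ER q) {p : P}
    {v : 𝓔 (ι p)} (hv : v ∈ Φ.Kperp (ι p)) {Y : TangentSpace 𝓘(ℝ, EP) p}
    (hY : C.anchor (ι p) v = tmap EP E ι p Y) :
    redAnchor hι hq p (redClass (C.pairing (ι p)) (Φ.K (ι p)) v hv) = tmap EP ER q p Y := by
  change tmap EP ER q p ((tmap EP E ι p).leftInverse (C.anchor (ι p) v)) = _
  rw [hY, LinearMap.leftInverse_apply_of_inj (LinearMap.ker_eq_bot.2 (hι.tmap_injective p))]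

/-- The two conditions differ by the factor `ε`, and `ε² = 1`. -/
theorem eigenLift_mem_Kperp_iff_connPairing (hC : C.IsExact) (hι : IsLeaf EP Φ ι)
    (hK : IsotropicOver Φ ι) (hs : s.IsMetric 𝓖) {ε : ℝ} (hε : ε * ε = 1) {p : P}
    (Y : TangentSpace 𝓘(ℝ, EP) p) :
    eigenLift 𝓖 s ε (ι p) (tmap EP E ι p Y) ∈ Φ.Kperp (ι p) ↔
      connPairing 𝓖 Φ s ι ε p Y = 0 := by
  rw [eigenLift_mem_Kperp_iff hC hι hK hs]
  constructor
  · intro h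
    ext γ
    have h1 := h γ
    rw [connPairing_apply, LinearMap.zero_apply]
    linear_combination ε * h1 - (inducedMetric 𝓖 s (ι p) (tmap EP E ι p Y)
      (tmap EP E ι p (infGen γ p))) * hε
  · intro h γ
    have h1 := LinearMap.congr_fun h γ
    rw [connPairing_apply, LinearMap.zero_apply] at h1
    linear_combination ε * h1 - (xiForm Φ s ι p γ Y) * hε

theorem redMetric_redClass (hK : IsotropicOver Φ ι) {p : P} {v : 𝓔 (ι p)}
    (hv : v ∈ Φ.Kperp (ι p)) (hGv : 𝓖.op (ι p) v ∈ Φ.Kperp (ι p)) :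
    redMetric 𝓖 hK p (redClass (C.pairing (ι p)) (Φ.K (ι p)) v hv) =
      redClass (C.pairing (ι p)) (Φ.K (ι p)) (𝓖.op (ι p) v) hGv :=
  haveI := finiteDimensional_fibre (F := F) (𝓔 := 𝓔) (ι p)
  redMetricOp_redClass (𝓖.isGenMetric (ι p)) (hK p) hv hGv

theorem redMetric_redMetric (hK : IsotropicOver Φ ι) {p : P} (z : RedFibre Φ (ι p)) :
    redMetric 𝓖 hK p (redMetric 𝓖 hK p z) = z :=
  haveI := finiteDimensional_fibre (F := F) (𝓔 := 𝓔) (ι p)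
  redMetricOp_redMetricOp (𝓖.isGenMetric (ι p)) (hK p) z

variable [ConnectedSpace G] [IsCancelSMul G P] [ProperSMul G P]
  (hC : C.IsExact) (hΦ : Φ.Preserves 𝓖) (hs : s.IsMetric 𝓖) (hι : IsLeaf EP Φ ι)
  (hK : IsotropicOver Φ ι) (hq : IsOrbitProjection G EP ER q)

/-- The element of the `ε`-eigenbundle in `K^⊥` over a tangent vector of the orbit space. -/
def eigenHlift (ε : ℝ) (p : P) : TangentSpace 𝓘(ℝ, ER) (q p) →ₗ[ℝ] 𝓔 (ι p) :=
  eigenLift 𝓖 s ε (ι p) ∘ₗ tmap EP E ι p ∘ₗ hlift hq (metricConnection s hC hΦ hs hι hK ε) p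

theorem eigenHlift_apply (ε : ℝ) (p : P) (X : TangentSpace 𝓘(ℝ, ER) (q p)) :
    eigenHlift hC hΦ hs hι hK hq ε p X = eigenLift 𝓖 s ε (ι p)
      (tmap EP E ι p (hlift hq (metricConnection s hC hΦ hs hι hK ε) p X)) := rfl

theorem eigenHlift_mem_Kperp {ε : ℝ} (hε : ε * ε = 1) (p : P)
    (X : TangentSpace 𝓘(ℝ, ER) (q p)) :
    eigenHlift hC hΦ hs hι hK hq ε p X ∈ Φ.Kperp (ι p) := by
  rw [eigenHlift_apply, eigenLift_mem_Kperp_iff_connPairing hC hι hK hs hε,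
    ← connForm_eq_zero_iff hC hι hK]
  exact connection_hlift hq (metricConnection s hC hΦ hs hι hK ε) p X

/-- An element of `K^⊥` in the `ε`-eigenbundle comes from a tangent vector of the orbit space. -/
theorem eq_eigenHlift {ε : ℝ} (hε : ε * ε = 1) {p : P} {v : 𝓔 (ι p)} (hv : v ∈ Φ.Kperp (ι p))
    (hGv : 𝓖.op (ι p) v = ε • v) {Y : TangentSpace 𝓘(ℝ, EP) p}
    (hY : C.anchor (ι p) v = tmap EP E ι p Y) :
    v = eigenHlift hC hΦ hs hι hK hq ε p (tmap EP ER q p Y) := by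
  have h1 := eq_eigenLift_of_op_eq hC hs hε hGv
  rw [hY] at h1
  have h2 : connForm 𝓖 s hC hι hK ε p Y = 0 := by
    rw [connForm_eq_zero_iff, ← eigenLift_mem_Kperp_iff_connPairing hC hι hK hs hε, ← h1]
    exact hv
  rw [eigenHlift_apply, hlift_eq hq (metricConnection s hC hΦ hs hι hK ε) rfl h2]
  exact h1

/-- The representative in `K^⊥ ∩ 𝓖 K^⊥` of the metric splitting of the reduced algebroid. -/
def splittingRep (p : P) : TangentSpace 𝓘(ℝ, ER) (q p) →ₗ[ℝ] 𝓔 (ι p) :=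
  (1 / 2 : ℝ) • (eigenHlift hC hΦ hs hι hK hq 1 p + eigenHlift hC hΦ hs hι hK hq (-1) p)

theorem splittingRep_apply (p : P) (X : TangentSpace 𝓘(ℝ, ER) (q p)) :
    splittingRep hC hΦ hs hι hK hq p X = (1 / 2 : ℝ) •
      (eigenHlift hC hΦ hs hι hK hq 1 p X + eigenHlift hC hΦ hs hι hK hq (-1) p X) := rfl

theorem op_splittingRep (p : P) (X : TangentSpace 𝓘(ℝ, ER) (q p)) :
    𝓖.op (ι p) (splittingRep hC hΦ hs hι hK hq p X) = (1 / 2 : ℝ) •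
      (eigenHlift hC hΦ hs hι hK hq 1 p X - eigenHlift hC hΦ hs hι hK hq (-1) p X) := by
  rw [splittingRep_apply, map_smul, map_add, eigenHlift_apply, eigenHlift_apply,
    op_eigenLift (by norm_num), op_eigenLift (by norm_num), one_smul, neg_smul, one_smul,
    ← sub_eq_add_neg]

theorem splittingRep_mem_Kperp (p : P) (X : TangentSpace 𝓘(ℝ, ER) (q p)) :
    splittingRep hC hΦ hs hι hK hq p X ∈ Φ.Kperp (ι p) :=
  Submodule.smul_mem _ _ (Submodule.add_mem _
    (eigenHlift_mem_Kperp hC hΦ hs hι hK hq (by norm_num) p X)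
    (eigenHlift_mem_Kperp hC hΦ hs hι hK hq (by norm_num) p X))

theorem op_splittingRep_mem_Kperp (p : P) (X : TangentSpace 𝓘(ℝ, ER) (q p)) :
    𝓖.op (ι p) (splittingRep hC hΦ hs hι hK hq p X) ∈ Φ.Kperp (ι p) := by
  rw [op_splittingRep]
  exact Submodule.smul_mem _ _ (Submodule.sub_mem _
    (eigenHlift_mem_Kperp hC hΦ hs hι hK hq (by norm_num) p X)
    (eigenHlift_mem_Kperp hC hΦ hs hι hK hq (by norm_num) p X))

/-- The mean of the two horizontal lifts. -/
def meanHlift (p : P) : TangentSpace 𝓘(ℝ, ER) (q p) →ₗ[ℝ] TangentSpace 𝓘(ℝ, EP) p :=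
  (1 / 2 : ℝ) • (hlift hq (metricConnection s hC hΦ hs hι hK 1) p
    + hlift hq (metricConnection s hC hΦ hs hι hK (-1)) p)

theorem tmap_meanHlift (p : P) (X : TangentSpace 𝓘(ℝ, ER) (q p)) :
    tmap EP ER q p (meanHlift hC hΦ hs hι hK hq p X) = X := by
  rw [meanHlift, LinearMap.smul_apply, map_smul, LinearMap.add_apply, map_add, tmap_hlift,
    tmap_hlift, ← two_smul ℝ X, smul_smul]
  norm_num

theorem anchor_splittingRep (p : P) (X : TangentSpace 𝓘(ℝ, ER) (q p)) :
    C.anchor (ι p) (splittingRep hC hΦ hs hι hK hq p X) =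
      tmap EP E ι p (meanHlift hC hΦ hs hι hK hq p X) := by
  rw [splittingRep_apply, map_smul, map_add, eigenHlift_apply, eigenHlift_apply,
    anchor_eigenLift hs, anchor_eigenLift hs, ← map_add, ← map_smul]
  rfl

theorem anchor_op_splittingRep (p : P) (X : TangentSpace 𝓘(ℝ, ER) (q p)) :
    C.anchor (ι p) (𝓖.op (ι p) (splittingRep hC hΦ hs hι hK hq p X)) =
      tmap EP E ι p ((1 / 2 : ℝ) • (hlift hq (metricConnection s hC hΦ hs hι hK 1) p X
        - hlift hq (metricConnection s hC hΦ hs hι hK (-1)) p X)) := by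
  rw [op_splittingRep, map_smul, map_sub, eigenHlift_apply, eigenHlift_apply,
    anchor_eigenLift hs, anchor_eigenLift hs, ← map_sub, ← map_smul]

/-- The metric splitting of the reduced algebroid. -/
def redSplitting (p : P) : TangentSpace 𝓘(ℝ, ER) (q p) →ₗ[ℝ] RedFibre Φ (ι p) :=
  (Submodule.mkQ _).comp ((splittingRep hC hΦ hs hι hK hq p).codRestrict (Φ.Kperp (ι p))
    (splittingRep_mem_Kperp hC hΦ hs hι hK hq p))

theorem redSplitting_apply (p : P) (X : TangentSpace 𝓘(ℝ, ER) (q p)) :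
    redSplitting hC hΦ hs hι hK hq p X = redClass (C.pairing (ι p)) (Φ.K (ι p))
      (splittingRep hC hΦ hs hι hK hq p X) (splittingRep_mem_Kperp hC hΦ hs hι hK hq p X) := rfl

theorem redAnchor_redSplitting (p : P) (X : TangentSpace 𝓘(ℝ, ER) (q p)) :
    redAnchor hι hq p (redSplitting hC hΦ hs hι hK hq p X) = X := by
  rw [redSplitting_apply, redAnchor_redClass hι hq _ (anchor_splittingRep hC hΦ hs hι hK hq p X),
    tmap_meanHlift]

/-- The image of the representative under `𝓖` lies over half the difference of two horizontal lifts
of the same vector, which `dq` kills. -/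
theorem redAnchor_redMetric_redSplitting (p : P) (X : TangentSpace 𝓘(ℝ, ER) (q p)) :
    redAnchor hι hq p (redMetric 𝓖 hK p (redSplitting hC hΦ hs hι hK hq p X)) = 0 := by
  rw [redSplitting_apply, redMetric_redClass hK _ (op_splittingRep_mem_Kperp hC hΦ hs hι hK hq p X),
    redAnchor_redClass hι hq _ (anchor_op_splittingRep hC hΦ hs hι hK hq p X), map_smul, map_sub,
    tmap_hlift, tmap_hlift, sub_self, smul_zero]

/-- Take the representative `v` of `z` with `v` and `𝓖 v` in `K^⊥`. Then `v ± 𝓖 v` are eigenelements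
in `K^⊥`, hence eigenlifts of horizontal lifts. Vanishing of the anchor of `z` says that the vectors
lifted are opposite, and half the difference of `v + 𝓖 v` and `v - 𝓖 v` is `𝓖 v`. -/
theorem exists_redSplitting_eq (p : P) {z : RedFibre Φ (ι p)} (hz : redAnchor hι hq p z = 0) :
    ∃ X, redSplitting hC hΦ hs hι hK hq p X = redMetric 𝓖 hK p z := by
  have := finiteDimensional_fibre (F := F) (𝓔 := 𝓔) (ι p)
  obtain ⟨v, hv, hGv, rfl⟩ := exists_redClass_eq (𝓖.isGenMetric (ι p)) (hK p) z
  have hsq := (𝓖.isGenMetric (ι p)).sq v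
  have hpart : ∀ ε : ℝ, ε * ε = 1 → ∃ Y : TangentSpace 𝓘(ℝ, EP) p,
      C.anchor (ι p) (v + ε • 𝓖.op (ι p) v) = tmap EP E ι p Y ∧
      v + ε • 𝓖.op (ι p) v = eigenHlift hC hΦ hs hι hK hq ε p (tmap EP ER q p Y) := by
    intro ε hε
    have hm : v + ε • 𝓖.op (ι p) v ∈ Φ.Kperp (ι p) :=
      Submodule.add_mem _ hv (Submodule.smul_mem _ _ hGv)
    obtain ⟨Y, hY⟩ := exists_tmap_eq_anchor hι hm
    refine ⟨Y, hY.symm, eq_eigenHlift hC hΦ hs hι hK hq hε hm ?_ hY.symm⟩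
    rw [map_add, map_smul, hsq, smul_add, smul_smul, hε, one_smul, add_comm]
  obtain ⟨Y, hY, hvY⟩ := hpart 1 (by norm_num)
  obtain ⟨Z, hZ, hvZ⟩ := hpart (-1) (by norm_num)
  -- The element `v` lies over `(Y + Z) / 2`, whose image under `dq` is the reduced anchor of `z`,
  -- namely zero.
  have hYZ : tmap EP ER q p Y = -tmap EP ER q p Z := by
    have h1 : C.anchor (ι p) v = tmap EP E ι p ((1 / 2 : ℝ) • (Y + Z)) := by
      rw [map_smul, map_add, ← hY, ← hZ, ← map_add, ← map_smul]
      congr 1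
      module
    rw [redAnchor_redClass hι hq hv h1, map_smul, map_add] at hz
    have h2 := (smul_eq_zero.1 hz).resolve_left (by norm_num)
    exact eq_neg_of_add_eq_zero_left h2
  refine ⟨tmap EP ER q p Y, ?_⟩
  rw [redSplitting_apply, redMetric_redClass hK hv hGv]
  congr 1
  rw [splittingRep_apply, ← hvY, hYZ, map_neg, ← hvZ]
  module

theorem isMetricSplitting_redSplitting (p : P) :
    IsMetricSplitting (redAnchor hι hq p) (redMetric 𝓖 hK p)
      (redSplitting hC hΦ hs hι hK hq p) := by
  refine ⟨redAnchor_redSplitting hC hΦ hs hι hK hq p, le_antisymm ?_ ?_⟩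
  · rintro _ ⟨X, rfl⟩
    exact ⟨_, redAnchor_redMetric_redSplitting hC hΦ hs hι hK hq p X, redMetric_redMetric hK _⟩
  · rintro _ ⟨z, hz, rfl⟩
    exact exists_redSplitting_eq hC hΦ hs hι hK hq p hz

theorem exists_section_eigenLift (ε : ℝ) {Y : ∀ p : P, TangentSpace 𝓘(ℝ, EP) p} {p : P}
    (hY : ExtendsNear E ι Y p) :
    ∃ e : Cₛ^∞⟮𝓘(ℝ, E); F, 𝓔⟯, ∀ᶠ p' in 𝓝 p,
      e (ι p') = eigenLift 𝓖 s ε (ι p') (tmap EP E ι p' (Y p')) := by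
  obtain ⟨Y', hY'⟩ := hY
  refine ⟨s.lift Y' + ε • opSection 𝓖 (s.lift Y'), ?_⟩
  filter_upwards [hY'] with p' hp'
  rw [← hp']
  rfl

theorem exists_section_splittingRep (X : VF ER R) (p : P) :
    ∃ e : Cₛ^∞⟮𝓘(ℝ, E); F, 𝓔⟯, ∀ᶠ p' in 𝓝 p,
      e (ι p') = splittingRep hC hΦ hs hι hK hq p' (X (q p')) := by
  obtain ⟨e, he⟩ := exists_section_eigenLift (𝓖 := 𝓖) (s := s) 1 (extendsNear_VF hι
    (hliftVF hq (metricConnection s hC hΦ hs hι hK 1) X) p)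
  obtain ⟨e', he'⟩ := exists_section_eigenLift (𝓖 := 𝓖) (s := s) (-1) (extendsNear_VF hι
    (hliftVF hq (metricConnection s hC hΦ hs hι hK (-1)) X) p)
  refine ⟨(1 / 2 : ℝ) • (e + e'), ?_⟩
  filter_upwards [he, he'] with p' h h'
  change (1 / 2 : ℝ) • (e (ι p') + e' (ι p')) = _
  rw [h, h']
  rfl

theorem leafAct_splittingRep (X : VF ER R) (g : G) (p : P) :
    splittingRep hC hΦ hs hι hK hq (g • p) (X (q (g • p))) =
      leafAct hι g p (splittingRep hC hΦ hs hι hK hq p (X (q p))) := by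
  simp only [splittingRep_apply, eigenHlift_apply, map_smul, map_add, leafAct_eigenLift hΦ hs hι,
    tmap_smul_hlift]

theorem isInvariantLift_splittingRep (X : VF ER R) :
    IsInvariantLift hι (redLift (redSplitting hC hΦ hs hι hK hq) X)
      (fun p => splittingRep hC hΦ hs hι hK hq p (X (q p))) where
  smooth p := by
    obtain ⟨e, he⟩ := exists_section_splittingRep hC hΦ hs hι hK hq X p
    refine ((e.contMDiff.comp hι.immersion.contMDiff).contMDiffAt).congr_of_eventuallyEq ?_
    filter_upwards [he] with p' hp'
    rw [← hp']
    rfl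
  invariant g p := leafAct_splittingRep hC hΦ hs hι hK hq X g p
  represents p := ⟨_, rfl⟩

theorem isRedMetricSplitting_redSplitting :
    IsRedMetricSplitting 𝓖 hι hK hq (redSplitting hC hΦ hs hι hK hq) where
  isMetricSplitting := isMetricSplitting_redSplitting hC hΦ hs hι hK hq
  smooth X := ⟨_, isInvariantLift_splittingRep hC hΦ hs hι hK hq X⟩

theorem eq_redSplitting {t : ∀ p, TangentSpace 𝓘(ℝ, ER) (q p) →ₗ[ℝ] RedFibre Φ (ι p)}
    (ht : IsRedMetricSplitting 𝓖 hι hK hq t) : t = redSplitting hC hΦ hs hι hK hq :=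
  funext fun p => (ht.isMetricSplitting p).unique
    (isMetricSplitting_redSplitting hC hΦ hs hι hK hq p)

end MetricSplitting

/-! ### Brackets of sections along the leaf. -/

section Brackets

/-- The failure of the bracket to be antisymmetric. -/
theorem pairing_bracket_add_swap (C : CourantAlgebroid E F 𝓔) (e₁ e₂ : Cₛ^∞⟮𝓘(ℝ, E); F, 𝓔⟯)
    (x : M) (v : 𝓔 x) :
    C.pairing x (C.bracket e₁ e₂ x) v + C.pairing x (C.bracket e₂ e₁ x) v =
      dirDeriv (fun y => C.pairing y (e₁ y) (e₂ y)) x (C.anchor x v) := by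
  have hd : ∀ e e' : Cₛ^∞⟮𝓘(ℝ, E); F, 𝓔⟯,
      MDifferentiableAt 𝓘(ℝ, E) 𝓘(ℝ, ℝ) (fun y => C.pairing y (e y) (e' y)) x := fun e e' =>
    (C.pairing_smooth e e').mdifferentiableAt (by simp)
  have h := C.bracket_self (e₁ + e₂) x v
  have h1 := C.bracket_self e₁ x v
  have h2 := C.bracket_self e₂ x v
  have h3 : (fun y => C.pairing y ((e₁ + e₂) y) ((e₁ + e₂) y)) =
      fun y => (C.pairing y (e₁ y) (e₁ y) + C.pairing y (e₂ y) (e₂ y))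
        + 2 * C.pairing y (e₁ y) (e₂ y) := by
    funext y
    rw [ContMDiffSection.coe_add, Pi.add_apply, map_add, map_add, LinearMap.add_apply,
      LinearMap.add_apply, C.pairing_symm y (e₂ y) (e₁ y)]
    ring
  have h4 : dirDeriv (fun y => (C.pairing y (e₁ y) (e₁ y) + C.pairing y (e₂ y) (e₂ y))
      + 2 * C.pairing y (e₁ y) (e₂ y)) x (C.anchor x v) =
      (dirDeriv (fun y => C.pairing y (e₁ y) (e₁ y)) x (C.anchor x v)
        + dirDeriv (fun y => C.pairing y (e₂ y) (e₂ y)) x (C.anchor x v))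
      + 2 * dirDeriv (fun y => C.pairing y (e₁ y) (e₂ y)) x (C.anchor x v) := by
    have h5 : MDifferentiableAt 𝓘(ℝ, E) 𝓘(ℝ, ℝ)
        (fun y => C.pairing y (e₁ y) (e₁ y) + C.pairing y (e₂ y) (e₂ y)) x := (hd _ _).add (hd _ _)
    have h6 : MDifferentiableAt 𝓘(ℝ, E) 𝓘(ℝ, ℝ) (fun y => 2 * C.pairing y (e₁ y) (e₂ y)) x :=
      (hd _ _).const_smul (2 : ℝ)
    rw [dirDeriv_add h5 h6, dirDeriv_add (hd _ _) (hd _ _), dirDeriv_const_mul (hd _ _)]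
  rw [h3, h4] at h
  simp only [map_add, LinearMap.add_apply, ContMDiffSection.coe_add, Pi.add_apply] at h
  linarith

theorem dirDeriv_leaf (hι : IsLeaf EP Φ ι) {f : M → ℝ} (hf : ContMDiff 𝓘(ℝ, E) 𝓘(ℝ, ℝ) ∞ f)
    {u : P → ℝ} {p : P} (hu : ∀ᶠ p' in 𝓝 p, f (ι p') = u p') (Y : TangentSpace 𝓘(ℝ, EP) p) :
    dirDeriv f (ι p) (tmap EP E ι p Y) = dirDeriv u p Y :=
  (dirDeriv_comp (hf.mdifferentiableAt (by simp)) (hι.mdifferentiableAt p) Y).symm.trans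
    (dirDeriv_congr hu Y)

/-- Anchors of elements of `K^⊥` are tangent to the leaf, so the derivative sees only the
restriction of `f` to it. -/
theorem dirDeriv_leaf_eq_zero (hι : IsLeaf EP Φ ι) {f : M → ℝ}
    (hf : ContMDiff 𝓘(ℝ, E) 𝓘(ℝ, ℝ) ∞ f) {p : P} (hu : ∀ᶠ p' in 𝓝 p, f (ι p') = 0)
    {v : 𝓔 (ι p)} (hv : v ∈ Φ.Kperp (ι p)) : dirDeriv f (ι p) (C.anchor (ι p) v) = 0 := by
  obtain ⟨Y, hY⟩ := exists_tmap_eq_anchor hι hv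
  rw [← hY, dirDeriv_leaf hι hf hu]
  exact dirDeriv_const 0 Y

theorem VF.mdifferentiableAt (X : VF E M) (x : M) :
    MDifferentiableAt 𝓘(ℝ, E) (𝓘(ℝ, E).prod 𝓘(ℝ, E))
      (fun y => (⟨y, X y⟩ : TangentBundle 𝓘(ℝ, E) M)) x :=
  X.contMDiff.mdifferentiableAt (by simp)

/-- Over the leaf, the anchor of the bracket of sections that lie over vector fields on the leaf. -/
theorem anchor_bracket_leaf (hι : IsLeaf EP Φ ι) {e₁ e₂ : Cₛ^∞⟮𝓘(ℝ, E); F, 𝓔⟯} {Y₁ Y₂ : VF EP P}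
    {p : P} (h₁ : ∀ᶠ p' in 𝓝 p, C.anchor (ι p') (e₁ (ι p')) = tmap EP E ι p' (Y₁ p'))
    (h₂ : ∀ᶠ p' in 𝓝 p, C.anchor (ι p') (e₂ (ι p')) = tmap EP E ι p' (Y₂ p')) :
    C.anchor (ι p) (C.bracket e₁ e₂ (ι p)) =
      tmap EP E ι p (mlieBracket 𝓘(ℝ, EP) Y₁ Y₂ p) := by
  rw [C.anchor_bracket]
  exact (tmap_mlieBracket_of_related
    (Eventually.of_forall fun _ => hι.immersion.contMDiff.contMDiffAt)
    (VF.mdifferentiableAt Y₁ p) (VF.mdifferentiableAt Y₂ p)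
    (VF.mdifferentiableAt (anchorVF C e₁) (ι p)) (VF.mdifferentiableAt (anchorVF C e₂) (ι p))
    (h₁.mono fun _ h => h.symm) (h₂.mono fun _ h => h.symm)).symm

theorem anchor_bracket_leaf_eq_zero (hι : IsLeaf EP Φ ι) {e₁ e₂ : Cₛ^∞⟮𝓘(ℝ, E); F, 𝓔⟯}
    {Y₁ : VF EP P}
    {p : P} (h₁ : ∀ᶠ p' in 𝓝 p, C.anchor (ι p') (e₁ (ι p')) = tmap EP E ι p' (Y₁ p'))
    (h₂ : ∀ᶠ p' in 𝓝 p, C.anchor (ι p') (e₂ (ι p')) = 0) :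
    C.anchor (ι p) (C.bracket e₁ e₂ (ι p)) = 0 ∧
      C.anchor (ι p) (C.bracket e₂ e₁ (ι p)) = 0 := by
  have h₃ : ∀ᶠ p' in 𝓝 p, C.anchor (ι p') (e₂ (ι p')) = tmap EP E ι p' ((0 : VF EP P) p') :=
    h₂.mono fun p' h => h.trans (map_zero _).symm
  constructor
  · rw [anchor_bracket_leaf hι h₁ h₃]
    have h4 : mlieBracket 𝓘(ℝ, EP) Y₁ (0 : VF EP P) p = 0 :=
      congrFun (mlieBracket_zero_right (I := 𝓘(ℝ, EP)) (W := fun p => Y₁ p)) p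
    rw [h4, map_zero]
  · rw [anchor_bracket_leaf hι h₃ h₁]
    have h4 : mlieBracket 𝓘(ℝ, EP) (0 : VF EP P) Y₁ p = 0 :=
      congrFun (mlieBracket_zero_left (I := 𝓘(ℝ, EP)) (W := fun p => Y₁ p)) p
    rw [h4, map_zero]

/-- Near `p`, the section `e` extends a `G`-invariant section of `K^⊥` over the leaf. -/
def InvariantNear (hι : IsLeaf EP Φ ι) (e : Cₛ^∞⟮𝓘(ℝ, E); F, 𝓔⟯) (p : P) : Prop :=
  ∃ k : ∀ p, 𝓔 (ι p), (∀ (g : G) p, k (g • p) = leafAct hι g p (k p)) ∧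
    (∀ p, k p ∈ Φ.Kperp (ι p)) ∧ ∀ᶠ p' in 𝓝 p, e (ι p') = k p'

theorem InvariantNear.eventually_mem {hι : IsLeaf EP Φ ι} {e : Cₛ^∞⟮𝓘(ℝ, E); F, 𝓔⟯} {p : P}
    (h : InvariantNear hι e p) : ∀ᶠ p' in 𝓝 p, e (ι p') ∈ Φ.Kperp (ι p') := by
  obtain ⟨k, -, hk, he⟩ := h
  filter_upwards [he] with p' hp'
  rw [hp']
  exact hk p'

theorem IsExtensionAt.invariantNear {hι : IsLeaf EP Φ ι} {z : ∀ p, RedFibre Φ (ι p)} {p : P}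
    {e : Cₛ^∞⟮𝓘(ℝ, E); F, 𝓔⟯} (h : IsExtensionAt hι z p e) : InvariantNear hι e p := by
  obtain ⟨k, hk, he⟩ := h
  exact ⟨k, hk.invariant, fun p => (hk.represents p).1, he⟩

theorem eq_of_eq_fibreCast {x y : M} (h : x = y) {e : Cₛ^∞⟮𝓘(ℝ, E); F, 𝓔⟯} {u : 𝓔 x}
    (he : e y = fibreCast h u) : e x = u := by
  subst h; exact he

/-- The operator `ad (Ψ a)` is the infinitesimal action and the orbit of `p` stays in the leaf,
where `e` is invariant near `p`. The function differentiated in `infinitesimal` is therefore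
constant near the identity. -/
theorem bracket_Ψ_eq_zero {hι : IsLeaf EP Φ ι} (a : 𝔞) {e : Cₛ^∞⟮𝓘(ℝ, E); F, 𝓔⟯} {p : P}
    (he : InvariantNear hι e p) : C.bracket (Φ.Ψ a) e (ι p) = 0 := by
  obtain ⟨k, hinv, -, hk⟩ := he
  apply C.pairing_nondeg
  intro w
  rw [← Φ.infinitesimal]
  have hc : Tendsto (fun g : G => g⁻¹ • p) (𝓝 1) (𝓝 p) := by
    have h := (mdifferentiableAt_inv_smul (EG := EG) (G := G) (E := EP) p).continuousAt
    rwa [ContinuousAt, inv_one, one_smul] at h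
  have h1 : (fun g : G => C.pairing (ι p) ((Φ.act g⁻¹ (ι p)).symm (e (g⁻¹ • ι p))) w) =ᶠ[𝓝 1]
      fun _ => C.pairing (ι p) (k p) w := by
    filter_upwards [hc.eventually hk] with g hg
    rw [hinv] at hg
    have h2 : e (g⁻¹ • ι p) = Φ.act g⁻¹ (ι p) (k p) := eq_of_eq_fibreCast _ hg
    rw [h2, LinearEquiv.symm_apply_apply]
  exact (dirDeriv_congr h1 _).trans (dirDeriv_const _ _)

/-- Invariance of the pairing reduces the claim to `⟨⟦e₁, Ψ a⟧, e₂⟩ = 0`, as `⟨Ψ a, e₂⟩` vanishes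
along the leaf. Up to the derivative of `⟨Ψ a, e₁⟩`, also zero along the leaf, this is `-⟨⟦Ψ a, e₁⟧,
e₂⟩ = 0`. -/
theorem bracket_mem_Kperp {hι : IsLeaf EP Φ ι} {e₁ e₂ : Cₛ^∞⟮𝓘(ℝ, E); F, 𝓔⟯} {p : P}
    (h₁ : InvariantNear hι e₁ p) (h₂ : ∀ᶠ p' in 𝓝 p, e₂ (ι p') ∈ Φ.Kperp (ι p')) :
    C.bracket e₁ e₂ (ι p) ∈ Φ.Kperp (ι p) := by
  rw [mem_Kperp]
  intro a
  have h3 := C.invariant e₁ (Φ.Ψ a) e₂ (ι p)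
  rw [dirDeriv_leaf_eq_zero hι (C.pairing_smooth _ _) (h₂.mono fun p' h => mem_Kperp.1 h a)
    h₁.eventually_mem.self_of_nhds] at h3
  have h4 := pairing_bracket_add_swap C (Φ.Ψ a) e₁ (ι p) (e₂ (ι p))
  rw [dirDeriv_leaf_eq_zero hι (C.pairing_smooth _ _)
    (h₁.eventually_mem.mono fun p' h => mem_Kperp.1 h a) h₂.self_of_nhds,
    bracket_Ψ_eq_zero a h₁, map_zero, LinearMap.zero_apply, zero_add] at h4
  rw [h4, zero_add] at h3
  exact h3.symm

theorem pairing_mem_K_mem_Kperp {x : M} {u v : 𝓔 x} (hu : u ∈ Φ.K x) (hv : v ∈ Φ.Kperp x) :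
    C.pairing x u v = 0 := hv u hu

/-- The bracket with a section of `K` is orthogonal to invariant sections of `K^⊥`. -/
theorem pairing_bracket_of_mem_K {hι : IsLeaf EP Φ ι} {d e₁ e₂ : Cₛ^∞⟮𝓘(ℝ, E); F, 𝓔⟯} {p : P}
    (hd : ∀ᶠ p' in 𝓝 p, d (ι p') ∈ Φ.K (ι p')) (h₁ : InvariantNear hι e₁ p)
    (h₂ : InvariantNear hι e₂ p) :
    C.pairing (ι p) (C.bracket e₁ d (ι p)) (e₂ (ι p)) = 0 ∧
      C.pairing (ι p) (C.bracket d e₁ (ι p)) (e₂ (ι p)) = 0 := by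
  have h3 := C.invariant e₁ d e₂ (ι p)
  rw [dirDeriv_leaf_eq_zero hι (C.pairing_smooth _ _)
    ((hd.and h₂.eventually_mem).mono fun p' h => pairing_mem_K_mem_Kperp h.1 h.2)
    h₁.eventually_mem.self_of_nhds,
    pairing_mem_K_mem_Kperp hd.self_of_nhds (bracket_mem_Kperp h₁ h₂.eventually_mem),
    add_zero] at h3
  refine ⟨h3.symm, ?_⟩
  have h4 := pairing_bracket_add_swap C d e₁ (ι p) (e₂ (ι p))
  rw [dirDeriv_leaf_eq_zero hι (C.pairing_smooth _ _)
    ((hd.and h₁.eventually_mem).mono fun p' h => pairing_mem_K_mem_Kperp h.1 h.2)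
    h₂.eventually_mem.self_of_nhds, ← h3, add_zero] at h4
  exact h4

end Brackets

/-! ### The reduced bracket is well defined. -/

section ReducedBracket

variable {ER : Type*} [NormedAddCommGroup ER] [NormedSpace ℝ ER] [FiniteDimensional ℝ ER]
  {R : Type*} [TopologicalSpace R] [ChartedSpace ER R] [IsManifold 𝓘(ℝ, ER) ∞ R] [T2Space R]
  {q : P → R}
  [ConnectedSpace G] [IsCancelSMul G P] [ProperSMul G P]
  (hC : C.IsExact) (hΦ : Φ.Preserves 𝓖) (hs : s.IsMetric 𝓖) (hι : IsLeaf EP Φ ι)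
  (hK : IsotropicOver Φ ι) (hq : IsOrbitProjection G EP ER q)

theorem mem_K_of_pairing_eigenHlift (p : P) {u : 𝓔 (ι p)} (hu : u ∈ Φ.Kperp (ι p))
    (h : ∀ ε : ℝ, ε * ε = 1 → ∀ X : TangentSpace 𝓘(ℝ, ER) (q p),
      C.pairing (ι p) u (eigenHlift hC hΦ hs hι hK hq ε p X) = 0) : u ∈ Φ.K (ι p) := by
  have := finiteDimensional_fibre (F := F) (𝓔 := 𝓔) (ι p)
  obtain ⟨v, hv, hGv, hvu⟩ := exists_redClass_eq (𝓖.isGenMetric (ι p)) (hK p)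
    (redClass (C.pairing (ι p)) (Φ.K (ι p)) u hu)
  have hvuK : v - u ∈ Φ.K (ι p) := (redClass_eq_iff hv hu).1 hvu
  have hsq := (𝓖.isGenMetric (ι p)).sq v
  have hpart : ∀ ε : ℝ, ε * ε = 1 → C.pairing (ι p) v (v + ε • 𝓖.op (ι p) v) = 0 := by
    intro ε hε
    have hm : v + ε • 𝓖.op (ι p) v ∈ Φ.Kperp (ι p) :=
      Submodule.add_mem _ hv (Submodule.smul_mem _ _ hGv)
    obtain ⟨Y, hY⟩ := exists_tmap_eq_anchor hι hm
    have h1 := eq_eigenHlift hC hΦ hs hι hK hq hε hm (by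
      rw [map_add, map_smul, hsq, smul_add, smul_smul, hε, one_smul, add_comm]) hY.symm
    have h2 := h ε hε (tmap EP ER q p Y)
    have h3 := pairing_mem_K_mem_Kperp hvuK hm
    rw [← h1] at h2
    rw [map_sub, LinearMap.sub_apply, h2, sub_zero] at h3
    exact h3
  have h1 := hpart 1 (by norm_num)
  have h2 := hpart (-1) (by norm_num)
  rw [map_add, map_smul, smul_eq_mul] at h1 h2
  have h3 : C.pairing (ι p) v (𝓖.op (ι p) v) = 0 := by linarith
  have hv0 : v = 0 := by
    by_contra hne
    have h4 := (𝓖.isGenMetric (ι p)).pos v hne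
    rw [(𝓖.isGenMetric (ι p)).selfAdjoint, h3] at h4
    exact lt_irrefl _ h4
  rw [hv0, zero_sub] at hvuK
  exact (Submodule.neg_mem_iff _).1 hvuK

theorem exists_invariantNear_eigenHlift {ε : ℝ} (hε : ε * ε = 1) (p : P)
    (X : TangentSpace 𝓘(ℝ, ER) (q p)) :
    ∃ e : Cₛ^∞⟮𝓘(ℝ, E); F, 𝓔⟯, InvariantNear hι e p ∧
      e (ι p) = eigenHlift hC hΦ hs hι hK hq ε p X := by
  obtain ⟨X', hX'⟩ := exists_section_eq (E := ER) (F := ER)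
    (V := fun r : R => TangentSpace 𝓘(ℝ, ER) r) X
  obtain ⟨e, he⟩ := exists_section_eigenLift (𝓖 := 𝓖) (s := s) ε (extendsNear_VF hι
    (hliftVF hq (metricConnection s hC hΦ hs hι hK ε) X') p)
  refine ⟨e, ⟨fun p => eigenHlift hC hΦ hs hι hK hq ε p (X' (q p)), fun g p => ?_, fun p =>
    eigenHlift_mem_Kperp hC hΦ hs hι hK hq hε p _, he⟩, ?_⟩
  · simp only [eigenHlift_apply, leafAct_eigenLift hΦ hs hι, tmap_smul_hlift]
  · rw [he.self_of_nhds, ← hX']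
    rfl

/-- Modulo `K`, the bracket depends only on the classes of invariant sections of `K^⊥`. -/
theorem bracket_sub_bracket_mem_K (hC : C.IsExact) (hΦ : Φ.Preserves 𝓖) (hs : s.IsMetric 𝓖)
    (hι : IsLeaf EP Φ ι) (hK : IsotropicOver Φ ι) (hq : IsOrbitProjection G EP ER q)
    {e₁ e₁' e₂ e₂' : Cₛ^∞⟮𝓘(ℝ, E); F, 𝓔⟯} {p : P}
    (h₁ : InvariantNear hι e₁ p) (h₁' : InvariantNear hι e₁' p) (h₂ : InvariantNear hι e₂ p)
    (h₂' : InvariantNear hι e₂' p)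
    (hd₁ : ∀ᶠ p' in 𝓝 p, e₁ (ι p') - e₁' (ι p') ∈ Φ.K (ι p'))
    (hd₂ : ∀ᶠ p' in 𝓝 p, e₂ (ι p') - e₂' (ι p') ∈ Φ.K (ι p')) :
    C.bracket e₁ e₂ (ι p) - C.bracket e₁' e₂' (ι p) ∈ Φ.K (ι p) := by
  refine mem_K_of_pairing_eigenHlift hC hΦ hs hι hK hq p (Submodule.sub_mem _
    (bracket_mem_Kperp h₁ h₂.eventually_mem) (bracket_mem_Kperp h₁' h₂'.eventually_mem)) ?_
  intro ε hε X
  obtain ⟨e, he, heX⟩ := exists_invariantNear_eigenHlift hC hΦ hs hι hK hq hε p X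
  -- The two arguments are changed one at a time, so that each correction is a bracket with a
  -- section lying in `K` along the leaf.
  have h3 : C.bracket e₁ e₂ (ι p) - C.bracket e₁' e₂' (ι p) =
      C.bracket (e₁ - e₁') e₂ (ι p) + C.bracket e₁' (e₂ - e₂') (ι p) := by
    rw [map_sub, map_sub, LinearMap.sub_apply, ContMDiffSection.coe_sub, ContMDiffSection.coe_sub,
      Pi.sub_apply, Pi.sub_apply]
    abel
  have h4 := (pairing_bracket_of_mem_K (d := e₁ - e₁') hd₁ h₂ he).2
  have h5 := (pairing_bracket_of_mem_K (d := e₂ - e₂') hd₂ h₁' he).1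
  rw [h3, ← heX, map_add, LinearMap.add_apply, h4, h5, add_zero]

end ReducedBracket

/-! ### The trilinear expression `⟨⟦e₁, e₂⟧, e₃⟩` on sections in the splitting span. -/

section ReducedCurvature

variable {ER : Type*} [NormedAddCommGroup ER] [NormedSpace ℝ ER] [FiniteDimensional ℝ ER]
  {R : Type*} [TopologicalSpace R] [ChartedSpace ER R] [IsManifold 𝓘(ℝ, ER) ∞ R] [T2Space R]
  {q : P → R}

/-- The bracket followed by the pairing, on sections that near `p` lie in an isotropic
subbundle. -/
theorem pairing_bracket_swap_left (hι : IsLeaf EP Φ ι) {e₁ e₂ e₃ : Cₛ^∞⟮𝓘(ℝ, E); F, 𝓔⟯} {p : P}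
    (h₁₂ : ∀ᶠ p' in 𝓝 p, C.pairing (ι p') (e₁ (ι p')) (e₂ (ι p')) = 0)
    (h₃ : e₃ (ι p) ∈ Φ.Kperp (ι p)) :
    C.pairing (ι p) (C.bracket e₁ e₂ (ι p)) (e₃ (ι p)) =
      -C.pairing (ι p) (C.bracket e₂ e₁ (ι p)) (e₃ (ι p)) := by
  have h := pairing_bracket_add_swap C e₁ e₂ (ι p) (e₃ (ι p))
  rw [dirDeriv_leaf_eq_zero hι (C.pairing_smooth _ _) h₁₂ h₃] at h
  linarith

theorem pairing_bracket_swap_right (hι : IsLeaf EP Φ ι) {e₁ e₂ e₃ : Cₛ^∞⟮𝓘(ℝ, E); F, 𝓔⟯} {p : P}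
    (h₂₃ : ∀ᶠ p' in 𝓝 p, C.pairing (ι p') (e₂ (ι p')) (e₃ (ι p')) = 0)
    (h₁ : e₁ (ι p) ∈ Φ.Kperp (ι p)) :
    C.pairing (ι p) (C.bracket e₁ e₂ (ι p)) (e₃ (ι p)) =
      -C.pairing (ι p) (C.bracket e₁ e₃ (ι p)) (e₂ (ι p)) := by
  have h := C.invariant e₁ e₂ e₃ (ι p)
  rw [dirDeriv_leaf_eq_zero hι (C.pairing_smooth _ _) h₂₃ h₁,
    C.pairing_symm (ι p) (e₂ (ι p))] at h
  linarith

variable [ConnectedSpace G] [IsCancelSMul G P] [ProperSMul G P]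
  (hC : C.IsExact) (hΦ : Φ.Preserves 𝓖) (hs : s.IsMetric 𝓖) (hι : IsLeaf EP Φ ι)
  (hK : IsotropicOver Φ ι) (hq : IsOrbitProjection G EP ER q)

/-- The anchor of `𝓖` of a representative is vertical, hence a generator, and generators are anchors
of elements of `K`. -/
theorem exists_anchor_op_splittingRep (p : P) (X : TangentSpace 𝓘(ℝ, ER) (q p)) :
    ∃ a, C.anchor (ι p) (𝓖.op (ι p) (splittingRep hC hΦ hs hι hK hq p X) - Φ.Ψ a (ι p)) = 0 := by
  obtain ⟨γ, hγ⟩ := exists_infGen_eq_of_tmap_eq_zero (EG := EG) hq (p := p)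
    (Y := (1 / 2 : ℝ) • (hlift hq (metricConnection s hC hΦ hs hι hK 1) p X
        - hlift hq (metricConnection s hC hΦ hs hι hK (-1)) p X)) (by
      rw [map_smul, map_sub, tmap_hlift, tmap_hlift, sub_self, smul_zero])
  refine ⟨A.splitting γ, ?_⟩
  rw [map_sub, anchor_op_splittingRep, anchor_Ψ_leaf hι, ExactCourantAlgebra.proj_splitting, hγ,
    sub_self]

/-- Corrected by elements of `K`, the images of the two representatives under `𝓖` are covectors and
pair to zero. The correction terms vanish because these images lie in `K^⊥` and `K` is isotropic.
Finally `𝓖` is orthogonal. -/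
theorem pairing_splittingRep (p : P) (X Y : TangentSpace 𝓘(ℝ, ER) (q p)) :
    C.pairing (ι p) (splittingRep hC hΦ hs hι hK hq p X)
      (splittingRep hC hΦ hs hι hK hq p Y) = 0 := by
  obtain ⟨a, ha⟩ := exists_anchor_op_splittingRep hC hΦ hs hι hK hq p X
  obtain ⟨b, hb⟩ := exists_anchor_op_splittingRep hC hΦ hs hι hK hq p Y
  have h := pairing_eq_zero_of_anchor hC ha hb
  have h1 := mem_Kperp.1 (op_splittingRep_mem_Kperp hC hΦ hs hι hK hq p Y) a
  have h2 := mem_Kperp.1 (op_splittingRep_mem_Kperp hC hΦ hs hι hK hq p X) b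
  have h3 := mem_Kperp.1 (hK p (Ψ_mem_K b (ι p))) a
  rw [map_sub, map_sub, LinearMap.sub_apply, LinearMap.sub_apply, h1, h3,
    C.pairing_symm _ _ (Φ.Ψ b (ι p)), h2, (𝓖.isGenMetric (ι p)).orthogonal] at h
  linarith

/-- The preimage in `K^⊥` of the image of the metric splitting. -/
def splittingSpan (p : P) : Submodule ℝ (𝓔 (ι p)) :=
  LinearMap.range (splittingRep hC hΦ hs hι hK hq p) ⊔ Φ.K (ι p)

theorem mem_splittingSpan {p : P} {v : 𝓔 (ι p)} :
    v ∈ splittingSpan hC hΦ hs hι hK hq p ↔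
      ∃ X a, v = splittingRep hC hΦ hs hι hK hq p X + Φ.Ψ a (ι p) := by
  rw [splittingSpan, Submodule.mem_sup]
  constructor
  · rintro ⟨_, ⟨X, rfl⟩, _, ⟨a, rfl⟩, rfl⟩
    exact ⟨X, a, rfl⟩
  · rintro ⟨X, a, rfl⟩
    exact ⟨_, ⟨X, rfl⟩, _, ⟨a, rfl⟩, rfl⟩

theorem splittingSpan_le_Kperp (p : P) :
    splittingSpan hC hΦ hs hι hK hq p ≤ Φ.Kperp (ι p) := by
  refine sup_le ?_ (hK p)
  rintro _ ⟨X, rfl⟩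
  exact splittingRep_mem_Kperp hC hΦ hs hι hK hq p X

theorem pairing_splittingSpan {p : P} {u v : 𝓔 (ι p)}
    (hu : u ∈ splittingSpan hC hΦ hs hι hK hq p) (hv : v ∈ splittingSpan hC hΦ hs hι hK hq p) :
    C.pairing (ι p) u v = 0 := by
  have hvK := mem_Kperp.1 (splittingSpan_le_Kperp hC hΦ hs hι hK hq p hv)
  obtain ⟨X, a, rfl⟩ := (mem_splittingSpan hC hΦ hs hι hK hq).1 hu
  obtain ⟨Y, b, rfl⟩ := (mem_splittingSpan hC hΦ hs hι hK hq).1 hv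
  rw [LinearMap.map_add₂, hvK a, map_add, pairing_splittingRep,
    C.pairing_symm _ _ (Φ.Ψ b (ι p)),
    mem_Kperp.1 (splittingRep_mem_Kperp hC hΦ hs hι hK hq p X) b]
  norm_num

/-- Near `p`, the section `e` takes values in the preimage of the image of the metric
splitting. -/
def SplittingNear (e : Cₛ^∞⟮𝓘(ℝ, E); F, 𝓔⟯) (p : P) : Prop :=
  ∀ᶠ p' in 𝓝 p, e (ι p') ∈ splittingSpan hC hΦ hs hι hK hq p'

variable {hC hΦ hs hι hK hq}

theorem SplittingNear.add {e₁ e₂ : Cₛ^∞⟮𝓘(ℝ, E); F, 𝓔⟯} {p : P}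
    (h₁ : SplittingNear hC hΦ hs hι hK hq e₁ p) (h₂ : SplittingNear hC hΦ hs hι hK hq e₂ p) :
    SplittingNear hC hΦ hs hι hK hq (e₁ + e₂) p :=
  (h₁.and h₂).mono fun _ h => Submodule.add_mem _ h.1 h.2

variable (hC hΦ hs hι hK hq) in
theorem splittingNear_Ψ (a : 𝔞) (p : P) : SplittingNear hC hΦ hs hι hK hq (Φ.Ψ a) p :=
  Eventually.of_forall fun p' => (le_sup_right : Φ.K (ι p') ≤ _) (Ψ_mem_K a (ι p'))

theorem SplittingNear.swap_left {e₁ e₂ e₃ : Cₛ^∞⟮𝓘(ℝ, E); F, 𝓔⟯} {p : P}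
    (h₁ : SplittingNear hC hΦ hs hι hK hq e₁ p) (h₂ : SplittingNear hC hΦ hs hι hK hq e₂ p)
    (h₃ : SplittingNear hC hΦ hs hι hK hq e₃ p) :
    C.pairing (ι p) (C.bracket e₁ e₂ (ι p)) (e₃ (ι p)) =
      -C.pairing (ι p) (C.bracket e₂ e₁ (ι p)) (e₃ (ι p)) :=
  pairing_bracket_swap_left hι
    ((h₁.and h₂).mono fun _ h => pairing_splittingSpan hC hΦ hs hι hK hq h.1 h.2)
    (splittingSpan_le_Kperp hC hΦ hs hι hK hq p h₃.self_of_nhds)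

theorem SplittingNear.swap_right {e₁ e₂ e₃ : Cₛ^∞⟮𝓘(ℝ, E); F, 𝓔⟯} {p : P}
    (h₁ : SplittingNear hC hΦ hs hι hK hq e₁ p) (h₂ : SplittingNear hC hΦ hs hι hK hq e₂ p)
    (h₃ : SplittingNear hC hΦ hs hι hK hq e₃ p) :
    C.pairing (ι p) (C.bracket e₁ e₂ (ι p)) (e₃ (ι p)) =
      -C.pairing (ι p) (C.bracket e₁ e₃ (ι p)) (e₂ (ι p)) :=
  pairing_bracket_swap_right hι
    ((h₂.and h₃).mono fun _ h => pairing_splittingSpan hC hΦ hs hι hK hq h.1 h.2)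
    (splittingSpan_le_Kperp hC hΦ hs hι hK hq p h₁.self_of_nhds)

/-- A cyclic rotation is two transpositions; isotropy of the span makes each transposition an exact
sign change. -/
theorem SplittingNear.rotate {e₁ e₂ e₃ : Cₛ^∞⟮𝓘(ℝ, E); F, 𝓔⟯} {p : P}
    (h₁ : SplittingNear hC hΦ hs hι hK hq e₁ p) (h₂ : SplittingNear hC hΦ hs hι hK hq e₂ p)
    (h₃ : SplittingNear hC hΦ hs hι hK hq e₃ p) :
    C.pairing (ι p) (C.bracket e₁ e₂ (ι p)) (e₃ (ι p)) =
      C.pairing (ι p) (C.bracket e₂ e₃ (ι p)) (e₁ (ι p)) := by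
  rw [h₁.swap_left h₂ h₃, h₂.swap_right h₁ h₃, neg_neg]

/-- The bracket followed by the pairing is tensorial on sections of an isotropic subbundle. -/
theorem SplittingNear.congr {e₁ e₂ e₃ e₁' e₂' e₃' : Cₛ^∞⟮𝓘(ℝ, E); F, 𝓔⟯} {p : P}
    (h₁ : SplittingNear hC hΦ hs hι hK hq e₁ p) (h₂ : SplittingNear hC hΦ hs hι hK hq e₂ p)
    (h₁' : SplittingNear hC hΦ hs hι hK hq e₁' p) (h₂' : SplittingNear hC hΦ hs hι hK hq e₂' p)
    (h₃' : SplittingNear hC hΦ hs hι hK hq e₃' p)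
    (h1 : e₁ (ι p) = e₁' (ι p)) (h2 : e₂ (ι p) = e₂' (ι p)) (h3 : e₃ (ι p) = e₃' (ι p)) :
    C.pairing (ι p) (C.bracket e₁ e₂ (ι p)) (e₃ (ι p)) =
      C.pairing (ι p) (C.bracket e₁' e₂' (ι p)) (e₃' (ι p)) := by
  -- Rotation brings each slot in turn to the last place, where only the value at `ι p` enters.
  rw [h3, h₁.rotate h₂ h₃', h1, h₂.rotate h₃' h₁', h2, h₃'.rotate h₁' h₂']

variable (hC hΦ hs hK hq) in
theorem exists_extension (p : P) (X : VF ER R) : ∃ e : Cₛ^∞⟮𝓘(ℝ, E); F, 𝓔⟯,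
    IsExtensionAt hι (redLift (redSplitting hC hΦ hs hι hK hq) X) p e ∧
    ∀ᶠ p' in 𝓝 p, e (ι p') = splittingRep hC hΦ hs hι hK hq p' (X (q p')) := by
  obtain ⟨e, he⟩ := exists_section_splittingRep hC hΦ hs hι hK hq X p
  exact ⟨e, ⟨_, isInvariantLift_splittingRep hC hΦ hs hι hK hq X, he⟩, he⟩

theorem splittingNear_of_eventually {e : Cₛ^∞⟮𝓘(ℝ, E); F, 𝓔⟯} {p : P} {X : VF ER R}
    (he : ∀ᶠ p' in 𝓝 p, e (ι p') = splittingRep hC hΦ hs hι hK hq p' (X (q p'))) :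
    SplittingNear hC hΦ hs hι hK hq e p := by
  filter_upwards [he] with p' h
  rw [h]
  exact (le_sup_left : LinearMap.range (splittingRep hC hΦ hs hι hK hq p') ≤ _) ⟨_, rfl⟩

variable (hC hΦ hs hK hq) in
theorem exists_extension_vector (p : P) (X : TangentSpace 𝓘(ℝ, ER) (q p)) :
    ∃ e : Cₛ^∞⟮𝓘(ℝ, E); F, 𝓔⟯, InvariantNear hι e p ∧ SplittingNear hC hΦ hs hι hK hq e p ∧
      e (ι p) = splittingRep hC hΦ hs hι hK hq p X := by
  obtain ⟨X', hX'⟩ := exists_section_eq (E := ER) (F := ER)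
    (V := fun r : R => TangentSpace 𝓘(ℝ, ER) r) X
  obtain ⟨e, he, he'⟩ := exists_extension hC hΦ hs hK hq p X'
  exact ⟨e, he.invariantNear, splittingNear_of_eventually he', by rw [he'.self_of_nhds, hX']⟩

/-- By tensoriality `e₂` may be replaced by `e + Ψ b` with `e` an invariant extension. Then `⟦Ψ a,
e⟧ = 0`, while `⟦Ψ a, Ψ b⟧` is again a value of `Ψ`, orthogonal to `e₃`. -/
theorem SplittingNear.pairing_bracket_Ψ_left {e₂ e₃ : Cₛ^∞⟮𝓘(ℝ, E); F, 𝓔⟯} {p : P}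
    (h₂ : SplittingNear hC hΦ hs hι hK hq e₂ p) (h₃ : SplittingNear hC hΦ hs hι hK hq e₃ p)
    (a : 𝔞) :
    C.pairing (ι p) (C.bracket (Φ.Ψ a) e₂ (ι p)) (e₃ (ι p)) = 0 := by
  obtain ⟨X, b, hX⟩ := (mem_splittingSpan hC hΦ hs hι hK hq).1 h₂.self_of_nhds
  obtain ⟨e, hinv, he, heX⟩ := exists_extension_vector hC hΦ hs hK hq p X
  rw [(splittingNear_Ψ hC hΦ hs hι hK hq a p).congr h₂
    (splittingNear_Ψ hC hΦ hs hι hK hq a p) (he.add (splittingNear_Ψ hC hΦ hs hι hK hq b p)) h₃ rfl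
    (by rw [hX, ← heX]; rfl) rfl, map_add, ContMDiffSection.coe_add, Pi.add_apply, map_add,
    bracket_Ψ_eq_zero a hinv, map_zero, zero_add, ← Φ.map_bracket]
  exact mem_Kperp.1 (splittingSpan_le_Kperp hC hΦ hs hι hK hq p h₃.self_of_nhds) _

theorem SplittingNear.pairing_bracket_Ψ_right {e₁ e₂ : Cₛ^∞⟮𝓘(ℝ, E); F, 𝓔⟯} {p : P}
    (h₁ : SplittingNear hC hΦ hs hι hK hq e₁ p) (h₂ : SplittingNear hC hΦ hs hι hK hq e₂ p)
    (a : 𝔞) :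
    C.pairing (ι p) (C.bracket e₁ e₂ (ι p)) (Φ.Ψ a (ι p)) = 0 := by
  rw [← (splittingNear_Ψ hC hΦ hs hι hK hq a p).rotate h₁ h₂]
  exact h₁.pairing_bracket_Ψ_left h₂ a

theorem SplittingNear.congr_mod_right {e₁ e₂ e₃ e₃' : Cₛ^∞⟮𝓘(ℝ, E); F, 𝓔⟯} {p : P}
    (h₁ : SplittingNear hC hΦ hs hι hK hq e₁ p) (h₂ : SplittingNear hC hΦ hs hι hK hq e₂ p)
    (h : e₃ (ι p) - e₃' (ι p) ∈ Φ.K (ι p)) :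
    C.pairing (ι p) (C.bracket e₁ e₂ (ι p)) (e₃ (ι p)) =
      C.pairing (ι p) (C.bracket e₁ e₂ (ι p)) (e₃' (ι p)) := by
  obtain ⟨a, ha⟩ := h
  have h0 := h₁.pairing_bracket_Ψ_right h₂ a
  change Φ.Ψ a (ι p) = _ at ha
  rw [ha, map_sub, sub_eq_zero] at h0
  exact h0

/-- The bracket followed by the pairing depends on the values modulo `K` only. -/
theorem SplittingNear.congr_mod {e₁ e₂ e₃ e₁' e₂' e₃' : Cₛ^∞⟮𝓘(ℝ, E); F, 𝓔⟯} {p : P}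
    (h₁ : SplittingNear hC hΦ hs hι hK hq e₁ p) (h₂ : SplittingNear hC hΦ hs hι hK hq e₂ p)
    (h₁' : SplittingNear hC hΦ hs hι hK hq e₁' p) (h₂' : SplittingNear hC hΦ hs hι hK hq e₂' p)
    (h₃' : SplittingNear hC hΦ hs hι hK hq e₃' p)
    (h1 : e₁ (ι p) - e₁' (ι p) ∈ Φ.K (ι p)) (h2 : e₂ (ι p) - e₂' (ι p) ∈ Φ.K (ι p))
    (h3 : e₃ (ι p) - e₃' (ι p) ∈ Φ.K (ι p)) :
    C.pairing (ι p) (C.bracket e₁ e₂ (ι p)) (e₃ (ι p)) =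
      C.pairing (ι p) (C.bracket e₁' e₂' (ι p)) (e₃' (ι p)) := by
  rw [h₁.congr_mod_right h₂ h3, h₁.rotate h₂ h₃', h₂.congr_mod_right h₃' h1, h₂.rotate h₃' h₁',
    h₃'.congr_mod_right h₁' h2, h₃'.rotate h₁' h₂']

end ReducedCurvature

/-! ### Transport of sections by the group. -/

section PushSection

theorem fibreCast_section_apply {x y : M} (h : x = y) (e : ∀ x, 𝓔 x) : fibreCast h (e x) = e y := by
  subst h; rfl

theorem fibreCast_act_section (g : G) {x y : M} (h : y = x) (h' : g • y = g • x)
    (e : Cₛ^∞⟮𝓘(ℝ, E); F, 𝓔⟯) :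
    fibreCast h' (Φ.act g y (e y)) = Φ.act g x (e x) := by
  subst h; rfl

/-- The image of a section under the action of `g`. -/
def pushSection (Φ : ExtendedAction C A) (g : G) (e : Cₛ^∞⟮𝓘(ℝ, E); F, 𝓔⟯) :
    Cₛ^∞⟮𝓘(ℝ, E); F, 𝓔⟯ where
  toFun x := fibreCast (smul_inv_smul g x) (Φ.act g (g⁻¹ • x) (e (g⁻¹ • x)))
  contMDiff_toFun := by
    have h1 : ContMDiff 𝓘(ℝ, E) (𝓘(ℝ, E).prod 𝓘(ℝ, F)) ∞
        (fun x => (⟨g⁻¹ • x, e (g⁻¹ • x)⟩ : TotalSpace F 𝓔)) :=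
      e.contMDiff.comp (contMDiff_smul_right EG g⁻¹)
    have h2 := Φ.act_smooth.comp ((contMDiff_const (c := g)).prodMk h1)
    convert h2 using 2 with x
    exact mk_fibreCast _ _

theorem pushSection_smul (g : G) (e : Cₛ^∞⟮𝓘(ℝ, E); F, 𝓔⟯) (x : M) :
    pushSection Φ g e (g • x) = Φ.act g x (e x) :=
  fibreCast_act_section g (inv_smul_smul g x) _ e

theorem pushSection_leaf (hι : IsLeaf EP Φ ι) (g : G) (e : Cₛ^∞⟮𝓘(ℝ, E); F, 𝓔⟯) (p : P) :
    pushSection Φ g e (ι (g • p)) = leafAct hι g p (e (ι p)) := by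
  rw [leafAct, LinearEquiv.trans_apply, ← pushSection_smul, fibreCast_section_apply]

/-- The group acts by automorphisms of the bracket and of the pairing. -/
theorem pairing_bracket_pushSection (hι : IsLeaf EP Φ ι) (g : G)
    (e₁ e₂ e₃ : Cₛ^∞⟮𝓘(ℝ, E); F, 𝓔⟯) (p : P) :
    C.pairing (ι (g • p)) (C.bracket (pushSection Φ g e₁) (pushSection Φ g e₂) (ι (g • p)))
      (pushSection Φ g e₃ (ι (g • p))) = C.pairing (ι p) (C.bracket e₁ e₂ (ι p)) (e₃ (ι p)) := by
  rw [hι.equivariant, Φ.act_bracket g e₁ e₂ _ _ (pushSection_smul g e₁) (pushSection_smul g e₂),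
    pushSection_smul, Φ.act_pairing]

theorem tendsto_inv_smul (EG : Type*) [NormedAddCommGroup EG] [NormedSpace ℝ EG]
    [ChartedSpace EG G] [ContMDiffSMul 𝓘(ℝ, EG) 𝓘(ℝ, EP) ∞ G P] (g : G) (p : P) :
    Tendsto (fun p' : P => g⁻¹ • p') (𝓝 (g • p)) (𝓝 p) := by
  have h := (contMDiff_smul_right (E := EP) EG g⁻¹ (M := P)).continuous.tendsto (g • p)
  rwa [inv_smul_smul] at h

end PushSection

/-! ### The reduced curvature as a smooth 3-form on the orbit space. -/

section ReducedCurvatureForm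

variable {ER : Type*} [NormedAddCommGroup ER] [NormedSpace ℝ ER] [FiniteDimensional ℝ ER]
  {R : Type*} [TopologicalSpace R] [ChartedSpace ER R] [IsManifold 𝓘(ℝ, ER) ∞ R] [T2Space R]
  {q : P → R}
  [ConnectedSpace G] [IsCancelSMul G P] [ProperSMul G P]
  (hC : C.IsExact) (hΦ : Φ.Preserves 𝓖) (hs : s.IsMetric 𝓖) (hι : IsLeaf EP Φ ι)
  (hK : IsotropicOver Φ ι) (hq : IsOrbitProjection G EP ER q)

/-- A section that near `p` extends an invariant lift of a section in the image of the metric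
splitting, with given value at `p`. -/
def vectorExtension (p : P) (X : TangentSpace 𝓘(ℝ, ER) (q p)) : Cₛ^∞⟮𝓘(ℝ, E); F, 𝓔⟯ :=
  Classical.choose (exists_extension_vector hC hΦ hs (hι := hι) hK hq p X)

theorem splittingNear_vectorExtension (p : P) (X : TangentSpace 𝓘(ℝ, ER) (q p)) :
    SplittingNear hC hΦ hs hι hK hq (vectorExtension hC hΦ hs hι hK hq p X) p :=
  (Classical.choose_spec (exists_extension_vector hC hΦ hs (hι := hι) hK hq p X)).2.1

theorem vectorExtension_apply (p : P) (X : TangentSpace 𝓘(ℝ, ER) (q p)) :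
    vectorExtension hC hΦ hs hι hK hq p X (ι p) = splittingRep hC hΦ hs hι hK hq p X :=
  (Classical.choose_spec (exists_extension_vector hC hΦ hs (hι := hι) hK hq p X)).2.2

/-- The curvature of the metric splitting of the reduced algebroid on three vectors. -/
def curvatureAt (p : P) (X Y Z : TangentSpace 𝓘(ℝ, ER) (q p)) : ℝ :=
  2 * C.pairing (ι p) (C.bracket (vectorExtension hC hΦ hs hι hK hq p X)
    (vectorExtension hC hΦ hs hι hK hq p Y) (ι p)) (vectorExtension hC hΦ hs hι hK hq p Z (ι p))

variable {hC hΦ hs hι hK hq}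

/-- The extensions used here need not be invariant. This freedom later allows sections lying over
arbitrary vector fields of the leaf. -/
theorem curvatureAt_eq {p : P} {X₁ X₂ X₃ : TangentSpace 𝓘(ℝ, ER) (q p)}
    {e₁ e₂ e₃ : Cₛ^∞⟮𝓘(ℝ, E); F, 𝓔⟯}
    (h₁ : SplittingNear hC hΦ hs hι hK hq e₁ p) (h₂ : SplittingNear hC hΦ hs hι hK hq e₂ p)
    (h1 : e₁ (ι p) - splittingRep hC hΦ hs hι hK hq p X₁ ∈ Φ.K (ι p))
    (h2 : e₂ (ι p) - splittingRep hC hΦ hs hι hK hq p X₂ ∈ Φ.K (ι p))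
    (h3 : e₃ (ι p) - splittingRep hC hΦ hs hι hK hq p X₃ ∈ Φ.K (ι p)) :
    curvatureAt hC hΦ hs hι hK hq p X₁ X₂ X₃ =
      2 * C.pairing (ι p) (C.bracket e₁ e₂ (ι p)) (e₃ (ι p)) := by
  rw [← vectorExtension_apply] at h1 h2 h3
  rw [curvatureAt, h₁.congr_mod h₂ (splittingNear_vectorExtension hC hΦ hs hι hK hq p X₁)
    (splittingNear_vectorExtension hC hΦ hs hι hK hq p X₂)
    (splittingNear_vectorExtension hC hΦ hs hι hK hq p X₃) h1 h2 h3]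

theorem curvatureAt_eq_of_eq {p : P} {X₁ X₂ X₃ : TangentSpace 𝓘(ℝ, ER) (q p)}
    {e₁ e₂ e₃ : Cₛ^∞⟮𝓘(ℝ, E); F, 𝓔⟯}
    (h₁ : SplittingNear hC hΦ hs hι hK hq e₁ p) (h₂ : SplittingNear hC hΦ hs hι hK hq e₂ p)
    (h1 : e₁ (ι p) = splittingRep hC hΦ hs hι hK hq p X₁)
    (h2 : e₂ (ι p) = splittingRep hC hΦ hs hι hK hq p X₂)
    (h3 : e₃ (ι p) = splittingRep hC hΦ hs hι hK hq p X₃) :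
    curvatureAt hC hΦ hs hι hK hq p X₁ X₂ X₃ =
      2 * C.pairing (ι p) (C.bracket e₁ e₂ (ι p)) (e₃ (ι p)) :=
  curvatureAt_eq h₁ h₂ (by rw [h1, sub_self]; exact Submodule.zero_mem _)
    (by rw [h2, sub_self]; exact Submodule.zero_mem _)
    (by rw [h3, sub_self]; exact Submodule.zero_mem _)

theorem curvatureAt_eq_of_eventually {p : P} {X₁ X₂ X₃ : VF ER R}
    {e₁ e₂ e₃ : Cₛ^∞⟮𝓘(ℝ, E); F, 𝓔⟯}
    (h₁ : ∀ᶠ p' in 𝓝 p, e₁ (ι p') = splittingRep hC hΦ hs hι hK hq p' (X₁ (q p')))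
    (h₂ : ∀ᶠ p' in 𝓝 p, e₂ (ι p') = splittingRep hC hΦ hs hι hK hq p' (X₂ (q p')))
    (h₃ : ∀ᶠ p' in 𝓝 p, e₃ (ι p') = splittingRep hC hΦ hs hι hK hq p' (X₃ (q p'))) :
    curvatureAt hC hΦ hs hι hK hq p (X₁ (q p)) (X₂ (q p)) (X₃ (q p)) =
      2 * C.pairing (ι p) (C.bracket e₁ e₂ (ι p)) (e₃ (ι p)) :=
  curvatureAt_eq_of_eq (splittingNear_of_eventually h₁) (splittingNear_of_eventually h₂)
    h₁.self_of_nhds h₂.self_of_nhds h₃.self_of_nhds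

variable (hC hΦ hs hι hK hq)

theorem curvatureAt_swap_left (p : P) (X Y Z : TangentSpace 𝓘(ℝ, ER) (q p)) :
    curvatureAt hC hΦ hs hι hK hq p X Y Z = -curvatureAt hC hΦ hs hι hK hq p Y X Z := by
  rw [curvatureAt, curvatureAt, (splittingNear_vectorExtension hC hΦ hs hι hK hq p X).swap_left
    (splittingNear_vectorExtension hC hΦ hs hι hK hq p Y)
    (splittingNear_vectorExtension hC hΦ hs hι hK hq p Z), mul_neg]

theorem curvatureAt_rotate (p : P) (X Y Z : TangentSpace 𝓘(ℝ, ER) (q p)) :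
    curvatureAt hC hΦ hs hι hK hq p X Y Z = curvatureAt hC hΦ hs hι hK hq p Y Z X := by
  rw [curvatureAt, curvatureAt, (splittingNear_vectorExtension hC hΦ hs hι hK hq p X).rotate
    (splittingNear_vectorExtension hC hΦ hs hι hK hq p Y)
    (splittingNear_vectorExtension hC hΦ hs hι hK hq p Z)]

theorem curvatureAt_add (p : P) (X Y Z Z' : TangentSpace 𝓘(ℝ, ER) (q p)) :
    curvatureAt hC hΦ hs hι hK hq p X Y (Z + Z') =
      curvatureAt hC hΦ hs hι hK hq p X Y Z + curvatureAt hC hΦ hs hι hK hq p X Y Z' := by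
  simp only [curvatureAt, vectorExtension_apply, map_add]
  ring

theorem curvatureAt_smul (p : P) (X Y Z : TangentSpace 𝓘(ℝ, ER) (q p)) (c : ℝ) :
    curvatureAt hC hΦ hs hι hK hq p X Y (c • Z) = c * curvatureAt hC hΦ hs hι hK hq p X Y Z := by
  simp only [curvatureAt, vectorExtension_apply, map_smul, smul_eq_mul]
  ring

theorem curvatureAt_self (p : P) (X Y : TangentSpace 𝓘(ℝ, ER) (q p)) :
    curvatureAt hC hΦ hs hι hK hq p X X Y = 0 := by
  have h := curvatureAt_swap_left hC hΦ hs hι hK hq p X X Y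
  linarith

/-- Pushing extensions at `p` forward by `g` gives extensions at `g • p`, because the
representatives of the splitting are equivariant. -/
theorem curvatureAt_smul_point (g : G) (p : P) (X Y Z : VF ER R) :
    curvatureAt hC hΦ hs hι hK hq (g • p) (X (q (g • p))) (Y (q (g • p))) (Z (q (g • p))) =
      curvatureAt hC hΦ hs hι hK hq p (X (q p)) (Y (q p)) (Z (q p)) := by
  obtain ⟨e₁, -, h₁⟩ := exists_extension hC hΦ hs (hι := hι) hK hq p X
  obtain ⟨e₂, -, h₂⟩ := exists_extension hC hΦ hs (hι := hι) hK hq p Y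
  obtain ⟨e₃, -, h₃⟩ := exists_extension hC hΦ hs (hι := hι) hK hq p Z
  have key : ∀ {X : VF ER R} {e : Cₛ^∞⟮𝓘(ℝ, E); F, 𝓔⟯},
      (∀ᶠ p' in 𝓝 p, e (ι p') = splittingRep hC hΦ hs hι hK hq p' (X (q p'))) →
      ∀ᶠ p' in 𝓝 (g • p), pushSection Φ g e (ι p') =
        splittingRep hC hΦ hs hι hK hq p' (X (q p')) := by
    intro X e he
    filter_upwards [(tendsto_inv_smul (EP := EP) EG g p).eventually he] with p' hp'
    have h := pushSection_leaf hι g e (g⁻¹ • p')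
    rw [hp', ← leafAct_splittingRep, smul_inv_smul] at h
    exact h
  rw [curvatureAt_eq_of_eventually (key h₁) (key h₂) (key h₃),
    curvatureAt_eq_of_eventually h₁ h₂ h₃, pairing_bracket_pushSection hι]

/-- Extensions chosen at one point compute the curvature at all nearby points. -/
theorem contMDiff_curvatureAt (X Y Z : VF ER R) :
    ContMDiff 𝓘(ℝ, EP) 𝓘(ℝ, ℝ) ∞
      (fun p => curvatureAt hC hΦ hs hι hK hq p (X (q p)) (Y (q p)) (Z (q p))) := by
  intro p
  obtain ⟨e₁, -, h₁⟩ := exists_extension hC hΦ hs (hι := hι) hK hq p X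
  obtain ⟨e₂, -, h₂⟩ := exists_extension hC hΦ hs (hι := hι) hK hq p Y
  obtain ⟨e₃, -, h₃⟩ := exists_extension hC hΦ hs (hι := hι) hK hq p Z
  have h : ContMDiff 𝓘(ℝ, EP) 𝓘(ℝ, ℝ) ∞
      (fun p => (2 : ℝ) • C.pairing (ι p) (C.bracket e₁ e₂ (ι p)) (e₃ (ι p))) :=
    (contMDiff_const (I := 𝓘(ℝ, EP)) (I' := 𝓘(ℝ, ℝ)) (c := (2 : ℝ))).smul
      ((C.pairing_smooth (C.bracket e₁ e₂) e₃).comp hι.immersion.contMDiff)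
  refine h.contMDiffAt.congr_of_eventuallyEq ?_
  filter_upwards [h₁.eventually_nhds, h₂.eventually_nhds, h₃.eventually_nhds] with p' k₁ k₂ k₃
  rw [curvatureAt_eq_of_eventually k₁ k₂ k₃, smul_eq_mul]

/-- The curvature of the metric splitting of the reduced algebroid at `q p`. -/
def curvatureMap (p : P) : (TangentSpace 𝓘(ℝ, ER) (q p)) [⋀^Fin 3]→ₗ[ℝ] ℝ where
  toFun v := curvatureAt hC hΦ hs hι hK hq p (v 0) (v 1) (v 2)
  map_update_add' := by
    intro inst v i X Y
    obtain rfl := Subsingleton.elim inst (instDecidableEqFin 3)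
    fin_cases i
    -- Linearity is clear only in the last slot; cyclic symmetry carries it to the other two.
    · simpa [curvatureAt_rotate hC hΦ hs hι hK hq p _ (v 1) (v 2)] using
        curvatureAt_add hC hΦ hs hι hK hq p (v 1) (v 2) X Y
    · simpa [← curvatureAt_rotate hC hΦ hs hι hK hq p (v 2) (v 0)] using
        curvatureAt_add hC hΦ hs hι hK hq p (v 2) (v 0) X Y
    · simpa using curvatureAt_add hC hΦ hs hι hK hq p (v 0) (v 1) X Y
  map_update_smul' := by
    intro inst v i c X
    obtain rfl := Subsingleton.elim inst (instDecidableEqFin 3)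
    fin_cases i
    · simpa [curvatureAt_rotate hC hΦ hs hι hK hq p _ (v 1) (v 2)] using
        curvatureAt_smul hC hΦ hs hι hK hq p (v 1) (v 2) X c
    · simpa [← curvatureAt_rotate hC hΦ hs hι hK hq p (v 2) (v 0)] using
        curvatureAt_smul hC hΦ hs hι hK hq p (v 2) (v 0) X c
    · simpa using curvatureAt_smul hC hΦ hs hι hK hq p (v 0) (v 1) X c
  map_eq_zero_of_eq' := by
    have h01 : ∀ v : Fin 3 → TangentSpace 𝓘(ℝ, ER) (q p), v 0 = v 1 →
        curvatureAt hC hΦ hs hι hK hq p (v 0) (v 1) (v 2) = 0 := fun v h => by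
      rw [h, curvatureAt_self]
    have h12 : ∀ v : Fin 3 → TangentSpace 𝓘(ℝ, ER) (q p), v 1 = v 2 →
        curvatureAt hC hΦ hs hι hK hq p (v 0) (v 1) (v 2) = 0 := fun v h => by
      rw [h, curvatureAt_rotate, curvatureAt_self]
    have h20 : ∀ v : Fin 3 → TangentSpace 𝓘(ℝ, ER) (q p), v 2 = v 0 →
        curvatureAt hC hΦ hs hι hK hq p (v 0) (v 1) (v 2) = 0 := fun v h => by
      rw [h, curvatureAt_rotate, curvatureAt_rotate, curvatureAt_self]
    intro v i j h hij
    fin_cases i <;> fin_cases j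
    · exact absurd rfl hij
    · exact h01 v h
    · exact h20 v h.symm
    · exact h01 v h.symm
    · exact absurd rfl hij
    · exact h12 v h
    · exact h20 v h
    · exact h12 v h.symm
    · exact absurd rfl hij

/-- The identification of the alternating forms at two equal points. -/
def formCast {r r' : R} (h : r = r') (f : (TangentSpace 𝓘(ℝ, ER) r) [⋀^Fin 3]→ₗ[ℝ] ℝ) :
    (TangentSpace 𝓘(ℝ, ER) r') [⋀^Fin 3]→ₗ[ℝ] ℝ := h ▸ f

theorem formCast_apply {r r' : R} (h : r = r')
    (f : (TangentSpace 𝓘(ℝ, ER) r) [⋀^Fin 3]→ₗ[ℝ] ℝ) (X Y Z : VF ER R) :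
    formCast h f ![X r', Y r', Z r'] = f ![X r, Y r, Z r] := by
  subst h; rfl

/-- The curvature of the metric splitting of the reduced algebroid, as an alternating form at a
point of the orbit space. -/
def orbitCurvature (r : R) : (TangentSpace 𝓘(ℝ, ER) r) [⋀^Fin 3]→ₗ[ℝ] ℝ :=
  formCast (Classical.choose_spec (hq.surjective r))
    (curvatureMap hC hΦ hs hι hK hq (Classical.choose (hq.surjective r)))

/-- The chosen point over `q p` and `p` lie in one orbit, along which the curvature is constant. -/
theorem orbitCurvature_apply (p : P) (X Y Z : VF ER R) :
    orbitCurvature hC hΦ hs hι hK hq (q p) ![X (q p), Y (q p), Z (q p)] =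
      curvatureAt hC hΦ hs hι hK hq p (X (q p)) (Y (q p)) (Z (q p)) := by
  rw [orbitCurvature, formCast_apply]
  obtain ⟨g, hg⟩ := (hq.fibres _ _).1 (Classical.choose_spec (hq.surjective (q p))).symm
  rw [← curvatureAt_smul_point hC hΦ hs hι hK hq g p X Y Z, hg]
  rfl

/-- The curvature of the metric splitting of the reduced algebroid. -/
def reducedCurvature : ThreeForm ER R where
  toFun := orbitCurvature hC hΦ hs hι hK hq
  smooth X Y Z := by
    refine contMDiff_of_comp_isSubmersion hq.submersion hq.surjective ?_
    simp only [orbitCurvature_apply]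
    exact contMDiff_curvatureAt hC hΦ hs hι hK hq X Y Z

theorem IsInvariantLift.sub_splittingRep_mem {X : VF ER R} {k : ∀ p, 𝓔 (ι p)}
    (h : IsInvariantLift hι (redLift (redSplitting hC hΦ hs hι hK hq) X) k) (p : P) :
    k p - splittingRep hC hΦ hs hι hK hq p (X (q p)) ∈ Φ.K (ι p) := by
  obtain ⟨hk, hkp⟩ := h.represents p
  exact (redClass_eq_iff hk (splittingRep_mem_Kperp hC hΦ hs hι hK hq p (X (q p)))).1 hkp

/-- The section witnessing the reduced bracket is the class of the bracket of chosen extensions. Any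
other extensions differ from these by `K` along the leaf, so their bracket has the same class. -/
theorem isRedCurvature_reducedCurvature :
    IsRedCurvature hι (redSplitting hC hΦ hs hι hK hq) (reducedCurvature hC hΦ hs hι hK hq) := by
  intro X Y Z
  choose e₁ h₁ k₁ using fun p => exists_extension hC hΦ hs (hι := hι) hK hq p X
  choose e₂ h₂ k₂ using fun p => exists_extension hC hΦ hs (hι := hι) hK hq p Y
  choose e₃ h₃ k₃ using fun p => exists_extension hC hΦ hs (hι := hι) hK hq p Z
  refine ⟨fun p => redClass (C.pairing (ι p)) (Φ.K (ι p)) (C.bracket (e₁ p) (e₂ p) (ι p))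
    (bracket_mem_Kperp (h₁ p).invariantNear (h₂ p).invariantNear.eventually_mem), fun p =>
    ⟨⟨e₁ p, h₁ p⟩, ⟨e₂ p, h₂ p⟩, fun e e' h h' => ⟨bracket_mem_Kperp h.invariantNear
      h'.invariantNear.eventually_mem, ?_⟩⟩, fun p => ?_⟩
  · refine (redClass_eq_iff _ _).2 (bracket_sub_bracket_mem_K hC hΦ hs hι hK hq h.invariantNear
      (h₁ p).invariantNear h'.invariantNear (h₂ p).invariantNear ?_ ?_)
    · obtain ⟨k, hk, hke⟩ := h
      filter_upwards [hke, k₁ p] with p' hp' hp''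
      rw [hp', hp'']
      exact hk.sub_splittingRep_mem hC hΦ hs hι hK hq p'
    · obtain ⟨k, hk, hke⟩ := h'
      filter_upwards [hke, k₂ p] with p' hp' hp''
      rw [hp', hp'']
      exact hk.sub_splittingRep_mem hC hΦ hs hι hK hq p'
  · refine (orbitCurvature_apply hC hΦ hs hι hK hq p X Y Z).trans ?_
    rw [curvatureAt_eq_of_eventually (k₁ p) (k₂ p) (k₃ p), (k₃ p).self_of_nhds]
    rfl

/-- The defining property speaks of vector fields on the orbit space. Every vector extends to one,
which pins the form down pointwise. -/
theorem IsRedCurvature.apply_eq {H : ThreeForm ER R}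
    (hH : IsRedCurvature hι (redSplitting hC hΦ hs hι hK hq) H) (p : P)
    (v : Fin 3 → TangentSpace 𝓘(ℝ, ER) (q p)) :
    H.toFun (q p) v = curvatureAt hC hΦ hs hι hK hq p (v 0) (v 1) (v 2) := by
  choose V hV using fun i => exists_section_eq (E := ER) (F := ER)
    (V := fun r : R => TangentSpace 𝓘(ℝ, ER) r) (v i)
  obtain ⟨e₁, h₁, k₁⟩ := exists_extension hC hΦ hs (hι := hι) hK hq p (V 0)
  obtain ⟨e₂, h₂, k₂⟩ := exists_extension hC hΦ hs (hι := hι) hK hq p (V 1)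
  obtain ⟨e₃, h₃, k₃⟩ := exists_extension hC hΦ hs (hι := hι) hK hq p (V 2)
  obtain ⟨σ, hσ, hHσ⟩ := hH (V 0) (V 1) (V 2)
  obtain ⟨-, -, hσp⟩ := hσ p
  obtain ⟨hmem, hσe⟩ := hσp e₁ e₂ h₁ h₂
  have hv : v = ![V 0 (q p), V 1 (q p), V 2 (q p)] := by
    funext i
    fin_cases i
    · exact (hV 0).symm
    · exact (hV 1).symm
    · exact (hV 2).symm
  have h4 := hHσ p
  rw [← hv, ← hσe] at h4
  rw [h4, ← hV 0, ← hV 1, ← hV 2, curvatureAt_eq_of_eventually k₁ k₂ k₃, k₃.self_of_nhds]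
  rfl

theorem IsRedCurvature.unique {H H' : ThreeForm ER R}
    (hH : IsRedCurvature hι (redSplitting hC hΦ hs hι hK hq) H)
    (hH' : IsRedCurvature hι (redSplitting hC hΦ hs hι hK hq) H') : H = H' := by
  have h : H.toFun = H'.toFun := by
    funext r
    obtain ⟨p, rfl⟩ := hq.surjective r
    ext v
    rw [hH.apply_eq, hH'.apply_eq]
  cases H
  cases H'
  cases h
  rfl

end ReducedCurvatureForm

/-! ### The 2-form `B`. -/

section Straightening

theorem xiForm_eq_sum (θ : PrincipalConnection EG G EP P) (p : P)
    (Y Z : TangentSpace 𝓘(ℝ, EP) p) :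
    ∑ i, (Module.finBasis ℝ (GroupLieAlgebra 𝓘(ℝ, EG) G)).repr (θ.toFun p Y) i *
      xi Φ s ι p (Module.finBasis ℝ (GroupLieAlgebra 𝓘(ℝ, EG) G) i) Z =
      xiForm Φ s ι p (θ.toFun p Y) Z := by
  conv_rhs => rw [← (Module.finBasis ℝ (GroupLieAlgebra 𝓘(ℝ, EG) G)).sum_repr (θ.toFun p Y)]
  rw [map_sum, LinearMap.sum_apply]
  refine Finset.sum_congr rfl fun i _ => ?_
  rw [map_smul, LinearMap.smul_apply, smul_eq_mul, xiForm_apply]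

theorem xiForm_infGen_eq_sum (θ : PrincipalConnection EG G EP P) (p : P)
    (γ : GroupLieAlgebra 𝓘(ℝ, EG) G) (Y : TangentSpace 𝓘(ℝ, EP) p) :
    ∑ i, (Module.finBasis ℝ (GroupLieAlgebra 𝓘(ℝ, EG) G)).repr (θ.toFun p Y) i *
      xiForm (EP := EP) Φ s ι p γ
        (infGen (Module.finBasis ℝ (GroupLieAlgebra 𝓘(ℝ, EG) G) i) p) =
      xiForm (EP := EP) Φ s ι p γ (infGen (θ.toFun p Y) p) := by
  conv_rhs => rw [← (Module.finBasis ℝ (GroupLieAlgebra 𝓘(ℝ, EG) G)).sum_repr (θ.toFun p Y)]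
  rw [← infGenMap_apply, map_sum, map_sum]
  refine Finset.sum_congr rfl fun i _ => ?_
  rw [map_smul, map_smul, smul_eq_mul, infGenMap_apply]

/-- The 2-form `B` without coordinates. -/
theorem straightening_eq (θ : PrincipalConnection EG G EP P) (p : P)
    (Y Z : TangentSpace 𝓘(ℝ, EP) p) :
    straightening Φ s ι θ p Y Z =
      xiForm Φ s ι p (θ.toFun p Y) Z - xiForm Φ s ι p (θ.toFun p Z) Y
      + (1 / 2) * (xiForm (EP := EP) Φ s ι p (θ.toFun p Z) (infGen (θ.toFun p Y) p)
        - xiForm (EP := EP) Φ s ι p (θ.toFun p Y) (infGen (θ.toFun p Z) p)) := by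
  have key : ∀ Y Z : TangentSpace 𝓘(ℝ, EP) p,
      ∑ i, ∑ j, xi (EP := EP) Φ s ι p (Module.finBasis ℝ (GroupLieAlgebra 𝓘(ℝ, EG) G) j)
        (infGen (Module.finBasis ℝ (GroupLieAlgebra 𝓘(ℝ, EG) G) i) p)
        * ((Module.finBasis ℝ (GroupLieAlgebra 𝓘(ℝ, EG) G)).repr (θ.toFun p Y) i
          * (Module.finBasis ℝ (GroupLieAlgebra 𝓘(ℝ, EG) G)).repr (θ.toFun p Z) j) =
      xiForm (EP := EP) Φ s ι p (θ.toFun p Z) (infGen (θ.toFun p Y) p) := by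
    intro Y Z
    rw [← xiForm_infGen_eq_sum]
    refine Finset.sum_congr rfl fun i _ => ?_
    rw [← xiForm_eq_sum, Finset.mul_sum]
    refine Finset.sum_congr rfl fun j _ => ?_
    ring
  simp only [straightening, mul_sub, Finset.sum_sub_distrib, xiForm_eq_sum]
  rw [key Y Z, key Z Y]

/-- Antisymmetry of `ξ_γ(X_γ')` merges the two halves of the quadratic term. -/
theorem straightening_eq_of_isotropic (hC : C.IsExact) (hι : IsLeaf EP Φ ι)
    (hK : IsotropicOver Φ ι) (θ : PrincipalConnection EG G EP P) (p : P)
    (Y Z : TangentSpace 𝓘(ℝ, EP) p) :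
    straightening Φ s ι θ p Y Z =
      xiForm Φ s ι p (θ.toFun p Y) Z - xiForm Φ s ι p (θ.toFun p Z) Y
      + xiForm (EP := EP) Φ s ι p (θ.toFun p Z) (infGen (θ.toFun p Y) p) := by
  rw [straightening_eq, xiForm_infGen hC hι hK p (θ.toFun p Y) (θ.toFun p Z)]
  ring

theorem straightening_swap (θ : PrincipalConnection EG G EP P) (p : P)
    (Y Z : TangentSpace 𝓘(ℝ, EP) p) :
    straightening Φ s ι θ p Y Z = -straightening Φ s ι θ p Z Y := by
  rw [straightening_eq, straightening_eq]
  ring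

/-- This property is what `B` is made for: since `i_{X_γ} B = ξ_γ`, elements `X_γ + ξ_γ` of `K` have
the form `Y + i_Y B`. The quadratic term cancels the unwanted `ξ_{θ(Z)}(X_γ)`. -/
theorem straightening_infGen (hC : C.IsExact) (hι : IsLeaf EP Φ ι)
    (hK : IsotropicOver Φ ι) (θ : PrincipalConnection EG G EP P) (p : P)
    (γ : GroupLieAlgebra 𝓘(ℝ, EG) G) (Z : TangentSpace 𝓘(ℝ, EP) p) :
    straightening (EP := EP) Φ s ι θ p (infGen γ p) Z = xiForm Φ s ι p γ Z := by
  rw [straightening_eq_of_isotropic hC hι hK, θ.vertical]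
  ring

theorem straightening_add_left (θ : PrincipalConnection EG G EP P) (p : P)
    (Y Y' Z : TangentSpace 𝓘(ℝ, EP) p) :
    straightening Φ s ι θ p (Y + Y') Z =
      straightening Φ s ι θ p Y Z + straightening Φ s ι θ p Y' Z := by
  simp only [straightening_eq, ← infGenMap_apply, map_add, LinearMap.add_apply]
  ring

theorem straightening_add_right (θ : PrincipalConnection EG G EP P) (p : P)
    (Y Z Z' : TangentSpace 𝓘(ℝ, EP) p) :
    straightening Φ s ι θ p Y (Z + Z') =
      straightening Φ s ι θ p Y Z + straightening Φ s ι θ p Y Z' := by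
  rw [straightening_swap, straightening_add_left, neg_add, ← straightening_swap,
    ← straightening_swap]

end Straightening

/-! ### The splitting span consists of elements of the form `Y + i_Y B`. -/

section SplittingPairing

variable {ER : Type*} [NormedAddCommGroup ER] [NormedSpace ℝ ER] [FiniteDimensional ℝ ER]
  {R : Type*} [TopologicalSpace R] [ChartedSpace ER R] [IsManifold 𝓘(ℝ, ER) ∞ R] [T2Space R]
  {q : P → R}
  [ConnectedSpace G] [IsCancelSMul G P] [ProperSMul G P]
  (hC : C.IsExact) (hΦ : Φ.Preserves 𝓖) (hs : s.IsMetric 𝓖) (hι : IsLeaf EP Φ ι)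
  (hK : IsotropicOver Φ ι) (hq : IsOrbitProjection G EP ER q)

/-- Half the difference of the lifts is the `τ_+`-lift minus the mean lift. This is vertical, and
`θ_+` of it is minus `θ_+` of the mean lift. -/
theorem half_sub_hlift (p : P) (X : TangentSpace 𝓘(ℝ, ER) (q p)) :
    (1 / 2 : ℝ) • (hlift hq (metricConnection s hC hΦ hs hι hK 1) p X
      - hlift hq (metricConnection s hC hΦ hs hι hK (-1)) p X) =
    infGen (-(metricConnection s hC hΦ hs hι hK 1).toFun p
      (meanHlift hC hΦ hs hι hK hq p X)) p := by
  have h1 : (1 / 2 : ℝ) • (hlift hq (metricConnection s hC hΦ hs hι hK 1) p X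
      - hlift hq (metricConnection s hC hΦ hs hι hK (-1)) p X) =
      hlift hq (metricConnection s hC hΦ hs hι hK 1) p X
        - meanHlift hC hΦ hs hι hK hq p X := by
    rw [meanHlift, LinearMap.smul_apply, LinearMap.add_apply]
    module
  obtain ⟨γ, hγ⟩ := exists_infGen_eq_of_tmap_eq_zero (EG := EG) hq (p := p)
    (Y := hlift hq (metricConnection s hC hΦ hs hι hK 1) p X
        - meanHlift hC hΦ hs hι hK hq p X) (by
      rw [map_sub, tmap_hlift, tmap_meanHlift, sub_self])
  have h2 := (metricConnection s hC hΦ hs hι hK 1).vertical p γ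
  rw [hγ, map_sub, connection_hlift, zero_sub] at h2
  rw [h1, h2, hγ]

/-- Split `W` into its vertical and `τ_+` parts. For vertical `W` the claim is membership of the
representative in `K^⊥`. For `W ∈ τ_+`, with `m` the mean lift, the left side is `g` of half the
difference of the lifts with `W`, that is `-g(X_{θ(m)}, W)`, which equals `ξ_{θ(m)}(W) = B(m, W)` by
the definition of `τ_+`. -/
theorem two_mul_pairing_splittingRep_splitting (p : P) (X : TangentSpace 𝓘(ℝ, ER) (q p))
    (W : TangentSpace 𝓘(ℝ, EP) p) :
    2 * C.pairing (ι p) (splittingRep hC hΦ hs hι hK hq p X)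
      (s.toFun (ι p) (tmap EP E ι p W)) =
    straightening Φ s ι (metricConnection s hC hΦ hs hι hK 1) p
      (meanHlift hC hΦ hs hι hK hq p X) W := by
  set θ := metricConnection s hC hΦ hs hι hK 1 with hθ
  set m := meanHlift hC hΦ hs hι hK hq p X with hm
  have hver : ∀ δ : GroupLieAlgebra 𝓘(ℝ, EG) G,
      2 * C.pairing (ι p) (splittingRep hC hΦ hs hι hK hq p X)
        (s.toFun (ι p) (tmap EP E ι p (infGen δ p))) =
      straightening (EP := EP) Φ s ι θ p m (infGen δ p) := by
    intro δ
    rw [straightening_swap, straightening_infGen hC hι hK]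
    have h := (mem_Kperp_iff hC hι hK s (anchor_splittingRep hC hΦ hs hι hK hq p X)).1
      (splittingRep_mem_Kperp hC hΦ hs hι hK hq p X) δ
    linarith
  have hhor : ∀ W : TangentSpace 𝓘(ℝ, EP) p, θ.toFun p W = 0 →
      2 * C.pairing (ι p) (splittingRep hC hΦ hs hι hK hq p X)
        (s.toFun (ι p) (tmap EP E ι p W)) = straightening Φ s ι θ p m W := by
    intro W hW
    have hW' : connPairing 𝓖 Φ s ι 1 p W = 0 := (connForm_eq_zero_iff hC hι hK).1 hW
    have h1 := LinearMap.congr_fun hW' (θ.toFun p m)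
    rw [connPairing_apply, LinearMap.zero_apply, one_mul] at h1
    have h2 := half_sub_hlift hC hΦ hs hι hK hq p X
    rw [straightening_eq_of_isotropic hC hι hK, hW, map_zero, LinearMap.zero_apply,
      LinearMap.zero_apply, sub_zero, add_zero, splittingRep_apply, map_smul, LinearMap.smul_apply,
      map_add, LinearMap.add_apply, smul_eq_mul, eigenHlift_apply, eigenHlift_apply]
    have h3 := two_mul_pairing_eigenLift_splitting (𝓖 := 𝓖) (s := s) 1
      (tmap EP E ι p (hlift hq θ p X)) (tmap EP E ι p W)
    have h4 := two_mul_pairing_eigenLift_splitting (𝓖 := 𝓖) (s := s) (-1)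
      (tmap EP E ι p (hlift hq (metricConnection s hC hΦ hs hι hK (-1)) p X)) (tmap EP E ι p W)
    have h5 := congrArg (fun Y => inducedMetricForm 𝓖 s (ι p) (tmap EP E ι p Y) (tmap EP E ι p W)) h2
    simp only [← infGenMap_apply, map_neg, map_smul, map_sub, LinearMap.neg_apply,
      LinearMap.smul_apply, LinearMap.sub_apply, smul_eq_mul, inducedMetricForm_apply] at h5
    rw [infGenMap_apply, inducedMetric_symm (tmap EP E ι p (infGen _ p))] at h5
    linarith
  have h1 := hver (θ.toFun p W)
  have h2 := hhor (W - infGen (θ.toFun p W) p) (by rw [map_sub, θ.vertical, sub_self])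
  have h3 : W = (W - infGen (θ.toFun p W) p) + infGen (θ.toFun p W) p := (sub_add_cancel _ _).symm
  rw [h3, straightening_add_right, ← h1, ← h2, map_add, map_add, map_add, mul_add]

/-- In the metric splitting, elements over `Y` in the preimage of the image of the reduced metric
splitting are of the form `Y + i_Y B`. -/
theorem two_mul_pairing_splittingSpan {p : P} {v : 𝓔 (ι p)}
    (hv : v ∈ splittingSpan hC hΦ hs hι hK hq p) {Y : TangentSpace 𝓘(ℝ, EP) p}
    (hY : C.anchor (ι p) v = tmap EP E ι p Y) (W : TangentSpace 𝓘(ℝ, EP) p) :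
    2 * C.pairing (ι p) v (s.toFun (ι p) (tmap EP E ι p W)) =
      straightening Φ s ι (metricConnection s hC hΦ hs hι hK 1) p Y W := by
  obtain ⟨X, a, rfl⟩ := (mem_splittingSpan hC hΦ hs hι hK hq).1 hv
  have h1 : Y = meanHlift hC hΦ hs hι hK hq p X + infGen (A.proj a) p := by
    apply hι.tmap_injective p
    rw [← hY, map_add, map_add, anchor_splittingRep, anchor_Ψ_leaf hι]
  rw [h1, straightening_add_left, straightening_infGen hC hι hK, LinearMap.map_add₂, mul_add,
    two_mul_pairing_splittingRep_splitting, two_mul_pairing_Ψ_splitting hC hι hK]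
  rfl

end SplittingPairing

/-! ### The curvature computed from sections `Y + i_Y B`. -/

section CurvatureFormula

/-- The section `β` lies in `T^*M` near `p` and restricts to the 1-form `2 b` on the leaf. -/
structure RepresentsForm (s : IsotropicSplitting C) (ι : P → M) (β : Cₛ^∞⟮𝓘(ℝ, E); F, 𝓔⟯)
    (b : ∀ p : P, TangentSpace 𝓘(ℝ, EP) p → ℝ) (p : P) : Prop where
  anchor_eq_zero : ∀ᶠ p' in 𝓝 p, C.anchor (ι p') (β (ι p')) = 0
  pairing_eq : ∀ᶠ p' in 𝓝 p, ∀ W : TangentSpace 𝓘(ℝ, EP) p',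
    2 * C.pairing (ι p') (β (ι p')) (s.toFun (ι p') (tmap EP E ι p' W)) = b p' W

theorem RepresentsForm.two_mul_pairing (hC : C.IsExact) {β : Cₛ^∞⟮𝓘(ℝ, E); F, 𝓔⟯}
    {b : ∀ p : P, TangentSpace 𝓘(ℝ, EP) p → ℝ} {p : P} (h : RepresentsForm s ι β b p) :
    ∀ᶠ p' in 𝓝 p, ∀ (v : 𝓔 (ι p')) (W : TangentSpace 𝓘(ℝ, EP) p'),
      C.anchor (ι p') v = tmap EP E ι p' W → 2 * C.pairing (ι p') (β (ι p')) v = b p' W := by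
  filter_upwards [h.anchor_eq_zero, h.pairing_eq] with p' h0 h1 v W hv
  rw [← h1, pairing_congr_anchor hC h0 (hv.trans (s.anchor_toFun _ _).symm)]

theorem RepresentsForm.dirDeriv_pairing (hC : C.IsExact) (hι : IsLeaf EP Φ ι)
    {β S : Cₛ^∞⟮𝓘(ℝ, E); F, 𝓔⟯}
    {b : ∀ p : P, TangentSpace 𝓘(ℝ, EP) p → ℝ} {p : P} (h : RepresentsForm s ι β b p)
    {Y : VF EP P} (hS : ∀ᶠ p' in 𝓝 p, C.anchor (ι p') (S (ι p')) = tmap EP E ι p' (Y p'))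
    (W : TangentSpace 𝓘(ℝ, EP) p) :
    2 * dirDeriv (fun y => C.pairing y (β y) (S y)) (ι p) (tmap EP E ι p W) =
      dirDeriv (fun p' => b p' (Y p')) p W := by
  have hd := C.pairing_smooth β S
  rw [← dirDeriv_const_mul (hd.mdifferentiableAt (by simp))]
  refine dirDeriv_leaf hι (contMDiff_const.mul hd) ?_ W
  filter_upwards [h.two_mul_pairing hC, hS] with p' h1 h2
  exact h1 _ _ h2

/-- The right side is `(L_Y b)(Z)`; it comes from invariance of the pairing. -/
theorem RepresentsForm.two_mul_pairing_bracket (hC : C.IsExact) (hι : IsLeaf EP Φ ι)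
    {β S T : Cₛ^∞⟮𝓘(ℝ, E); F, 𝓔⟯}
    {b : ∀ p : P, TangentSpace 𝓘(ℝ, EP) p → ℝ} {p : P} (h : RepresentsForm s ι β b p)
    {Y Z : VF EP P} (hS : ∀ᶠ p' in 𝓝 p, C.anchor (ι p') (S (ι p')) = tmap EP E ι p' (Y p'))
    (hT : ∀ᶠ p' in 𝓝 p, C.anchor (ι p') (T (ι p')) = tmap EP E ι p' (Z p')) :
    2 * C.pairing (ι p) (C.bracket S β (ι p)) (T (ι p)) =
      dirDeriv (fun p' => b p' (Z p')) p (Y p) - b p (mlieBracket 𝓘(ℝ, EP) Y Z p) := by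
  have h1 := C.invariant S β T (ι p)
  rw [hS.self_of_nhds] at h1
  have h2 := h.dirDeriv_pairing hC hι hT (Y p)
  have h3 := (h.two_mul_pairing hC).self_of_nhds _ _ (anchor_bracket_leaf hι hS hT)
  linarith

/-- The right side is `-db(Y, Z)`: the symmetric part of the bracket adds `Z b(Y)` to minus the Lie
derivative. -/
theorem RepresentsForm.two_mul_pairing_bracket_left (hC : C.IsExact) (hι : IsLeaf EP Φ ι)
    {β S T : Cₛ^∞⟮𝓘(ℝ, E); F, 𝓔⟯}
    {b : ∀ p : P, TangentSpace 𝓘(ℝ, EP) p → ℝ} {p : P} (h : RepresentsForm s ι β b p)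
    {Y Z : VF EP P} (hS : ∀ᶠ p' in 𝓝 p, C.anchor (ι p') (S (ι p')) = tmap EP E ι p' (Y p'))
    (hT : ∀ᶠ p' in 𝓝 p, C.anchor (ι p') (T (ι p')) = tmap EP E ι p' (Z p')) :
    2 * C.pairing (ι p) (C.bracket β S (ι p)) (T (ι p)) =
      dirDeriv (fun p' => b p' (Y p')) p (Z p) - dirDeriv (fun p' => b p' (Z p')) p (Y p)
        + b p (mlieBracket 𝓘(ℝ, EP) Y Z p) := by
  have h1 := pairing_bracket_add_swap C β S (ι p) (T (ι p))
  rw [hT.self_of_nhds] at h1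
  have h2 := h.dirDeriv_pairing hC hι hS (Z p)
  have h3 := h.two_mul_pairing_bracket hC hι hS hT
  linarith

/-- The `H`-twisted bracket of sections `Y_i + i_{Y_i} B` over the leaf. -/
theorem two_mul_pairing_bracket_eq (hC : C.IsExact) (hι : IsLeaf EP Φ ι)
    {H : ThreeForm E M} (hH : s.IsCurvature H)
    {B : ∀ p : P, TangentSpace 𝓘(ℝ, EP) p → TangentSpace 𝓘(ℝ, EP) p → ℝ}
    (hB : ∀ p Y Z, B p Y Z = -B p Z Y) {p : P} {e : Fin 3 → Cₛ^∞⟮𝓘(ℝ, E); F, 𝓔⟯}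
    {Y : Fin 3 → VF EP P}
    (he : ∀ i, ∀ᶠ p' in 𝓝 p, C.anchor (ι p') (e i (ι p')) = tmap EP E ι p' (Y i p'))
    (heB : ∀ i, ∀ᶠ p' in 𝓝 p, ∀ W : TangentSpace 𝓘(ℝ, EP) p',
      2 * C.pairing (ι p') (e i (ι p')) (s.toFun (ι p') (tmap EP E ι p' W)) = B p' (Y i p') W) :
    2 * C.pairing (ι p) (C.bracket (e 0) (e 1) (ι p)) (e 2 (ι p)) =
      H.toFun (ι p) ![tmap EP E ι p (Y 0 p), tmap EP E ι p (Y 1 p), tmap EP E ι p (Y 2 p)]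
      + extDerivTwo B (Y 0) (Y 1) (Y 2) p := by
  -- Each section is written as `s Y + β` with `β` a covector along the leaf restricting to `i_Y B`.
  -- Of the eight terms of the expansion, the one without `β` is `H`, the three with one `β` add up
  -- to `dB`, and the rest vanish.
  choose Y' hY' using fun i => extendsNear_VF (E := E) hι (Y i) p
  have hS : ∀ i, ∀ᶠ p' in 𝓝 p, C.anchor (ι p') (s.lift (Y' i) (ι p')) = tmap EP E ι p' (Y i p') := by
    intro i
    filter_upwards [hY' i] with p' hp'
    rw [lift_apply, s.anchor_toFun, hp']
  have hβ : ∀ i, RepresentsForm s ι (e i - s.lift (Y' i)) (fun p' => B p' (Y i p')) p := by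
    intro i
    constructor
    · filter_upwards [hS i, he i] with p' h1 h2
      rw [ContMDiffSection.coe_sub, Pi.sub_apply, map_sub, h1, h2, sub_self]
    · filter_upwards [heB i] with p' h1 W
      rw [ContMDiffSection.coe_sub, Pi.sub_apply, map_sub, LinearMap.sub_apply, lift_apply,
        s.isotropic, sub_zero, h1]
  have hdec : ∀ i, e i = s.lift (Y' i) + (e i - s.lift (Y' i)) := fun i =>
    (add_sub_cancel _ _).symm
  generalize hβe : (fun i => e i - s.lift (Y' i)) = β at *
  replace hβe : ∀ i, e i - s.lift (Y' i) = β i := fun i => congrFun hβe i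
  simp only [hβe] at hβ hdec
  have a0 := fun i => (hβ i).anchor_eq_zero
  have t1 : H.toFun (ι p) ![tmap EP E ι p (Y 0 p), tmap EP E ι p (Y 1 p), tmap EP E ι p (Y 2 p)] =
      2 * C.pairing (ι p) (C.bracket (s.lift (Y' 0)) (s.lift (Y' 1)) (ι p))
        (s.lift (Y' 2) (ι p)) := by
    rw [← hH, (hY' 0).self_of_nhds, (hY' 1).self_of_nhds, (hY' 2).self_of_nhds]
  have t2 := ((hβ 2).two_mul_pairing hC).self_of_nhds _ _ (anchor_bracket_leaf hι (hS 0) (hS 1))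
  have t3 := (hβ 1).two_mul_pairing_bracket hC hι (hS 0) (hS 2)
  have t4 := (hβ 0).two_mul_pairing_bracket_left hC hι (hS 1) (hS 2)
  have z1 : C.pairing (ι p) (C.bracket (s.lift (Y' 0)) (β 1) (ι p)) (β 2 (ι p)) = 0 :=
    pairing_eq_zero_of_anchor hC (anchor_bracket_leaf_eq_zero hι (hS 0) (a0 1)).1
      (a0 2).self_of_nhds
  have z2 : C.pairing (ι p) (C.bracket (β 0) (s.lift (Y' 1)) (ι p)) (β 2 (ι p)) = 0 :=
    pairing_eq_zero_of_anchor hC (anchor_bracket_leaf_eq_zero hι (hS 1) (a0 0)).2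
      (a0 2).self_of_nhds
  -- Seen along the leaf, the covector section `β 0` lies over the zero vector field.
  have a0' : ∀ᶠ p' in 𝓝 p, C.anchor (ι p') (β 0 (ι p')) = tmap EP E ι p' ((0 : VF EP P) p') :=
    (a0 0).mono fun p' h => h.trans (map_zero _).symm
  have z3 : C.pairing (ι p) (C.bracket (β 0) (β 1) (ι p)) (β 2 (ι p)) = 0 :=
    pairing_eq_zero_of_anchor hC (anchor_bracket_leaf_eq_zero hι a0' (a0 1)).1
      (a0 2).self_of_nhds
  have z4 : C.pairing (ι p) (C.bracket (β 0) (β 1) (ι p)) (s.lift (Y' 2) (ι p)) = 0 := by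
    -- Here the last entry is not a covector, so isotropy of `T^*M` does not apply directly.
    -- Invariance shifts the bracket onto it, leaving a derivative in the direction `π (β 0) = 0`
    -- and a pairing of two covectors.
    have h1 := C.invariant (β 0) (β 1) (s.lift (Y' 2)) (ι p)
    rw [pairing_eq_zero_of_anchor hC (a0 1).self_of_nhds
      (anchor_bracket_leaf_eq_zero hι (hS 2) (a0 0)).2, (a0 0).self_of_nhds] at h1
    have h2 : dirDeriv (fun y => C.pairing y (β 1 y) (s.lift (Y' 2) y)) (ι p)
      (0 : TangentSpace 𝓘(ℝ, E) (ι p)) = 0 := map_zero (mfderiv 𝓘(ℝ, E) 𝓘(ℝ, ℝ) _ (ι p))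
    linarith
  have hexp : C.pairing (ι p) (C.bracket (e 0) (e 1) (ι p)) (e 2 (ι p)) =
      C.pairing (ι p) (C.bracket (s.lift (Y' 0)) (s.lift (Y' 1)) (ι p)) (s.lift (Y' 2) (ι p))
      + C.pairing (ι p) (C.bracket (s.lift (Y' 0)) (s.lift (Y' 1)) (ι p)) (β 2 (ι p))
      + C.pairing (ι p) (C.bracket (s.lift (Y' 0)) (β 1) (ι p)) (s.lift (Y' 2) (ι p))
      + C.pairing (ι p) (C.bracket (s.lift (Y' 0)) (β 1) (ι p)) (β 2 (ι p))
      + C.pairing (ι p) (C.bracket (β 0) (s.lift (Y' 1)) (ι p)) (s.lift (Y' 2) (ι p))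
      + C.pairing (ι p) (C.bracket (β 0) (s.lift (Y' 1)) (ι p)) (β 2 (ι p))
      + C.pairing (ι p) (C.bracket (β 0) (β 1) (ι p)) (s.lift (Y' 2) (ι p))
      + C.pairing (ι p) (C.bracket (β 0) (β 1) (ι p)) (β 2 (ι p)) := by
    rw [hdec 0, hdec 1, hdec 2]
    simp only [map_add, LinearMap.add_apply, ContMDiffSection.coe_add, Pi.add_apply]
    ring
  rw [C.pairing_symm] at t2
  rw [hexp, z1, z2, z3, z4, t1, extDerivTwo, hB p (mlieBracket 𝓘(ℝ, EP) (Y 0) (Y 1) p),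
    hB p (mlieBracket 𝓘(ℝ, EP) (Y 0) (Y 2) p), hB p (mlieBracket 𝓘(ℝ, EP) (Y 1) (Y 2) p)]
  linarith

/-- A section of `K` over the leaf with smooth coefficients extends. -/
theorem exists_section_Ψ (hι : IsLeaf EP Φ ι) {γ : P → EG}
    (hγ : ContMDiff 𝓘(ℝ, EP) 𝓘(ℝ, EG) ∞ γ) (p : P) :
    ∃ e : Cₛ^∞⟮𝓘(ℝ, E); F, 𝓔⟯, ∀ᶠ p' in 𝓝 p,
      e (ι p') = Φ.Ψ (A.splitting (γ p' : GroupLieAlgebra 𝓘(ℝ, EG) G)) (ι p') := by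
  let b := Module.finBasis ℝ EG
  have hc : ∀ i, ∃ f : M → ℝ, ContMDiff 𝓘(ℝ, E) 𝓘(ℝ, ℝ) ∞ f ∧
      ∀ᶠ p' in 𝓝 p, f (ι p') = b.repr (γ p') i := by
    intro i
    have h1 : ContMDiff 𝓘(ℝ, EP) 𝓘(ℝ, ℝ) ∞ (fun p' => b.repr (γ p') i) :=
      (LinearMap.toContinuousLinearMap (𝕜 := ℝ) (E := EG) (F' := ℝ)
        (b.coord i)).contMDiff.comp hγ
    exact exists_function_extending hι.immersion
      (Eventually.of_forall fun p' => h1.contMDiffAt)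
  choose f hf hfc using hc
  let u : ∀ i, Cₛ^∞⟮𝓘(ℝ, E); F, 𝓔⟯ := fun i =>
    ⟨fun x => f i x • Φ.Ψ (A.splitting (b i : GroupLieAlgebra 𝓘(ℝ, EG) G)) x,
      (hf i).smul_section (Φ.Ψ _).contMDiff⟩
  have hu : ∀ (t : Finset (Fin (Module.finrank ℝ EG))) (x : M), (∑ i ∈ t, u i) x =
      ∑ i ∈ t, f i x • Φ.Ψ (A.splitting (b i : GroupLieAlgebra 𝓘(ℝ, EG) G)) x := by
    intro t x
    induction t using Finset.induction_on with
    | empty => simp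
    | insert a t ha ih =>
      rw [Finset.sum_insert ha, Finset.sum_insert ha, ContMDiffSection.coe_add, Pi.add_apply, ih]
      rfl
  refine ⟨∑ i, u i, ?_⟩
  have hfc' : ∀ᶠ p' in 𝓝 p, ∀ i, f i (ι p') = b.repr (γ p') i := eventually_all.2 hfc
  filter_upwards [hfc'] with p' hp'
  rw [hu]
  let L : EG →ₗ[ℝ] 𝓔 (ι p') :=
    { toFun := fun δ => Φ.Ψ (A.splitting (δ : GroupLieAlgebra 𝓘(ℝ, EG) G)) (ι p')
      map_add' := fun δ δ' => (congrArg (fun a => Φ.Ψ a (ι p')) (map_add A.splitting δ δ')).trans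
        (by rw [map_add]; rfl)
      map_smul' := fun c δ => (congrArg (fun a => Φ.Ψ a (ι p')) (map_smul A.splitting c δ)).trans
        (by rw [map_smul]; rfl) }
  have h2 : L (γ p') = ∑ i, b.repr (γ p') i • L (b i) := by
    conv_lhs => rw [← b.sum_repr (γ p')]
    simp only [map_sum, map_smul]
  refine Eq.trans ?_ h2.symm
  refine Finset.sum_congr rfl fun i _ => ?_
  rw [hp']
  rfl

theorem ExtendsNear.sub {Y Z : ∀ p : P, TangentSpace 𝓘(ℝ, EP) p} {p : P}
    (hY : ExtendsNear E ι Y p) (hZ : ExtendsNear E ι Z p) :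
    ExtendsNear E ι (fun p => Y p - Z p) p := by
  obtain ⟨Y', hY'⟩ := hY
  obtain ⟨Z', hZ'⟩ := hZ
  refine ⟨Y' - Z', ?_⟩
  filter_upwards [hY', hZ'] with p' h1 h2
  rw [ContMDiffSection.coe_sub, Pi.sub_apply, h1, h2, map_sub]

theorem extendsNear_infGen_of_contMDiff (hι : IsLeaf EP Φ ι)
    {γ : P → GroupLieAlgebra 𝓘(ℝ, EG) G}
    (hγ : ContMDiff (M' := EG) 𝓘(ℝ, EP) 𝓘(ℝ, EG) ∞ γ) (p : P) :
    ExtendsNear E ι (fun p => (infGen (γ p) p : TangentSpace 𝓘(ℝ, EP) p)) p := by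
  obtain ⟨e, he⟩ := exists_section_Ψ hι hγ p
  refine ⟨anchorVF C e, ?_⟩
  filter_upwards [he] with p' hp'
  rw [anchorVF_apply, hp', anchor_Ψ_leaf hι, ExactCourantAlgebra.proj_splitting]

end CurvatureFormula

/-! ### The reduced curvature pulled back to the leaf. -/

section PullBack

variable {ER : Type*} [NormedAddCommGroup ER] [NormedSpace ℝ ER] [FiniteDimensional ℝ ER]
  {R : Type*} [TopologicalSpace R] [ChartedSpace ER R] [IsManifold 𝓘(ℝ, ER) ∞ R] [T2Space R]
  {q : P → R}
  [ConnectedSpace G] [IsCancelSMul G P] [ProperSMul G P]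
  (hC : C.IsExact) (hΦ : Φ.Preserves 𝓖) (hs : s.IsMetric 𝓖) (hι : IsLeaf EP Φ ι)
  (hK : IsotropicOver Φ ι) (hq : IsOrbitProjection G EP ER q)

theorem hlift_tmap (hq : IsOrbitProjection G EP ER q) (θ : PrincipalConnection EG G EP P) (p : P)
    (Y : TangentSpace 𝓘(ℝ, EP) p) :
    hlift hq θ p (tmap EP ER q p Y) = Y - infGen (θ.toFun p Y) p := by
  refine hlift_eq hq θ ?_ ?_
  · rw [map_sub, tmap_orbit_infGen hq, sub_zero]
  · rw [map_sub, θ.vertical, sub_self]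

/-- Every vector field on the leaf is covered by a section in the preimage of the image of the
metric splitting. -/
theorem exists_splittingNear (Y : VF EP P) (p : P) :
    ∃ e : Cₛ^∞⟮𝓘(ℝ, E); F, 𝓔⟯, SplittingNear hC hΦ hs hι hK hq e p ∧
      e (ι p) - splittingRep hC hΦ hs hι hK hq p (tmap EP ER q p (Y p)) ∈ Φ.K (ι p) ∧
      ∀ᶠ p' in 𝓝 p, C.anchor (ι p') (e (ι p')) = tmap EP E ι p' (Y p') := by
  have hpart : ∀ ε : ℝ, ∃ e : Cₛ^∞⟮𝓘(ℝ, E); F, 𝓔⟯, ∀ᶠ p' in 𝓝 p,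
      e (ι p') = eigenHlift hC hΦ hs hι hK hq ε p' (tmap EP ER q p' (Y p')) := by
    intro ε
    obtain ⟨e, he⟩ := exists_section_eigenLift (𝓖 := 𝓖) (s := s) ε
      ((extendsNear_VF hι Y p).sub (extendsNear_infGen_of_contMDiff hι
        ((metricConnection s hC hΦ hs hι hK ε).smooth Y) p))
    refine ⟨e, ?_⟩
    filter_upwards [he] with p' hp'
    rw [hp', eigenHlift_apply, hlift_tmap]
  obtain ⟨e₁, h₁⟩ := hpart 1
  obtain ⟨e₂, h₂⟩ := hpart (-1)
  -- The horizontal lifts of `dq Y` are `Y - X_{θ_±(Y)}`. Their mean misses `Y` by the generator of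
  -- the mean of `θ_+(Y)` and `θ_-(Y)`, which this section of `K` supplies.
  obtain ⟨e₃, h₃⟩ := exists_section_Ψ hι (γ := fun p => (1 / 2 : ℝ) •
      ((metricConnection s hC hΦ hs hι hK 1).toFun p (Y p)
        + (metricConnection s hC hΦ hs hι hK (-1)).toFun p (Y p) : EG))
    (((1 / 2 : ℝ) • ContinuousLinearMap.id ℝ EG).contMDiff.comp
      (((metricConnection s hC hΦ hs hι hK 1).smooth Y).add
        ((metricConnection s hC hΦ hs hι hK (-1)).smooth Y))) p
  have hval : ∀ᶠ p' in 𝓝 p, ((1 / 2 : ℝ) • (e₁ + e₂) + e₃) (ι p') =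
      splittingRep hC hΦ hs hι hK hq p' (tmap EP ER q p' (Y p')) + Φ.Ψ (A.splitting
        ((1 / 2 : ℝ) • ((metricConnection s hC hΦ hs hι hK 1).toFun p' (Y p')
          + (metricConnection s hC hΦ hs hι hK (-1)).toFun p' (Y p')))) (ι p') := by
    filter_upwards [h₁, h₂, h₃] with p' k₁ k₂ k₃
    rw [ContMDiffSection.coe_add, Pi.add_apply, k₃, splittingRep_apply, ← k₁, ← k₂]
    rfl
  refine ⟨(1 / 2 : ℝ) • (e₁ + e₂) + e₃, ?_, ?_, ?_⟩
  · filter_upwards [hval] with p' hp'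
    exact (mem_splittingSpan hC hΦ hs hι hK hq).2 ⟨_, _, hp'⟩
  · rw [hval.self_of_nhds, add_sub_cancel_left]
    exact Ψ_mem_K _ _
  · filter_upwards [hval] with p' hp'
    rw [hp', map_add, anchor_splittingRep, anchor_Ψ_leaf hι, ExactCourantAlgebra.proj_splitting,
      ← map_add, meanHlift, LinearMap.smul_apply, LinearMap.add_apply, hlift_tmap, hlift_tmap]
    congr 1
    rw [← infGenMap_apply, ← infGenMap_apply, ← infGenMap_apply, map_smul, map_add]
    module

/-- The curvature of the metric splitting of the reduced algebroid, pulled back to the leaf. -/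
theorem curvatureAt_tmap {H : ThreeForm E M} (hH : s.IsCurvature H) (Y₁ Y₂ Y₃ : VF EP P) (p : P) :
    curvatureAt hC hΦ hs hι hK hq p (tmap EP ER q p (Y₁ p)) (tmap EP ER q p (Y₂ p))
      (tmap EP ER q p (Y₃ p)) =
    H.toFun (ι p) ![tmap EP E ι p (Y₁ p), tmap EP E ι p (Y₂ p), tmap EP E ι p (Y₃ p)]
      + extDerivTwo (straightening Φ s ι (metricConnection s hC hΦ hs hι hK 1)) Y₁ Y₂ Y₃ p := by
  choose e he hep hea using
    fun i => exists_splittingNear hC hΦ hs hι hK hq ((![Y₁, Y₂, Y₃] : Fin 3 → VF EP P) i) p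
  refine (curvatureAt_eq (he 0) (he 1) (hep 0) (hep 1) (hep 2)).trans ?_
  refine two_mul_pairing_bracket_eq hC hι hH (straightening_swap _) hea fun i => ?_
  filter_upwards [he i, hea i] with p' h1 h2 W
  exact two_mul_pairing_splittingSpan hC hΦ hs hι hK hq h1 h2 W

end PullBack

/-! ### The exterior derivative of `B` on horizontal vectors. -/

section Horizontal

theorem xiForm_eq_sum_basis (p : P) (γ : GroupLieAlgebra 𝓘(ℝ, EG) G)
    (Z : TangentSpace 𝓘(ℝ, EP) p) :
    xiForm Φ s ι p γ Z = ∑ i, (Module.finBasis ℝ (GroupLieAlgebra 𝓘(ℝ, EG) G)).repr γ i *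
      xiForm Φ s ι p (Module.finBasis ℝ (GroupLieAlgebra 𝓘(ℝ, EG) G) i) Z := by
  conv_lhs => rw [← (Module.finBasis ℝ (GroupLieAlgebra 𝓘(ℝ, EG) G)).sum_repr γ]
  rw [map_sum, LinearMap.sum_apply]
  refine Finset.sum_congr rfl fun i _ => ?_
  rw [map_smul, LinearMap.smul_apply, smul_eq_mul]

/-- The derivative of a function with values in the Lie algebra. -/
def algebraDeriv (γ : P → GroupLieAlgebra 𝓘(ℝ, EG) G) (p : P) (v : TangentSpace 𝓘(ℝ, EP) p) :
    GroupLieAlgebra 𝓘(ℝ, EG) G :=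
  dirDeriv (W := EG) γ p v

theorem mdifferentiableAt_repr {γ : P → GroupLieAlgebra 𝓘(ℝ, EG) G} {p : P}
    (hγ : MDifferentiableAt (M' := EG) 𝓘(ℝ, EP) 𝓘(ℝ, EG) γ p)
    (i : Fin (Module.finrank ℝ (GroupLieAlgebra 𝓘(ℝ, EG) G))) :
    MDifferentiableAt 𝓘(ℝ, EP) 𝓘(ℝ, ℝ)
      (fun p' => (Module.finBasis ℝ (GroupLieAlgebra 𝓘(ℝ, EG) G)).repr (γ p') i) p :=
  (LinearMap.toContinuousLinearMap (𝕜 := ℝ) (E := EG) (F' := ℝ)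
    ((Module.finBasis ℝ (GroupLieAlgebra 𝓘(ℝ, EG) G)).coord i)).mdifferentiableAt.comp p hγ

theorem dirDeriv_repr {γ : P → GroupLieAlgebra 𝓘(ℝ, EG) G} {p : P}
    (hγ : MDifferentiableAt (M' := EG) 𝓘(ℝ, EP) 𝓘(ℝ, EG) γ p)
    (i : Fin (Module.finrank ℝ (GroupLieAlgebra 𝓘(ℝ, EG) G))) (v : TangentSpace 𝓘(ℝ, EP) p) :
    dirDeriv (fun p' => (Module.finBasis ℝ (GroupLieAlgebra 𝓘(ℝ, EG) G)).repr (γ p') i) p v =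
      (Module.finBasis ℝ (GroupLieAlgebra 𝓘(ℝ, EG) G)).repr
        (algebraDeriv γ p v) i :=
  dirDeriv_clm (LinearMap.toContinuousLinearMap (𝕜 := ℝ) (E := EG) (F' := ℝ)
    ((Module.finBasis ℝ (GroupLieAlgebra 𝓘(ℝ, EG) G)).coord i)) hγ v

theorem mdifferentiableAt_xiForm (hι : IsLeaf EP Φ ι) {γ : P → GroupLieAlgebra 𝓘(ℝ, EG) G} {p : P}
    (hγ : MDifferentiableAt (M' := EG) 𝓘(ℝ, EP) 𝓘(ℝ, EG) γ p)
    {Z : ∀ p : P, TangentSpace 𝓘(ℝ, EP) p} (hZ : ExtendsNear E ι Z p) :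
    MDifferentiableAt 𝓘(ℝ, EP) 𝓘(ℝ, ℝ) (fun p' => xiForm Φ s ι p' (γ p') (Z p')) p := by
  simp only [fun p' => xiForm_eq_sum_basis (Φ := Φ) (s := s) (ι := ι) p' (γ p') (Z p')]
  exact mdifferentiableAt_sum _ fun i _ => (mdifferentiableAt_repr hγ i).mul
    ((contMDiffAt_xiForm hι _ hZ).mdifferentiableAt (by simp))

/-- At a zero of `γ` the product rule keeps only the derivative of `γ`. -/
theorem dirDeriv_xiForm (hι : IsLeaf EP Φ ι) {γ : P → GroupLieAlgebra 𝓘(ℝ, EG) G} {p : P}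
    (hγ : MDifferentiableAt (M' := EG) 𝓘(ℝ, EP) 𝓘(ℝ, EG) γ p) (hγp : γ p = 0)
    {Z : ∀ p : P, TangentSpace 𝓘(ℝ, EP) p} (hZ : ExtendsNear E ι Z p)
    (v : TangentSpace 𝓘(ℝ, EP) p) :
    dirDeriv (fun p' => xiForm Φ s ι p' (γ p') (Z p')) p v =
      xiForm Φ s ι p (algebraDeriv γ p v) (Z p) := by
  simp only [fun p' => xiForm_eq_sum_basis (Φ := Φ) (s := s) (ι := ι) p' (γ p') (Z p')]
  have hξ : ∀ i, MDifferentiableAt 𝓘(ℝ, EP) 𝓘(ℝ, ℝ) (fun p' => xiForm Φ s ι p'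
      (Module.finBasis ℝ (GroupLieAlgebra 𝓘(ℝ, EG) G) i) (Z p')) p := fun i =>
    (contMDiffAt_xiForm hι _ hZ).mdifferentiableAt (by simp)
  have hprod : ∀ i, MDifferentiableAt 𝓘(ℝ, EP) 𝓘(ℝ, ℝ) (fun p' =>
      (Module.finBasis ℝ (GroupLieAlgebra 𝓘(ℝ, EG) G)).repr (γ p') i * xiForm Φ s ι p'
        (Module.finBasis ℝ (GroupLieAlgebra 𝓘(ℝ, EG) G) i) (Z p')) p := fun i =>
    (mdifferentiableAt_repr hγ i).mul (hξ i)
  rw [dirDeriv_sum _ fun i _ => hprod i, xiForm_eq_sum_basis]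
  refine Finset.sum_congr rfl fun i _ => ?_
  rw [dirDeriv_mul (mdifferentiableAt_repr hγ i) (hξ i), dirDeriv_repr hγ, hγp, map_zero,
    Finsupp.zero_apply, zero_mul, zero_add, mul_comm]

/-- The derivative of `B(Y, Z)` at a point where `Y` and `Z` are horizontal. -/
theorem dirDeriv_straightening (hC : C.IsExact) (hι : IsLeaf EP Φ ι) (hK : IsotropicOver Φ ι)
    (θ : PrincipalConnection EG G EP P) {Y Z : VF EP P} {p : P}
    (hY : θ.toFun p (Y p) = 0) (hZ : θ.toFun p (Z p) = 0) (v : TangentSpace 𝓘(ℝ, EP) p) :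
    dirDeriv (fun p' => straightening Φ s ι θ p' (Y p') (Z p')) p v =
      xiForm Φ s ι p (algebraDeriv (fun p' => θ.toFun p' (Y p')) p v) (Z p)
      - xiForm Φ s ι p (algebraDeriv (fun p' => θ.toFun p' (Z p')) p v) (Y p) := by
  have hd : ∀ Y : VF EP P, MDifferentiableAt (M' := EG) 𝓘(ℝ, EP) 𝓘(ℝ, EG)
      (fun p' => θ.toFun p' (Y p')) p := fun Y => (θ.smooth Y).mdifferentiableAt (by simp)
  have hv := extendsNear_infGen_of_contMDiff hι (θ.smooth Y) p
  have hf := mdifferentiableAt_xiForm (s := s) hι (hd Y) (extendsNear_VF hι Z p)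
  have hg := mdifferentiableAt_xiForm (s := s) hι (hd Z) (extendsNear_VF hι Y p)
  have hh := mdifferentiableAt_xiForm (s := s) hι (hd Z) hv
  have hfg : MDifferentiableAt 𝓘(ℝ, EP) 𝓘(ℝ, ℝ) (fun p' =>
      xiForm Φ s ι p' (θ.toFun p' (Y p')) (Z p') - xiForm Φ s ι p' (θ.toFun p' (Z p')) (Y p')) p :=
    hf.sub hg
  -- The last term of `B` has the generator of `θ(Y)` in the second slot of `ξ`. That generator
  -- vanishes at `p`, so the term has zero derivative there.
  simp only [straightening_eq_of_isotropic hC hι hK]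
  rw [dirDeriv_add hfg hh, dirDeriv_sub hf hg, dirDeriv_xiForm hι (hd Y) hY (extendsNear_VF hι Z p),
    dirDeriv_xiForm hι (hd Z) hZ (extendsNear_VF hι Y p), dirDeriv_xiForm hι (hd Z) hZ hv, hY,
    ← infGenMap_apply, map_zero, map_zero, add_zero]

theorem straightening_of_horizontal (hC : C.IsExact) (hι : IsLeaf EP Φ ι) (hK : IsotropicOver Φ ι)
    (θ : PrincipalConnection EG G EP P) {p : P} (Y : TangentSpace 𝓘(ℝ, EP) p)
    {Z : TangentSpace 𝓘(ℝ, EP) p} (hZ : θ.toFun p Z = 0) :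
    straightening Φ s ι θ p Y Z = xiForm Φ s ι p (θ.toFun p Y) Z := by
  rw [straightening_eq_of_isotropic hC hι hK, hZ, map_zero, LinearMap.zero_apply,
    LinearMap.zero_apply, sub_zero, add_zero]

/-- At a point where `Y` is horizontal the algebraic bracket in the curvature vanishes and only `dθ`
is left. -/
theorem xiForm_curvature (θ : PrincipalConnection EG G EP P) {Y Z : VF EP P} {p : P}
    (hY : θ.toFun p (Y p) = 0) (W : TangentSpace 𝓘(ℝ, EP) p) :
    xi Φ s ι p (θ.curvature Y Z p) W =
      xiForm Φ s ι p (algebraDeriv (fun p' => θ.toFun p' (Z p')) p (Y p)) W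
      - xiForm Φ s ι p (algebraDeriv (fun p' => θ.toFun p' (Y p')) p (Z p)) W
      - xiForm Φ s ι p (θ.toFun p (mlieBracket 𝓘(ℝ, EP) Y Z p)) W := by
  have h1 : θ.curvature Y Z p =
      (algebraDeriv (fun p' => θ.toFun p' (Z p')) p (Y p)
        - algebraDeriv (fun p' => θ.toFun p' (Y p')) p (Z p)
        - θ.toFun p (mlieBracket 𝓘(ℝ, EP) Y Z p)) + ⁅θ.toFun p (Y p), θ.toFun p (Z p)⁆ := rfl
  rw [hY, zero_lie, add_zero] at h1
  rw [← xiForm_apply, h1, map_sub, map_sub, LinearMap.sub_apply, LinearMap.sub_apply]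

/-- On horizontal vectors, `dB = ⟨F, ξ⟩`. -/
theorem extDerivTwo_straightening (hC : C.IsExact) (hι : IsLeaf EP Φ ι) (hK : IsotropicOver Φ ι)
    (θ : PrincipalConnection EG G EP P) {Y₁ Y₂ Y₃ : VF EP P} {p : P}
    (h₁ : θ.toFun p (Y₁ p) = 0) (h₂ : θ.toFun p (Y₂ p) = 0) (h₃ : θ.toFun p (Y₃ p) = 0) :
    extDerivTwo (straightening Φ s ι θ) Y₁ Y₂ Y₃ p = curvaturePairing Φ s ι θ Y₁ Y₂ Y₃ p := by
  have hswap : mlieBracket 𝓘(ℝ, EP) Y₃ Y₁ p = -mlieBracket 𝓘(ℝ, EP) Y₁ Y₃ p :=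
    mlieBracket_swap_apply
  rw [extDerivTwo, curvaturePairing, xiForm_curvature θ h₁, xiForm_curvature θ h₂,
    xiForm_curvature θ h₃, dirDeriv_straightening hC hι hK θ h₂ h₃,
    dirDeriv_straightening hC hι hK θ h₁ h₃, dirDeriv_straightening hC hι hK θ h₁ h₂,
    straightening_of_horizontal hC hι hK θ _ h₁, straightening_of_horizontal hC hι hK θ _ h₂,
    straightening_of_horizontal hC hι hK θ _ h₃, hswap, map_neg, map_neg, LinearMap.neg_apply]
  ring

end Horizontal

end Reduction

end CourantReduction

end

/-! ### The reduction theorem. -/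

theorem mainTheorem7
    {EM : Type*} [NormedAddCommGroup EM] [NormedSpace ℝ EM] [FiniteDimensional ℝ EM]
    {M : Type*} [TopologicalSpace M] [ChartedSpace EM M] [IsManifold 𝓘(ℝ, EM) ∞ M]
    [T2Space M] [SecondCountableTopology M]
    {F : Type*} [NormedAddCommGroup F] [NormedSpace ℝ F] [FiniteDimensional ℝ F]
    {𝓔 : M → Type*} [TopologicalSpace (TotalSpace F 𝓔)] [∀ x, AddCommGroup (𝓔 x)]
    [∀ x, Module ℝ (𝓔 x)] [∀ x, TopologicalSpace (𝓔 x)] [FiberBundle F 𝓔] [VectorBundle ℝ F 𝓔]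
    [ContMDiffVectorBundle ∞ F 𝓔 𝓘(ℝ, EM)]
    {EG : Type*} [NormedAddCommGroup EG] [NormedSpace ℝ EG] [FiniteDimensional ℝ EG]
    {G : Type*} [TopologicalSpace G] [ChartedSpace EG G] [Group G] [LieGroup 𝓘(ℝ, EG) ∞ G]
    [ConnectedSpace G] [T2Space G]
    [MulAction G M] [ContMDiffSMul 𝓘(ℝ, EG) 𝓘(ℝ, EM) ∞ G M]
    {𝔞 : Type*} [AddCommGroup 𝔞] [Module ℝ 𝔞]
    {EP : Type*} [NormedAddCommGroup EP] [NormedSpace ℝ EP] [FiniteDimensional ℝ EP]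
    {P : Type*} [TopologicalSpace P] [ChartedSpace EP P] [IsManifold 𝓘(ℝ, EP) ∞ P]
    [T2Space P] [SecondCountableTopology P]
    [MulAction G P] [ContMDiffSMul 𝓘(ℝ, EG) 𝓘(ℝ, EP) ∞ G P] [IsCancelSMul G P] [ProperSMul G P]
    {ER : Type*} [NormedAddCommGroup ER] [NormedSpace ℝ ER] [FiniteDimensional ℝ ER]
    {R : Type*} [TopologicalSpace R] [ChartedSpace ER R] [IsManifold 𝓘(ℝ, ER) ∞ R]
    [T2Space R] [SecondCountableTopology R]
    (C : CourantAlgebroid EM F 𝓔) (hC : C.IsExact) (𝓖 : GeneralizedMetric C)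
    (A : ExactCourantAlgebra (GroupLieAlgebra 𝓘(ℝ, EG) G) 𝔞) (Φ : ExtendedAction C A)
    (hΦ : Φ.Preserves 𝓖)
    (ι : P → M) (hι : IsLeaf EP Φ ι) (hK : IsotropicOver Φ ι)
    (q : P → R) (hq : IsOrbitProjection G EP ER q)
    (s : IsotropicSplitting C) (hs : s.IsMetric 𝓖)
    (H : ThreeForm EM M) (hH : s.IsCurvature H) :
    (∃! θ : PrincipalConnection EG G EP P,
      ∀ p, {Y | θ.toFun p Y = 0} = tauPlus 𝓖 Φ s ι p) ∧
    (∃! t : ∀ p, TangentSpace 𝓘(ℝ, ER) (q p) →ₗ[ℝ] RedFibre Φ (ι p),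
      IsRedMetricSplitting 𝓖 hι hK hq t) ∧
    ∀ (θ : PrincipalConnection EG G EP P)
      (t : ∀ p, TangentSpace 𝓘(ℝ, ER) (q p) →ₗ[ℝ] RedFibre Φ (ι p)),
      (∀ p, {Y | θ.toFun p Y = 0} = tauPlus 𝓖 Φ s ι p) →
      IsRedMetricSplitting 𝓖 hι hK hq t →
      (∃! Hred : ThreeForm ER R, IsRedCurvature hι t Hred) ∧
      ∀ Hred : ThreeForm ER R, IsRedCurvature hι t Hred →
        ∀ (Y₁ Y₂ Y₃ : VF EP P) (p : P),
          Hred.toFun (q p)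
              ![tmap EP ER q p (Y₁ p), tmap EP ER q p (Y₂ p), tmap EP ER q p (Y₃ p)] =
            H.toFun (ι p)
              ![tmap EP EM ι p (Y₁ p), tmap EP EM ι p (Y₂ p), tmap EP EM ι p (Y₃ p)]
            + extDerivTwo (straightening Φ s ι θ) Y₁ Y₂ Y₃ p ∧
          (Y₁ p ∈ tauPlus 𝓖 Φ s ι p → Y₂ p ∈ tauPlus 𝓖 Φ s ι p → Y₃ p ∈ tauPlus 𝓖 Φ s ι p →
            Hred.toFun (q p)
                ![tmap EP ER q p (Y₁ p), tmap EP ER q p (Y₂ p), tmap EP ER q p (Y₃ p)] =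
              H.toFun (ι p)
                ![tmap EP EM ι p (Y₁ p), tmap EP EM ι p (Y₂ p), tmap EP EM ι p (Y₃ p)]
              + curvaturePairing Φ s ι θ Y₁ Y₂ Y₃ p) := by
  refine ⟨existsUnique_connection hC hΦ hs hι hK,
    ⟨redSplitting hC hΦ hs hι hK hq, isRedMetricSplitting_redSplitting hC hΦ hs hι hK hq,
      fun _ ht => eq_redSplitting hC hΦ hs hι hK hq ht⟩, fun θ t hθ ht => ?_⟩
  -- By the two uniqueness statements the given connection and splitting are the ones constructed
  -- for `ε = 1`, for which the curvature formula was computed.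
  have hker : ∀ p, {Y | (metricConnection s hC hΦ hs hι hK 1).toFun p Y = 0} =
      tauPlus 𝓖 Φ s ι p := fun p =>
    Set.ext fun _ => (connForm_eq_zero_iff hC hι hK).trans mem_tauPlus_iff.symm
  obtain rfl : θ = metricConnection s hC hΦ hs hι hK 1 :=
    PrincipalConnection.ext_ker fun p => (hθ p).trans (hker p).symm
  obtain rfl := eq_redSplitting hC hΦ hs hι hK hq ht
  refine ⟨⟨reducedCurvature hC hΦ hs hι hK hq, isRedCurvature_reducedCurvature hC hΦ hs hι hK hq,
    fun H' hH' => IsRedCurvature.unique hC hΦ hs hι hK hq hH'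
      (isRedCurvature_reducedCurvature hC hΦ hs hι hK hq)⟩, fun Hred hHred Y₁ Y₂ Y₃ p => ?_⟩
  have h := (IsRedCurvature.apply_eq hC hΦ hs hι hK hq hHred p
    ![tmap EP ER q p (Y₁ p), tmap EP ER q p (Y₂ p), tmap EP ER q p (Y₃ p)]).trans
    (curvatureAt_tmap hC hΦ hs hι hK hq hH Y₁ Y₂ Y₃ p)
  refine ⟨h, fun h₁ h₂ h₃ => ?_⟩
  rw [← hker p] at h₁ h₂ h₃
  rw [h, extDerivTwo_straightening hC hι hK _ h₁ h₂ h₃]
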